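/- **Setting.** Let $\Gamma\subset SL_2(\mathbb C)$ be a nontrivial finite subgroup, $\pi$ the character of its defining two-dimensional representation, $R(\Gamma)$ the space of complex class functions on $\Gamma$, $\Gamma^*=\{\gamma_0,\dots,\gamma_r\}$ the set of irreducible characters with $\gamma_0$ trivial, and $R_{\mathbb Z}(\Gamma)=\bigoplus_i\mathbb Z\gamma_i$. Put $\xi=2\gamma_0-\pi$ (the McKay virtual character), $\langle f,g\rangle_\xi=\frac1{|\Gamma|}\sum_{x\in\Gamma}\xi(x)f(x)g(x^{-1})$ and $a_{ij}=\langle\gamma_i,\gamma_j\rangle_\xi$. *Spin wreath products.* Let $\tilde S_n$ be generated by $z,t_1,\dots,t_{n-1}$ with relations $z^2=1$, $t_i^2=(t_it_{i+1})^3=z$, $t_it_j=zt_jt_i$ for $i>j+1$, $zt_i=t_iz$, with $\theta:\tilde S_n\to S_n$, $t_i\mapsto(i,i+1)$, $z\mapsto1$. Let $\tilde\Gamma_n=\Gamma^n\rtimes\tilde S_n$, where $\tilde S_n$ permutes coordinates through $\theta$, graded by the parity of the underlying permutation. Let $R^-(\tilde\Gamma_n)$ be the space of complex class functions $f$ on $\tilde\Gamma_n$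 with $f(zx)=-f(x)$ that vanish on odd elements, and $R^-_\Gamma=\bigoplus_{n\ge0}R^-(\tilde\Gamma_n)$. Let $\tilde\Gamma_n\hat\times\tilde\Gamma_m\subset\tilde\Gamma_{n+m}$ be the subgroup in which $\tilde\Gamma_n$ uses the first $n$ coordinates and $t_1,\dots,t_{n-1}$, and $\tilde\Gamma_m$ uses the last $m$ coordinates and $t_{n+1},\dots,t_{n+m-1}$. For $u\in R^-(\tilde\Gamma_n)$, *multiplication by $u$* is the operator $R^-(\tilde\Gamma_m)\to R^-(\tilde\Gamma_{n+m})$, $g\mapsto\mathrm{Ind}(u\otimes g)$ (all $m$), where $(u\otimes g)(ab)=u(a)g(b)$. *Contraction with $u$* is the operator sending $f\in R^-(\tilde\Gamma_{n+m})$ to $b\mapsto|\tilde\Gamma_n|^{-1}\sum_{a\in\tilde\Gamma_n}\eta_n(\xi)(a)\,u(a)\,f(a^{-1}b)$ in $R^-(\tilde\Gamma_m)$, and $R^-(\tilde\Gamma_k)$ to $0$ for $k<n$. Here, for $f\in R(\Gamma)$, $\eta_n(f)(w)$ is the product of the values of $f$ at the cycle products of $w$, where the cycle product of $(g,t)$ along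 a cycle $(i_1\,i_2\cdots i_k)$ of $\theta(t)$ is $g_{i_k}g_{i_{k-1}}\cdots g_{i_1}$. *Basic elements.* Let $\chi_n$ be the character of the basic spin supermodule of $\tilde S_n$ (of dimension $2^{\lfloor n/2\rfloor}$, $z\mapsto-1$, $t_j\mapsto\sqrt{\tfrac{j+1}{2j}}\,e_j-\sqrt{\tfrac{j-1}{2j}}\,e_{j-1}$ with $e_j^2=-1$, $e_ie_j=-e_je_i$ for $i\neq j$, $e_{2j+1},e_{2j+2}$ acting on $(\mathbb C^{2})^{\otimes\lfloor n/2\rfloor}$ as $\sqrt{-1}$ times $\sigma_3^{\otimes j}\otimes\sigma_1\otimes1\otimes\cdots$ and $\sigma_3^{\otimes j}\otimes\sigma_2\otimes1\otimes\cdots$ for the Pauli matrices). For $f\in R(\Gamma)$ put $\chi_n(f)(g,t)=\eta_n(f)(g,t)\,\chi_n(t)\in R^-(\tilde\Gamma_n)$. For odd $n$ let $\sigma_n(f)\in R^-(\tilde\Gamma_n)$ have the value $\frac n{\sqrt2}f(c)$ at the conjugates of all $(g,t_1\cdots t_{n-1})$ with cycle product $c$, the value $-\frac n{\sqrt2}f(c)$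 at the conjugates of all $(g,zt_1\cdots t_{n-1})$ with cycle product $c$, and $0$ elsewhere. On $R_\Gamma^-$, for $n\ge0$ and $\bar n\in\{0,1\}$ the parity of $n$, let $H_{-n}(f)$ and $H_n(f)$ be multiplication by, respectively contraction with, $2^{\bar n/2}\chi_n(f)$; for odd $n>0$ let $a_{-n}(f)$ and $a_n(f)$ be multiplication by, respectively contraction with, $\sigma_n(f)$. Put $H_+(f,z)=\sum_{n\ge0}H_{-n}(f)z^n$ and $H_-(f,z)=\sum_{n\ge0}H_n(f)z^{-n}$ (here $H_0(f)=1$). *The lattice part.* Put $c_1(\alpha,\beta)=\langle\alpha,\beta\rangle_\xi+\langle\alpha,\alpha\rangle_\xi\langle\beta,\beta\rangle_\xi$ modulo $2$, an alternating form on $R_{\mathbb F_2}(\Gamma)=R_{\mathbb Z}(\Gamma)/2R_{\mathbb Z}(\Gamma)$. Let $1\to\{\pm1\}\to\hat R\to R_{\mathbb F_2}(\Gamma)\to1$ be a central extension with commutators $aba^{-1}b^{-1}=(-1)^{c_1(\bar a,\bar b)}$, and $\bar\alpha\mapsto e_{\bar\alpha}$ a section with $e_{\bar0}=1$ and $e_{\bar\gamma_i}^2=1$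 for all $i$. Let $\epsilon:R_{\mathbb Z}(\Gamma)\times R_{\mathbb Z}(\Gamma)\to\{\pm1\}$ be its cocycle, $e_{\bar\alpha}e_{\bar\beta}=\epsilon(\alpha,\beta)e_{\overline{\alpha+\beta}}$. Let $\Phi\supseteq2R_{\mathbb Z}(\Gamma)$ be a subgroup of $R_{\mathbb Z}(\Gamma)$ maximal such that $c_1$ vanishes on $\Phi/2R_{\mathbb Z}(\Gamma)$, and fix an irreducible $\hat R$-module structure on $\mathbb C[R_{\mathbb Z}(\Gamma)/\Phi]$ (with basis $e^{[\beta]}$) in which $-1\in\hat R$ acts as $-1$ and each $e_{\bar\alpha}$ maps $e^{[\beta]}$ to a scalar multiple of $e^{[\alpha+\beta]}$. On $\mathcal F_\Gamma^-=R_\Gamma^-\otimes\mathbb C[R_{\mathbb Z}(\Gamma)/\Phi]$, for $\gamma\in R_{\mathbb Z}(\Gamma)$, define $X_n(\gamma)$, $n\in\mathbb Z$, by $$\sum_{n\in\mathbb Z}X_n(\gamma)z^{-n}=H_+(\gamma,z)\,H_-(\gamma,-z)\,e_{\bar\gamma},$$ where $H_\pm$ and $a_m(\gamma)$ act on the first tensor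 factor and $e_{\bar\gamma}$ on the second. *The Lie algebra.* The twisted toroidal Lie algebra of $A=(a_{ij})$ is the complex Lie algebra with generators $C$, $h_i(m)$ ($m$ odd) and $x_n(\pm\alpha_i)$ ($n\in\mathbb Z$, $0\le i\le r$) and the following relations, with $h_i(m)=0$ for even $m$: $C$ is central, $$x_n(\alpha_i)=(-1)^nx_n(-\alpha_i),$$ $$[h_i(m),h_j(m')]=\tfrac m2a_{ij}\delta_{m,-m'}C\qquad(m,m'\text{ odd}),$$ $$[h_i(m),x_n(\alpha_j)]=a_{ij}x_{n+m}(\alpha_j)\qquad(m\text{ odd}),$$ $$[x_n(\alpha_i),x_{n'}(-\alpha_i)]=8\{h_i(n+n')+\tfrac n2\delta_{n,-n'}C\},$$ $$\sum_{s=0}^{a_{ij}}\binom{a_{ij}}s[x_{n+s}(\alpha_i),x_{n'-a_{ij}-s}(\alpha_j)]=0\quad\text{if }a_{ij}\ge0,$$ $$\sum_{s=0}^{-a_{ij}}(-1)^s\binom{-a_{ij}}s[x_{n+s}(\alpha_i),x_{n'-a_{ij}-s}(\alpha_j)]=0\quad\text{if }a_{ij}<0,$$ for all $0\le i,j\le r$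 and $n,n'\in\mathbb Z$. **Theorem.** All $a_{ij}$ are integers, and there is a representation of the twisted toroidal Lie algebra of $A$ on $\mathcal F_\Gamma^-$ such that $$x_n(\alpha_i)\mapsto X_n(\gamma_i),\qquad x_n(-\alpha_i)\mapsto\epsilon(\gamma_i,\gamma_i)X_n(-\gamma_i),\qquad h_i(m)\mapsto a_m(\gamma_i),\qquad C\mapsto1$$ for all $0\le i\le r$, all $n\in\mathbb Z$ and all odd $m$. -/

import Mathlib

open scoped DirectSum TensorProduct

noncomputable section

namespace TwistedMcKay

/-! ### The spin group -/

/-- Generators `z, t_1, …, t_{n-1}` of the spin group. The index `i : Fin (n - 1)` stands for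
`t_{i+1}`, which lies over the transposition of the (zero-based) letters `i` and `i + 1`. -/
inductive SpinGen (n : ℕ) : Type
  | z : SpinGen n
  | t (i : Fin (n - 1)) : SpinGen n

/-- The defining relators of the spin group:
`z² = 1`, `t_i² = z = (t_i t_{i+1})³`, `t_i t_j = z t_j t_i` for `i > j + 1`, `z t_i = t_i z`. -/
inductive SpinRel (n : ℕ) : FreeGroup (SpinGen n) → Prop
  | z_sq : SpinRel n (FreeGroup.of .z ^ 2)
  | t_sq (i : Fin (n - 1)) : SpinRel n (FreeGroup.of (.t i) ^ 2 * (FreeGroup.of .z)⁻¹)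
  | braid (i j : Fin (n - 1)) (h : i.val + 1 = j.val) :
      SpinRel n ((FreeGroup.of (.t i) * FreeGroup.of (.t j)) ^ 3 * (FreeGroup.of .z)⁻¹)
  | far (i j : Fin (n - 1)) (h : j.val + 1 < i.val) :
      SpinRel n (FreeGroup.of (.t i) * FreeGroup.of (.t j) *
        (FreeGroup.of .z * FreeGroup.of (.t j) * FreeGroup.of (.t i))⁻¹)
  | central (i : Fin (n - 1)) :
      SpinRel n (FreeGroup.of .z * FreeGroup.of (.t i) *
        (FreeGroup.of (.t i) * FreeGroup.of .z)⁻¹)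

/-- The spin group `S̃_n`, the double cover of the symmetric group given by generators and
relations. -/
abbrev SpinSym (n : ℕ) : Type := PresentedGroup (Set.ofPred (SpinRel n))

namespace SpinSym

/-- The central element `z`. -/
def z (n : ℕ) : SpinSym n := PresentedGroup.of .z

/-- The generator `t i`, lying over the transposition of `i` and `i + 1`. -/
def t {n : ℕ} (i : Fin (n - 1)) : SpinSym n := PresentedGroup.of (.t i)

variable {n : ℕ}

theorem z_mul_z : z n * z n = 1 := by
  have h := PresentedGroup.one_of_mem (rels := Set.ofPred (SpinRel n)) SpinRel.z_sq
  simpa [pow_two, z, PresentedGroup.of] using h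

theorem t_mul_t (i : Fin (n - 1)) : t i * t i = z n := by
  have h := PresentedGroup.one_of_mem (rels := Set.ofPred (SpinRel n)) (SpinRel.t_sq i)
  rw [map_mul, map_pow, map_inv, mul_inv_eq_one, pow_two] at h
  exact h

theorem t_braid (i j : Fin (n - 1)) (h : i.val + 1 = j.val) : (t i * t j) ^ 3 = z n := by
  have h := PresentedGroup.one_of_mem (rels := Set.ofPred (SpinRel n)) (SpinRel.braid i j h)
  rw [map_mul, map_pow, map_inv, mul_inv_eq_one, map_mul] at h
  exact h

theorem t_far (i j : Fin (n - 1)) (h : j.val + 1 < i.val) : t i * t j = z n * t j * t i := by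
  have h := PresentedGroup.one_of_mem (rels := Set.ofPred (SpinRel n)) (SpinRel.far i j h)
  rw [map_mul, map_inv, mul_inv_eq_one, map_mul, map_mul, map_mul] at h
  exact h

theorem z_t (i : Fin (n - 1)) : z n * t i = t i * z n := by
  have h := PresentedGroup.one_of_mem (rels := Set.ofPred (SpinRel n)) (SpinRel.central i)
  rw [map_mul, map_inv, mul_inv_eq_one, map_mul, map_mul] at h
  exact h

theorem mem_of_gens (H : Subgroup (SpinSym n)) (hz : z n ∈ H) (ht : ∀ i, t i ∈ H)
    (x : SpinSym n) : x ∈ H :=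
  PresentedGroup.generated_by _ H (fun g => by cases g; exacts [hz, ht _]) x

theorem hom_ext {G : Type*} [Group G] {φ ψ : SpinSym n →* G} (hz : φ (z n) = ψ (z n))
    (ht : ∀ i, φ (t i) = ψ (t i)) : φ = ψ :=
  PresentedGroup.ext fun g => by cases g; exacts [hz, ht _]

theorem z_comm (x : SpinSym n) : z n * x = x * z n := by
  have := mem_of_gens (Subgroup.centralizer {z n}) (by simp [Subgroup.mem_centralizer_iff])
    (fun i => by simp [Subgroup.mem_centralizer_iff, z_t]) x
  simpa [Subgroup.mem_centralizer_iff] using this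

/-- The homomorphism out of the spin group given by images of the generators that satisfy the
relations. -/
def lift {G : Type*} [Group G] (a : G) (b : Fin (n - 1) → G) (h1 : a * a = 1)
    (h2 : ∀ i, b i * b i = a) (h3 : ∀ i j : Fin (n - 1), i.val + 1 = j.val → (b i * b j) ^ 3 = a)
    (h4 : ∀ i j : Fin (n - 1), j.val + 1 < i.val → b i * b j = a * b j * b i)
    (h5 : ∀ i, a * b i = b i * a) : SpinSym n →* G :=
  PresentedGroup.toGroup (f := fun g => SpinGen.rec a b g) (by
    rintro r (_ | _ | ⟨i, j, h⟩ | ⟨i, j, h⟩ | _)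
    · simp [pow_two, h1]
    · simp [pow_two, h2]
    · simp [h3 i j h]
    · simp [h4 i j h]
    · simp [h5])

section lift
variable {G : Type*} [Group G] (a : G) (b : Fin (n - 1) → G) (h1 : a * a = 1)
    (h2 : ∀ i, b i * b i = a) (h3 : ∀ i j : Fin (n - 1), i.val + 1 = j.val → (b i * b j) ^ 3 = a)
    (h4 : ∀ i j : Fin (n - 1), j.val + 1 < i.val → b i * b j = a * b j * b i)
    (h5 : ∀ i, a * b i = b i * a)

theorem lift_z : lift a b h1 h2 h3 h4 h5 (z n) = a := PresentedGroup.toGroup.of _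
theorem lift_t (i : Fin (n - 1)) : lift a b h1 h2 h3 h4 h5 (t i) = b i :=
  PresentedGroup.toGroup.of _
end lift

/-- The (zero-based) adjacent transposition `(i, i + 1)`. -/
def adj (i : Fin (n - 1)) : Equiv.Perm (Fin n) :=
  Equiv.swap ⟨i.val, by omega⟩ ⟨i.val + 1, by omega⟩

/-- The projection `θ_n` onto the symmetric group: `t_i ↦ (i, i + 1)`, `z ↦ 1`. -/
def θ (n : ℕ) : SpinSym n →* Equiv.Perm (Fin n) :=
  lift 1 adj (by simp) (fun i => by simp [adj])
    (fun i j h => by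
      have e : adj j = Equiv.swap ⟨i.val + 1, by omega⟩ ⟨j.val + 1, by omega⟩ := by
        simp only [adj, h]
      have h3 := Equiv.Perm.isThreeCycle_swap_mul_swap_same
        (a := (⟨i.val + 1, by omega⟩ : Fin n)) (b := ⟨i.val, by omega⟩) (c := ⟨j.val + 1, by omega⟩)
        (by simp [Fin.ext_iff]) (by simp [Fin.ext_iff]; omega) (by simp [Fin.ext_iff]; omega)
      rw [e, adj, Equiv.swap_comm, ← h3.orderOf, pow_orderOf_eq_one])
    (fun i j h => by
      rw [one_mul]
      refine (Equiv.Perm.disjoint_swap_swap ?_).commute.eq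
      simp [Fin.ext_iff]
      omega)
    (fun i => by simp)

@[simp] theorem θ_z : θ n (z n) = 1 := lift_z _ _ _ _ _ _ _
@[simp] theorem θ_t (i : Fin (n - 1)) : θ n (t i) = adj i := lift_t _ _ _ _ _ _ _ _

/-- The parity `d` of the spin group, written multiplicatively: `t_i ↦ -1`, `z ↦ 1`. -/
def sgn (n : ℕ) : SpinSym n →* ℤˣ := Equiv.Perm.sign.comp (θ n)

@[simp] theorem sgn_z : sgn n (z n) = 1 := by simp [sgn]
@[simp] theorem sgn_t (i : Fin (n - 1)) : sgn n (t i) = -1 := by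
  simp [sgn, adj, Fin.ext_iff]

/-- The embedding of `S̃_n` into `S̃_{n+m}` on the first generators: `t_i ↦ t_i`. -/
def embL (n m : ℕ) : SpinSym n →* SpinSym (n + m) :=
  lift (z _) (fun i => t ⟨i.val, by omega⟩) z_mul_z (fun _ => t_mul_t _)
    (fun _ _ h => t_braid _ _ h) (fun _ _ h => t_far _ _ h) (fun _ => z_t _)

/-- The embedding of `S̃_m` into `S̃_{n+m}` on the last generators: `t_j ↦ t_{n+j}`. -/
def embR (n m : ℕ) : SpinSym m →* SpinSym (n + m) :=
  lift (z _) (fun i => t ⟨n + i.val, by omega⟩) z_mul_z (fun _ => t_mul_t _)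
    (fun _ _ h => t_braid _ _ (by simp only; omega)) (fun _ _ h => t_far _ _ (by simp only; omega))
    (fun _ => z_t _)

variable {m : ℕ}

@[simp] theorem embL_z : embL n m (z n) = z _ := lift_z _ _ _ _ _ _ _
@[simp] theorem embL_t (i : Fin (n - 1)) : embL n m (t i) = t ⟨i.val, by omega⟩ :=
  lift_t _ _ _ _ _ _ _ _
@[simp] theorem embR_z : embR n m (z m) = z _ := lift_z _ _ _ _ _ _ _
@[simp] theorem embR_t (i : Fin (m - 1)) : embR n m (t i) = t ⟨n + i.val, by omega⟩ :=
  lift_t _ _ _ _ _ _ _ _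

theorem sgn_embL (x : SpinSym n) : sgn _ (embL n m x) = sgn n x := by
  have : (sgn _).comp (embL n m) = sgn n := hom_ext (by simp) (by simp)
  exact DFunLike.congr_fun this x

theorem sgn_embR (x : SpinSym m) : sgn _ (embR n m x) = sgn m x := by
  have : (sgn _).comp (embR n m) = sgn m := hom_ext (by simp) (by simp)
  exact DFunLike.congr_fun this x

/-- The permutation of `n + m` letters acting as `σ` on the first `n` and as `τ` on the last `m`. -/
def blockPerm (n m : ℕ) : Equiv.Perm (Fin n) × Equiv.Perm (Fin m) →* Equiv.Perm (Fin (n + m)) :=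
  (finSumFinEquiv.permCongrHom.toMonoidHom).comp (Equiv.Perm.sumCongrHom (Fin n) (Fin m))

theorem blockPerm_castAdd (σ : Equiv.Perm (Fin n)) (τ : Equiv.Perm (Fin m)) (i : Fin n) :
    blockPerm n m (σ, τ) (Fin.castAdd m i) = Fin.castAdd m (σ i) := by
  simp [blockPerm, Equiv.permCongrHom]

theorem blockPerm_natAdd (σ : Equiv.Perm (Fin n)) (τ : Equiv.Perm (Fin m)) (i : Fin m) :
    blockPerm n m (σ, τ) (Fin.natAdd n i) = Fin.natAdd n (τ i) := by
  simp [blockPerm, Equiv.permCongrHom]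

theorem θ_embL (x : SpinSym n) : θ _ (embL n m x) = blockPerm n m (θ n x, 1) := by
  have : (θ _).comp (embL n m) = (blockPerm n m).comp ((MonoidHom.inl _ _).comp (θ n)) := by
    refine hom_ext (by simp; exact (map_one (blockPerm n m)).symm) fun i => Equiv.ext fun x => ?_
    simp only [MonoidHom.comp_apply, embL_t, θ_t, MonoidHom.inl_apply]
    refine Fin.addCases (fun a => ?_) (fun a => ?_) x
    · rw [blockPerm_castAdd]
      simp only [adj, Equiv.swap_apply_def, Fin.ext_iff, Fin.val_castAdd]
      split_ifs <;> simp
    · rw [blockPerm_natAdd]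
      simp only [adj, Equiv.swap_apply_def, Fin.ext_iff, Fin.val_natAdd]
      split_ifs <;> simp <;> omega
  exact DFunLike.congr_fun this x

theorem θ_embR (x : SpinSym m) : θ _ (embR n m x) = blockPerm n m (1, θ m x) := by
  have : (θ _).comp (embR n m) = (blockPerm n m).comp ((MonoidHom.inr _ _).comp (θ m)) := by
    refine hom_ext (by simp; exact (map_one (blockPerm n m)).symm) fun i => Equiv.ext fun x => ?_
    simp only [MonoidHom.comp_apply, embR_t, θ_t, MonoidHom.inr_apply]
    refine Fin.addCases (fun a => ?_) (fun a => ?_) x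
    · rw [blockPerm_castAdd]
      simp only [adj, Equiv.swap_apply_def, Fin.ext_iff, Fin.val_castAdd]
      split_ifs <;> simp <;> omega
    · rw [blockPerm_natAdd]
      simp only [adj, Equiv.swap_apply_def, Fin.ext_iff, Fin.val_natAdd]
      split_ifs <;> simp <;> omega
  exact DFunLike.congr_fun this x

/-- Even elements of the first factor commute with the second factor. -/
theorem embR_comm_embL (y : SpinSym m) (x : SpinSym n) (hx : sgn n x = 1) :
    embR n m y * embL n m x = embL n m x * embR n m y := by
  classical
  -- the sign character with values in the centre `{1, z}`
  let c : ℤˣ → SpinSym (n + m) := fun u => if u = 1 then 1 else z _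
  have hc : ∀ u v, c (u * v) = c u * c v := by
    intro u v
    rcases Int.units_eq_one_or u with rfl | rfl <;> rcases Int.units_eq_one_or v with rfl | rfl <;>
      simp [c, z_mul_z]
  have hcc : ∀ u x, c u * x = x * c u := by
    intro u x
    rcases Int.units_eq_one_or u with rfl | rfl <;> simp [c, z_comm]
  have key : ∀ j : Fin (m - 1), embL n m x * embR n m (t j) = embR n m (t j) * embL n m x := by
    intro j
    let T := embR n m (t j)
    let φ : SpinSym n →* SpinSym (n + m) := MonoidHom.mk' (fun x => c (sgn n x) * embL n m x) (by
      intro a b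
      rw [map_mul, map_mul, hc, mul_assoc, mul_assoc, ← mul_assoc (c (sgn n b)), hcc _ (embL n m a)]
      simp only [mul_assoc])
    have e : (MulAut.conj T).toMonoidHom.comp (embL n m) = φ := by
      refine hom_ext ?_ fun i => ?_
      · simp [φ, c, ← z_comm]
      · simp only [MonoidHom.comp_apply, MulEquiv.coe_toMonoidHom, MulAut.conj_apply, φ,
          MonoidHom.mk'_apply, sgn_t, T, embR_t, embL_t, c]
        rw [mul_inv_eq_iff_eq_mul, if_neg (by decide)]
        exact t_far _ _ (by simp only; omega)
    have := DFunLike.congr_fun e x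
    simp only [MonoidHom.comp_apply, MulEquiv.coe_toMonoidHom, MulAut.conj_apply, φ,
          MonoidHom.mk'_apply, hx, c, if_true, one_mul, mul_inv_eq_iff_eq_mul] at this
    exact this.symm
  have := mem_of_gens ((Subgroup.centralizer {embL n m x}).comap (embR n m))
    (by simp [Subgroup.mem_centralizer_iff, z_comm])
    (fun i => by simpa [Subgroup.mem_centralizer_iff] using key i) y
  simp only [Subgroup.mem_comap, Subgroup.mem_centralizer_iff, Set.mem_singleton_iff,
    forall_eq] at this
  exact this.symm

end SpinSym
namespace SpinSym

/-- `tn i` is the generator `t i` for a natural number `i < n - 1`, and `1` otherwise. -/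
def tn (n i : ℕ) : SpinSym n := if h : i < n - 1 then t ⟨i, h⟩ else 1

theorem tn_of_lt {n i : ℕ} (h : i < n - 1) : tn n i = t ⟨i, h⟩ := dif_pos h

theorem tn_braid {n i : ℕ} (h : i + 1 < n - 1) :
    tn n (i + 1) * tn n i * tn n (i + 1) = tn n i * tn n (i + 1) * tn n i := by
  rw [tn_of_lt h, tn_of_lt (show i < n - 1 by omega)]
  set a : SpinSym n := t ⟨i, by omega⟩
  set b : SpinSym n := t ⟨i + 1, h⟩
  have h1 : a * a = z n := t_mul_t _
  have h2 : b * b = z n := t_mul_t _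
  have h3 : (a * b) ^ 3 = z n := t_braid _ _ rfl
  have ha : a⁻¹ = z n * a := by
    rw [inv_eq_iff_mul_eq_one, ← mul_assoc, ← z_comm, mul_assoc, h1, z_mul_z]
  have hb : b⁻¹ = z n * b := by
    rw [inv_eq_iff_mul_eq_one, ← mul_assoc, ← z_comm, mul_assoc, h2, z_mul_z]
  have h4 : a * b * a = z n * (b * a * b)⁻¹ := by
    rw [eq_mul_inv_iff_mul_eq, ← h3]
    simp only [pow_succ, pow_zero, one_mul, mul_assoc]
  rw [h4, mul_inv_rev, mul_inv_rev, ha, hb]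
  have hz : ∀ x : SpinSym n, x * z n = z n * x := fun x => (z_comm x).symm
  have hz' : ∀ x y : SpinSym n, x * (z n * y) = z n * (x * y) := fun x y => by
    rw [← mul_assoc, hz, mul_assoc]
  have hzz : ∀ x : SpinSym n, z n * (z n * x) = x := fun x => by
    rw [← mul_assoc, z_mul_z, one_mul]
  simp only [mul_assoc, hz', hzz]

/-- The descending product `t_{N-1} ⋯ t_k` (for `k ≤ N`), indexed by its length. -/
def desc (n N : ℕ) : ℕ → SpinSym n
  | 0 => 1
  | l + 1 => desc n N l * tn n (N - (l + 1))

theorem desc_far {N : ℕ} (l j : ℕ) (hl : l ≤ N + 1) (hj : j + 1 + l < N + 1) :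
    ∃ κ ∈ (embL (N + 1) 1).range, desc (N + 1 + 1) (N + 1) l * tn (N + 1 + 1) j =
      κ * desc (N + 1 + 1) (N + 1) l := by
  induction l with
  | zero =>
    refine ⟨tn _ j, ⟨t ⟨j, by omega⟩, ?_⟩, by simp [desc]⟩
    rw [embL_t, tn_of_lt (by omega)]
  | succ l ih =>
    obtain ⟨κ, hκ, e⟩ := ih (by omega) (by omega)
    refine ⟨z _ * κ, mul_mem ⟨z _, embL_z⟩ hκ, ?_⟩
    have hf : tn (N + 1 + 1) (N + 1 - (l + 1)) * tn (N + 1 + 1) j =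
        z _ * tn _ j * tn _ (N + 1 - (l + 1)) := by
      rw [tn_of_lt (show N + 1 - (l + 1) < N + 1 + 1 - 1 by omega),
        tn_of_lt (show j < N + 1 + 1 - 1 by omega)]
      exact t_far _ _ (by simp only; omega)
    rw [desc, mul_assoc, hf, ← mul_assoc, ← mul_assoc, ← z_comm, mul_assoc (z _), e]
    simp only [mul_assoc]

theorem desc_near {N : ℕ} (l j : ℕ) (hl : l ≤ N + 1) (hjN : j < N + 1) (hj : N + 1 < j + l) :
    ∃ κ ∈ (embL (N + 1) 1).range, desc (N + 1 + 1) (N + 1) l * tn (N + 1 + 1) j =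
      κ * desc (N + 1 + 1) (N + 1) l := by
  induction l with
  | zero => omega
  | succ l ih =>
    by_cases h : N + 1 < j + l
    · obtain ⟨κ, hκ, e⟩ := ih (by omega) h
      refine ⟨z _ * κ, mul_mem ⟨z _, embL_z⟩ hκ, ?_⟩
      have hf : tn (N + 1 + 1) (N + 1 - (l + 1)) * tn (N + 1 + 1) j =
          z _ * tn _ j * tn _ (N + 1 - (l + 1)) := by
        rw [tn_of_lt (show N + 1 - (l + 1) < N + 1 + 1 - 1 by omega),
          tn_of_lt (show j < N + 1 + 1 - 1 by omega)]
        have := t_far (n := N + 1 + 1) ⟨j, by omega⟩ ⟨N + 1 - (l + 1), by omega⟩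
          (by simp only; omega)
        rw [mul_assoc, this, ← mul_assoc, ← mul_assoc, z_mul_z, one_mul]
      rw [desc, mul_assoc, hf, ← mul_assoc, ← mul_assoc, ← z_comm, mul_assoc (z _), e]
      simp only [mul_assoc]
    · obtain ⟨l, rfl⟩ : ∃ l', l = l' + 1 := ⟨l - 1, by omega⟩
      have e1 : N + 1 - (l + 1) = j := by omega
      obtain ⟨i, rfl⟩ : ∃ i, j = i + 1 := ⟨j - 1, by omega⟩
      have e2 : N + 1 - (l + 1 + 1) = i := by omega
      obtain ⟨κ, hκ, e⟩ := desc_far (N := N) l i (by omega) (by omega)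
      refine ⟨κ, hκ, ?_⟩
      rw [desc, desc, e1, e2, mul_assoc, mul_assoc, ← mul_assoc (tn _ (i + 1)),
        tn_braid (by omega), ← mul_assoc, ← mul_assoc, e]
      simp only [mul_assoc]

theorem finite_step (N : ℕ) [Finite (SpinSym (N + 1))] : Finite (SpinSym (N + 1 + 1)) := by
  let D := desc (N + 1 + 1) (N + 1)
  let K := (embL (N + 1) 1).range
  let A : Set (SpinSym (N + 1 + 1)) :=
    Set.range fun p : SpinSym (N + 1) × Fin (N + 2) => embL (N + 1) 1 p.1 * D p.2
  have hA : ∀ κ ∈ K, ∀ l, l ≤ N + 1 → κ * D l ∈ A := by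
    rintro _ ⟨a, rfl⟩ l hl
    exact ⟨(a, ⟨l, by omega⟩), rfl⟩
  have hzK : z _ ∈ K := ⟨z _, embL_z⟩
  have hz : ∀ x ∈ A, x * z _ ∈ A := by
    rintro _ ⟨⟨a, l⟩, rfl⟩
    rw [← z_comm, ← mul_assoc]
    exact hA _ (mul_mem hzK ⟨a, rfl⟩) _ (by omega)
  have ht : ∀ x ∈ A, ∀ j < N + 1, x * tn _ j ∈ A := by
    rintro _ ⟨⟨a, ⟨l, hl⟩⟩, rfl⟩ j hj
    simp only
    rw [mul_assoc]
    have ha : embL (N + 1) 1 a ∈ K := ⟨a, rfl⟩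
    rcases lt_trichotomy (j + l) (N + 1) with h | h | h
    · rcases Nat.lt_or_ge (j + 1 + l) (N + 1) with h' | h'
      · obtain ⟨κ, hκ, e⟩ := desc_far (N := N) l j (by omega) h'
        rw [e, ← mul_assoc]
        exact hA _ (mul_mem ha hκ) l (by omega)
      · have : D l * tn _ j = D (l + 1) := by
          rw [show j = N + 1 - (l + 1) by omega]; rfl
        rw [this]
        exact hA _ ha _ (by omega)
    · obtain ⟨l, rfl⟩ : ∃ l', l = l' + 1 := ⟨l - 1, by omega⟩
      have : D (l + 1) * tn _ j = z _ * D l := by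
        change D l * tn _ (N + 1 - (l + 1)) * _ = _
        rw [show N + 1 - (l + 1) = j by omega, mul_assoc, tn_of_lt (by omega), t_mul_t, z_comm]
      rw [this, ← mul_assoc]
      exact hA _ (mul_mem ha hzK) _ (by omega)
    · obtain ⟨κ, hκ, e⟩ := desc_near (N := N) l j (by omega) hj h
      rw [e, ← mul_assoc]
      exact hA _ (mul_mem ha hκ) l (by omega)
  have ht' : ∀ x ∈ A, ∀ i, x * t i ∈ A := fun x hx i => by
    have := ht x hx i.val (by have := i.2; omega)
    rwa [tn_of_lt i.2] at this
  let H : Subgroup (SpinSym (N + 1 + 1)) :=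
    { carrier := {g | (∀ x ∈ A, x * g ∈ A) ∧ ∀ x ∈ A, x * g⁻¹ ∈ A}
      mul_mem' := fun {a b} ha hb => by
        refine ⟨fun x hx => ?_, fun x hx => ?_⟩
        · rw [← mul_assoc]; exact hb.1 _ (ha.1 _ hx)
        · rw [mul_inv_rev, ← mul_assoc]; exact ha.2 _ (hb.2 _ hx)
      one_mem' := by simp
      inv_mem' := fun {a} ha => by
        refine ⟨ha.2, ?_⟩
        simpa using ha.1 }
  have hzi : (z (N + 1 + 1))⁻¹ = z _ := inv_eq_of_mul_eq_one_left z_mul_z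
  have hH : ∀ g, g ∈ H := mem_of_gens H ⟨hz, by rw [hzi]; exact hz⟩ fun i => ⟨fun x hx => ht' x hx i,
    fun x hx => by
      have : (t i : SpinSym (N + 1 + 1))⁻¹ = z _ * t i := by
        rw [inv_eq_iff_mul_eq_one, ← mul_assoc, ← z_comm, mul_assoc, t_mul_t, z_mul_z]
      rw [this, ← mul_assoc]
      exact ht' _ (hz x hx) i⟩
  have h1 : (1 : SpinSym (N + 1 + 1)) ∈ A := by
    have := hA 1 (one_mem K) 0 (by omega)
    simpa [D, desc] using this
  have hAu : A = Set.univ := Set.eq_univ_of_forall fun g => by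
    have := (hH g).1 1 h1
    rwa [one_mul] at this
  exact Set.finite_univ_iff.mp (hAu ▸ Set.finite_range _)

instance instFinite : (n : ℕ) → Finite (SpinSym n)
  | 0 => finite_small 0 (by omega)
  | 1 => finite_small 1 (by omega)
  | N + 2 => have := instFinite (N + 1); finite_step N
where
  finite_small (n : ℕ) (hn : n ≤ 1) : Finite (SpinSym n) := by
    have h : ∀ x : SpinSym n, x ∈ Subgroup.zpowers (z n) :=
      mem_of_gens _ (Subgroup.mem_zpowers _) fun i => by have := i.2; omega
    have hf : IsOfFinOrder (z n) := isOfFinOrder_iff_pow_eq_one.mpr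
      ⟨2, by norm_num, by rw [pow_two, z_mul_z]⟩
    exact Set.finite_univ_iff.mp ((finite_zpowers.mpr hf).subset fun x _ => h x)

end SpinSym

/-! ### The spin wreath product -/

section Wreath
variable (Γ : Type*) [Group Γ]

/-- The wreath product `Γ̃_n = Γ^n ⋊ S̃_n`, with `S̃_n` permuting coordinates through `θ_n`:
`t (g_1, …, g_n) = (g_{s⁻¹(1)}, …, g_{s⁻¹(n)})` for `s = θ_n(t)`. -/
abbrev SpinWreath (n : ℕ) : Type _ :=
  (Fin n → Γ) ⋊[(mulAutArrow (A := Fin n) (M := Γ)).comp (SpinSym.θ n)] SpinSym n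

instance SpinWreath.instFinite [Finite Γ] (n : ℕ) : Finite (SpinWreath Γ n) :=
  Finite.of_equiv _ SemidirectProduct.equivProd.symm

variable {Γ} {n m : ℕ}

namespace SpinWreath

/-- The central element `z` of `Γ̃_n`. -/
def z (n : ℕ) : SpinWreath Γ n := SemidirectProduct.inr (SpinSym.z n)

/-- The projection of `Γ̃_n` to the symmetric group. -/
def perm (n : ℕ) : SpinWreath Γ n →* Equiv.Perm (Fin n) :=
  (SpinSym.θ n).comp SemidirectProduct.rightHom

/-- The parity of `Γ̃_n`, written multiplicatively: `w` is even iff `sgn n w = 1`. -/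
def sgn (n : ℕ) : SpinWreath Γ n →* ℤˣ := (SpinSym.sgn n).comp SemidirectProduct.rightHom

theorem mul_left' (a b : SpinWreath Γ n) (i : Fin n) :
    (a * b).left i = a.left i * b.left ((perm n a)⁻¹ i) := rfl

theorem perm_z : perm n (z n : SpinWreath Γ n) = 1 := by simp [perm, z]

theorem z_comm (w : SpinWreath Γ n) : z n * w = w * z n := by
  refine SemidirectProduct.ext (funext fun i => ?_) (SpinSym.z_comm _)
  rw [mul_left', mul_left', perm_z]
  simp [z]

theorem z_mul_z : z n * z n = (1 : SpinWreath Γ n) := by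
  simp only [z, ← map_mul, SpinSym.z_mul_z, map_one]

/-- The product of `a ∈ Γ̃_n` and `b ∈ Γ̃_m` inside `Γ̃_{n+m}`. Its range is the spin product
`Γ̃_n ×̂ Γ̃_m`, a subgroup of `Γ̃_{n+m}`; each element of that subgroup comes from exactly two pairs,
`(a, b)` and `(z a, z b)`. -/
def juxt (a : SpinWreath Γ n) (b : SpinWreath Γ m) : SpinWreath Γ (n + m) :=
  ⟨Fin.append a.left b.left, SpinSym.embL n m a.right * SpinSym.embR n m b.right⟩

theorem perm_juxt (a : SpinWreath Γ n) (b : SpinWreath Γ m) :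
    perm _ (juxt a b) = SpinSym.blockPerm n m (perm n a, perm m b) := by
  change SpinSym.θ _ (SpinSym.embL n m a.right * SpinSym.embR n m b.right) = _
  rw [map_mul, SpinSym.θ_embL, SpinSym.θ_embR, ← map_mul]
  simp [perm]

theorem sgn_juxt (a : SpinWreath Γ n) (b : SpinWreath Γ m) :
    sgn _ (juxt a b) = sgn n a * sgn m b := by
  change SpinSym.sgn _ (SpinSym.embL n m a.right * SpinSym.embR n m b.right) = _
  rw [map_mul, SpinSym.sgn_embL, SpinSym.sgn_embR]
  rfl

theorem juxt_mul (a a' : SpinWreath Γ n) (b b' : SpinWreath Γ m)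
    (h : SpinSym.embR n m b.right * SpinSym.embL n m a'.right =
      SpinSym.embL n m a'.right * SpinSym.embR n m b.right) :
    juxt a b * juxt a' b' = juxt (a * a') (b * b') := by
  refine SemidirectProduct.ext (funext fun i => ?_) ?_
  · rw [mul_left', perm_juxt, ← map_inv, Prod.inv_mk]
    refine Fin.addCases (fun i => ?_) (fun i => ?_) i
    · rw [SpinSym.blockPerm_castAdd]; simp [juxt, mul_left']; rfl
    · rw [SpinSym.blockPerm_natAdd]; simp [juxt, mul_left']; rfl
  · change SpinSym.embL n m a.right * SpinSym.embR n m b.right *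
      (SpinSym.embL n m a'.right * SpinSym.embR n m b'.right) =
      SpinSym.embL n m (a.right * a'.right) * SpinSym.embR n m (b.right * b'.right)
    rw [map_mul, map_mul, mul_assoc, ← mul_assoc (SpinSym.embR n m b.right), h]
    simp only [mul_assoc]

theorem z_mul_juxt_left (a : SpinWreath Γ n) (b : SpinWreath Γ m) :
    juxt (z n * a) b = z _ * juxt a b := by
  have : (z (n + m) : SpinWreath Γ (n + m)) = juxt (z n) 1 := by
    refine SemidirectProduct.ext (funext fun i => ?_) ?_
    · refine Fin.addCases (fun i => ?_) (fun i => ?_) i <;> simp [juxt, z]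
    · simp [juxt, z]
  rw [this, juxt_mul _ _ _ _ (by simp), one_mul]

theorem z_mul_juxt_right (a : SpinWreath Γ n) (b : SpinWreath Γ m) :
    juxt a (z m * b) = z _ * juxt a b := by
  have : (z (n + m) : SpinWreath Γ (n + m)) = juxt 1 (z m) := by
    refine SemidirectProduct.ext (funext fun i => ?_) ?_
    · refine Fin.addCases (fun i => ?_) (fun i => ?_) i <;> simp [juxt, z]
    · simp [juxt, z]
  rw [this, juxt_mul _ _ _ _ (by simp [z, SpinSym.z_comm]), one_mul]

/-- Conjugation by an element of the second factor, on even elements of the first factor. -/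
theorem conj_juxt (y : SpinWreath Γ m) (a : SpinWreath Γ n) (b : SpinWreath Γ m)
    (ha : sgn n a = 1) : juxt 1 y * juxt a b * (juxt 1 y)⁻¹ = juxt a (y * b * y⁻¹) := by
  rw [mul_inv_eq_iff_eq_mul, juxt_mul, juxt_mul]
  · simp
  · simp
  · exact SpinSym.embR_comm_embL _ _ ha

end SpinWreath
end Wreath

/-! ### Class functions and irreducible characters of `Γ` -/

section Characters
variable (Γ : Type*) [Group Γ]

/-- The space `R(Γ)` of complex class functions on `Γ`. -/
def ClassFn : Submodule ℂ (Γ → ℂ) where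
  carrier := {f | ∀ x y, f (x * y * x⁻¹) = f y}
  add_mem' hf hg x y := by simp only [Pi.add_apply, hf x y, hg x y]
  zero_mem' _ _ := rfl
  smul_mem' c f hf x y := by simp only [Pi.smul_apply, hf x y]

theorem character_mem {V : Type*} [AddCommGroup V] [Module ℂ V] (ρ : Representation ℂ Γ V) :
    ρ.character ∈ ClassFn Γ := fun x y => by
  rw [mul_assoc, Representation.char_mul_comm, inv_mul_cancel_right]

/-- The set `Γ^*` of complex irreducible characters of `Γ`. -/
def IrrChar : Type _ :=
  {χ : ClassFn Γ // ∃ (d : ℕ) (ρ : Representation ℂ Γ (Fin d → ℂ)),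
    ρ.IsIrreducible ∧ (χ : Γ → ℂ) = ρ.character}

/-- The lattice `R_ℤ(Γ) = ⨁ ℤ γ_i` of virtual characters, as the free abelian group on the
irreducible characters. -/
abbrev RZ : Type _ := IrrChar Γ →₀ ℤ

variable {Γ}

/-- An irreducible character as an element of the lattice. -/
def IrrChar.toRZ (γ : IrrChar Γ) : RZ Γ := Finsupp.single γ 1

/-- The class function underlying an element of the lattice. -/
def RZ.toClassFn : RZ Γ →+ ClassFn Γ :=
  Finsupp.liftAddHom fun γ => (zmultiplesHom (ClassFn Γ)) γ.1

/-- The weighted bilinear form `⟨f, g⟩_ξ = |Γ|⁻¹ ∑_x ξ(x) f(x) g(x⁻¹)` on `R(Γ)`. -/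
def weightedForm (ξ f g : ClassFn Γ) : ℂ :=
  (Nat.card Γ : ℂ)⁻¹ * ∑ᶠ x : Γ, ξ.1 x * f.1 x * g.1 x⁻¹

/-- The integer value of the weighted form on the lattice `R_ℤ(Γ)` (when `ξ` is a virtual
character, `⟨α, β⟩_ξ` is an integer). -/
def latticeForm (ξ : ClassFn Γ) (α β : RZ Γ) : ℤ :=
  ⌊(weightedForm ξ α.toClassFn β.toClassFn).re⌋

/-- The matrix `a_{ij} = ⟨γ_i, γ_j⟩_ξ`. -/
def formMatrix (ξ : ClassFn Γ) (i j : IrrChar Γ) : ℤ := latticeForm ξ i.toRZ j.toRZ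

end Characters

/-! ### Class functions on the spin wreath products -/

section SuperSpin
variable {Γ : Type*} [Group Γ] {n m : ℕ}

open SpinWreath

/-- The cycle product of `w = (g, t)` along the cycle `(i_1 i_2 … i_k)` of `θ(t)` with `i_k = i`,
that is `g_{i_k} g_{i_{k-1}} ⋯ g_{i_1}`. It is the `i`-th coordinate of the `Γ^n`-part
`g · t(g) ⋯ t^{k-1}(g)` of `w ^ k`. -/
def cycleProd (w : SpinWreath Γ n) (i : Fin n) : Γ :=
  (w ^ Function.minimalPeriod (perm n w) i).left i

/-- The class function `η_n(f)`: the product, over all cycles of `w`, of the values of `f` at the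
cycle products. It is the character of `V^{⊗ n}` if `f` is the character of `V`. -/
def eta (f : ClassFn Γ) (w : SpinWreath Γ n) : ℂ :=
  ∏ᶠ c : Quotient (Equiv.Perm.SameCycle.setoid (perm n w)), f.1 (cycleProd w c.out)

theorem pow_perm_fix (w : SpinWreath Γ n) (i : Fin n) :
    perm n (w ^ Function.minimalPeriod (perm n w) i) i = i := by
  rw [map_pow, ← Equiv.Perm.iterate_eq_pow]
  exact Function.iterate_minimalPeriod

theorem cycleProd_conj (f : ClassFn Γ) (x w : SpinWreath Γ n) (i : Fin n) :
    f.1 (cycleProd (x * w * x⁻¹) (perm n x i)) = f.1 (cycleProd w i) := by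
  have hp : Function.minimalPeriod (perm n (x * w * x⁻¹)) (perm n x i) =
      Function.minimalPeriod (perm n w) i := by
    rw [Function.minimalPeriod_eq_minimalPeriod_iff]
    intro k
    simp only [Function.IsPeriodicPt, Function.IsFixedPt, Equiv.Perm.iterate_eq_pow, ← map_pow,
      conj_pow]
    simp
  have hfix := pow_perm_fix w i
  rw [cycleProd, hp, conj_pow, cycleProd]
  set v := w ^ Function.minimalPeriod (perm n w) i
  have hfix' : (perm n v)⁻¹ i = i := by rw [Equiv.Perm.inv_eq_iff_eq, hfix]
  have : (x * v * x⁻¹).left (perm n x i) =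
      x.left (perm n x i) * v.left i * (x.left (perm n x i))⁻¹ := by
    have hx : (1 : Fin n → Γ) (perm n x i) =
      x.left (perm n x i) * x⁻¹.left i := by
      have := congrFun (congrArg SemidirectProduct.left (mul_inv_cancel x)) (perm n x i)
      rw [mul_left'] at this
      simpa using this.symm
    rw [mul_left', mul_left', map_mul, mul_inv_rev, Equiv.Perm.mul_apply]
    rw [show (perm n x)⁻¹ (perm n x i) = i from (perm n x).symm_apply_apply i, hfix']
    rw [← eq_inv_of_mul_eq_one_right (hx.symm.trans rfl)]
  rw [this]
  exact f.2 _ _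

theorem cycleProd_sameCycle (f : ClassFn Γ) (w : SpinWreath Γ n) {i j : Fin n}
    (h : (perm n w).SameCycle i j) : f.1 (cycleProd w i) = f.1 (cycleProd w j) := by
  obtain ⟨k, rfl⟩ := h
  have := cycleProd_conj f (w ^ k) w i
  rw [← this, map_zpow]
  have hw : w ^ k * w * (w ^ k)⁻¹ = w := by
    rw [mul_inv_eq_iff_eq_mul]
    exact ((Commute.refl w).zpow_left k).eq
  rw [hw]

theorem eta_eq_of_conj (f : ClassFn Γ) (w w' : SpinWreath Γ n) (τ : Equiv.Perm (Fin n))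
    (h1 : perm n w' = τ * perm n w * τ⁻¹)
    (h2 : ∀ i, f.1 (cycleProd w' (τ i)) = f.1 (cycleProd w i)) : eta f w' = eta f w := by
  have hs : ∀ i j, (perm n w).SameCycle i j ↔ (perm n w').SameCycle (τ i) (τ j) := by
    intro i j
    rw [h1, Equiv.Perm.sameCycle_conj]
    simp
  let e : Quotient (Equiv.Perm.SameCycle.setoid (perm n w)) ≃
      Quotient (Equiv.Perm.SameCycle.setoid (perm n w')) := Quotient.congr τ hs
  refine (finprod_eq_of_bijective e e.bijective fun c => ?_).symm
  rw [← h2]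
  refine cycleProd_sameCycle f w' (Quotient.exact (s := Equiv.Perm.SameCycle.setoid (perm n w')) ?_)
  rw [Quotient.out_eq]
  conv_rhs => rw [← c.out_eq]
  rfl

theorem eta_conj (f : ClassFn Γ) (x w : SpinWreath Γ n) : eta f (x * w * x⁻¹) = eta f w :=
  eta_eq_of_conj f w _ (perm n x) (by simp) (cycleProd_conj f x w)

theorem eta_z (f : ClassFn Γ) (w : SpinWreath Γ n) : eta f (z n * w) = eta f w := by
  have hp : perm n (z n * w) = perm n w := by rw [map_mul, perm_z, one_mul]
  refine eta_eq_of_conj f w _ 1 (by simp [hp]) fun i => ?_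
  have hz : ∀ k : ℕ, (z n ^ k : SpinWreath Γ n) = SemidirectProduct.inr (SpinSym.z n ^ k) :=
    fun k => by rw [z, map_pow]
  rw [cycleProd, cycleProd, hp, (show Commute (z n) w from z_comm w).mul_pow, Equiv.Perm.one_apply,
    mul_left', map_pow, perm_z, hz, SemidirectProduct.left_inr]
  simp

variable (Γ) in
/-- The space `R^-(Γ̃_n)` of spin super class functions: class functions `f` on `Γ̃_n` with
`f(z x) = -f(x)` that vanish at all odd elements. -/
def SuperSpin (n : ℕ) : Submodule ℂ (SpinWreath Γ n → ℂ) where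
  carrier := {f | (∀ x y, f (x * y * x⁻¹) = f y) ∧ (∀ x, f (z n * x) = - f x) ∧
    ∀ x, sgn n x = -1 → f x = 0}
  add_mem' := by
    rintro f g ⟨h1, h2, h3⟩ ⟨k1, k2, k3⟩
    refine ⟨fun x y => ?_, fun x => ?_, fun x hx => ?_⟩
    · simp only [Pi.add_apply, h1 x y, k1 x y]
    · simp only [Pi.add_apply, h2, k2, neg_add]
    · simp only [Pi.add_apply, h3 x hx, k3 x hx, add_zero]
  zero_mem' := by simp
  smul_mem' := by
    rintro c f ⟨h1, h2, h3⟩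
    refine ⟨fun x y => ?_, fun x => ?_, fun x hx => ?_⟩
    · simp only [Pi.smul_apply, h1 x y]
    · simp only [Pi.smul_apply, h2, smul_neg]
    · simp only [Pi.smul_apply, h3 x hx, smul_zero]

variable [Finite Γ]

open Classical in
/-- The super outer tensor product `f ⊗ g` on `Γ̃_n ×̂ Γ̃_m`, extended by zero to `Γ̃_{n+m}`:
its value at `juxt a b` is `f(a) g(b)`. (The factor `1/2` accounts for the two preimages `(a, b)` and
`(z a, z b)` of a point, at which `f(a) g(b)` takes the same value.) -/
def outer (f : SpinWreath Γ n → ℂ) (g : SpinWreath Γ m → ℂ) (w : SpinWreath Γ (n + m)) : ℂ :=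
  2⁻¹ * ∑ᶠ p : SpinWreath Γ n × SpinWreath Γ m, if juxt p.1 p.2 = w then f p.1 * g p.2 else 0

/-- The function on `Γ̃_{n+m}` induced from `f ⊗ g` on the subgroup `Γ̃_n ×̂ Γ̃_m`. -/
def indProd (f : SpinWreath Γ n → ℂ) (g : SpinWreath Γ m → ℂ) (w : SpinWreath Γ (n + m)) : ℂ :=
  (Nat.card (Set.range fun p : SpinWreath Γ n × SpinWreath Γ m => juxt p.1 p.2) : ℂ)⁻¹ *
    ∑ᶠ x : SpinWreath Γ (n + m), outer f g (x⁻¹ * w * x)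

theorem finsum_add' {α : Type*} [Finite α] (f g : α → ℂ) :
    ∑ᶠ a, (f a + g a) = ∑ᶠ a, f a + ∑ᶠ a, g a :=
  finsum_add_distrib (Set.toFinite _) (Set.toFinite _)

theorem finsum_mul' {α : Type*} [Finite α] (c : ℂ) (f : α → ℂ) :
    ∑ᶠ a, c * f a = c * ∑ᶠ a, f a :=
  (mul_finsum f c).symm

theorem outer_add (f : SpinWreath Γ n → ℂ) (g g' : SpinWreath Γ m → ℂ)
    (w : SpinWreath Γ (n + m)) : outer f (g + g') w = outer f g w + outer f g' w := by
  rw [outer, outer, outer, ← mul_add, ← finsum_add']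
  congr 1
  refine finsum_congr fun p => ?_
  split_ifs <;> simp [mul_add]

theorem outer_smul (f : SpinWreath Γ n → ℂ) (c : ℂ) (g : SpinWreath Γ m → ℂ)
    (w : SpinWreath Γ (n + m)) : outer f (c • g) w = c * outer f g w := by
  rw [outer, outer, mul_left_comm, ← finsum_mul' c]
  congr 1
  refine finsum_congr fun p => ?_
  split_ifs
  · simp; ring
  · simp

theorem outer_z (f : SpinWreath Γ n → ℂ) (g : SpinWreath Γ m → ℂ) (hg : g ∈ SuperSpin Γ m)
    (w : SpinWreath Γ (n + m)) : outer f g (z _ * w) = - outer f g w := by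
  rw [outer, outer, ← mul_neg, ← finsum_neg_distrib]
  congr 1
  let e : SpinWreath Γ n × SpinWreath Γ m ≃ SpinWreath Γ n × SpinWreath Γ m :=
    Equiv.prodCongr (Equiv.refl _) (Equiv.mulLeft (z m))
  refine (finsum_eq_of_bijective e e.bijective fun p => ?_).symm
  have h1 : (e p).1 = p.1 := rfl
  have h2 : (e p).2 = z m * p.2 := rfl
  have h3 : juxt (e p).1 (e p).2 = z (n + m) * w ↔ juxt p.1 p.2 = w := by
    rw [h1, h2, z_mul_juxt_right, mul_right_inj]
  by_cases h : juxt p.1 p.2 = w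
  · rw [if_pos h, if_pos (h3.mpr h), h1, h2, hg.2.1, mul_neg]
  · rw [if_neg h, if_neg (fun h' => h (h3.mp h')), neg_zero]

theorem outer_odd (f : SpinWreath Γ n → ℂ) (g : SpinWreath Γ m → ℂ) (hf : f ∈ SuperSpin Γ n)
    (hg : g ∈ SuperSpin Γ m) (w : SpinWreath Γ (n + m)) (hw : sgn _ w = -1) : outer f g w = 0 := by
  rw [outer, finsum_eq_zero_of_forall_eq_zero, mul_zero]
  intro p
  split_ifs with h
  · rw [← h, sgn_juxt] at hw
    rcases Int.units_eq_one_or (sgn n p.1) with h1 | h1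
    · rw [h1, one_mul] at hw
      rw [hg.2.2 _ hw, mul_zero]
    · rw [hf.2.2 _ h1, zero_mul]
  · rfl

theorem indProd_mem (f : SpinWreath Γ n → ℂ) (g : SpinWreath Γ m → ℂ) (hf : f ∈ SuperSpin Γ n)
    (hg : g ∈ SuperSpin Γ m) : indProd f g ∈ SuperSpin Γ (n + m) := by
  refine ⟨fun x y => ?_, fun x => ?_, fun x hx => ?_⟩
  · rw [indProd, indProd]
    congr 1
    refine (finsum_eq_of_bijective _ (Equiv.mulLeft x).bijective fun u => ?_).symm
    simp [mul_assoc]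
  · rw [indProd, indProd, ← mul_neg, ← finsum_neg_distrib]
    congr 1
    refine finsum_congr fun u => ?_
    rw [← outer_z f g hg, ← mul_assoc, ← z_comm]
    simp only [mul_assoc]
  · rw [indProd, finsum_eq_zero_of_forall_eq_zero, mul_zero]
    intro u
    refine outer_odd f g hf hg _ ?_
    simp [hx]

/-- Left multiplication by `u ∈ R^-(Γ̃_n)`: the composite
`R^-(Γ̃_m) → R^-(Γ̃_n ×̂ Γ̃_m) → R^-(Γ̃_{n+m})` of `u ⊗ -` and induction. -/
def mulLeft (m : ℕ) (u : SuperSpin Γ n) : SuperSpin Γ m →ₗ[ℂ] SuperSpin Γ (n + m) where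
  toFun g := ⟨indProd u.1 g.1, indProd_mem _ _ u.2 g.2⟩
  map_add' g g' := by
    ext w
    simp only [indProd, Submodule.coe_add, Pi.add_apply, outer_add, finsum_add', mul_add]
  map_smul' c g := by
    ext w
    simp only [indProd, Submodule.coe_smul, Pi.smul_apply, outer_smul, finsum_mul', smul_eq_mul,
      RingHom.id_apply]
    ring

/-- Restriction to `Γ̃_n ×̂ Γ̃_m` followed by the pairing `⟨u, -⟩_ξ` in the first tensor factor, where
`⟨u, f⟩_ξ = |Γ̃_n|⁻¹ ∑_a η_n(ξ)(a) u(a) f(a⁻¹)` is the weighted form of `R^-(Γ̃_n)`. -/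
def pairLeft (ξ : ClassFn Γ) (m : ℕ) (u : SuperSpin Γ n) :
    SuperSpin Γ (n + m) →ₗ[ℂ] SuperSpin Γ m where
  toFun f := ⟨fun b => (Nat.card (SpinWreath Γ n) : ℂ)⁻¹ *
      ∑ᶠ a : SpinWreath Γ n, eta ξ a * u.1 a * f.1 (juxt a⁻¹ b), by
    refine ⟨fun x y => ?_, fun x => ?_, fun x hx => ?_⟩ <;> beta_reduce
    · congr 1
      refine finsum_congr fun a => ?_
      rcases Int.units_eq_one_or (sgn n a) with h | h
      · rw [← conj_juxt x _ y (by simp [h]), f.2.1]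
      · rw [u.2.2.2 _ h]; simp
    · rw [← mul_neg, ← finsum_neg_distrib]
      congr 1
      refine finsum_congr fun a => ?_
      rw [z_mul_juxt_right, f.2.2.1]
      ring
    · rw [finsum_eq_zero_of_forall_eq_zero, mul_zero]
      intro a
      rcases Int.units_eq_one_or (sgn n a) with h | h
      · rw [f.2.2.2 _ (by rw [sgn_juxt]; simp [h, hx]), mul_zero]
      · rw [u.2.2.2 _ h]; simp⟩
  map_add' g g' := by
    ext w
    simp only [Submodule.coe_add, Pi.add_apply, mul_add, finsum_add']
  map_smul' c g := by
    ext w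
    simp only [Submodule.coe_smul, Pi.smul_apply, smul_eq_mul, RingHom.id_apply]
    rw [mul_left_comm, ← finsum_mul' c]
    congr 1
    refine finsum_congr fun a => ?_
    ring

end SuperSpin

/-! ### The basic spin supermodule -/

section BasicSpin

/-- Matrices acting on `⊗^k ℂ^{1|1}`, with the basis indexed by `Fin k → Fin 2`. -/
abbrev TensMat (k : ℕ) : Type := Matrix (Fin k → Fin 2) (Fin k → Fin 2) ℂ

/-- The Kronecker product `S_0 ⊗ ⋯ ⊗ S_{k-1}` of `2 × 2` matrices. -/
def kron {k : ℕ} (S : Fin k → Matrix (Fin 2) (Fin 2) ℂ) : TensMat k :=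
  Matrix.of fun a b => ∏ l, S l (a l) (b l)

/-- The Pauli matrices. -/
def σ₁ : Matrix (Fin 2) (Fin 2) ℂ := !![0, 1; 1, 0]
def σ₂ : Matrix (Fin 2) (Fin 2) ℂ := !![0, -Complex.I; Complex.I, 0]
def σ₃ : Matrix (Fin 2) (Fin 2) ℂ := !![1, 0; 0, -1]

/-- The tensor factors of the `m`-th Clifford generator (`m` counted from `0`, so that
`m = 2 j` and `m = 2 j + 1` stand for `e_{2j+1}` and `e_{2j+2}`). -/
def cliffFactor (m l : ℕ) : Matrix (Fin 2) (Fin 2) ℂ :=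
  if l < m / 2 then σ₃ else if l = m / 2 then (if Even m then σ₁ else σ₂) else 1

/-- The Clifford generators on `⊗^k ℂ^{1|1}`:
`√-1 σ₃^{⊗ j} ⊗ σ₁ ⊗ 1 ⊗ ⋯` and `√-1 σ₃^{⊗ j} ⊗ σ₂ ⊗ 1 ⊗ ⋯`. -/
def cliff (k m : ℕ) : TensMat k := Complex.I • kron fun l => cliffFactor m l

/-- The image of the generator `t_{i+1}` in the basic spin supermodule,
`√((j+1)/(2j)) e_j - √((j-1)/(2j)) e_{j-1}` with `j = i + 1`. -/
def spinGenMat (k i : ℕ) : TensMat k :=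
  ((Real.sqrt ((i + 2) / (2 * (i + 1))) : ℝ) : ℂ) • cliff k i -
    ((Real.sqrt (i / (2 * (i + 1))) : ℝ) : ℂ) • cliff k (i - 1)

theorem kron_mul {k : ℕ} (S T : Fin k → Matrix (Fin 2) (Fin 2) ℂ) :
    kron S * kron T = kron (fun l => S l * T l) := by
  ext a b
  simp only [kron, Matrix.mul_apply, Matrix.of_apply, ← Finset.prod_mul_distrib]
  rw [Finset.prod_univ_sum, Fintype.piFinset_univ]

theorem kron_one {k : ℕ} : kron (fun _ : Fin k => 1) = 1 := by
  ext a b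
  simp only [kron, Matrix.of_apply, Matrix.one_apply]
  rw [Finset.prod_ite_zero]
  simp [funext_iff]

/-- Kronecker products that anticommute in one factor and commute in the others anticommute. -/
theorem kron_anticomm {k : ℕ} (S T : Fin k → Matrix (Fin 2) (Fin 2) ℂ) (l₀ : Fin k)
    (h0 : S l₀ * T l₀ = -(T l₀ * S l₀)) (h : ∀ l, l ≠ l₀ → S l * T l = T l * S l) :
    kron S * kron T = -(kron T * kron S) := by
  rw [kron_mul, kron_mul]
  ext a b
  simp only [kron, Matrix.of_apply, Matrix.neg_apply]
  rw [← Finset.mul_prod_erase _ _ (Finset.mem_univ l₀),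
    ← Finset.mul_prod_erase _ (fun l => (T l * S l) (a l) (b l)) (Finset.mem_univ l₀), h0,
    Matrix.neg_apply, neg_mul]
  congr 2
  exact Finset.prod_congr rfl fun l hl => by rw [h l (Finset.ne_of_mem_erase hl)]

theorem σ₁_sq : σ₁ * σ₁ = 1 := by ext i j; fin_cases i <;> fin_cases j <;> simp [σ₁]
theorem σ₂_sq : σ₂ * σ₂ = 1 := by ext i j; fin_cases i <;> fin_cases j <;> simp [σ₂]
theorem σ₃_sq : σ₃ * σ₃ = 1 := by ext i j; fin_cases i <;> fin_cases j <;> simp [σ₃]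
theorem σ₁₂ : σ₁ * σ₂ = -(σ₂ * σ₁) := by
  ext i j; fin_cases i <;> fin_cases j <;> simp [σ₁, σ₂]
theorem σ₁₃ : σ₁ * σ₃ = -(σ₃ * σ₁) := by
  ext i j; fin_cases i <;> fin_cases j <;> simp [σ₁, σ₃]
theorem σ₂₃ : σ₂ * σ₃ = -(σ₃ * σ₂) := by
  ext i j; fin_cases i <;> fin_cases j <;> simp [σ₂, σ₃]

theorem cliffFactor_sq (m l : ℕ) : cliffFactor m l * cliffFactor m l = 1 := by
  unfold cliffFactor
  split_ifs <;> simp [σ₁_sq, σ₂_sq, σ₃_sq]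

theorem cliff_sq (k m : ℕ) : cliff k m * cliff k m = -1 := by
  rw [cliff, smul_mul_smul_comm, kron_mul, Complex.I_mul_I]
  simp only [cliffFactor_sq, kron_one, neg_smul, one_smul]

theorem cliff_anticomm {k m m' : ℕ} (h : m < m') (hm : m / 2 < k) :
    cliff k m * cliff k m' = -(cliff k m' * cliff k m) := by
  rw [cliff, cliff, smul_mul_smul_comm, smul_mul_smul_comm,
    kron_anticomm _ _ ⟨m / 2, hm⟩, smul_neg]
  · rcases (Nat.div_le_div_right h.le : m / 2 ≤ m' / 2).lt_or_eq with h' | h'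
    · simp only [cliffFactor, lt_irrefl, if_false, if_true, h']
      split_ifs
      · exact σ₁₃
      · exact σ₂₃
    · have h1 : Even m := by rw [Nat.even_iff]; omega
      have h2 : ¬ Even m' := by rw [Nat.even_iff]; omega
      simp only [cliffFactor, h', lt_irrefl, if_false, if_true, h1, h2]
      exact σ₁₂
  · intro l hl
    have hl' : l.val ≠ m / 2 := fun e => hl (Fin.ext e)
    rcases lt_or_gt_of_ne hl' with h' | h'
    · have : l.val < m' / 2 := lt_of_lt_of_le h' (Nat.div_le_div_right h.le)
      simp [cliffFactor, h', this]
    · have h'' : ¬ l.val < m / 2 := by omega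
      simp [cliffFactor, h'', hl']

theorem cliff_parity {k m : ℕ} (hm : m / 2 < k) :
    cliff k m * kron (fun _ => σ₃) = -(kron (fun _ => σ₃) * cliff k m) := by
  rw [cliff, smul_mul_assoc, mul_smul_comm, kron_anticomm _ _ ⟨m / 2, hm⟩, smul_neg]
  · simp only [cliffFactor, lt_irrefl, if_false, if_true]
    split_ifs
    · exact σ₁₃
    · exact σ₂₃
  · intro l hl
    have hl' : l.val ≠ m / 2 := fun e => hl (Fin.ext e)
    simp only [cliffFactor, hl', if_false]
    split_ifs <;> simp

theorem spinGenMat_zero (k : ℕ) : spinGenMat k 0 = cliff k 0 := by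
  simp [spinGenMat]

theorem spinGenMat_sq {k i : ℕ} (hi : i / 2 < k) : spinGenMat k i * spinGenMat k i = -1 := by
  rcases i with _ | i
  · rw [spinGenMat_zero, cliff_sq]
  set a : ℝ := Real.sqrt (((i + 1 : ℕ) + 2) / (2 * ((i + 1 : ℕ) + 1))) with ha
  set b : ℝ := Real.sqrt ((i + 1 : ℕ) / (2 * ((i + 1 : ℕ) + 1))) with hb
  have hab : (a : ℂ) * a + b * b = 1 := by
    rw [← Complex.ofReal_mul, ← Complex.ofReal_mul, ← Complex.ofReal_add, ha, hb,
      Real.mul_self_sqrt (by positivity), Real.mul_self_sqrt (by positivity)]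
    norm_cast
    push_cast
    field_simp
    ring
  have e1 : spinGenMat k (i + 1) = (a : ℂ) • cliff k (i + 1) - (b : ℂ) • cliff k i := rfl
  have hc := cliff_anticomm (k := k) (m := i) (m' := i + 1) (by omega) (by omega)
  rw [e1, sub_mul, mul_sub, mul_sub]
  simp only [smul_mul_smul_comm, cliff_sq, hc]
  trans ((a : ℂ) * a + b * b) • (-1 : TensMat k)
  · module
  · rw [hab, one_smul]

theorem spinGenMat_far {k i j : ℕ} (h : j + 1 < i) (hi : i / 2 < k) :
    spinGenMat k i * spinGenMat k j = -(spinGenMat k j * spinGenMat k i) := by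
  have h1 := cliff_anticomm (k := k) (m := j) (m' := i) (by omega) (by omega)
  have h2 := cliff_anticomm (k := k) (m := j) (m' := i - 1) (by omega) (by omega)
  have h3 := cliff_anticomm (k := k) (m := j - 1) (m' := i) (by omega) (by omega)
  have h4 := cliff_anticomm (k := k) (m := j - 1) (m' := i - 1) (by omega) (by omega)
  simp only [spinGenMat, sub_mul, mul_sub, smul_mul_smul_comm, h1, h2, h3, h4]
  module

theorem spinGenMat_near {k i : ℕ} (hi : (i + 1) / 2 < k) :
    spinGenMat k i * spinGenMat k (i + 1) + spinGenMat k (i + 1) * spinGenMat k i = 1 := by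
  set a : ℝ := Real.sqrt ((i + 2) / (2 * (i + 1))) with ha
  set b : ℝ := Real.sqrt (i / (2 * (i + 1))) with hb
  set c : ℝ := Real.sqrt (((i + 1 : ℕ) + 2) / (2 * ((i + 1 : ℕ) + 1))) with hc
  set d : ℝ := Real.sqrt ((i + 1 : ℕ) / (2 * ((i + 1 : ℕ) + 1))) with hd
  have had : (a : ℂ) * d = 2⁻¹ := by
    rw [← Complex.ofReal_mul, ha, hd, ← Real.sqrt_mul (by positivity),
      show ((i + 2 : ℝ) / (2 * (i + 1)) * ((i + 1 : ℕ) / (2 * ((i + 1 : ℕ) + 1)))) = (2⁻¹) ^ 2 by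
        push_cast; field_simp; ring, Real.sqrt_sq (by norm_num)]
    norm_num
  have e0 : spinGenMat k i = (a : ℂ) • cliff k i - (b : ℂ) • cliff k (i - 1) := rfl
  have e1 : spinGenMat k (i + 1) = (c : ℂ) • cliff k (i + 1) - (d : ℂ) • cliff k i := rfl
  have hda : (d : ℂ) * a = 2⁻¹ := by rw [mul_comm, had]
  have h1 := cliff_anticomm (k := k) (m := i) (m' := i + 1) (by omega) (by omega)
  have h2 := cliff_anticomm (k := k) (m := i - 1) (m' := i + 1) (by omega) (by omega)
  have h3 : (b : ℂ) • (cliff k (i - 1) * cliff k i) = -((b : ℂ) • (cliff k i * cliff k (i - 1))) := by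
    rcases i with _ | i
    · simp [hb]
    · rw [cliff_anticomm (k := k) (m := i + 1 - 1) (m' := i + 1) (by omega) (by omega), smul_neg]
  have h3' : (b : ℂ) • (cliff k (i - 1) * (d : ℂ) • cliff k i) =
      -((d : ℂ) • (b : ℂ) • (cliff k i * cliff k (i - 1))) := by
    rw [mul_smul_comm, smul_comm, h3, smul_neg]
  rw [e0, e1]
  simp only [sub_mul, mul_sub, smul_mul_assoc, h3']
  simp only [mul_smul_comm, h1, h2, cliff_sq, smul_smul, had, hda]
  have h5 : (2⁻¹ : ℂ) • (-1 : TensMat k) = -1 + (2⁻¹ : ℂ) • (1 : TensMat k) := by module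
  rw [h5]
  module

theorem spinGenMat_parity {k i : ℕ} (hi : i / 2 < k) :
    spinGenMat k i * kron (fun _ => σ₃) = -(kron (fun _ => σ₃) * spinGenMat k i) := by
  have h1 := cliff_parity (k := k) (m := i) hi
  have h2 := cliff_parity (k := k) (m := i - 1) (by omega)
  simp only [spinGenMat, sub_mul, mul_sub, smul_mul_assoc, mul_smul_comm, h1, h2]
  module

/-- The image of a generator as an invertible matrix. -/
def spinGenUnit (n : ℕ) (i : Fin (n - 1)) : (TensMat (n / 2))ˣ where
  val := spinGenMat (n / 2) i
  inv := -spinGenMat (n / 2) i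
  val_inv := by rw [mul_neg, spinGenMat_sq (by omega), neg_neg]
  inv_val := by rw [neg_mul, spinGenMat_sq (by omega), neg_neg]

/-- The basic spin supermodule `⊗^{⌊n/2⌋} ℂ^{1|1}` of `S̃_n`: `z` acts as `-1` and the generators
act through the Clifford algebra. -/
def basicSpin (n : ℕ) : SpinSym n →* (TensMat (n / 2))ˣ :=
  SpinSym.lift (-1) (spinGenUnit n) (by simp)
    (fun i => Units.ext (spinGenMat_sq (k := n / 2) (i := i.val) (by omega)))
    (fun i j h => Units.ext (by
      have hx := spinGenMat_sq (k := n / 2) (i := i.val) (by omega)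
      have hy := spinGenMat_sq (k := n / 2) (i := i.val + 1) (by omega)
      have hxy := spinGenMat_near (k := n / 2) (i := i.val) (by omega)
      have e : (((spinGenUnit n i * spinGenUnit n j) ^ 3 : (TensMat (n / 2))ˣ) : TensMat (n / 2)) =
          (spinGenMat (n / 2) i * spinGenMat (n / 2) (i.val + 1)) ^ 3 := by
        rw [h]; rfl
      rw [e]
      set x := spinGenMat (n / 2) i.val
      set y := spinGenMat (n / 2) (i.val + 1)
      have h2 : (x * y) * (x * y) = x * y - 1 := by
        have : y * x = 1 - x * y := by rw [← hxy]; abel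
        rw [show x * y * (x * y) = x * (y * x) * y by simp only [mul_assoc], this, mul_sub, mul_one,
          sub_mul, show x * (x * y) * y = (x * x) * (y * y) by simp only [mul_assoc], hx, hy]
        simp
      rw [pow_succ, pow_two, h2, sub_mul, h2]
      simp))
    (fun i j h => Units.ext (by
      have := spinGenMat_far (k := n / 2) (i := i.val) (j := j.val) h (by omega)
      simpa [spinGenUnit] using this))
    (fun i => Units.ext (by simp))

/-- The character `χ_n` of the basic spin supermodule. -/
def basicSpinChar (n : ℕ) (x : SpinSym n) : ℂ := Matrix.trace (basicSpin n x : TensMat (n / 2))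

theorem basicSpinChar_conj {n : ℕ} (x y : SpinSym n) :
    basicSpinChar n (x * y * x⁻¹) = basicSpinChar n y := by
  simp only [basicSpinChar, map_mul, map_inv, Units.val_mul]
  rw [Matrix.trace_mul_comm, ← mul_assoc, Units.inv_mul, one_mul]

theorem basicSpinChar_z {n : ℕ} (x : SpinSym n) :
    basicSpinChar n (SpinSym.z n * x) = -basicSpinChar n x := by
  have : basicSpin n (SpinSym.z n) = -1 := SpinSym.lift_z _ _ _ _ _ _ _
  simp [basicSpinChar, this]

theorem basicSpinChar_odd {n : ℕ} (x : SpinSym n) (hx : SpinSym.sgn n x = -1) :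
    basicSpinChar n x = 0 := by
  let P : TensMat (n / 2) := kron fun _ => σ₃
  have hP : P * P = 1 := by
    simp only [P, kron_mul, σ₃_sq, kron_one]
  let U : (TensMat (n / 2))ˣ := ⟨P, P, hP, hP⟩
  let s : ℤˣ →* (TensMat (n / 2))ˣ := Units.map (algebraMap ℤ (TensMat (n / 2))).toMonoidHom
  have hs : s (-1) = -1 := by ext1; simp [s]
  have hcomm : ∀ (u : ℤˣ) (v : (TensMat (n / 2))ˣ), s u * v = v * s u := by
    intro u v
    rcases Int.units_eq_one_or u with rfl | rfl
    · simp
    · rw [hs]; simp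
  have e : (MulAut.conj U).toMonoidHom.comp (basicSpin n) =
      MonoidHom.mk' (fun x => s (SpinSym.sgn n x) * basicSpin n x) (by
        intro a b
        rw [map_mul, map_mul, map_mul, mul_assoc, mul_assoc, ← mul_assoc (s (SpinSym.sgn n b)),
          hcomm _ (basicSpin n a)]
        simp only [mul_assoc]) := by
    refine SpinSym.hom_ext ?_ fun i => ?_
    · have : basicSpin n (SpinSym.z n) = -1 := SpinSym.lift_z _ _ _ _ _ _ _
      simp [this]
    · have hi : basicSpin n (SpinSym.t i) = spinGenUnit n i := SpinSym.lift_t _ _ _ _ _ _ _ _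
      simp only [MonoidHom.comp_apply, MulEquiv.coe_toMonoidHom, MulAut.conj_apply,
        MonoidHom.mk'_apply, SpinSym.sgn_t, hi, hs]
      rw [mul_inv_eq_iff_eq_mul]
      ext1
      have := spinGenMat_parity (k := n / 2) (i := i.val) (by omega)
      simp only [Units.val_mul, Units.val_neg, neg_mul, one_mul]
      change P * spinGenMat _ _ = -(spinGenMat _ _ * P)
      rw [this, neg_neg]
  have h := DFunLike.congr_fun e x
  simp only [MonoidHom.comp_apply, MulEquiv.coe_toMonoidHom, MulAut.conj_apply,
        MonoidHom.mk'_apply, hx, hs] at h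
  have h' : Matrix.trace (P * (basicSpin n x : TensMat (n / 2)) * P) = - basicSpinChar n x := by
    have h2 : Matrix.trace (P * (basicSpin n x : TensMat (n / 2)) * P) =
        Matrix.trace ((-1 * basicSpin n x : (TensMat (n / 2))ˣ) : TensMat (n / 2)) :=
      congrArg (fun v : (TensMat (n / 2))ˣ => Matrix.trace (v : TensMat (n / 2))) h
    rw [h2]
    simp [basicSpinChar]
  rw [Matrix.trace_mul_comm, ← mul_assoc, hP, one_mul] at h'
  exact self_eq_neg.mp h'

end BasicSpin

/-! ### The spin class functions `χ_n(γ)` and `σ_n(γ)` -/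

section Elements
variable {Γ : Type*} [Group Γ]

open SpinWreath

/-- The spin super class function `χ_n(f) = η_n(f) * χ_n` for `f ∈ R(Γ)`. If `f` is the character of
`V`, it is the character of the supermodule `V^{⊗ n} ⊗ U` with `U` the basic spin supermodule. -/
def chi (n : ℕ) (f : ClassFn Γ) : SuperSpin Γ n where
  val w := eta f w * basicSpinChar n w.right
  property := by
    refine ⟨fun x y => ?_, fun x => ?_, fun x hx => ?_⟩ <;> beta_reduce
    · rw [eta_conj]
      congr 1
      exact basicSpinChar_conj x.right y.right
    · rw [eta_z, ← mul_neg]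
      congr 1
      exact basicSpinChar_z x.right
    · rw [basicSpinChar_odd x.right hx, mul_zero]

/-- The standard lift `t_1 t_2 ⋯ t_{n-1}` of an `n`-cycle (for odd `n`). -/
def stdCycle (n : ℕ) : SpinSym n := (List.ofFn fun i : Fin (n - 1) => SpinSym.t i).prod

theorem sgn_stdCycle {n : ℕ} (hn : Odd n) : SpinSym.sgn n (stdCycle n) = 1 := by
  have : ∀ i, SpinSym.sgn n (SpinSym.t i) = -1 := fun i => SpinSym.sgn_t i
  rw [stdCycle, map_list_prod, List.map_ofFn]
  simp only [Function.comp_def, this, List.ofFn_const, List.prod_replicate]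
  exact Even.neg_one_pow (Nat.Odd.sub_odd hn odd_one)

open Classical in
/-- The class function with value `1` on `⋃_c D_n(c)^+`, the conjugates of all
`(g, t_1 ⋯ t_{n-1})`, with value `-1` on `⋃_c D_n(c)^-`, the conjugates of all
`(g, z t_1 ⋯ t_{n-1})`, and with value `0` elsewhere. -/
def cycleSign (n : ℕ) (w : SpinWreath Γ n) : ℂ :=
  (if ∃ g : Fin n → Γ, IsConj (⟨g, stdCycle n⟩ : SpinWreath Γ n) w then 1 else 0) -
    (if ∃ g : Fin n → Γ, IsConj (⟨g, SpinSym.z n * stdCycle n⟩ : SpinWreath Γ n) w then 1 else 0)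

open Classical in
theorem cycleSign_conj {n : ℕ} (x y : SpinWreath Γ n) :
    cycleSign n (x * y * x⁻¹) = cycleSign n y := by
  have h : ∀ v : SpinWreath Γ n, IsConj v (x * y * x⁻¹) ↔ IsConj v y := fun v =>
    ⟨fun h => h.trans (isConj_iff.mpr ⟨x⁻¹, by group⟩),
      fun h => h.trans (isConj_iff.mpr ⟨x, rfl⟩)⟩
  unfold cycleSign
  congr 1
  · exact if_congr (exists_congr fun g => h _) rfl rfl
  · exact if_congr (exists_congr fun g => h _) rfl rfl

open Classical in
theorem cycleSign_z {n : ℕ} (x : SpinWreath Γ n) : cycleSign n (z n * x) = -cycleSign n x := by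
  have hzz : ∀ v : SpinWreath Γ n, z n * (z n * v) = v := fun v => by
    rw [← mul_assoc, z_mul_z, one_mul]
  have h1 : ∀ v : SpinWreath Γ n, IsConj v (z n * x) ↔ IsConj (z n * v) x := by
    intro v
    simp only [isConj_iff]
    refine exists_congr fun c => ?_
    have hz : c * (z n * v) * c⁻¹ = z n * (c * v * c⁻¹) := by
      rw [← mul_assoc, ← z_comm c]
      simp only [mul_assoc]
    rw [hz]
    constructor
    · intro h; rw [h, hzz]
    · intro h; rw [← h, hzz]
  have h2 : ∀ (g : Fin n → Γ) (s : SpinSym n),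
      z n * (⟨g, s⟩ : SpinWreath Γ n) = ⟨g, SpinSym.z n * s⟩ := by
    intro g s
    refine SemidirectProduct.ext (funext fun i => ?_) rfl
    rw [mul_left', perm_z]
    simp [z]
  have h3 : SpinSym.z n * (SpinSym.z n * stdCycle n) = stdCycle n := by
    rw [← mul_assoc, SpinSym.z_mul_z, one_mul]
  unfold cycleSign
  rw [neg_sub]
  congr 1
  · exact if_congr (exists_congr fun g => by rw [h1, h2]) rfl rfl
  · exact if_congr (exists_congr fun g => by rw [h1, h2, h3]) rfl rfl

theorem cycleSign_odd {n : ℕ} (hn : Odd n) (x : SpinWreath Γ n) (hx : sgn n x = -1) :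
    cycleSign n x = 0 := by
  have h1 : ∀ v : SpinWreath Γ n, sgn n v = 1 → ¬ IsConj v x := by
    intro v hv h
    obtain ⟨c, rfl⟩ := isConj_iff.mp h
    rw [map_mul, map_mul, hv, mul_one, ← map_mul, mul_inv_cancel, map_one] at hx
    exact absurd hx (by decide)
  unfold cycleSign
  rw [if_neg, if_neg, sub_zero]
  · rintro ⟨g, hg⟩
    refine h1 _ ?_ hg
    change SpinSym.sgn n (SpinSym.z n * stdCycle n) = 1
    rw [map_mul, SpinSym.sgn_z, sgn_stdCycle hn, one_mul]
  · rintro ⟨g, hg⟩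
    exact h1 _ (sgn_stdCycle hn) hg

/-- The spin super class function `σ_n(f)` for `n` odd and `f ∈ R(Γ)`: it takes the value
`± (n / √2) f(c)` on `D_n(c)^±`, the classes of `n`-cycles with cycle product in `c`, and vanishes
elsewhere. (At an `n`-cycle, `eta f w` is the value of `f` at the cycle product.) -/
def sigma (n : ℕ) (hn : Odd n) (f : ClassFn Γ) : SuperSpin Γ n where
  val w := ((n : ℂ) / (Real.sqrt 2 : ℝ)) * eta f w * cycleSign n w
  property := by
    refine ⟨fun x y => ?_, fun x => ?_, fun x hx => ?_⟩ <;> beta_reduce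
    · rw [eta_conj, cycleSign_conj]
    · rw [eta_z, cycleSign_z, mul_neg]
    · rw [cycleSign_odd hn x hx, mul_zero]

end Elements

/-! ### The space `R^-_Γ` and the operators on it -/

section Operators
variable (Γ : Type*) [Group Γ] [Finite Γ]

/-- The space `R^-_Γ = ⨁_n R^-(Γ̃_n)`. -/
abbrev RMinus : Type _ := ⨁ n : ℕ, SuperSpin Γ n

instance : AddCommGroup (RMinus Γ) :=
  { (inferInstance : AddCommMonoid (RMinus Γ)),
    (DirectSum.instAddCommGroup : AddCommGroup (RMinus Γ)) with }

variable {Γ}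

/-- The operator `R^-(Γ̃_m) → R^-(Γ̃_{n+m})` of multiplication by `u ∈ R^-(Γ̃_n)`, for all `m`. -/
def creation {n : ℕ} (u : SuperSpin Γ n) : Module.End ℂ (RMinus Γ) :=
  DirectSum.toModule ℂ ℕ (RMinus Γ) fun m =>
    DirectSum.lof ℂ ℕ (fun k => SuperSpin Γ k) (n + m) ∘ₗ mulLeft m u

/-- The operator `R^-(Γ̃_{n+m}) → R^-(Γ̃_m)` of restriction and pairing with `u ∈ R^-(Γ̃_n)` under
`⟨ , ⟩_ξ`, for all `m` (it is zero on `R^-(Γ̃_k)` for `k < n`). -/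
def annihilation (ξ : ClassFn Γ) {n : ℕ} (u : SuperSpin Γ n) : Module.End ℂ (RMinus Γ) where
  toFun f := DFinsupp.mapRange.linearMap (fun m => pairLeft ξ m u)
    (DFinsupp.comapDomain (fun m => n + m) (add_right_injective n) f)
  map_add' f g := by
    rw [← map_add]
    exact congrArg _ (DFinsupp.comapDomain_add _ _ f g)
  map_smul' c f := by
    rw [RingHom.id_apply, ← map_smul]
    exact congrArg _ (DFinsupp.comapDomain_smul _ _ c f)

/-- The normalization factor `2^{n̄/2}`, where `n̄ ∈ {0, 1}` is the parity of `n`. -/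
def parityFactor (n : ℕ) : ℂ := if Even n then 1 else (Real.sqrt 2 : ℝ)

/-- `H_{-n}(f)`: induction product with `2^{n̄/2} χ_n(f)`. -/
def Hminus (f : ClassFn Γ) (n : ℕ) : Module.End ℂ (RMinus Γ) :=
  creation (parityFactor n • chi n f)

/-- `H_n(f)`: restriction and pairing with `2^{n̄/2} χ_n(f)`. -/
def Hplus (ξ f : ClassFn Γ) (n : ℕ) : Module.End ℂ (RMinus Γ) :=
  annihilation ξ (parityFactor n • chi n f)

/-- The coefficient of `z^{-n}` in `H_+(f, z) H_-(f, -z)`, where `H_+(f, z) = ∑_{j ≥ 0} H_{-j}(f) z^j`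
and `H_-(f, z) = ∑_{k ≥ 0} H_k(f) z^{-k}` have constant term `H_0(f) = 1`. On `R^-(Γ̃_m)` only the
finitely many terms with `k ≤ m` and `j = k - n ≥ 0` contribute. -/
def vertexCoeff (ξ f : ClassFn Γ) (n : ℤ) : Module.End ℂ (RMinus Γ) :=
  DirectSum.toModule ℂ ℕ (RMinus Γ) fun m =>
    ∑ k ∈ Finset.range (m + 1), if n ≤ k then
      ((-1 : ℂ) ^ k • (Hminus f ((k : ℤ) - n).toNat * Hplus ξ f k)) ∘ₗ
        DirectSum.lof ℂ ℕ (fun k => SuperSpin Γ k) m else 0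

theorem natAbs_odd {m : ℤ} (hm : Odd m) : Odd m.natAbs := Int.natAbs_odd.mpr hm

/-- The operators `a_m(f)` for odd `m`: `a_{-n}(f)` is the induction product with `σ_n(f)` and
`a_n(f)` is restriction and pairing with `σ_n(f)`, for `n > 0`. -/
def heisenberg (ξ f : ClassFn Γ) (m : ℤ) (hm : Odd m) : Module.End ℂ (RMinus Γ) :=
  if m < 0 then creation (sigma m.natAbs (natAbs_odd hm) f)
  else annihilation ξ (sigma m.natAbs (natAbs_odd hm) f)

end Operators

/-! ### The central extension of `R_ℤ(Γ)/2R_ℤ(Γ)` and the space `F_Γ^-` -/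

section Lattice
variable (Γ : Type*) [Group Γ]

/-- `R_{𝔽₂}(Γ) = R_ℤ(Γ) / 2 R_ℤ(Γ)`. -/
abbrev RF2 : Type _ := RZ Γ ⧸ (nsmulAddMonoidHom (α := RZ Γ) 2).range

variable {Γ}

/-- The class of a lattice element in the (multiplicatively written) group `R_{𝔽₂}(Γ)`. -/
def RZ.bar (α : RZ Γ) : Multiplicative (RF2 Γ) :=
  Multiplicative.ofAdd (QuotientAddGroup.mk α)

/-- The alternating form `c₁(α, β) = ⟨α, β⟩_ξ + ⟨α, α⟩_ξ ⟨β, β⟩_ξ`, to be read modulo `2`. -/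
def c₁ (ξ : ClassFn Γ) (α β : RZ Γ) : ℤ :=
  latticeForm ξ α β + latticeForm ξ α α * latticeForm ξ β β

/-- A group extension of `R_{𝔽₂}(Γ)` by `{±1}` is of the required type if it is central with
commutators `a b a⁻¹ b⁻¹ = (-1)^{c₁(a, b)}`. -/
structure IsSpinExtension (ξ : ClassFn Γ) {E : Type*} [Group E]
    (S : GroupExtension ℤˣ E (Multiplicative (RF2 Γ))) : Prop where
  central : ∀ (s : ℤˣ) (a : E), S.inl s * a = a * S.inl s
  commutator : ∀ (a b : E) (α β : RZ Γ), S.rightHom a = α.bar → S.rightHom b = β.bar →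
    a * b * a⁻¹ * b⁻¹ = S.inl ((-1) ^ c₁ ξ α β)

/-- `Φ` is a subgroup of `R_ℤ(Γ)` containing `2 R_ℤ(Γ)` that is maximal such that `c₁` vanishes
modulo `2` on `Φ`. -/
def IsMaximalIsotropic (ξ : ClassFn Γ) (Φ : AddSubgroup (RZ Γ)) : Prop :=
  Maximal (fun Ψ : AddSubgroup (RZ Γ) => (nsmulAddMonoidHom (α := RZ Γ) 2).range ≤ Ψ ∧
    ∀ α ∈ Ψ, ∀ β ∈ Ψ, Even (c₁ ξ α β)) Φ

/-- The space `ℂ[R_ℤ(Γ)/Φ]`. -/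
abbrev LatticeSpace (Φ : AddSubgroup (RZ Γ)) : Type _ := (RZ Γ ⧸ Φ) →₀ ℂ

/-- The basis element `e^{[β]}` of `ℂ[R_ℤ(Γ)/Φ]`. -/
def latticeVec (Φ : AddSubgroup (RZ Γ)) (β : RZ Γ) : LatticeSpace Φ :=
  Finsupp.single (QuotientAddGroup.mk β) 1

/-- The space `F_Γ^- = R^-_Γ ⊗ ℂ[R_ℤ(Γ)/Φ]`. -/
abbrev FockSpace (Φ : AddSubgroup (RZ Γ)) : Type _ := RMinus Γ ⊗[ℂ] LatticeSpace Φ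

variable [Finite Γ]

/-- The component `X_n(γ)` of the twisted vertex operator
`X(γ, z) = ∑_n X_n(γ) z^{-n} = H_+(γ, z) H_-(γ, -z) e_γ̄` on `F_Γ^-`, where `e` is a section of the
extension, acting on `ℂ[R_ℤ(Γ)/Φ]` through `ρ`. -/
def vertexOp (ξ : ClassFn Γ) {E : Type*} [Group E]
    {S : GroupExtension ℤˣ E (Multiplicative (RF2 Γ))} (e : S.Section) {Φ : AddSubgroup (RZ Γ)}
    (ρ : Representation ℂ E (LatticeSpace Φ)) (γ : RZ Γ) (n : ℤ) :
    Module.End ℂ (FockSpace Φ) :=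
  TensorProduct.map (vertexCoeff ξ γ.toClassFn n) (ρ (e γ.bar))

/-- The operator `a_m(γ)` on `F_Γ^-`, acting on the first tensor factor. -/
def heisenbergOp (ξ : ClassFn Γ) (Φ : AddSubgroup (RZ Γ)) (γ : RZ Γ) (m : ℤ) (hm : Odd m) :
    Module.End ℂ (FockSpace Φ) :=
  TensorProduct.map (heisenberg ξ γ.toClassFn m hm) LinearMap.id

end Lattice

/-! ### The twisted toroidal Lie algebra -/

section Toroidal
variable (I : Type*)

/-- Generators of the twisted toroidal Lie algebra: `C`, `h_i(m)` for odd `m`, `x_n(α_i)` and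
`x_n(-α_i)`. -/
inductive ToroidalGen : Type _
  | C : ToroidalGen
  | h (i : I) (m : ℤ) (hm : Odd m) : ToroidalGen
  | xPos (i : I) (n : ℤ) : ToroidalGen
  | xNeg (i : I) (n : ℤ) : ToroidalGen

namespace ToroidalGen
variable {I}

/-- The generator `C` in the free Lie algebra. -/
def freeC : FreeLieAlgebra ℂ (ToroidalGen I) := FreeLieAlgebra.of ℂ .C

/-- The element `h_i(m)`, which is `0` for even `m`. -/
def freeH (i : I) (m : ℤ) : FreeLieAlgebra ℂ (ToroidalGen I) :=
  if hm : Odd m then FreeLieAlgebra.of ℂ (.h i m hm) else 0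

/-- The generator `x_n(α_i)`. -/
def freeX (i : I) (n : ℤ) : FreeLieAlgebra ℂ (ToroidalGen I) := FreeLieAlgebra.of ℂ (.xPos i n)

/-- The generator `x_n(-α_i)`. -/
def freeY (i : I) (n : ℤ) : FreeLieAlgebra ℂ (ToroidalGen I) := FreeLieAlgebra.of ℂ (.xNeg i n)

end ToroidalGen

open ToroidalGen

variable {I}

/-- The elements of the free Lie algebra that are set to zero. -/
inductive ToroidalRel (A : I → I → ℤ) : FreeLieAlgebra ℂ (ToroidalGen I) → Prop
  /-- `C` is central. -/
  | central (g : ToroidalGen I) : ToroidalRel A ⁅(freeC : FreeLieAlgebra ℂ (ToroidalGen I)), FreeLieAlgebra.of ℂ g⁆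
  /-- `x_n(α_i) = (-1)^n x_n(-α_i)`. -/
  | x_neg (i : I) (n : ℤ) : ToroidalRel A (freeX i n - ((-1 : ℂ) ^ n) • freeY i n)
  /-- `[h_i(m), h_j(m')] = (m/2) a_{ij} δ_{m,-m'} C`. -/
  | h_h (i j : I) (m m' : ℤ) (hm : Odd m) (hm' : Odd m') :
      ToroidalRel A (⁅freeH i m, freeH j m'⁆ -
        (if m = -m' then (m : ℂ) / 2 * (A i j : ℂ) else 0) • freeC)
  /-- `[h_i(m), x_n(α_j)] = a_{ij} x_{n+m}(α_j)`. -/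
  | h_x (i j : I) (m n : ℤ) (hm : Odd m) :
      ToroidalRel A (⁅freeH i m, freeX j n⁆ - (A i j : ℂ) • freeX j (n + m))
  /-- `[x_n(α_i), x_{n'}(-α_i)] = 8 (h_i(n+n') + (n/2) δ_{n,-n'} C)`. -/
  | x_x (i : I) (n n' : ℤ) :
      ToroidalRel A (⁅freeX i n, freeY i n'⁆ -
        (8 : ℂ) • (freeH i (n + n') + (if n = -n' then (n : ℂ) / 2 else 0) • freeC))
  /-- `∑_{s=0}^{a} binom(a, s) [x_{n+s}(α_i), x_{n'-a-s}(α_j)] = 0` for `a = a_{ij} ≥ 0`. -/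
  | serre_nonneg (i j : I) (n n' : ℤ) (h : 0 ≤ A i j) :
      ToroidalRel A (∑ s ∈ Finset.range ((A i j).toNat + 1),
        ((A i j).toNat.choose s : ℂ) • ⁅freeX i (n + s), freeX j (n' - A i j - s)⁆)
  /-- `∑_{s=0}^{-a} (-1)^s binom(-a, s) [x_{n+s}(α_i), x_{n'-a-s}(α_j)] = 0` for `a = a_{ij} < 0`. -/
  | serre_neg (i j : I) (n n' : ℤ) (h : A i j < 0) :
      ToroidalRel A (∑ s ∈ Finset.range ((-A i j).toNat + 1),
        ((-1 : ℂ) ^ s * ((-A i j).toNat.choose s : ℂ)) •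
          ⁅freeX i (n + s), freeX j (n' - A i j - s)⁆)

/-- The twisted toroidal Lie algebra attached to a symmetric integer matrix `A`, by generators and
relations. -/
abbrev Toroidal (A : I → I → ℤ) : Type _ :=
  FreeLieAlgebra ℂ (ToroidalGen I) ⧸
    (LieSubmodule.lieSpan ℂ (FreeLieAlgebra ℂ (ToroidalGen I)) (Set.ofPred (ToroidalRel A)) :
      LieIdeal ℂ (FreeLieAlgebra ℂ (ToroidalGen I)))

/-- The image of a generator in the twisted toroidal Lie algebra. -/
def Toroidal.gen (A : I → I → ℤ) (g : ToroidalGen I) : Toroidal A :=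
  LieSubmodule.Quotient.mk (FreeLieAlgebra.of ℂ g)

end Toroidal

/-! ### The McKay virtual character -/

section McKay

/-- The McKay virtual character `ξ = 2 γ_0 - π` of a subgroup `Γ ⊂ SL_2(ℂ)`: `ξ(g) = 2 - tr(g)`. -/
def mcKay (Γ : Subgroup (Matrix.SpecialLinearGroup (Fin 2) ℂ)) : ClassFn Γ where
  val g := 2 - Matrix.trace (g : Matrix.SpecialLinearGroup (Fin 2) ℂ).1
  property x y := by
    simp only [Subgroup.coe_mul, InvMemClass.coe_inv]
    congr 1
    have h1 : (((x : Matrix.SpecialLinearGroup (Fin 2) ℂ) * y *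
        (x : Matrix.SpecialLinearGroup (Fin 2) ℂ)⁻¹ :
        Matrix.SpecialLinearGroup (Fin 2) ℂ) : Matrix (Fin 2) (Fin 2) ℂ) =
        x.1.1 * y.1.1 * (x.1⁻¹).1 := rfl
    have h2 : (x.1⁻¹).1 * x.1.1 = 1 := by
      have := congrArg Subtype.val (inv_mul_cancel x.1)
      exact this
    rw [h1, Matrix.trace_mul_comm, ← mul_assoc, h2, one_mul]

end McKay
end TwistedMcKay

end

open TwistedMcKay

attribute [local instance] LieRing.ofAssociativeRing

/-!
The proof translates the spin class functions into polynomials, shows that the operators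
`H_{±n}(f)` are the coefficients of exponentials of Heisenberg operators, and then follows the
standard computation with twisted vertex operators.

*Characteristics.* The basic spin character is compared with the trace of a product of anticommuting
vectors of norm prescribed by a Gram matrix, a quantity that is determined by Wick's rule
(`trace_word_eq`). This yields a multiplicative function `wreathX` on pairs of elements with disjoint
supports, with an explicit value at full cycles, so that `2^{n̄/2} χ_n(f)` and `σ_n(f)` both are
`wreathX` times a product over the cycles (`HasWeight`). The Frobenius characteristic `frob` sends a
spin class function `F` to the average over `w` of `F w * wreathX w` times the product of the
variables `p_c`, where `c` runs through the types of the cycles of `w` (length and conjugacy class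
of the cycle product). It is injective (`frob_injective`), turns induction products into products
(`charComp_creation`) and contractions into coefficients of a substitution `p_c ↦ p_c + u_c X^{|c|}`
(`charComp_annihilation`). For `σ_n(f)` the latter is a derivation, which gives the Heisenberg
relations (`aPlus_aMinus`).

*Exponentials.* The Euler operator applied to the characteristic of `wreathX` singles out one cycle,
and gives the recursion `n H_{±n}(f) = 2 ∑_{j + k = n} H_{±j}(f) a_{±k}(f)` (`Hminus_recursion`,
`Hplus_recursion`), that is, `H_±(f, z) = exp (∑_{k odd} (2 / k) a_{∓k}(f) z^{±k})` in the form of a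
differential equation (`IsExp`). Everything else is deduced from this equation and the Heisenberg
relations: exponentials of creation and annihilation operators can be exchanged at the cost of a
power of `(1 + t) / (1 - t)` with exponent `a_{ij}` (`IsExp.exchange`).

*Commutators.* In normal order, the commutator of `X_n(γ_i)` and `X_l(γ_j)`, with the sign
`(-1)^{a_{ij}}` that is made up for by the lattice part, is a sum of terms depending only on `n + l`
with coefficients which are the expansion coefficients of the difference of the two expansions of
`((1 - t) / (1 + t))^{a_{ij}}` (`VertexSystem.X_bracket`). Multiplication by `(1 ± t)^{|a_{ij}|}`
removes the denominators and hence kills this difference, which is the relation of Serre type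
(`commCoeff_serre_nonneg`, `commCoeff_serre_neg`). For `i = j` the exponent is `2`, the difference is
a derivative of the delta function (`commCoeff_two`), and the commutator is a Heisenberg operator
plus a scalar (`VertexSystem.X_X_self`).

*The matrix.* The numbers `a_{ij}` are integers by the orthogonality of characters, and `a_{ii} = 2`
since no irreducible representation occurs in its tensor product with the defining one
(`sum_trace_mul_char_eq_zero`): if `-1 ∈ Γ` it acts on the two with different signs, and otherwise `Γ`
has odd order and is abelian. As the diagonal entries are even, the commutator of `e_{γ_i}` and
`e_{γ_j}` is `(-1)^{a_{ij}}` (`rep_section_comm`).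
-/

open TwistedMcKay

attribute [local instance] LieRing.ofAssociativeRing

noncomputable section

namespace TwistedMcKay

/-! ### Traces of words in anticommuting vectors -/

section Wick
variable {ι : Type*} {c : ι → ι → ℂ}

/-- Moving a vector through a word from left to right: if `v i v j + v j v i = c i j`, each letter
that is passed contributes a contraction. -/
theorem mul_word_eq {A : Type*} [Ring A] [Algebra ℂ A] {v : ι → A}
    (hv : ∀ i j, v i * v j + v j * v i = c i j • (1 : A)) (d : ι) (a : ι) (l : List ι) :
    v a * (l.map v).prod = ∑ j ∈ Finset.range l.length,
      ((-1 : ℂ) ^ j * c a (l.getD j d)) • ((l.eraseIdx j).map v).prod +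
        (-1 : ℂ) ^ l.length • ((l.map v).prod * v a) := by
  induction l with
  | nil => simp
  | cons b l ih =>
    rw [List.length_cons, Finset.sum_range_succ']
    simp only [List.map_cons, List.prod_cons, List.eraseIdx_cons_succ, List.getD_cons_succ,
      List.eraseIdx_cons_zero, List.getD_cons_zero, pow_succ, pow_zero, one_mul]
    rw [← mul_assoc, eq_sub_of_add_eq (hv a b), sub_mul, mul_assoc, ih, mul_add, Finset.mul_sum,
      smul_mul_assoc, one_mul]
    simp only [mul_smul_comm, mul_neg, mul_one, neg_mul, neg_smul, Finset.sum_neg_distrib, mul_assoc]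
    abel

/-- Wick's theorem in comparative form: a functional that is tracial with respect to the vectors
`v i` is determined, up to its value at `1`, on words of even length by the Gram matrix `c`. -/
theorem trace_word_eq {A A' : Type*} [Ring A] [Algebra ℂ A] [Ring A'] [Algebra ℂ A']
    {v : ι → A} {v' : ι → A'}
    (hv : ∀ i j, v i * v j + v j * v i = c i j • (1 : A))
    (hv' : ∀ i j, v' i * v' j + v' j * v' i = c i j • (1 : A'))
    (T : A →ₗ[ℂ] ℂ) (T' : A' →ₗ[ℂ] ℂ) (hT : ∀ i x, T (v i * x) = T (x * v i))
    (hT' : ∀ i x, T' (v' i * x) = T' (x * v' i)) (l : List ι) (hl : Even l.length) :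
    T (l.map v).prod * T' 1 = T' (l.map v').prod * T 1 := by
  induction hn : l.length using Nat.strong_induction_on generalizing l with
  | _ n ih =>
  rcases l with _ | ⟨a, l⟩
  · simp [mul_comm]
  · have hodd : Odd l.length := by
      rw [List.length_cons, Nat.even_add_one, Nat.not_even_iff_odd] at hl
      exact hl
    -- Carrying the first letter `a` through the word `l` of odd length costs a sign `-1` and yields the
    -- contractions of `a`; carrying it around cyclically does not change the trace. Hence twice the trace
    -- of the word is the sum of its contractions.
    have e1 := congrArg T (mul_word_eq hv a a l)
    have e2 := congrArg T' (mul_word_eq hv' a a l)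
    simp only [map_add, map_sum, map_smul, hodd.neg_one_pow, smul_eq_mul, ← hT, ← hT'] at e1 e2
    have e3 : ∀ j ∈ Finset.range l.length,
        T ((l.eraseIdx j).map v).prod * T' 1 = T' ((l.eraseIdx j).map v').prod * T 1 := by
      intro j hj
      have hj' := Finset.mem_range.mp hj
      have hlen : (l.eraseIdx j).length = l.length - 1 := by
        rw [List.length_eraseIdx, if_pos hj']
      refine ih _ ?_ _ ?_ hlen
      · rw [← hn, List.length_cons]; omega
      · rw [hlen]; exact Nat.Odd.sub_odd hodd odd_one
    have e4 : (∑ j ∈ Finset.range l.length, (-1 : ℂ) ^ j * c a (l.getD j a) *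
          T ((l.eraseIdx j).map v).prod) * T' 1 =
        (∑ j ∈ Finset.range l.length, (-1 : ℂ) ^ j * c a (l.getD j a) *
          T' ((l.eraseIdx j).map v').prod) * T 1 := by
      rw [Finset.sum_mul, Finset.sum_mul]
      refine Finset.sum_congr rfl fun j hj => ?_
      rw [mul_assoc, e3 j hj]; ring
    simp only [List.map_cons, List.prod_cons]
    linear_combination (1 / 2 : ℂ) * T' 1 * e1 - (1 / 2 : ℂ) * T 1 * e2 + (1 / 2 : ℂ) * e4

end Wick

/-! ### The normalized basic spin character -/

namespace SpinSym
variable {n m : ℕ}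

/-- Every element of the spin group is a word in the `t_i`, up to the central element. -/
theorem exists_word (x : SpinSym n) :
    ∃ l : List (Fin (n - 1)), x = (l.map t).prod ∨ x = z n * (l.map t).prod := by
  have hzz : ∀ y : SpinSym n, z n * (z n * y) = y := fun y => by rw [← mul_assoc, z_mul_z, one_mul]
  have hzi : (z n)⁻¹ = z n := inv_eq_of_mul_eq_one_left z_mul_z
  let H : Subgroup (SpinSym n) :=
    { carrier := {x | ∃ l : List (Fin (n - 1)), x = (l.map t).prod ∨ x = z n * (l.map t).prod}
      one_mem' := ⟨[], by simp⟩
      mul_mem' := by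
        rintro _ _ ⟨l, rfl | rfl⟩ ⟨l', rfl | rfl⟩ <;> refine ⟨l ++ l', ?_⟩ <;>
          rw [List.map_append, List.prod_append]
        · exact Or.inl rfl
        · right; rw [← mul_assoc, ← z_comm, mul_assoc]
        · right; rw [mul_assoc]
        · left; rw [mul_assoc, ← mul_assoc _ (z n), ← z_comm, mul_assoc, hzz]
      inv_mem' := by
        have key : ∀ l : List (Fin (n - 1)), ∃ l' : List (Fin (n - 1)),
            (l.map t).prod⁻¹ = (l'.map t).prod ∨ (l.map t).prod⁻¹ = z n * (l'.map t).prod := by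
          intro l
          induction l with
          | nil => exact ⟨[], by simp⟩
          | cons i l ih =>
            obtain ⟨l', h⟩ := ih
            refine ⟨l' ++ [i], ?_⟩
            have hi : (t i : SpinSym n)⁻¹ = z n * t i := by
              rw [inv_eq_iff_mul_eq_one, ← mul_assoc, ← z_comm, mul_assoc, t_mul_t, z_mul_z]
            simp only [List.map_cons, List.prod_cons, mul_inv_rev, List.map_append, List.map_nil,
              List.prod_append, List.prod_nil, mul_one, hi]
            rcases h with h | h <;> rw [h]
            · right; rw [← mul_assoc, ← z_comm, mul_assoc]
            · left; rw [mul_assoc, ← mul_assoc _ (z n), ← z_comm, mul_assoc, hzz]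
        rintro _ ⟨l, rfl | rfl⟩
        · exact key l
        · obtain ⟨l', h | h⟩ := key l
          · exact ⟨l', Or.inr (by rw [mul_inv_rev, hzi, h, z_comm])⟩
          · exact ⟨l', Or.inl (by rw [mul_inv_rev, hzi, h, ← z_comm, hzz])⟩ }
  exact mem_of_gens H ⟨[], by simp⟩ (fun i => ⟨[i], by simp⟩) x

theorem sgn_word (l : List (Fin (n - 1))) : sgn n (l.map t).prod = (-1) ^ l.length := by
  induction l with
  | nil => simp
  | cons i l ih => simp [ih, pow_succ]

theorem even_length_of_sgn {l : List (Fin (n - 1))} (h : sgn n (l.map t).prod = 1) :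
    Even l.length := by
  rw [sgn_word] at h
  by_contra h'
  rw [(Nat.not_even_iff_odd.mp h').neg_one_pow] at h
  exact absurd h (by decide)

/-- An even element of the spin group is a word of even length, up to the central element. -/
theorem exists_even_word (x : SpinSym n) (hx : sgn n x = 1) :
    ∃ l : List (Fin (n - 1)), Even l.length ∧ (x = (l.map t).prod ∨ x = z n * (l.map t).prod) := by
  obtain ⟨l, h⟩ := exists_word x
  refine ⟨l, even_length_of_sgn ?_, h⟩
  rcases h with rfl | rfl
  · exact hx
  · simpa using hx

end SpinSym

/-- The Gram matrix of the generators in the basic spin module: the value of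
`t_i t_j + t_j t_i` for zero-based indices `i`, `j`. -/
def spinGram (i j : ℕ) : ℂ := if i = j then -2 else if i + 1 = j ∨ j + 1 = i then 1 else 0

theorem spinGenMat_gram {k i j : ℕ} (hi : i / 2 < k) (hj : j / 2 < k) :
    spinGenMat k i * spinGenMat k j + spinGenMat k j * spinGenMat k i =
      spinGram i j • (1 : TensMat k) := by
  unfold spinGram
  rcases lt_trichotomy i j with h | rfl | h
  · rw [if_neg h.ne]
    by_cases h' : i + 1 = j
    · subst h'
      rw [if_pos (Or.inl rfl), spinGenMat_near hj, one_smul]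
    · rw [if_neg (by omega), spinGenMat_far (by omega) hj]; simp
  · rw [if_pos rfl, spinGenMat_sq hi]
    module
  · rw [if_neg h.ne']
    by_cases h' : j + 1 = i
    · subst h'
      rw [if_pos (Or.inr rfl), add_comm, spinGenMat_near hi, one_smul]
    · rw [if_neg (by omega), spinGenMat_far (by omega) hi]; simp

/-- The trace on `TensMat k`, as a linear functional. -/
def tensTrace (k : ℕ) : TensMat k →ₗ[ℂ] ℂ := Matrix.traceLinearMap _ ℂ ℂ

theorem tensTrace_comm {k : ℕ} (x y : TensMat k) : tensTrace k (x * y) = tensTrace k (y * x) :=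
  Matrix.trace_mul_comm x y

theorem tensTrace_one (k : ℕ) : tensTrace k 1 = 2 ^ k := by
  simp [tensTrace, Matrix.traceLinearMap, Matrix.trace_one]

theorem basicSpin_z (n : ℕ) : basicSpin n (SpinSym.z n) = -1 := SpinSym.lift_z _ _ _ _ _ _ _

theorem basicSpin_t {n : ℕ} (i : Fin (n - 1)) :
    (basicSpin n (SpinSym.t i) : TensMat (n / 2)) = spinGenMat (n / 2) i := by
  have : basicSpin n (SpinSym.t i) = spinGenUnit n i := SpinSym.lift_t _ _ _ _ _ _ _ _
  rw [this]; rfl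

theorem basicSpin_word {n : ℕ} (l : List (Fin (n - 1))) :
    (basicSpin n (l.map SpinSym.t).prod : TensMat (n / 2)) =
      (l.map fun i : Fin (n - 1) => spinGenMat (n / 2) i).prod := by
  induction l with
  | nil => simp
  | cons i l ih => simp only [List.map_cons, List.prod_cons, map_mul, Units.val_mul, ih, basicSpin_t]

theorem basicSpinChar_word {n : ℕ} (l : List (Fin (n - 1))) :
    basicSpinChar n (l.map SpinSym.t).prod =
      tensTrace (n / 2) (l.map fun i : Fin (n - 1) => spinGenMat (n / 2) i).prod := by
  rw [basicSpinChar, basicSpin_word]; rfl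

/-- The normalized basic spin character `2^{n̄/2} χ_n`. -/
def spinX (n : ℕ) (x : SpinSym n) : ℂ := parityFactor n * basicSpinChar n x

theorem spinX_conj {n : ℕ} (x y : SpinSym n) : spinX n (x * y * x⁻¹) = spinX n y := by
  rw [spinX, spinX, basicSpinChar_conj]

theorem spinX_z {n : ℕ} (x : SpinSym n) : spinX n (SpinSym.z n * x) = -spinX n x := by
  rw [spinX, spinX, basicSpinChar_z, mul_neg]

theorem spinX_odd {n : ℕ} (x : SpinSym n) (hx : SpinSym.sgn n x = -1) : spinX n x = 0 := by
  rw [spinX, basicSpinChar_odd x hx, mul_zero]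

theorem sqrt_two_mul : ((Real.sqrt 2 : ℝ) : ℂ) * (Real.sqrt 2 : ℝ) = 2 := by
  rw [← Complex.ofReal_mul, Real.mul_self_sqrt (by norm_num)]; norm_num

theorem sqrt_two_ne : ((Real.sqrt 2 : ℝ) : ℂ) ≠ 0 := by
  intro h
  have := sqrt_two_mul
  rw [h] at this
  norm_num at this

theorem parityFactor_mul_pow (n : ℕ) :
    parityFactor n * 2 ^ (n / 2) = ((Real.sqrt 2 : ℝ) : ℂ) ^ n := by
  have h2 : (2 : ℂ) ^ (n / 2) = ((Real.sqrt 2 : ℝ) : ℂ) ^ (2 * (n / 2)) := by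
    rw [pow_mul, pow_two, sqrt_two_mul]
  rw [h2, parityFactor]
  split_ifs with h
  · rw [one_mul, Nat.two_mul_div_two_of_even h]
  · rw [← pow_succ', Nat.two_mul_div_two_add_one_of_odd (Nat.not_even_iff_odd.mp h)]

/-- The normalized basic spin character of a word of even length, in terms of any functional
on any algebra in which vectors with the same Gram matrix are given. -/
theorem spinX_word {n : ℕ} {A : Type*} [Ring A] [Algebra ℂ A] {v : Fin (n - 1) → A}
    (hv : ∀ i j, v i * v j + v j * v i = spinGram i j • (1 : A)) (T : A →ₗ[ℂ] ℂ)
    (hT : ∀ i x, T (v i * x) = T (x * v i)) (l : List (Fin (n - 1))) (hl : Even l.length) :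
    spinX n (l.map SpinSym.t).prod * T 1 = ((Real.sqrt 2 : ℝ) : ℂ) ^ n * T (l.map v).prod := by
  have := trace_word_eq (c := fun i j : Fin (n - 1) => spinGram i j)
    (v := fun i : Fin (n - 1) => spinGenMat (n / 2) i)
    (fun i j => spinGenMat_gram (by omega) (by omega)) hv (tensTrace (n / 2)) T
    (fun _ _ => tensTrace_comm _ _) hT l hl
  rw [tensTrace_one] at this
  rw [spinX, basicSpinChar_word, mul_assoc, this, ← parityFactor_mul_pow]
  ring

theorem spinX_one (n : ℕ) : spinX n 1 = ((Real.sqrt 2 : ℝ) : ℂ) ^ n := by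
  rw [spinX, ← parityFactor_mul_pow, basicSpinChar, map_one, Units.val_one, ← tensTrace_one]
  rfl

/-- The normalized basic spin character is multiplicative on the spin product. -/
theorem spinX_emb {n m : ℕ} (a : SpinSym n) (b : SpinSym m) (ha : SpinSym.sgn n a = 1)
    (hb : SpinSym.sgn m b = 1) :
    spinX (n + m) (SpinSym.embL n m a * SpinSym.embR n m b) = spinX n a * spinX m b := by
  have key : ∀ (l : List (Fin (n - 1))) (l' : List (Fin (m - 1))), Even l.length →
      Even l'.length → spinX (n + m) (SpinSym.embL n m (l.map SpinSym.t).prod *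
        SpinSym.embR n m (l'.map SpinSym.t).prod) =
        spinX n (l.map SpinSym.t).prod * spinX m (l'.map SpinSym.t).prod := by
    intro l l' hl hl'
    have hs : ((Real.sqrt 2 : ℝ) : ℂ) ^ (n + m) ≠ 0 := pow_ne_zero _ sqrt_two_ne
    let k := (n + m) / 2
    let vL : Fin (n - 1) → TensMat k := fun i => spinGenMat k i
    let vR : Fin (m - 1) → TensMat k := fun j => spinGenMat k (n + j)
    let y : TensMat k := (l'.map vR).prod
    have hx : (basicSpin (n + m) (SpinSym.embL n m (l.map SpinSym.t).prod) : TensMat k) =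
        (l.map vL).prod := by
      clear hl
      induction l with
      | nil => simp
      | cons i l ih =>
        simp only [List.map_cons, List.prod_cons, map_mul, Units.val_mul, ih, SpinSym.embL_t]
        rw [basicSpin_t]
    have hy : (basicSpin (n + m) (SpinSym.embR n m (l'.map SpinSym.t).prod) : TensMat k) = y := by
      simp only [y]
      clear hl'
      induction l' with
      | nil => simp
      | cons i l ih =>
        simp only [List.map_cons, List.prod_cons, map_mul, Units.val_mul, ih, SpinSym.embR_t]
        rw [basicSpin_t]
    have hanti : ∀ i j, vR j * vL i = -(vL i * vR j) := fun i j =>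
      spinGenMat_far (by have := i.2; omega) (by have := j.2; omega)
    -- Two anticommuting families: a word of even length in the right one commutes with the left one.
    -- Hence the trace of the product with such a word is tracial with respect to the left vectors.
    have hcomm : ∀ i, y * vL i = vL i * y := by
      intro i
      have : ∀ l : List (Fin (m - 1)), (l.map vR).prod * vL i =
          (-1 : ℂ) ^ l.length • (vL i * (l.map vR).prod) := by
        intro l
        induction l with
        | nil => simp
        | cons j l ih =>
          simp only [List.map_cons, List.prod_cons, mul_assoc, ih, List.length_cons, pow_succ,
            mul_smul_comm]
          rw [← mul_assoc, hanti, neg_mul, mul_neg_one, neg_smul, smul_neg, mul_assoc]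
      rw [this, hl'.neg_one_pow, one_smul]
    have hTr : ∀ x x' : TensMat k, tensTrace k (x * x') = tensTrace k (x' * x) := tensTrace_comm
    have e1 := spinX_word (n := n) (v := vL)
      (fun i j => spinGenMat_gram (by omega) (by omega))
      ((tensTrace k).comp (LinearMap.mulRight ℂ y)) (fun i x => by
        simp only [LinearMap.comp_apply, LinearMap.mulRight_apply]
        rw [mul_assoc, hTr, mul_assoc, hcomm, mul_assoc]) l hl
    have e2 := spinX_word (n := m) (v := vR)
      (fun i j => by
        rw [spinGenMat_gram (by omega) (by omega)]
        simp only [spinGram, Nat.add_right_inj, Nat.add_assoc])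
      (tensTrace k) (fun i x => hTr _ _) l' hl'
    simp only [LinearMap.comp_apply, LinearMap.mulRight_apply, one_mul] at e1
    rw [tensTrace_one] at e2
    have e3 : spinX (n + m) (SpinSym.embL n m (l.map SpinSym.t).prod *
        SpinSym.embR n m (l'.map SpinSym.t).prod) =
        parityFactor (n + m) * tensTrace k ((l.map vL).prod * y) := by
      rw [spinX, basicSpinChar, map_mul, Units.val_mul, hx, hy]; rfl
    rw [e3]
    have hp := parityFactor_mul_pow (n + m)
    have h2 : (2 : ℂ) ^ k ≠ 0 := pow_ne_zero _ (by norm_num)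
    refine mul_right_cancel₀ hs ?_
    rw [← hp] 
    rw [pow_add] at hp
    have hn0 : ((Real.sqrt 2 : ℝ) : ℂ) ^ n ≠ 0 := pow_ne_zero _ sqrt_two_ne
    have hm0 : ((Real.sqrt 2 : ℝ) : ℂ) ^ m ≠ 0 := pow_ne_zero _ sqrt_two_ne
    refine mul_right_cancel₀ hn0 (mul_right_cancel₀ hm0 ?_)
    change parityFactor (n + m) * (2 : ℂ) ^ k = _ at hp
    change _ = spinX n _ * spinX m _ * (parityFactor (n + m) * 2 ^ k) * _ * _
    generalize spinX n (l.map SpinSym.t).prod = X1 at *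
    generalize spinX m (l'.map SpinSym.t).prod = X2 at *
    generalize ((Real.sqrt 2 : ℝ) : ℂ) ^ n = r1 at *
    generalize ((Real.sqrt 2 : ℝ) : ℂ) ^ m = r2 at *
    change X1 * tensTrace k y = _ at e1
    change X2 * _ = r2 * tensTrace k y at e2
    generalize tensTrace k y = Y at *
    generalize tensTrace k ((l.map vL).prod * y) = Z at *
    change parityFactor (n + m) * Z * (parityFactor (n + m) * 2 ^ k) * r1 * r2 = _
    generalize parityFactor (n + m) = p at *
    linear_combination (-p * p * 2 ^ k * r2) * e1 - (p * p * 2 ^ k * X1) * e2 +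
      (X1 * X2 * p * 2 ^ k) * (hp) + (0:ℂ) * hp
  obtain ⟨l, hl, h | h⟩ := SpinSym.exists_even_word a ha <;>
    obtain ⟨l', hl', h' | h'⟩ := SpinSym.exists_even_word b hb <;> subst h <;> subst h'
  · exact key l l' hl hl'
  · rw [map_mul, SpinSym.embR_z, ← mul_assoc, ← SpinSym.z_comm, mul_assoc, spinX_z, spinX_z,
      key l l' hl hl', mul_neg]
  · rw [map_mul, SpinSym.embL_z, mul_assoc, spinX_z, spinX_z, key l l' hl hl', neg_mul]
  · rw [map_mul, SpinSym.embL_z, mul_assoc, spinX_z, spinX_z, map_mul, SpinSym.embR_z, ← mul_assoc,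
      ← SpinSym.z_comm, mul_assoc, spinX_z, spinX_z, key l l' hl hl', neg_mul_neg, neg_neg]

/-- The normalized basic spin character takes the same value at an even element and its inverse:
the inverse of a word of even length is the reversed word, and the Gram matrix does not see the
difference between an algebra and its opposite. -/
theorem spinX_inv {n : ℕ} (a : SpinSym n) (ha : SpinSym.sgn n a = 1) :
    spinX n a⁻¹ = spinX n a := by
  have hzi : (SpinSym.z n)⁻¹ = SpinSym.z n := inv_eq_of_mul_eq_one_left SpinSym.z_mul_z
  have hzz : ∀ y : SpinSym n, SpinSym.z n * (SpinSym.z n * y) = y := fun y => by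
    rw [← mul_assoc, SpinSym.z_mul_z, one_mul]
  have hrev : ∀ l : List (Fin (n - 1)),
      (l.map SpinSym.t).prod⁻¹ = SpinSym.z n ^ l.length * (l.reverse.map SpinSym.t).prod := by
    intro l
    induction l with
    | nil => simp
    | cons i l ih =>
      have hi : (SpinSym.t i : SpinSym n)⁻¹ = SpinSym.z n * SpinSym.t i := by
        rw [inv_eq_iff_mul_eq_one, ← mul_assoc, ← SpinSym.z_comm, mul_assoc, SpinSym.t_mul_t,
          SpinSym.z_mul_z]
      simp only [List.map_cons, List.prod_cons, mul_inv_rev, ih, hi, List.reverse_cons,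
        List.map_append, List.prod_append, List.map_nil, List.prod_nil, mul_one, List.length_cons,
        pow_succ]
      rw [mul_assoc, mul_assoc, ← mul_assoc _ (SpinSym.z n), ← SpinSym.z_comm, mul_assoc]
  have key : ∀ l : List (Fin (n - 1)), Even l.length →
      spinX n (l.map SpinSym.t).prod⁻¹ = spinX n (l.map SpinSym.t).prod := by
    intro l hl
    obtain ⟨k, hk⟩ := hl
    have hz : SpinSym.z n ^ l.length = 1 := by
      rw [hk, ← two_mul, pow_mul, pow_two, SpinSym.z_mul_z, one_pow]
    rw [hrev, hz, one_mul]
    let v : Fin (n - 1) → TensMat (n / 2) := fun i => spinGenMat (n / 2) i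
    have hv : ∀ i j, v i * v j + v j * v i = spinGram i j • (1 : TensMat (n / 2)) := fun i j =>
      spinGenMat_gram (by omega) (by omega)
    have e1 := spinX_word (n := n) (A := (TensMat (n / 2))ᵐᵒᵖ) (v := fun i => MulOpposite.op (v i))
      (fun i j => by
        rw [← MulOpposite.op_mul, ← MulOpposite.op_mul, ← MulOpposite.op_add, add_comm, hv]; rfl)
      ((tensTrace (n / 2)).comp (MulOpposite.opLinearEquiv ℂ).symm.toLinearMap)
      (fun i x => tensTrace_comm _ _) l.reverse (by rw [List.length_reverse]; exact ⟨k, hk⟩)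
    have e2 := spinX_word (n := n) hv (tensTrace (n / 2)) (fun i x => tensTrace_comm _ _) l ⟨k, hk⟩
    have e3 : ((l.reverse.map fun i => MulOpposite.op (v i)).prod : (TensMat (n / 2))ᵐᵒᵖ) =
        MulOpposite.op (l.map v).prod := by
      rw [MulOpposite.op_list_prod, List.map_reverse, List.map_map]
      rfl
    simp only [e3, LinearMap.comp_apply] at e1
    change spinX n _ * tensTrace (n / 2) 1 = _ * tensTrace (n / 2) (l.map v).prod at e1
    rw [tensTrace_one] at e1 e2
    exact mul_right_cancel₀ (pow_ne_zero (n / 2) (by norm_num)) (e1.trans e2.symm)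
  obtain ⟨l, hl, h | h⟩ := SpinSym.exists_even_word a ha <;> subst h
  · exact key l hl
  · rw [mul_inv_rev, hzi, ← SpinSym.z_comm, spinX_z, spinX_z, key l hl]

/-- The normalized basic spin character has the value `√2` at the standard lift of an odd cycle. -/
theorem spinX_stdCycle {n : ℕ} (hn : Odd n) : spinX n (stdCycle n) = (Real.sqrt 2 : ℝ) := by
  -- the trace of `v_p v_{p+1} ⋯ v_{p+2q-1}`, by induction on `q`
  have key : ∀ k q p : ℕ, p + 2 * q ≤ 2 * k → tensTrace k
      ((List.range' p (2 * q)).map fun i => spinGenMat k i).prod * 2 ^ q = 2 ^ k := by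
    intro k q
    induction q with
    | zero => intro p _; simp [tensTrace_one]
    | succ q ih =>
      intro p hp
      have hlist : List.range' p (2 * (q + 1)) = p :: (p + 1) :: List.range' (p + 2) (2 * q) := by
        rw [show 2 * (q + 1) = 2 * q + 1 + 1 by ring, List.range'_succ, List.range'_succ]
      have ih' := ih (p + 2) (by omega)
      rw [hlist]
      simp only [List.map_cons, List.prod_cons]
      set y := ((List.range' (p + 2) (2 * q)).map fun i => spinGenMat k i).prod with hy
      have hcomm : spinGenMat k p * y = y * spinGenMat k p := by
        have : ∀ l : List ℕ, (∀ j ∈ l, p + 1 < j ∧ j / 2 < k) →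
            (l.map fun i => spinGenMat k i).prod * spinGenMat k p =
              (-1 : ℂ) ^ l.length • (spinGenMat k p * (l.map fun i => spinGenMat k i).prod) := by
          intro l
          induction l with
          | nil => simp
          | cons j l ih =>
            intro h
            have hj := h j (by simp)
            simp only [List.map_cons, List.prod_cons, mul_assoc,
              ih (fun i hi => h i (List.mem_cons_of_mem _ hi)), List.length_cons, pow_succ,
              mul_smul_comm]
            rw [← mul_assoc, spinGenMat_far hj.1 hj.2, neg_mul, mul_neg_one, neg_smul, smul_neg,
              mul_assoc]
        rw [hy, this _ (fun j hj => by
          rw [List.mem_range'_1] at hj; omega), List.length_range',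
          (even_two_mul q).neg_one_pow, one_smul]
      have hnear := spinGenMat_near (k := k) (i := p) (by omega)
      have e1 : tensTrace k (spinGenMat k p * (spinGenMat k (p + 1) * y)) =
          tensTrace k (spinGenMat k (p + 1) * spinGenMat k p * y) := by
        rw [tensTrace_comm, mul_assoc, ← hcomm, mul_assoc]
      have e2 : tensTrace k (spinGenMat k p * (spinGenMat k (p + 1) * y)) +
          tensTrace k (spinGenMat k (p + 1) * spinGenMat k p * y) = tensTrace k y := by
        rw [← mul_assoc, ← map_add, ← add_mul, hnear, one_mul]
      rw [← e1] at e2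
      rw [pow_succ]
      linear_combination ih' + 2 ^ q * e2
  obtain ⟨q, rfl⟩ := hn
  have h1 : stdCycle (2 * q + 1) = ((List.finRange (2 * q + 1 - 1)).map SpinSym.t).prod := by
    rw [stdCycle, List.ofFn_eq_map]
  have h2 : ((List.finRange (2 * q + 1 - 1)).map
      fun i : Fin (2 * q + 1 - 1) => spinGenMat ((2 * q + 1) / 2) (i : ℕ)) =
      (List.range' 0 (2 * q)).map fun i => spinGenMat ((2 * q + 1) / 2) i := by
    rw [← List.range_eq_range', ← List.map_coe_finRange_eq_range, List.map_map]
    rfl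
  have hd : (2 * q + 1) / 2 = q := by omega
  rw [spinX, h1, basicSpinChar_word, h2]
  have := key ((2 * q + 1) / 2) q 0 (by omega)
  have hp : (2 : ℂ) ^ ((2 * q + 1) / 2) = 1 * 2 ^ q := by rw [hd, one_mul]
  have h3 := mul_right_cancel₀ (pow_ne_zero q (by norm_num : (2 : ℂ) ≠ 0)) (this.trans hp)
  rw [h3, mul_one, parityFactor, if_neg (by rw [Nat.not_even_iff_odd]; exact ⟨q, rfl⟩)]


/-! ### The order of the spin group -/

namespace SpinSym
variable {n m : ℕ}

/-- Coset representatives: `S̃_{N+2}` is covered by the cosets `S̃_{N+1} t_{N+1} ⋯ t_k`. -/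
theorem embL_desc_surjective (N : ℕ) : Function.Surjective
    fun p : SpinSym (N + 1) × Fin (N + 2) => embL (N + 1) 1 p.1 * desc (N + 1 + 1) (N + 1) p.2 := by
  let D := desc (N + 1 + 1) (N + 1)
  let K := (embL (N + 1) 1).range
  let A : Set (SpinSym (N + 1 + 1)) :=
    Set.range fun p : SpinSym (N + 1) × Fin (N + 2) => embL (N + 1) 1 p.1 * D p.2
  have hA : ∀ κ ∈ K, ∀ l, l ≤ N + 1 → κ * D l ∈ A := by
    rintro _ ⟨a, rfl⟩ l hl
    exact ⟨(a, ⟨l, by omega⟩), rfl⟩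
  have hzK : z _ ∈ K := ⟨z _, embL_z⟩
  have hz : ∀ x ∈ A, z _ * x ∈ A := by
    rintro _ ⟨⟨a, l⟩, rfl⟩
    rw [← mul_assoc]
    exact hA _ (mul_mem hzK ⟨a, rfl⟩) _ (by omega)
  -- The union of the cosets is stable under right multiplication by every generator: `t_j` moves to
  -- the left of the product `t_{N+1} ⋯ t_k`, or lengthens it, or shortens it.
  have ht : ∀ x ∈ A, ∀ i, x * t i ∈ A := by
    rintro _ ⟨⟨a, ⟨l, hl⟩⟩, rfl⟩ ⟨j, hj⟩
    have ha : embL (N + 1) 1 a ∈ K := ⟨a, rfl⟩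
    rw [← tn_of_lt hj]
    simp only
    rw [mul_assoc]
    rcases lt_trichotomy (j + l) (N + 1) with h | h | h
    · rcases Nat.lt_or_ge (j + 1 + l) (N + 1) with h' | h'
      · obtain ⟨κ, hκ, e⟩ := desc_far (N := N) l j (by omega) h'
        rw [e, ← mul_assoc]
        exact hA _ (mul_mem ha hκ) l (by omega)
      · have : D l * tn _ j = D (l + 1) := by
          rw [show j = N + 1 - (l + 1) by omega]; rfl
        rw [this]
        exact hA _ ha _ (by omega)
    · obtain ⟨l, rfl⟩ : ∃ l', l = l' + 1 := ⟨l - 1, by omega⟩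
      have : D (l + 1) * tn _ j = z _ * D l := by
        change D l * tn _ (N + 1 - (l + 1)) * _ = _
        rw [show N + 1 - (l + 1) = j by omega, mul_assoc, tn_of_lt (by omega), t_mul_t, z_comm]
      rw [this, ← mul_assoc]
      exact hA _ (mul_mem ha hzK) _ (by omega)
    · obtain ⟨κ, hκ, e⟩ := desc_near (N := N) l j (by omega) (by omega) h
      rw [e, ← mul_assoc]
      exact hA _ (mul_mem ha hκ) l (by omega)
  have h1 : (1 : SpinSym (N + 1 + 1)) ∈ A := by
    have := hA 1 (one_mem K) 0 (by omega)
    simpa [D, desc] using this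
  have hw : ∀ l : List (Fin (N + 1 + 1 - 1)), (l.map t).prod ∈ A := by
    intro l
    induction l using List.reverseRecOn with
    | nil => exact h1
    | append_singleton l i ih =>
      rw [List.map_append, List.prod_append, List.map_singleton, List.prod_singleton]
      exact ht _ ih i
  intro x
  obtain ⟨l, h | h⟩ := exists_word x
  · rw [h]; exact hw l
  · rw [h]; exact hz _ (hw l)

theorem card_le : ∀ n : ℕ, Nat.card (SpinSym n) ≤ 2 * n.factorial := by
  have small : ∀ n ≤ 1, Nat.card (SpinSym n) ≤ 2 * n.factorial := by
    intro n hn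
    have hs : Function.Surjective fun b : Bool => if b then (1 : SpinSym n) else z n := by
      intro x
      obtain ⟨l, h⟩ := exists_word x
      have hl : l = [] := by
        rcases l with _ | ⟨i, l⟩
        · rfl
        · have := i.2; omega
      subst hl
      rcases h with h | h
      · exact ⟨true, by simpa using h.symm⟩
      · exact ⟨false, by simpa using h.symm⟩
    have := Nat.card_le_card_of_surjective _ hs
    rw [Nat.card_eq_fintype_card (α := Bool), Fintype.card_bool] at this
    have := Nat.factorial_pos n
    omega
  intro n
  induction n with
  | zero => exact small 0 (by omega)
  | succ n ih =>
    rcases n with _ | N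
    · exact small 1 le_rfl
    · have := Nat.card_le_card_of_surjective _ (embL_desc_surjective N)
      rw [Nat.card_prod, Nat.card_eq_fintype_card (α := Fin _), Fintype.card_fin] at this
      rw [Nat.factorial_succ]
      calc _ ≤ _ := this
        _ ≤ 2 * (N + 1).factorial * (N + 2) := Nat.mul_le_mul_right _ ih
        _ = _ := by ring

theorem z_ne_one (n : ℕ) : z n ≠ 1 := by
  intro h
  have h1 := basicSpin_z n
  rw [h, map_one] at h1
  have h2 := congrArg (fun u : (TensMat (n / 2))ˣ => tensTrace (n / 2) (u : TensMat (n / 2))) h1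
  simp only [Units.val_one, Units.val_neg, map_neg, tensTrace_one] at h2
  exact pow_ne_zero (n / 2) (by norm_num : (2 : ℂ) ≠ 0) (self_eq_neg.mp h2)

theorem θ_surjective (n : ℕ) : Function.Surjective (θ n) := by
  rw [← MonoidHom.range_eq_top]
  rcases n with _ | n
  · exact Subsingleton.elim _ _
  · rw [eq_top_iff]
    have h := Equiv.Perm.mclosure_swap_castSucc_succ n
    intro σ _
    have hσ : σ ∈ Submonoid.closure (Set.range fun i : Fin n => Equiv.swap i.castSucc i.succ) := by
      rw [h]; trivial
    refine (Submonoid.closure_le (S := (θ (n + 1)).range.toSubmonoid)).mpr ?_ hσ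
    rintro _ ⟨i, rfl⟩
    exact ⟨t ⟨i, i.2⟩, by rw [θ_t]; rfl⟩

theorem card_ker_θ (n : ℕ) : Nat.card (θ n).ker * n.factorial = Nat.card (SpinSym n) := by
  rw [← Subgroup.card_mul_index (θ n).ker, Subgroup.index_ker,
    MonoidHom.range_eq_top.mpr (θ_surjective n), Subgroup.card_top, Nat.card_eq_fintype_card (α := Equiv.Perm _),
    Fintype.card_perm, Fintype.card_fin]

/-- The kernel of the projection of the spin group to the symmetric group is `{1, z}`. -/
theorem eq_one_or_z {x : SpinSym n} (hx : θ n x = 1) : x = 1 ∨ x = z n := by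
  classical
  by_contra h
  push Not at h
  have h2 : Nat.card (θ n).ker ≤ 2 := by
    have h1 := card_ker_θ n
    have h3 := card_le n
    rw [← h1] at h3
    exact Nat.le_of_mul_le_mul_right h3 n.factorial_pos
  let f : Fin 3 → (θ n).ker := ![1, ⟨z n, by simp [MonoidHom.mem_ker]⟩, ⟨x, hx⟩]
  have hf : Function.Injective f := by
    have hz := z_ne_one n
    intro i j hij
    fin_cases i <;> fin_cases j <;> simp [f, Subtype.ext_iff] at hij ⊢ <;> grind
  have := Nat.card_le_card_of_injective f hf
  rw [Nat.card_eq_fintype_card (α := Fin 3), Fintype.card_fin] at this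
  omega

theorem card_eq (n : ℕ) : Nat.card (SpinSym n) = 2 * n.factorial := by
  refine le_antisymm (card_le n) ?_
  rw [← card_ker_θ]
  refine Nat.mul_le_mul_right _ ?_
  let f : Bool → (θ n).ker := fun b => if b then 1 else ⟨z n, by simp [MonoidHom.mem_ker]⟩
  have hf : Function.Injective f := by
    have hz := z_ne_one n
    intro i j hij
    rcases i <;> rcases j <;> simp [f, Subtype.ext_iff] at hij ⊢ <;> grind
  have := Nat.card_le_card_of_injective f hf
  rwa [Nat.card_eq_fintype_card (α := Bool), Fintype.card_bool] at this

/-- Elements with the same projection differ by the central element. -/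
theorem eq_or_eq_z_mul {x y : SpinSym n} (h : θ n x = θ n y) : x = y ∨ x = z n * y := by
  have : θ n (x * y⁻¹) = 1 := by rw [map_mul, map_inv, h, mul_inv_cancel]
  rcases eq_one_or_z this with h | h
  · exact Or.inl (mul_inv_eq_one.mp h)
  · exact Or.inr (mul_inv_eq_iff_eq_mul.mp h)

end SpinSym

namespace SpinWreath
variable {Γ : Type*} [Group Γ] {n m : ℕ}

theorem card_eq [Finite Γ] (n : ℕ) :
    Nat.card (SpinWreath Γ n) = 2 * (Nat.card Γ ^ n * n.factorial) := by
  rw [Nat.card_congr SemidirectProduct.equivProd, Nat.card_prod, SpinSym.card_eq, Nat.card_fun,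
    Nat.card_eq_fintype_card (α := Fin n), Fintype.card_fin]
  ring

theorem z_mul_mk (g : Fin n → Γ) (s : SpinSym n) :
    z n * (⟨g, s⟩ : SpinWreath Γ n) = ⟨g, SpinSym.z n * s⟩ := by
  refine SemidirectProduct.ext (funext fun i => ?_) rfl
  rw [mul_left', perm_z]
  simp [z]

theorem z_mul_ne (w : SpinWreath Γ n) : z n * w ≠ w := by
  rw [Ne, mul_eq_right]
  intro h
  exact SpinSym.z_ne_one n (congrArg SemidirectProduct.right h)

/-- The fibres of `juxt` are the pairs `(a, b)`, `(z a, z b)`. -/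
theorem juxt_eq_juxt_iff {a a' : SpinWreath Γ n} {b b' : SpinWreath Γ m} :
    juxt a' b' = juxt a b ↔ (a' = a ∧ b' = b) ∨ (a' = z n * a ∧ b' = z m * b) := by
  constructor
  · intro h
    have hl : Fin.append a'.left b'.left = Fin.append a.left b.left :=
      congrArg SemidirectProduct.left h
    have hl1 : a'.left = a.left := funext fun i => by
      simpa using congrFun hl (Fin.castAdd m i)
    have hl2 : b'.left = b.left := funext fun i => by
      simpa using congrFun hl (Fin.natAdd n i)
    have hp := congrArg (perm _) h
    rw [perm_juxt, perm_juxt] at hp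
    have hp1 : perm n a' = perm n a := Equiv.ext fun i => by
      have := DFunLike.congr_fun hp (Fin.castAdd m i)
      rwa [SpinSym.blockPerm_castAdd, SpinSym.blockPerm_castAdd, Fin.castAdd_inj] at this
    have hp2 : perm m b' = perm m b := Equiv.ext fun i => by
      have := DFunLike.congr_fun hp (Fin.natAdd n i)
      rwa [SpinSym.blockPerm_natAdd, SpinSym.blockPerm_natAdd, Fin.natAdd_inj] at this
    have ea : a' = a ∨ a' = z n * a := by
      rcases SpinSym.eq_or_eq_z_mul (x := a'.right) (y := a.right) hp1 with e | e
      · exact Or.inl (SemidirectProduct.ext hl1 e)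
      · right
        obtain ⟨g, s⟩ := a
        rw [z_mul_mk]
        exact SemidirectProduct.ext hl1 e
    have eb : b' = b ∨ b' = z m * b := by
      rcases SpinSym.eq_or_eq_z_mul (x := b'.right) (y := b.right) hp2 with e | e
      · exact Or.inl (SemidirectProduct.ext hl2 e)
      · right
        obtain ⟨g, s⟩ := b
        rw [z_mul_mk]
        exact SemidirectProduct.ext hl2 e
    rcases ea with rfl | rfl <;> rcases eb with rfl | rfl
    · exact Or.inl ⟨rfl, rfl⟩
    · rw [z_mul_juxt_right] at h
      exact absurd h (z_mul_ne _)
    · rw [z_mul_juxt_left] at h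
      exact absurd h (z_mul_ne _)
    · exact Or.inr ⟨rfl, rfl⟩
  · rintro (⟨rfl, rfl⟩ | ⟨rfl, rfl⟩)
    · rfl
    · rw [z_mul_juxt_left, z_mul_juxt_right, ← mul_assoc, z_mul_z, one_mul]

theorem perm_surjective (n : ℕ) : Function.Surjective (perm n : SpinWreath Γ n →* _) := by
  intro σ
  obtain ⟨x, hx⟩ := SpinSym.θ_surjective n σ
  exact ⟨SemidirectProduct.inr x, by simpa [perm] using hx⟩

/-- The spin product `Γ̃_n ×̂ Γ̃_m` consists of all elements that preserve the first `n` letters. -/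
theorem exists_juxt (w : SpinWreath Γ (n + m))
    (h : ∀ i : Fin n, ∃ j : Fin n, perm _ w (Fin.castAdd m i) = Fin.castAdd m j) :
    ∃ a b, juxt a b = w := by
  -- the permutation splits into blocks
  have h1 : ∃ σ τ, perm _ w = SpinSym.blockPerm n m (σ, τ) := by
    let p : Equiv.Perm (Fin n ⊕ Fin m) := finSumFinEquiv.symm.permCongr (perm _ w)
    have hp : p ∈ (Equiv.Perm.sumCongrHom (Fin n) (Fin m)).range := by
      refine Equiv.Perm.mem_sumCongrHom_range_of_perm_mapsTo_inl ?_
      rintro _ ⟨i, rfl⟩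
      obtain ⟨j, hj⟩ := h i
      refine ⟨j, ?_⟩
      simp [p, hj]
    obtain ⟨⟨σ, τ⟩, hst⟩ := hp
    refine ⟨σ, τ, Equiv.ext fun x => ?_⟩
    change _ = finSumFinEquiv ((Equiv.Perm.sumCongrHom (Fin n) (Fin m)) (σ, τ)
      (finSumFinEquiv.symm x))
    rw [hst]
    simp [p]
  obtain ⟨σ, τ, hw⟩ := h1
  obtain ⟨s, hs⟩ := SpinSym.θ_surjective n σ
  obtain ⟨t, ht⟩ := SpinSym.θ_surjective m τ
  let a : SpinWreath Γ n := ⟨fun i => w.left (Fin.castAdd m i), s⟩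
  let b : SpinWreath Γ m := ⟨fun i => w.left (Fin.natAdd n i), t⟩
  have hl : (juxt a b).left = w.left := funext fun i => by
    refine Fin.addCases (fun i => ?_) (fun i => ?_) i <;> simp [juxt, a, b]
  have hp : perm _ w = perm _ (juxt a b) := by
    rw [perm_juxt, hw]
    congr 2
    · exact hs.symm
    · exact ht.symm
  rcases SpinSym.eq_or_eq_z_mul (x := w.right) (y := (juxt a b).right) hp with e | e
  · exact ⟨a, b, SemidirectProduct.ext hl e.symm⟩
  · refine ⟨z n * a, b, ?_⟩
    rw [z_mul_juxt_left]
    change z _ * (⟨(juxt a b).left, (juxt a b).right⟩ : SpinWreath Γ (n + m)) = w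
    rw [z_mul_mk]
    exact SemidirectProduct.ext hl e.symm

end SpinWreath


/-! ### Products over the cycles of a permutation -/

section CycProd
variable {α : Type*} [Finite α] {R : Type*} [CommMonoid R]

/-- The product over the cycles of `σ` (fixed points included) of the values of `G`, for a function
`G` that is constant on cycles. -/
def cycProd (σ : Equiv.Perm α) (G : α → R) : R :=
  ∏ᶠ c : Quotient (Equiv.Perm.SameCycle.setoid σ), G c.out

/-- A function is constant on the cycles of a permutation. -/
def CycConst {β : Type*} (σ : Equiv.Perm α) (G : α → β) : Prop := ∀ i, G (σ i) = G i

omit [Finite α] [CommMonoid R] in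
theorem CycConst.sameCycle {β : Type*} {σ : Equiv.Perm α} {G : α → β} (h : CycConst σ G) {i j : α}
    (hij : σ.SameCycle i j) : G i = G j := by
  obtain ⟨k, rfl⟩ := hij
  have h1 : ∀ (k : ℕ) (i : α), G ((σ ^ k) i) = G i := by
    intro k
    induction k with
    | zero => simp
    | succ k ih => intro i; rw [pow_succ, Equiv.Perm.mul_apply, ih, h]
  obtain ⟨k, rfl | rfl⟩ := k.eq_nat_or_neg
  · rw [zpow_natCast, h1]
  · rw [zpow_neg, zpow_natCast]
    have h2 : (σ ^ k) ((σ ^ k)⁻¹ i) = i := (σ ^ k).apply_symm_apply i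
    conv_lhs => rw [← h2]
    rw [h1]

omit [Finite α] [CommMonoid R] in
theorem CycConst.out {β : Type*} {σ : Equiv.Perm α} {G : α → β} (h : CycConst σ G) (i : α) :
    G (Quotient.mk (Equiv.Perm.SameCycle.setoid σ) i).out = G i :=
  h.sameCycle (Quotient.exact (s := Equiv.Perm.SameCycle.setoid σ) (Quotient.out_eq _))

omit [Finite α] in
theorem cycProd_congr {σ : Equiv.Perm α} {G G' : α → R} (h : ∀ i, G i = G' i) :
    cycProd σ G = cycProd σ G' := by rw [funext h]

theorem cycProd_mul (σ : Equiv.Perm α) (G G' : α → R) :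
    cycProd σ (fun i => G i * G' i) = cycProd σ G * cycProd σ G' :=
  finprod_mul_distrib (Set.toFinite _) (Set.toFinite _)

theorem map_cycProd {R' F : Type*} [CommMonoid R'] [FunLike F R R'] [MonoidHomClass F R R'] (φ : F)
    (σ : Equiv.Perm α) (G : α → R) : φ (cycProd σ G) = cycProd σ (fun i => φ (G i)) :=
  MonoidHom.map_finprod (φ : R →* R') (Set.toFinite _)

omit [Finite α] in
theorem cycProd_conj (σ τ : Equiv.Perm α) (G G' : α → R) (hG : CycConst σ G)
    (h : ∀ i, G (τ i) = G' i) :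
    cycProd σ G = cycProd (τ⁻¹ * σ * τ) G' := by
  have hs : ∀ i j, (τ⁻¹ * σ * τ).SameCycle i j ↔ σ.SameCycle (τ i) (τ j) := by
    intro i j
    have := Equiv.Perm.sameCycle_conj (f := σ) (g := τ⁻¹) (x := i) (y := j)
    rw [inv_inv] at this
    exact this
  let e : Quotient (Equiv.Perm.SameCycle.setoid (τ⁻¹ * σ * τ)) ≃
      Quotient (Equiv.Perm.SameCycle.setoid σ) := Quotient.congr τ hs
  refine (finprod_eq_of_bijective e e.bijective fun c => ?_).symm
  rw [← h]
  refine hG.sameCycle (Quotient.exact (s := Equiv.Perm.SameCycle.setoid σ) ?_)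
  rw [Quotient.out_eq]
  conv_rhs => rw [← c.out_eq]
  rfl

end CycProd

section Expansion
variable {α : Type*} [Fintype α]

theorem card_sameCycle (σ : Equiv.Perm α) (i : α) [DecidablePred (σ.SameCycle i)] :
    (Finset.univ.filter (σ.SameCycle i)).card = Function.minimalPeriod σ i := by
  classical
  have h := MulAction.minimalPeriod_eq_card (a := σ) (b := i)
  have h2 : Function.minimalPeriod (fun x => σ • x) i = Function.minimalPeriod σ i := rfl
  rw [← h2, h, ← Fintype.card_coe]
  refine Fintype.card_congr (Equiv.subtypeEquivRight fun j => ?_)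
  rw [Finset.mem_filter, and_iff_right (Finset.mem_univ _)]
  constructor
  · rintro ⟨k, hk⟩
    exact ⟨⟨σ ^ k, ⟨k, rfl⟩⟩, hk⟩
  · rintro ⟨⟨_, ⟨k, rfl⟩⟩, hk⟩
    exact ⟨k, hk⟩

open Classical in
/-- Expanding a product over cycles of sums: the terms are indexed by the invariant subsets, and the
exponent of the counting variable `y` is the size of the subset. -/
theorem cycProd_add {R : Type*} [CommSemiring R] (σ : Equiv.Perm α) (y : R) (G G' : α → R) :
    cycProd σ (fun i => G i + y ^ Function.minimalPeriod σ i * G' i) =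
      ∑ A : Finset α, if ∀ i, σ i ∈ A ↔ i ∈ A then
        y ^ A.card * cycProd σ (fun i => if i ∈ A then G' i else G i) else 0 := by
  let Q := Quotient (Equiv.Perm.SameCycle.setoid σ)
  let mk : α → Q := Quotient.mk _
  -- The invariant subsets are the preimages of the sets of cycles.
  let pre : Finset Q → Finset α := fun t => Finset.univ.filter fun i => mk i ∈ t
  have hmk : ∀ i, mk (σ i) = mk i := fun i => Quotient.sound (s := Equiv.Perm.SameCycle.setoid σ)
    (show σ.SameCycle (σ i) i from ⟨-1, by simp⟩)
  have hout : ∀ c : Q, mk c.out = c := fun c => c.out_eq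
  have hpre : ∀ t, ∀ i, σ i ∈ pre t ↔ i ∈ pre t := by
    intro t i
    simp only [pre, Finset.mem_filter, Finset.mem_univ, true_and, hmk]
  have hinj : Function.Injective pre := by
    intro t t' h
    ext c
    have := Finset.ext_iff.mp h c.out
    simpa only [pre, Finset.mem_filter, Finset.mem_univ, true_and, hout] using this
  have hsurj : ∀ A : Finset α, (∀ i, σ i ∈ A ↔ i ∈ A) → ∃ t, pre t = A := by
    intro A hA
    have hc : CycConst σ (fun i => i ∈ A) := fun i => propext (hA i)
    refine ⟨A.image mk, ?_⟩
    ext i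
    simp only [pre, Finset.mem_filter, Finset.mem_univ, true_and, Finset.mem_image]
    constructor
    · rintro ⟨j, hj, h⟩
      have := hc.sameCycle (Quotient.exact (s := Equiv.Perm.SameCycle.setoid σ) h)
      exact this.mp hj
    · intro h
      exact ⟨i, h, rfl⟩
  have hcard : ∀ t, (pre t).card = ∑ c ∈ t, Function.minimalPeriod σ c.out := by
    intro t
    have : pre t = t.biUnion fun c => Finset.univ.filter fun j => σ.SameCycle c.out j := by
      ext i
      simp only [pre, Finset.mem_filter, Finset.mem_univ, true_and, Finset.mem_biUnion]
      constructor
      · intro h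
        exact ⟨_, h, Quotient.exact (s := Equiv.Perm.SameCycle.setoid σ) (Quotient.out_eq _)⟩
      · rintro ⟨c, hc, h⟩
        have : mk i = c := by
          rw [← hout c]
          exact (Quotient.sound (s := Equiv.Perm.SameCycle.setoid σ) h).symm
        rwa [this]
    rw [this, Finset.card_biUnion]
    · simp only [card_sameCycle]
    · intro c _ c' _ hne
      refine Finset.disjoint_left.mpr fun j hj hj' => hne ?_
      simp only [Finset.mem_filter, Finset.mem_univ, true_and] at hj hj'
      rw [← hout c, ← hout c']
      exact Quotient.sound (s := Equiv.Perm.SameCycle.setoid σ) (hj.trans hj'.symm)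
  rw [cycProd, finprod_eq_prod_of_fintype]
  simp only [add_comm (G _)]
  rw [Finset.prod_add, ← Finset.sum_filter, Finset.powerset_univ]
  refine Finset.sum_bij (fun t _ => pre t) (fun t _ => by simpa using hpre t)
    (fun t _ t' _ h => hinj h) (fun A hA => ?_) fun t _ => ?_
  · obtain ⟨t, ht⟩ := hsurj A (by simpa using hA)
    exact ⟨t, Finset.mem_univ _, ht⟩
  · rw [hcard, cycProd, finprod_eq_prod_of_fintype, Finset.prod_mul_distrib,
      Finset.prod_pow_eq_pow_sum, mul_assoc]
    congr 1
    have h1 : ∀ c : Q, c.out ∈ pre t ↔ c ∈ t := fun c => by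
      simp only [pre, Finset.mem_filter, Finset.mem_univ, true_and, hout]
    have h2 : ∀ c : Q, (if c.out ∈ pre t then G' c.out else G c.out) =
        if c ∈ t then G' c.out else G c.out := fun c => by simp only [h1]
    change _ = ∏ c : Q, (if c.out ∈ pre t then G' c.out else G c.out)
    simp only [h2]
    rw [Finset.prod_ite]
    congr 1
    · exact Finset.prod_congr (by ext; simp) fun _ _ => rfl
    · exact Finset.prod_congr (by ext; simp) fun _ _ => rfl

end Expansion

section Block
variable {n m : ℕ} {R : Type*} [CommMonoid R]

theorem blockPerm_zpow (σ : Equiv.Perm (Fin n)) (τ : Equiv.Perm (Fin m)) (k : ℤ) :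
    (SpinSym.blockPerm n m (σ, τ)) ^ k = SpinSym.blockPerm n m (σ ^ k, τ ^ k) := by
  rw [← map_zpow]; rfl

theorem sameCycle_blockPerm_castAdd {σ : Equiv.Perm (Fin n)} {τ : Equiv.Perm (Fin m)}
    {i j : Fin n} : (SpinSym.blockPerm n m (σ, τ)).SameCycle (Fin.castAdd m i) (Fin.castAdd m j) ↔
      σ.SameCycle i j := by
  simp only [Equiv.Perm.SameCycle, blockPerm_zpow, SpinSym.blockPerm_castAdd, Fin.castAdd_inj]

theorem sameCycle_blockPerm_natAdd {σ : Equiv.Perm (Fin n)} {τ : Equiv.Perm (Fin m)}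
    {i j : Fin m} : (SpinSym.blockPerm n m (σ, τ)).SameCycle (Fin.natAdd n i) (Fin.natAdd n j) ↔
      τ.SameCycle i j := by
  simp only [Equiv.Perm.SameCycle, blockPerm_zpow, SpinSym.blockPerm_natAdd, Fin.natAdd_inj]

theorem not_sameCycle_blockPerm {σ : Equiv.Perm (Fin n)} {τ : Equiv.Perm (Fin m)}
    {i : Fin n} {j : Fin m} :
    ¬ (SpinSym.blockPerm n m (σ, τ)).SameCycle (Fin.castAdd m i) (Fin.natAdd n j) := by
  simp only [Equiv.Perm.SameCycle, blockPerm_zpow, SpinSym.blockPerm_castAdd, not_exists]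
  intro k h
  have := congrArg Fin.val h
  simp at this
  omega

open Classical in
theorem cycProd_blockPerm (σ : Equiv.Perm (Fin n)) (τ : Equiv.Perm (Fin m)) (G : Fin (n + m) → R)
    (hG : CycConst (SpinSym.blockPerm n m (σ, τ)) G) :
    cycProd (SpinSym.blockPerm n m (σ, τ)) G =
      cycProd σ (fun i => G (Fin.castAdd m i)) * cycProd τ (fun i => G (Fin.natAdd n i)) := by
  let Q := Quotient (Equiv.Perm.SameCycle.setoid (SpinSym.blockPerm n m (σ, τ)))
  let Q₁ := Quotient (Equiv.Perm.SameCycle.setoid σ)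
  let Q₂ := Quotient (Equiv.Perm.SameCycle.setoid τ)
  let f₁ : Q₁ → Q := Quotient.map (Fin.castAdd m) fun i j h => sameCycle_blockPerm_castAdd.mpr h
  let f₂ : Q₂ → Q := Quotient.map (Fin.natAdd n) fun i j h => sameCycle_blockPerm_natAdd.mpr h
  have hb : Function.Bijective (Sum.elim f₁ f₂) := by
    constructor
    · rintro (c | c) (d | d) h <;> induction c using Quotient.inductionOn <;>
        induction d using Quotient.inductionOn <;>
        have h' := Quotient.exact (s := Equiv.Perm.SameCycle.setoid (SpinSym.blockPerm n m (σ, τ))) h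
      · exact congrArg _ (Quotient.sound (s := Equiv.Perm.SameCycle.setoid σ)
          (sameCycle_blockPerm_castAdd.mp h'))
      · exact absurd h' not_sameCycle_blockPerm
      · exact absurd (Equiv.Perm.SameCycle.symm h') not_sameCycle_blockPerm
      · exact congrArg _ (Quotient.sound (s := Equiv.Perm.SameCycle.setoid τ)
          (sameCycle_blockPerm_natAdd.mp h'))
    · intro c
      induction c using Quotient.inductionOn with | _ i
      refine Fin.addCases (fun i => ?_) (fun i => ?_) i
      · exact ⟨Sum.inl (Quotient.mk _ i), rfl⟩
      · exact ⟨Sum.inr (Quotient.mk _ i), rfl⟩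
  have e : cycProd (SpinSym.blockPerm n m (σ, τ)) G = ∏ᶠ c : Q₁ ⊕ Q₂,
      Sum.elim (fun c : Q₁ => G (Fin.castAdd m c.out)) (fun c : Q₂ => G (Fin.natAdd n c.out)) c := by
    refine (finprod_eq_of_bijective _ hb fun c => ?_).symm
    rcases c with c | c
    · conv_rhs => rw [← c.out_eq]
      exact (hG.out _).symm
    · conv_rhs => rw [← c.out_eq]
      exact (hG.out _).symm
  rw [e, finprod_eq_prod_of_fintype, Fintype.prod_sum_type, cycProd, cycProd,
    finprod_eq_prod_of_fintype, finprod_eq_prod_of_fintype]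
  rfl

end Block

/-! ### Cycle types in the wreath product -/

section CycleType
variable {Γ : Type*} [Group Γ] {n m : ℕ}

open SpinWreath

theorem isConj_of_classFn {a b : Γ} (h : ∀ f : ClassFn Γ, f.1 a = f.1 b) : IsConj a b := by
  classical
  let f : ClassFn Γ := ⟨fun x => if IsConj a x then 1 else 0, fun x y => by
    refine if_congr ⟨fun h => h.trans (isConj_iff.mpr ⟨x⁻¹, by group⟩),
      fun h => h.trans (isConj_iff.mpr ⟨x, rfl⟩)⟩ rfl rfl⟩
  have := h f
  simp only [f, IsConj.refl, if_true] at this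
  by_contra h'
  rw [if_neg h'] at this
  exact one_ne_zero this

/-- The value of a class function on a conjugacy class. -/
def onClass (f : ClassFn Γ) : ConjClasses Γ → ℂ :=
  Quotient.lift f.1 fun a b h => by
    obtain ⟨c, rfl⟩ := isConj_iff.mp h
    exact (f.2 c a).symm

variable (Γ) in
/-- The types of a cycle in a wreath product: its length and the class of its cycle product. -/
abbrev CycType : Type _ := ℕ × ConjClasses Γ

/-- The type of the cycle of `w` through the letter `i`. -/
def cycType (w : SpinWreath Γ n) (i : Fin n) : CycType Γ :=
  (Function.minimalPeriod (perm n w) i, ConjClasses.mk (cycleProd w i))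

theorem cycType_eq {w : SpinWreath Γ n} {w' : SpinWreath Γ m} {i : Fin n} {j : Fin m}
    (h1 : Function.minimalPeriod (perm n w) i = Function.minimalPeriod (perm m w') j)
    (h2 : ∀ f : ClassFn Γ, f.1 (cycleProd w i) = f.1 (cycleProd w' j)) :
    cycType w i = cycType w' j :=
  Prod.ext h1 (ConjClasses.mk_eq_mk_iff_isConj.mpr (isConj_of_classFn h2))

theorem cycType_conj (x w : SpinWreath Γ n) (i : Fin n) :
    cycType (x * w * x⁻¹) (perm n x i) = cycType w i := by
  refine cycType_eq ?_ fun f => cycleProd_conj f x w i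
  rw [Function.minimalPeriod_eq_minimalPeriod_iff]
  intro k
  simp only [Function.IsPeriodicPt, Function.IsFixedPt, Equiv.Perm.iterate_eq_pow, ← map_pow,
    conj_pow]
  simp

theorem cycType_cycConst (w : SpinWreath Γ n) : CycConst (perm n w) (cycType w) := by
  intro i
  have := cycType_conj w w i
  rwa [mul_inv_cancel_right] at this

theorem perm_juxt_pow (a : SpinWreath Γ n) (b : SpinWreath Γ m) (k : ℕ) :
    perm _ (juxt a b ^ k) = SpinSym.blockPerm n m (perm n (a ^ k), perm m (b ^ k)) := by
  rw [map_pow, perm_juxt, ← map_pow]; simp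

theorem juxt_pow_left_castAdd (a : SpinWreath Γ n) (b : SpinWreath Γ m) (k : ℕ) (i : Fin n) :
    (juxt a b ^ k).left (Fin.castAdd m i) = (a ^ k).left i := by
  induction k with
  | zero => simp
  | succ k ih =>
    rw [pow_succ, pow_succ, mul_left', mul_left', ih, perm_juxt_pow, ← map_inv, Prod.inv_mk,
      SpinSym.blockPerm_castAdd]
    simp [juxt]

theorem juxt_pow_left_natAdd (a : SpinWreath Γ n) (b : SpinWreath Γ m) (k : ℕ) (i : Fin m) :
    (juxt a b ^ k).left (Fin.natAdd n i) = (b ^ k).left i := by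
  induction k with
  | zero => simp
  | succ k ih =>
    rw [pow_succ, pow_succ, mul_left', mul_left', ih, perm_juxt_pow, ← map_inv, Prod.inv_mk,
      SpinSym.blockPerm_natAdd]
    simp [juxt]

theorem minimalPeriod_perm_juxt_castAdd (a : SpinWreath Γ n) (b : SpinWreath Γ m) (i : Fin n) :
    Function.minimalPeriod (perm _ (juxt a b)) (Fin.castAdd m i) =
      Function.minimalPeriod (perm n a) i := by
  rw [Function.minimalPeriod_eq_minimalPeriod_iff]
  intro k
  simp only [Function.IsPeriodicPt, Function.IsFixedPt, Equiv.Perm.iterate_eq_pow, ← map_pow,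
    perm_juxt_pow, SpinSym.blockPerm_castAdd, Fin.castAdd_inj]

theorem minimalPeriod_perm_juxt_natAdd (a : SpinWreath Γ n) (b : SpinWreath Γ m) (i : Fin m) :
    Function.minimalPeriod (perm _ (juxt a b)) (Fin.natAdd n i) =
      Function.minimalPeriod (perm m b) i := by
  rw [Function.minimalPeriod_eq_minimalPeriod_iff]
  intro k
  simp only [Function.IsPeriodicPt, Function.IsFixedPt, Equiv.Perm.iterate_eq_pow, ← map_pow,
    perm_juxt_pow, SpinSym.blockPerm_natAdd, Fin.natAdd_inj]

theorem cycType_juxt_castAdd (a : SpinWreath Γ n) (b : SpinWreath Γ m) (i : Fin n) :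
    cycType (juxt a b) (Fin.castAdd m i) = cycType a i := by
  have h := minimalPeriod_perm_juxt_castAdd a b i
  refine Prod.ext h (congrArg ConjClasses.mk ?_)
  rw [cycleProd, h, juxt_pow_left_castAdd, cycleProd]

theorem cycType_juxt_natAdd (a : SpinWreath Γ n) (b : SpinWreath Γ m) (i : Fin m) :
    cycType (juxt a b) (Fin.natAdd n i) = cycType b i := by
  have h := minimalPeriod_perm_juxt_natAdd a b i
  refine Prod.ext h (congrArg ConjClasses.mk ?_)
  rw [cycleProd, h, juxt_pow_left_natAdd, cycleProd]

/-- The product over the cycles of `w` of the values of `p` at their types. -/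
def cycTypeProd {R : Type*} [CommMonoid R] (p : CycType Γ → R) (w : SpinWreath Γ n) : R :=
  cycProd (perm n w) fun i => p (cycType w i)

section cycTypeProd
variable {R : Type*} [CommMonoid R] (p q : CycType Γ → R)

theorem comp_cycType_cycConst {β : Type*} (p : CycType Γ → β) (w : SpinWreath Γ n) :
    CycConst (perm n w) fun i => p (cycType w i) := fun i => by
  simp only [cycType_cycConst w i]

theorem cycTypeProd_conj (x w : SpinWreath Γ n) :
    cycTypeProd p (x * w * x⁻¹) = cycTypeProd p w := by
  rw [cycTypeProd, cycProd_conj _ (perm n x) _ (fun i => p (cycType w i))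
    (comp_cycType_cycConst p _) fun i => by rw [cycType_conj], cycTypeProd]
  congr 1
  simp [mul_assoc]

theorem cycTypeProd_juxt (a : SpinWreath Γ n) (b : SpinWreath Γ m) :
    cycTypeProd p (juxt a b) = cycTypeProd p a * cycTypeProd p b := by
  have h := comp_cycType_cycConst p (juxt a b)
  rw [perm_juxt] at h
  rw [cycTypeProd, perm_juxt, cycProd_blockPerm _ _ _ h]
  simp only [cycType_juxt_castAdd, cycType_juxt_natAdd]
  rfl

theorem map_cycTypeProd {R' F : Type*} [CommMonoid R'] [FunLike F R R'] [MonoidHomClass F R R']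
    (φ : F) (w : SpinWreath Γ n) : φ (cycTypeProd p w) = cycTypeProd (fun c => φ (p c)) w :=
  map_cycProd φ _ _

theorem cycTypeProd_mul (w : SpinWreath Γ n) :
    cycTypeProd (fun c => p c * q c) w = cycTypeProd p w * cycTypeProd q w := cycProd_mul _ _ _

theorem eta_eq_cycTypeProd (f : ClassFn Γ) (w : SpinWreath Γ n) :
    eta f w = cycTypeProd (fun c => onClass f c.2) w := rfl

end cycTypeProd

end CycleType


/-! ### The Frobenius characteristic -/

section Frobenius
variable {Γ : Type*} [Group Γ] {n m : ℕ}

open SpinWreath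

/-- The normalized basic spin character, as a function on the wreath product. -/
def wreathX (w : SpinWreath Γ n) : ℂ := spinX n w.right

theorem wreathX_conj (x w : SpinWreath Γ n) : wreathX (x * w * x⁻¹) = wreathX w :=
  spinX_conj x.right w.right

theorem wreathX_z (w : SpinWreath Γ n) : wreathX (z n * w) = -wreathX w := spinX_z w.right

theorem wreathX_odd (w : SpinWreath Γ n) (hw : sgn n w = -1) : wreathX w = 0 := spinX_odd _ hw

theorem wreathX_inv (w : SpinWreath Γ n) (hw : sgn n w = 1) : wreathX w⁻¹ = wreathX w :=
  spinX_inv w.right hw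

theorem wreathX_juxt (a : SpinWreath Γ n) (b : SpinWreath Γ m) (ha : sgn n a = 1)
    (hb : sgn m b = 1) : wreathX (juxt a b) = wreathX a * wreathX b :=
  spinX_emb a.right b.right ha hb

theorem wreathX_mem : (wreathX : SpinWreath Γ n → ℂ) ∈ SuperSpin Γ n :=
  ⟨wreathX_conj, wreathX_z, wreathX_odd⟩

theorem _root_.TwistedMcKay.SpinSym.embR_word_mul_embL_word (l : List (Fin (n - 1)))
    (l' : List (Fin (m - 1))) :
    SpinSym.embR n m (l'.map SpinSym.t).prod * SpinSym.embL n m (l.map SpinSym.t).prod =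
      (SpinSym.z _ ^ l'.length) ^ l.length *
        (SpinSym.embL n m (l.map SpinSym.t).prod * SpinSym.embR n m (l'.map SpinSym.t).prod) := by
  have hz : ∀ x : SpinSym (n + m), SpinSym.z _ * x = x * SpinSym.z _ := SpinSym.z_comm
  -- moving a generator of the first factor past a word in the second one
  have h1 : ∀ (i : Fin (n - 1)) (l : List (Fin (m - 1))),
      SpinSym.embR n m (l.map SpinSym.t).prod * SpinSym.embL n m (SpinSym.t i) =
        SpinSym.z _ ^ l.length *
          (SpinSym.embL n m (SpinSym.t i) * SpinSym.embR n m (l.map SpinSym.t).prod) := by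
    intro i l
    induction l with
    | nil => simp
    | cons j l ih =>
      have hf : SpinSym.embR n m (SpinSym.t j) * SpinSym.embL n m (SpinSym.t i) =
          SpinSym.z _ * SpinSym.embL n m (SpinSym.t i) * SpinSym.embR n m (SpinSym.t j) := by
        rw [SpinSym.embR_t, SpinSym.embL_t]
        exact SpinSym.t_far _ _ (by have := i.2; simp only; omega)
      rw [List.map_cons, List.prod_cons, map_mul, mul_assoc, ih, List.length_cons, pow_succ,
        ← mul_assoc, ← ((show Commute (SpinSym.z _) _ from hz _).pow_left l.length).eq, mul_assoc,
        ← mul_assoc (SpinSym.embR n m (SpinSym.t j)), hf]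
      simp only [mul_assoc]
  induction l with
  | nil => simp
  | cons i l ih =>
    rw [List.map_cons, List.prod_cons, map_mul, ← mul_assoc, h1, List.length_cons, pow_succ',
      mul_assoc, mul_assoc, ih, ← mul_assoc _ (_ ^ l.length),
      ← (((show Commute (SpinSym.z _) _ from hz _).pow_left l'.length).pow_left l.length).eq]
    simp only [mul_assoc]

/-- Even elements of the second factor commute with the first factor. -/
theorem _root_.TwistedMcKay.SpinSym.embR_comm_embL_of_even_right (y : SpinSym m) (x : SpinSym n)
    (hy : SpinSym.sgn m y = 1) :
    SpinSym.embR n m y * SpinSym.embL n m x = SpinSym.embL n m x * SpinSym.embR n m y := by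
  obtain ⟨l', ⟨q, hq⟩, h'⟩ := SpinSym.exists_even_word y hy
  obtain ⟨l, h⟩ := SpinSym.exists_word x
  have key := SpinSym.embR_word_mul_embL_word l l'
  have hz : SpinSym.z (n + m) ^ l'.length = 1 := by
    rw [hq, ← two_mul, pow_mul, pow_two, SpinSym.z_mul_z, one_pow]
  rw [hz, one_pow, one_mul] at key
  have hc : ∀ u, Commute (SpinSym.z (n + m)) u := SpinSym.z_comm
  have key : Commute _ _ := key
  change Commute _ _
  rcases h with rfl | rfl <;> rcases h' with rfl | rfl <;>
    try simp only [map_mul, SpinSym.embL_z, SpinSym.embR_z]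
  · exact key
  · exact (hc _).mul_left key
  · exact (hc _).symm.mul_right key
  · exact (hc _).mul_left ((hc _).symm.mul_right key)

/-- Odd elements of the two factors of the spin product anticommute. -/
theorem _root_.TwistedMcKay.SpinSym.embR_anticomm_embL (y : SpinSym m) (x : SpinSym n)
    (hy : SpinSym.sgn m y = -1) (hx : SpinSym.sgn n x = -1) :
    SpinSym.embR n m y * SpinSym.embL n m x =
      SpinSym.z _ * (SpinSym.embL n m x * SpinSym.embR n m y) := by
  have h2 := SpinSym.embR_word_mul_embL_word (n := n) (m := m)
  have h3 : ∀ k l : ℕ, Odd k → Odd l → ((SpinSym.z (n + m)) ^ k) ^ l = SpinSym.z _ := by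
    intro k l hk hl
    obtain ⟨q, hq⟩ := hk.mul hl
    rw [← pow_mul, hq, pow_succ, pow_mul, pow_two, SpinSym.z_mul_z, one_pow, one_mul]
  have hodd : ∀ {k : ℕ} (l : List (Fin (k - 1))), SpinSym.sgn k (l.map SpinSym.t).prod = -1 →
      Odd l.length := by
    intro k l h
    rw [SpinSym.sgn_word] at h
    by_contra h'
    rw [(Nat.not_odd_iff_even.mp h').neg_one_pow] at h
    exact absurd h (by decide)
  obtain ⟨l, h | h⟩ := SpinSym.exists_word x <;> obtain ⟨l', h' | h'⟩ := SpinSym.exists_word y <;>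
    subst h <;> subst h' <;>
    try simp only [map_mul (SpinSym.sgn _), SpinSym.sgn_z, one_mul] at hx hy
  all_goals
    try simp only [map_mul, SpinSym.embL_z, SpinSym.embR_z]
  · rw [h2, h3 _ _ (hodd _ hy) (hodd _ hx)]
  · rw [mul_assoc, h2, h3 _ _ (hodd _ hy) (hodd _ hx), ← mul_assoc (SpinSym.embL n m _),
      ← SpinSym.z_comm]
    simp only [mul_assoc]
  · rw [← mul_assoc, ← SpinSym.z_comm, mul_assoc, h2, h3 _ _ (hodd _ hy) (hodd _ hx)]
    simp only [mul_assoc]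
  · rw [mul_assoc, ← mul_assoc _ (SpinSym.z _), ← SpinSym.z_comm (SpinSym.embR n m _), mul_assoc,
      h2, h3 _ _ (hodd _ hy) (hodd _ hx), mul_assoc, ← mul_assoc (SpinSym.embL n m _) (SpinSym.z _),
      ← SpinSym.z_comm (SpinSym.embL n m _)]
    simp only [mul_assoc]

/-- Spin class functions vanish at products of two odd elements: such products are conjugate to
their multiple by `z`. -/
theorem apply_juxt_of_odd {F : SpinWreath Γ (n + m) → ℂ} (hF : F ∈ SuperSpin Γ (n + m))
    (a : SpinWreath Γ n) (b : SpinWreath Γ m) (ha : sgn n a = -1) (hb : sgn m b = -1) :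
    F (juxt a b) = 0 := by
  have hcomm : juxt a 1 * juxt a b = z _ * (juxt a b * juxt a 1) := by
    have e1 : juxt a 1 * juxt a b = juxt (a * a) b := by
      rw [juxt_mul _ _ _ _ (by simp), one_mul]
    have e2 : juxt a b = juxt a 1 * juxt 1 b := by
      rw [juxt_mul _ _ _ _ (by simp), one_mul, mul_one]
    have e3 : juxt 1 b * juxt a 1 = z _ * juxt a b := by
      refine SemidirectProduct.ext (funext fun i => ?_) ?_
      · rw [mul_left', mul_left', perm_juxt, perm_z, ← map_inv, Prod.inv_mk]
        refine Fin.addCases (fun i => ?_) (fun i => ?_) i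
        · rw [SpinSym.blockPerm_castAdd]; simp [juxt, z]
        · rw [SpinSym.blockPerm_natAdd]; simp [juxt, z]
      · have := SpinSym.embR_anticomm_embL (n := n) (m := m) b.right a.right hb ha
        change SpinSym.embL n m 1 * SpinSym.embR n m b.right *
          (SpinSym.embL n m a.right * SpinSym.embR n m 1) =
          SpinSym.z _ * (SpinSym.embL n m a.right * SpinSym.embR n m b.right)
        rw [map_one, map_one, one_mul, mul_one, this]
    have e4 : juxt a b * juxt a 1 = z _ * (juxt a 1 * juxt a b) := by
      conv_lhs => rw [e2]
      rw [mul_assoc, e3, ← mul_assoc, ← z_comm, mul_assoc]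
    rw [e4, ← mul_assoc, z_mul_z, one_mul]
  have h := hF.1 (juxt a 1) (juxt a b)
  rw [hcomm, mul_assoc, mul_inv_cancel_right, hF.2.1] at h
  exact neg_eq_self.mp h

variable [Finite Γ]

instance SpinWreath.instFintype (n : ℕ) : Fintype (SpinWreath Γ n) := Fintype.ofFinite _

theorem card_ne_zero (n : ℕ) : (Nat.card (SpinWreath Γ n) : ℂ) ≠ 0 :=
  Nat.cast_ne_zero.mpr Nat.card_pos.ne'

open Classical in
/-- Each element of the spin product has exactly two preimages under `juxt`. -/
theorem sum_juxt {M : Type*} [AddCommGroup M] [Module ℂ M] (φ : SpinWreath Γ (n + m) → M) :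
    ∑ p : SpinWreath Γ n × SpinWreath Γ m, φ (juxt p.1 p.2) =
      (2 : ℂ) • ∑ w, if ∃ a b, juxt a b = w then φ w else 0 := by
  rw [Finset.smul_sum, ← Finset.sum_fiberwise (s := Finset.univ)
    (g := fun p : SpinWreath Γ n × SpinWreath Γ m => juxt p.1 p.2)]
  refine Finset.sum_congr rfl fun w _ => ?_
  split_ifs with h
  · obtain ⟨a, b, rfl⟩ := h
    have hf : (Finset.univ.filter fun p : SpinWreath Γ n × SpinWreath Γ m =>
        juxt p.1 p.2 = juxt a b) = {(a, b), (z n * a, z m * b)} := by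
      ext ⟨a', b'⟩
      simp [juxt_eq_juxt_iff]
    rw [hf, Finset.sum_pair]
    · have : juxt (z n * a) (z m * b) = juxt a b := juxt_eq_juxt_iff.mpr (Or.inr ⟨rfl, rfl⟩)
      simp only [this, two_smul]
    · intro h
      exact z_mul_ne a (Prod.ext_iff.mp h).1.symm
  · rw [smul_zero, Finset.sum_eq_zero]
    rintro ⟨a, b⟩ hp
    exact absurd ⟨a, b, (Finset.mem_filter.mp hp).2⟩ h

theorem card_range_juxt : (Nat.card (Set.range fun p : SpinWreath Γ n × SpinWreath Γ m =>
    juxt p.1 p.2) : ℂ) * 2 = Nat.card (SpinWreath Γ n) * Nat.card (SpinWreath Γ m) := by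
  classical
  have h := sum_juxt (n := n) (m := m) (Γ := Γ) (fun _ => (1 : ℂ))
  rw [Finset.sum_const, Finset.card_univ, Fintype.card_prod, nsmul_one, ← Finset.sum_filter,
    Finset.sum_const, nsmul_one, smul_eq_mul] at h
  rw [Nat.card_eq_fintype_card (α := SpinWreath Γ n), Nat.card_eq_fintype_card (α := SpinWreath Γ m)]
  rw [← Nat.cast_mul, h, mul_comm, Nat.card_eq_fintype_card, Fintype.card_subtype]
  congr 3
  ext w
  simp

section frob
variable {R : Type*} [CommRing R] [Algebra ℂ R]

/-- The Frobenius characteristic of a spin class function, with values in a commutative algebra `R`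
in which a value `p` of each power sum variable is given:
`|Γ̃_n|⁻¹ ∑_w F(w) X(w) ∏_c p(c)`, the product being over the cycles of `w`, where `X` is the
normalized basic spin character. -/
def frob (p : CycType Γ → R) (F : SpinWreath Γ n → ℂ) : R :=
  (Nat.card (SpinWreath Γ n) : ℂ)⁻¹ • ∑ w, (F w * wreathX w) • cycTypeProd p w

theorem frob_add (p : CycType Γ → R) (F G : SpinWreath Γ n → ℂ) :
    frob p (F + G) = frob p F + frob p G := by
  simp only [frob, Pi.add_apply, add_mul, add_smul, Finset.sum_add_distrib, smul_add]

theorem frob_smul (p : CycType Γ → R) (c : ℂ) (F : SpinWreath Γ n → ℂ) :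
    frob p (c • F) = c • frob p F := by
  simp only [frob, Pi.smul_apply, smul_eq_mul, mul_assoc, mul_smul, ← Finset.smul_sum]
  rw [smul_comm]

theorem map_frob {R' : Type*} [CommRing R'] [Algebra ℂ R'] (φ : R →ₐ[ℂ] R') (p : CycType Γ → R)
    (F : SpinWreath Γ n → ℂ) : φ (frob p F) = frob (fun c => φ (p c)) F := by
  simp only [frob, map_smul, map_sum, map_cycTypeProd]

theorem outer_sum {M : Type*} [AddCommGroup M] [Module ℂ M] (F : SpinWreath Γ n → ℂ)
    (G : SpinWreath Γ m → ℂ) (φ : SpinWreath Γ (n + m) → M) :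
    ∑ w, outer F G w • φ w =
      (2⁻¹ : ℂ) • ∑ a, ∑ b, (F a * G b) • φ (juxt a b) := by
  classical
  have h : ∀ w, outer F G w • φ w = (2⁻¹ : ℂ) • ∑ p : SpinWreath Γ n × SpinWreath Γ m,
      if juxt p.1 p.2 = w then (F p.1 * G p.2) • φ w else 0 := by
    intro w
    rw [outer, finsum_eq_sum_of_fintype, mul_smul, Finset.sum_smul]
    congr 1
    refine Finset.sum_congr rfl fun p _ => ?_
    split_ifs <;> simp
  simp only [h, ← Finset.smul_sum]
  rw [Finset.sum_comm, Fintype.sum_prod_type]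
  simp

/-- The Frobenius characteristic turns induction products into products: Frobenius reciprocity for
the class function `w ↦ X(w) ∏_c p(c)`, which is multiplicative on the spin product. -/
theorem frob_indProd (p : CycType Γ → R) {F : SpinWreath Γ n → ℂ} {G : SpinWreath Γ m → ℂ}
    (hF : F ∈ SuperSpin Γ n) (hG : G ∈ SuperSpin Γ m) :
    frob p (indProd F G) = frob p F * frob p G := by
  set H : ℂ := (Nat.card (Set.range fun p : SpinWreath Γ n × SpinWreath Γ m => juxt p.1 p.2) : ℂ)
    with hH
  set N : ℂ := (Nat.card (SpinWreath Γ (n + m)) : ℂ) with hN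
  let φ : SpinWreath Γ (n + m) → R := fun w => wreathX w • cycTypeProd p w
  have hφ : ∀ x w, φ (x * w * x⁻¹) = φ w := fun x w => by
    simp only [φ, wreathX_conj, cycTypeProd_conj]
  have h1 : ∀ w, (indProd F G w * wreathX w) • cycTypeProd p w =
      H⁻¹ • ∑ x : SpinWreath Γ (n + m), outer F G (x⁻¹ * w * x) • φ w := by
    intro w
    rw [indProd, finsum_eq_sum_of_fintype, mul_smul, mul_smul, Finset.sum_smul]
  -- By conjugation invariance of `φ`, the average in the definition of induction does not matter.
  have h2 : ∀ x : SpinWreath Γ (n + m), ∑ w, outer F G (x⁻¹ * w * x) • φ w =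
      ∑ w, outer F G w • φ w := by
    intro x
    refine Fintype.sum_equiv (MulAut.conj x⁻¹).toEquiv _ _ fun w => ?_
    have e : (MulAut.conj x⁻¹).toEquiv w = x⁻¹ * w * x := by simp
    rw [e]
    congr 1
    conv_lhs => rw [← hφ x⁻¹ w, inv_inv]
  -- The factor `wreathX` is only multiplicative on even elements; on odd ones `F` or `G` vanishes.
  have h3 : ∀ a b, (F a * G b) • φ (juxt a b) =
      ((F a * wreathX a) • cycTypeProd p a) * ((G b * wreathX b) • cycTypeProd p b) := by
    intro a b
    rcases Int.units_eq_one_or (sgn n a) with ha | ha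
    · rcases Int.units_eq_one_or (sgn m b) with hb | hb
      · simp only [φ, wreathX_juxt a b ha hb, cycTypeProd_juxt, smul_mul_smul_comm, smul_smul]
        congr 1
        ring
      · rw [hG.2.2 b hb]; simp
    · rw [hF.2.2 a ha]; simp
  have hcard : H * 2 = _ := card_range_juxt
  have hn := card_ne_zero (Γ := Γ) n
  have hm := card_ne_zero (Γ := Γ) m
  have hN0 : N ≠ 0 := card_ne_zero (n + m)
  have hH0 : H ≠ 0 := by
    intro h
    rw [h, zero_mul] at hcard
    exact mul_ne_zero hn hm hcard.symm
  simp only [frob, h1, ← Finset.smul_sum]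
  rw [Finset.sum_comm, Finset.sum_congr rfl fun x _ => h2 x, Finset.sum_const, Finset.card_univ,
    ← Nat.card_eq_fintype_card, outer_sum]
  simp only [h3]
  rw [← Finset.sum_mul_sum, ← Nat.cast_smul_eq_nsmul ℂ, smul_mul_smul_comm, smul_smul, smul_smul,
    smul_smul]
  congr 1
  have hinv : (Nat.card (SpinWreath Γ n) : ℂ)⁻¹ * (Nat.card (SpinWreath Γ m) : ℂ)⁻¹ = (H * 2)⁻¹ := by
    rw [hcard, mul_inv]
  rw [hinv, ← hN]
  field_simp

/-! ### The Frobenius characteristic of a contraction -/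

open Classical in
/-- The contribution of a set `A` of letters to the expansion of a product over cycles of sums
`p + q`: the cycles in `A` contribute `q` and the others `p`, if `A` is invariant. -/
def markedTerm (q p : CycType Γ → R) (F : SpinWreath Γ n → ℂ) (A : Finset (Fin n))
    (w : SpinWreath Γ n) : R :=
  if ∀ i, perm n w i ∈ A ↔ i ∈ A then
    (F w * wreathX w) • cycProd (perm n w)
      (fun i => if i ∈ A then q (cycType w i) else p (cycType w i)) else 0

omit [Finite Γ] in
theorem markedTerm_conj (q p : CycType Γ → R) {F : SpinWreath Γ n → ℂ}
    (hF : F ∈ SuperSpin Γ n) (A A' : Finset (Fin n)) (x w : SpinWreath Γ n)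
    (hA : ∀ i, perm n x i ∈ A' ↔ i ∈ A) :
    markedTerm q p F A' (x * w * x⁻¹) = markedTerm q p F A w := by
  have hp : ∀ i, perm n (x * w * x⁻¹) (perm n x i) = perm n x (perm n w i) := fun i => by simp
  have hinv : (∀ i, perm n (x * w * x⁻¹) i ∈ A' ↔ i ∈ A') ↔ ∀ i, perm n w i ∈ A ↔ i ∈ A := by
    rw [← (perm n x).forall_congr_right]
    simp only [hp, hA]
  unfold markedTerm
  by_cases h : ∀ i, perm n w i ∈ A ↔ i ∈ A
  · rw [if_pos h, if_pos (hinv.mpr h), hF.1, wreathX_conj]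
    congr 1
    rw [cycProd_conj _ (perm n x) _ (fun i => if i ∈ A then q (cycType w i) else p (cycType w i))]
    · congr 1
      simp [mul_assoc]
    · intro i
      have h1 := cycType_cycConst (x * w * x⁻¹) i
      simp only [hinv.mpr h i, h1]
    · intro i
      simp only [hA, cycType_conj]
  · rw [if_neg h, if_neg (fun h' => h (hinv.mp h'))]

omit [Finite Γ] in
theorem markedTerm_juxt (q p : CycType Γ → R) {F : SpinWreath Γ (n + m) → ℂ}
    (hF : F ∈ SuperSpin Γ (n + m)) (a : SpinWreath Γ n) (b : SpinWreath Γ m) :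
    markedTerm q p F (Finset.univ.map (Fin.castAddEmb m)) (juxt a b) =
      wreathX a • (cycTypeProd q a * ((F (juxt a b) * wreathX b) • cycTypeProd p b)) := by
  have h1 : ∀ i : Fin n, Fin.castAdd m i ∈ Finset.univ.map (Fin.castAddEmb (n := n) m) := fun i =>
    Finset.mem_map.mpr ⟨i, Finset.mem_univ _, rfl⟩
  have h2 : ∀ i : Fin m, Fin.natAdd n i ∉ Finset.univ.map (Fin.castAddEmb (n := n) m) := by
    intro i h
    obtain ⟨j, _, hj⟩ := Finset.mem_map.mp h
    have := congrArg Fin.val hj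
    simp at this
    omega
  have hinv : ∀ i, perm _ (juxt a b) i ∈ Finset.univ.map (Fin.castAddEmb (n := n) m) ↔
      i ∈ Finset.univ.map (Fin.castAddEmb (n := n) m) := by
    intro i
    rw [perm_juxt]
    refine Fin.addCases (fun i => ?_) (fun i => ?_) i
    · rw [SpinSym.blockPerm_castAdd]; simp only [h1]
    · rw [SpinSym.blockPerm_natAdd]; simp only [h2]
  rw [markedTerm, if_pos hinv]
  have hc : CycConst (perm _ (juxt a b)) (fun i =>
      if i ∈ Finset.univ.map (Fin.castAddEmb (n := n) m) then q (cycType (juxt a b) i)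
        else p (cycType (juxt a b) i)) := by
    intro i
    simp only [hinv, cycType_cycConst (juxt a b) i]
  rw [perm_juxt] at hc ⊢
  rw [cycProd_blockPerm _ _ _ hc]
  simp only [h1, h2, if_true, if_false, cycType_juxt_castAdd, cycType_juxt_natAdd]
  rcases Int.units_eq_one_or (sgn n a) with ha | ha
  · rcases Int.units_eq_one_or (sgn m b) with hb | hb
    · rw [wreathX_juxt a b ha hb, mul_smul_comm, smul_smul]
      congr 1
      ring
    · rw [hF.2.2 _ (by rw [sgn_juxt, ha, hb, one_mul])]; simp
  · rcases Int.units_eq_one_or (sgn m b) with hb | hb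
    · rw [hF.2.2 _ (by rw [sgn_juxt, ha, hb, mul_one])]; simp
    · rw [apply_juxt_of_odd hF a b ha hb]; simp

/-- The sum of the contributions of a set of letters depends on its size only, and is a sum over the
spin product. -/
theorem sum_markedTerm (q p : CycType Γ → R) {F : SpinWreath Γ (n + m) → ℂ}
    (hF : F ∈ SuperSpin Γ (n + m)) (A : Finset (Fin (n + m))) (hA : A.card = n) :
    ∑ w, markedTerm q p F A w = (2⁻¹ : ℂ) • ∑ a : SpinWreath Γ n, wreathX a • (cycTypeProd q a *
      ∑ b, (F (juxt a b) * wreathX b) • cycTypeProd p b) := by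
  classical
  set A₀ : Finset (Fin (n + m)) := Finset.univ.map (Fin.castAddEmb m) with hA₀
  have hc : Fintype.card {i // i ∈ A₀} = Fintype.card {i // i ∈ A} := by
    rw [Fintype.card_coe, Fintype.card_coe, hA, hA₀, Finset.card_map, Finset.card_univ,
      Fintype.card_fin]
  let e := Fintype.equivOfCardEq hc
  -- Conjugation by an element `x` carrying the first `n` letters to `A` reduces to the case of `A₀`.
  obtain ⟨x, hx⟩ := perm_surjective (Γ := Γ) (n + m) e.extendSubtype
  have hxA : ∀ i, perm _ x i ∈ A ↔ i ∈ A₀ := by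
    intro i
    rw [hx]
    by_cases h : i ∈ A₀
    · exact iff_of_true (e.extendSubtype_mem i h) h
    · exact iff_of_false (e.extendSubtype_not_mem i h) h
  have h1 : ∑ w, markedTerm q p F A w = ∑ w, markedTerm q p F A₀ w := by
    refine (Fintype.sum_equiv (MulAut.conj x).toEquiv _ _ fun w => ?_).symm
    exact (markedTerm_conj q p hF A₀ A x w hxA).symm
  -- The elements leaving `A₀` invariant are those of the spin product.
  have h2 : ∀ w, markedTerm q p F A₀ w =
      if ∃ a b, juxt a b = w then markedTerm q p F A₀ w else 0 := by
    intro w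
    split_ifs with h
    · rfl
    · rw [markedTerm, if_neg]
      intro hinv
      refine h (exists_juxt w fun i => ?_)
      have : perm _ w (Fin.castAdd m i) ∈ A₀ :=
        (hinv _).mpr (Finset.mem_map.mpr ⟨i, Finset.mem_univ _, rfl⟩)
      obtain ⟨j, _, hj⟩ := Finset.mem_map.mp this
      exact ⟨j, hj.symm⟩
  have h3 := sum_juxt (markedTerm q p F A₀)
  rw [← Finset.sum_congr rfl fun w _ => h2 w] at h3
  rw [h1, ← inv_smul_eq_iff₀ (two_ne_zero)] at *
  rw [← h3, Fintype.sum_prod_type]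
  congr 1
  refine Finset.sum_congr rfl fun a _ => ?_
  rw [Finset.mul_sum, Finset.smul_sum]
  exact Finset.sum_congr rfl fun b _ => markedTerm_juxt q p hF a b

theorem frob_add_eq (p q : CycType Γ → R) (F : SpinWreath Γ n → ℂ) :
    frob (fun c => Polynomial.C (p c) + Polynomial.X ^ c.1 * Polynomial.C (q c)) F =
      (Nat.card (SpinWreath Γ n) : ℂ)⁻¹ • ∑ A : Finset (Fin n),
        Polynomial.X ^ A.card * Polynomial.C (∑ w, markedTerm q p F A w) := by
  classical
  rw [frob]
  congr 1
  have h : ∀ w : SpinWreath Γ n, (F w * wreathX w) •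
      cycTypeProd (fun c => Polynomial.C (p c) + Polynomial.X ^ c.1 * Polynomial.C (q c)) w =
      ∑ A : Finset (Fin n), Polynomial.X ^ A.card * Polynomial.C (markedTerm q p F A w) := by
    intro w
    have := cycProd_add (perm n w) (Polynomial.X : Polynomial R)
      (fun i => Polynomial.C (p (cycType w i))) (fun i => Polynomial.C (q (cycType w i)))
    rw [cycTypeProd]
    refine (congrArg _ this).trans ?_
    rw [Finset.smul_sum]
    refine Finset.sum_congr rfl fun A _ => ?_
    unfold markedTerm
    split_ifs with hA
    · rw [← Polynomial.smul_C, mul_smul_comm, map_cycProd]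
      simp only [apply_ite Polynomial.C]
      congr!
    · simp
  rw [Finset.sum_congr rfl fun w _ => h w, Finset.sum_comm]
  simp only [map_sum, Finset.mul_sum]

/-- Substituting `p + y^r q` for the power sums of degree `r` in a Frobenius characteristic, the
coefficient of `y^n` is the Frobenius characteristic of a contraction. -/
theorem coeff_frob_add (p q : CycType Γ → R) {F : SpinWreath Γ (n + m) → ℂ}
    (hF : F ∈ SuperSpin Γ (n + m)) :
    (frob (fun c => Polynomial.C (p c) + Polynomial.X ^ c.1 * Polynomial.C (q c)) F).coeff n =
      (Nat.card (SpinWreath Γ n) : ℂ)⁻¹ • ∑ a : SpinWreath Γ n, wreathX a • (cycTypeProd q a *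
        frob p (fun b => F (juxt a b))) := by
  classical
  rw [frob_add_eq, Polynomial.coeff_smul, Polynomial.finsetSum_coeff]
  simp only [Polynomial.coeff_X_pow_mul', Polynomial.coeff_C]
  have h : ∀ A : Finset (Fin (n + m)), (if A.card ≤ n then
      if n - A.card = 0 then ∑ w, markedTerm q p F A w else 0 else 0) =
      if A.card = n then (2⁻¹ : ℂ) • ∑ a : SpinWreath Γ n, wreathX a • (cycTypeProd q a *
      ∑ b, (F (juxt a b) * wreathX b) • cycTypeProd p b) else 0 := by
    intro A
    by_cases hA : A.card = n
    · rw [if_pos hA, if_pos hA.le, if_pos (by omega), sum_markedTerm q p hF A hA]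
    · rw [if_neg hA]
      split_ifs
      · omega
      · rfl
      · rfl
  rw [Finset.sum_congr rfl fun A _ => h A, ← Finset.sum_filter, Finset.sum_const]
  have hcard : (Finset.univ.filter fun A : Finset (Fin (n + m)) => A.card = n).card =
      (n + m).choose n := by
    rw [Finset.univ_filter_card_eq, Finset.card_powersetCard, Finset.card_univ, Fintype.card_fin]
  have hR : ∀ a : SpinWreath Γ n, wreathX a • (cycTypeProd q a * frob p (fun b => F (juxt a b))) =
      (Nat.card (SpinWreath Γ m) : ℂ)⁻¹ • (wreathX a • (cycTypeProd q a *
        ∑ b, (F (juxt a b) * wreathX b) • cycTypeProd p b)) := fun a => by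
    rw [frob, mul_smul_comm, smul_comm]
  rw [Finset.sum_congr rfl fun a _ => hR a, ← Finset.smul_sum, hcard, ← Nat.cast_smul_eq_nsmul ℂ,
    smul_smul, smul_smul, smul_smul]
  congr 1
  rw [SpinWreath.card_eq, SpinWreath.card_eq, SpinWreath.card_eq, ← Nat.add_choose_mul_factorial_mul_factorial,
    pow_add]
  have h1 : (Nat.card Γ : ℂ) ≠ 0 := Nat.cast_ne_zero.mpr Nat.card_pos.ne'
  have h2 : ((n + m).choose n : ℂ) ≠ 0 :=
    Nat.cast_ne_zero.mpr (Nat.choose_pos (Nat.le_add_right n m)).ne'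
  have h3 : (n.factorial : ℂ) ≠ 0 := Nat.cast_ne_zero.mpr n.factorial_ne_zero
  have h4 : (m.factorial : ℂ) ≠ 0 := Nat.cast_ne_zero.mpr m.factorial_ne_zero
  have h5 : ((n + m).choose m : ℂ) = (n + m).choose n := by rw [Nat.choose_symm_add]
  push_cast
  rw [h5]
  field_simp

theorem coeff_frob_add_of_lt (p q : CycType Γ → R) {F : SpinWreath Γ n → ℂ} {k : ℕ} (hk : n < k) :
    (frob (fun c => Polynomial.C (p c) + Polynomial.X ^ c.1 * Polynomial.C (q c)) F).coeff k = 0 := by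
  classical
  rw [frob_add_eq, Polynomial.coeff_smul, Polynomial.finsetSum_coeff, Finset.sum_eq_zero, smul_zero]
  intro A _
  have : A.card ≤ n := by simpa using Finset.card_le_univ A
  rw [Polynomial.coeff_X_pow_mul', if_pos (by omega), Polynomial.coeff_C, if_neg (by omega)]

end frob
end Frobenius


/-! ### Full cycles -/

section FullCycles

/-- A permutation is a full cycle if all letters lie in one cycle. -/
def IsFullCycle {n : ℕ} (σ : Equiv.Perm (Fin n)) : Prop := ∀ i j, σ.SameCycle i j

variable {n : ℕ} {σ τ : Equiv.Perm (Fin n)}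

theorem isFullCycle_iff (i : Fin n) : IsFullCycle σ ↔ Function.minimalPeriod σ i = n := by
  classical
  rw [← card_sameCycle]
  constructor
  · intro h
    rw [Finset.filter_true_of_mem fun j _ => h i j, Finset.card_univ, Fintype.card_fin]
  · intro h
    have hu : Finset.univ.filter (σ.SameCycle i) = Finset.univ := by
      rw [← Finset.card_eq_iff_eq_univ, h, Fintype.card_fin]
    have : ∀ j, σ.SameCycle i j := fun j => by
      have := Finset.mem_univ j
      rw [← hu] at this
      exact (Finset.mem_filter.mp this).2
    exact fun j k => (this j).symm.trans (this k)

theorem IsFullCycle.isCycle (h : IsFullCycle σ) (hn : 2 ≤ n) :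
    σ.IsCycle ∧ σ.support.card = n := by
  have hne : ∀ i, σ i ≠ i := by
    intro i hi
    have h1 := (isFullCycle_iff i).mp h
    rw [Function.minimalPeriod_eq_one_iff_isFixedPt.mpr hi] at h1
    omega
  refine ⟨⟨⟨0, by omega⟩, hne _, fun y _ => h _ _⟩, ?_⟩
  have : σ.support = Finset.univ := by
    ext i
    simp [Equiv.Perm.mem_support, hne]
  rw [this, Finset.card_univ, Fintype.card_fin]

theorem IsFullCycle.isConj (hσ : IsFullCycle σ) (hτ : IsFullCycle τ) : IsConj σ τ := by
  rcases Nat.lt_or_ge n 2 with hn | hn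
  · have : Subsingleton (Fin n) := Fin.subsingleton_iff_le_one.mpr (by omega)
    rw [Subsingleton.elim σ τ]
  · obtain ⟨h1, h2⟩ := hσ.isCycle hn
    obtain ⟨h3, h4⟩ := hτ.isCycle hn
    exact h1.isConj h3 (h2.trans h4.symm)

theorem IsFullCycle.of_isConj (hσ : IsFullCycle σ) (h : IsConj σ τ) : IsFullCycle τ := by
  obtain ⟨c, rfl⟩ := isConj_iff.mp h
  intro i j
  rw [Equiv.Perm.sameCycle_conj]
  exact hσ _ _

theorem isFullCycle_θ_stdCycle (n : ℕ) : IsFullCycle (SpinSym.θ n (stdCycle n)) := by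
  have h : SpinSym.θ n (stdCycle n) = (List.finRange n).formPerm := by
    rw [stdCycle, map_list_prod, List.map_ofFn]
    rw [List.formPerm]
    congr 1
    refine List.ext_getElem (by simp) fun i h1 h2 => ?_
    simp [SpinSym.adj]
  rw [h]
  have key : ∀ j : Fin n, (List.finRange n).formPerm.SameCycle ⟨0, by have := j.2; omega⟩ j := by
    intro j
    refine ⟨(j.val : ℤ), ?_⟩
    have := List.formPerm_pow_apply_getElem (List.finRange n) (List.nodup_finRange n) j.val 0
      (by have := j.2; simp; omega)
    simp only [List.getElem_finRange, List.length_finRange, Nat.zero_add, Nat.mod_eq_of_lt j.2] at this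
    rw [zpow_natCast]
    exact this
  intro i j
  exact (key i).symm.trans (key j)

/-- There are `(n - 1)!` full cycles on `n` letters. -/
theorem card_isFullCycle (hn : 0 < n) [DecidablePred fun σ : Equiv.Perm (Fin n) => IsFullCycle σ] :
    (Finset.univ.filter fun σ : Equiv.Perm (Fin n) => IsFullCycle σ).card = (n - 1).factorial := by
  rcases Nat.lt_or_ge n 2 with hn2 | hn2
  · obtain rfl : n = 1 := by omega
    rw [Finset.filter_true_of_mem fun σ _ i j => by rw [Subsingleton.elim i j]]
    rfl
  · have h := Equiv.Perm.card_of_cycleType_singleton (α := Fin n) hn2 (by simp)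
    rw [Fintype.card_fin, Nat.choose_self, mul_one] at h
    rw [← h]
    congr 1
    ext σ
    simp only [Finset.mem_filter, Finset.mem_univ, true_and]
    constructor
    · intro hf
      obtain ⟨h1, h2⟩ := hf.isCycle hn2
      rw [h1.cycleType, h2]
    · intro hc
      have h1 : σ.IsCycle := by
        rw [← Equiv.Perm.card_cycleType_eq_one, hc]; rfl
      have h2 : σ.support.card = n := by
        rw [← Equiv.Perm.sum_cycleType, hc]; simp
      have h3 : ∀ i, σ i ≠ i := fun i => by
        rw [← Equiv.Perm.mem_support]
        have : σ.support = Finset.univ := by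
          rw [← Finset.card_eq_iff_eq_univ, h2, Fintype.card_fin]
        rw [this]; exact Finset.mem_univ i
      exact fun i j => h1.sameCycle (h3 i) (h3 j)

end FullCycles

section WreathFull
variable {Γ : Type*} [Group Γ] {n m : ℕ}

open SpinWreath

theorem cycTypeProd_of_full {R : Type*} [CommMonoid R] (p : CycType Γ → R) (w : SpinWreath Γ n)
    (h : IsFullCycle (perm n w)) (i : Fin n) : cycTypeProd p w = p (cycType w i) := by
  have hs : ∀ c : Quotient (Equiv.Perm.SameCycle.setoid (perm n w)), c = Quotient.mk _ i := by
    intro c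
    induction c using Quotient.inductionOn with | _ j
    exact Quotient.sound (s := Equiv.Perm.SameCycle.setoid (perm n w)) (h j i)
  let u : Unique (Quotient (Equiv.Perm.SameCycle.setoid (perm n w))) := ⟨⟨Quotient.mk _ i⟩, hs⟩
  rw [cycTypeProd, cycProd, finprod_unique]
  exact (comp_cycType_cycConst p w).out i

theorem cycTypeProd_of_not_full {R : Type*} [CommSemiring R] (p : CycType Γ → R)
    (w : SpinWreath Γ n) (hp : ∀ c : CycType Γ, c.1 ≠ n → p c = 0) (hn : 0 < n)
    (h : ¬ IsFullCycle (perm n w)) : cycTypeProd p w = 0 := by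
  classical
  have h0 : Function.minimalPeriod (perm n w) ⟨0, hn⟩ ≠ n := fun h' => h ((isFullCycle_iff _).mpr h')
  rw [cycTypeProd, cycProd, finprod_eq_prod_of_fintype]
  refine Finset.prod_eq_zero (Finset.mem_univ (Quotient.mk _ ⟨0, hn⟩)) ?_
  have := (comp_cycType_cycConst p w).out ⟨0, hn⟩
  exact this.trans (hp _ h0)

theorem wreathX_mk (g : Fin n → Γ) (s : SpinSym n) : wreathX (⟨g, s⟩ : SpinWreath Γ n) = spinX n s :=
  rfl

/-- A lift of a full cycle is conjugate to a standard one, up to the central element. -/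
theorem exists_conj_std (w : SpinWreath Γ n) (h : IsFullCycle (perm n w)) :
    ∃ (x : SpinWreath Γ n) (g : Fin n → Γ), x * w * x⁻¹ = ⟨g, stdCycle n⟩ ∨
      x * w * x⁻¹ = ⟨g, SpinSym.z n * stdCycle n⟩ := by
  obtain ⟨c, hc⟩ := isConj_iff.mp (h.isConj (isFullCycle_θ_stdCycle n))
  obtain ⟨x, rfl⟩ := perm_surjective (Γ := Γ) n c
  have hp : SpinSym.θ n (x * w * x⁻¹).right = SpinSym.θ n (stdCycle n) := by
    rw [← hc, ← map_inv, ← map_mul, ← map_mul]; rfl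
  refine ⟨x, (x * w * x⁻¹).left, ?_⟩
  rcases SpinSym.eq_or_eq_z_mul hp with e | e
  · exact Or.inl (SemidirectProduct.ext rfl e)
  · exact Or.inr (SemidirectProduct.ext rfl e)

theorem wreathX_sq_of_full (hn : Odd n) (w : SpinWreath Γ n) (h : IsFullCycle (perm n w)) :
    wreathX w * wreathX w = 2 := by
  obtain ⟨x, g, e | e⟩ := exists_conj_std w h
  · rw [← wreathX_conj x w, e, wreathX_mk, spinX_stdCycle hn, sqrt_two_mul]
  · rw [← wreathX_conj x w, e, wreathX_mk, spinX_z, spinX_stdCycle hn, neg_mul_neg, sqrt_two_mul]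

theorem sgn_of_full (w : SpinWreath Γ n) (h : IsFullCycle (perm n w)) :
    sgn n w = (-1) ^ (n - 1) := by
  obtain ⟨x, g, e⟩ := exists_conj_std w h
  have h1 : sgn n (x * w * x⁻¹) = sgn n w := by
    rw [map_mul, map_mul, map_inv, mul_comm (sgn n x), mul_inv_cancel_right]
  have h2 : SpinSym.sgn n (stdCycle n) = (-1) ^ (n - 1) := by
    have : ∀ i, SpinSym.sgn n (SpinSym.t i) = -1 := fun i => SpinSym.sgn_t i
    rw [stdCycle, map_list_prod, List.map_ofFn]
    simp only [Function.comp_def, this, List.ofFn_const, List.prod_replicate]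
  rw [← h1, ← h2]
  rcases e with e | e <;> rw [e]
  · rfl
  · change SpinSym.sgn n (SpinSym.z n * stdCycle n) = _
    rw [map_mul, SpinSym.sgn_z, one_mul]

open Classical in
/-- The sign of a lift of an odd cycle is read off from the basic spin character. -/
theorem cycleSign_eq (hn : Odd n) (w : SpinWreath Γ n) :
    cycleSign n w * (Real.sqrt 2 : ℝ) = if IsFullCycle (perm n w) then wreathX w else 0 := by
  have hX : ∀ (g : Fin n → Γ), IsConj (⟨g, stdCycle n⟩ : SpinWreath Γ n) w →
      wreathX w = (Real.sqrt 2 : ℝ) := by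
    intro g h
    obtain ⟨c, rfl⟩ := isConj_iff.mp h
    rw [wreathX_conj, wreathX_mk, spinX_stdCycle hn]
  have hX' : ∀ (g : Fin n → Γ), IsConj (⟨g, SpinSym.z n * stdCycle n⟩ : SpinWreath Γ n) w →
      wreathX w = -(Real.sqrt 2 : ℝ) := by
    intro g h
    obtain ⟨c, rfl⟩ := isConj_iff.mp h
    rw [wreathX_conj, wreathX_mk, spinX_z, spinX_stdCycle hn]
  have hne : ((Real.sqrt 2 : ℝ) : ℂ) ≠ -(Real.sqrt 2 : ℝ) := fun h =>
    sqrt_two_ne (self_eq_neg.mp h)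
  unfold cycleSign
  by_cases h : IsFullCycle (perm n w)
  · rw [if_pos h]
    obtain ⟨x, g, e | e⟩ := exists_conj_std w h
    · have h1 : IsConj (⟨g, stdCycle n⟩ : SpinWreath Γ n) w :=
        (isConj_iff.mpr ⟨x, e⟩ : IsConj w _).symm
      rw [if_pos ⟨g, h1⟩, if_neg, hX g h1]
      · simp
      · rintro ⟨g', h2⟩
        exact hne ((hX g h1).symm.trans (hX' g' h2))
    · have h1 : IsConj (⟨g, SpinSym.z n * stdCycle n⟩ : SpinWreath Γ n) w :=
        (isConj_iff.mpr ⟨x, e⟩ : IsConj w _).symm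
      rw [if_neg, if_pos ⟨g, h1⟩, hX' g h1]
      · simp
      · rintro ⟨g', h2⟩
        exact hne ((hX g' h2).symm.trans (hX' g h1))
  · have h1 : ∀ s : SpinSym n, SpinSym.θ n s = SpinSym.θ n (stdCycle n) →
        ¬ ∃ g : Fin n → Γ, IsConj (⟨g, s⟩ : SpinWreath Γ n) w := by
      rintro s hs ⟨g, hg⟩
      refine h (IsFullCycle.of_isConj (σ := perm n (⟨g, s⟩ : SpinWreath Γ n)) ?_ ?_)
      · change IsFullCycle (SpinSym.θ n s)
        rw [hs]; exact isFullCycle_θ_stdCycle n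
      · exact (perm n).map_isConj hg
    rw [if_neg h, if_neg (h1 _ rfl), if_neg (h1 _ (by simp)), sub_zero, zero_mul]

/-- Two lifts of full cycles with conjugate cycle products are conjugate, up to the central
element. -/
theorem exists_conj_of_full {w w' : SpinWreath Γ n} (h : IsFullCycle (perm n w))
    (h' : IsFullCycle (perm n w')) (i : Fin n) (hc : cycType w i = cycType w' i) :
    ∃ x, w' = x * w * x⁻¹ ∨ w' = z n * (x * w * x⁻¹) := by
  -- reduction to elements over the same permutation
  suffices key : ∀ v : SpinWreath Γ n, perm n v = perm n w' → cycType v i = cycType w' i →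
      ∃ x, w' = x * v * x⁻¹ ∨ w' = z n * (x * v * x⁻¹) by
    obtain ⟨c, hcc⟩ := isConj_iff.mp (h.isConj h')
    obtain ⟨x, rfl⟩ := perm_surjective (Γ := Γ) n c
    have hv : cycType (x * w * x⁻¹) i = cycType w' i := by
      have hfull : IsFullCycle (perm n (x * w * x⁻¹)) := by
        rw [map_mul, map_mul, map_inv, hcc]; exact h'
      rw [← hc, ← cycType_conj x w i]
      exact (cycType_cycConst _).sameCycle (hfull _ _)
    obtain ⟨y, hy⟩ := key (x * w * x⁻¹) (by rw [map_mul, map_mul, map_inv, hcc]) hv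
    refine ⟨y * x, ?_⟩
    have : y * x * w * (y * x)⁻¹ = y * (x * w * x⁻¹) * y⁻¹ := by group
    rwa [this]
  intro v hp hv
  have hk : Function.minimalPeriod (perm n w') i = n := (isFullCycle_iff i).mp h'
  set σ := perm n w' with hσ
  -- the cycle products are conjugate by `c`
  obtain ⟨c, hcv⟩ := isConj_iff.mp (ConjClasses.mk_eq_mk_iff_isConj.mp (congrArg Prod.snd hv))
  -- partial cycle products
  let A : SpinWreath Γ n → ℕ → Γ := fun u j => (u ^ j).left ((σ ^ j) i)
  have hA : ∀ u : SpinWreath Γ n, perm n u = σ → ∀ j,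
      A u (j + 1) = u.left ((σ ^ (j + 1)) i) * A u j := by
    intro u hu j
    simp only [A]
    rw [pow_succ' u, mul_left', hu, pow_succ', Equiv.Perm.mul_apply]
    exact congrArg _ (congrArg (u ^ j).left (σ.symm_apply_apply _))
  have hA0 : ∀ u : SpinWreath Γ n, A u 0 = 1 := fun u => by simp [A]
  have hσn : (σ ^ n) i = i := by
    have := Function.iterate_minimalPeriod (f := σ) (x := i)
    rwa [hk, Equiv.Perm.iterate_eq_pow] at this
  have hAn : ∀ u : SpinWreath Γ n, perm n u = σ → A u n = cycleProd u i := by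
    intro u hu
    simp only [A, cycleProd]
    rw [hu, hk, hσn]
  let φ : ℕ → Γ := fun j => A w' j * c * (A v j)⁻¹
  have hφ : ∀ j, φ (j + 1) = w'.left ((σ ^ (j + 1)) i) * φ j * (v.left ((σ ^ (j + 1)) i))⁻¹ := by
    intro j
    simp only [φ]
    rw [hA w' rfl, hA v hp]
    group
  have hφn : ∀ j, φ (j + n) = φ j := by
    intro j
    induction j with
    | zero =>
      simp only [φ, Nat.zero_add, hA0]
      rw [hAn w' rfl, hAn v hp, ← hcv]
      group
    | succ j ih =>
      have : (σ ^ (j + n + 1)) i = (σ ^ (j + 1)) i := by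
        rw [show j + n + 1 = j + 1 + n by ring, pow_add, Equiv.Perm.mul_apply, hσn]
      rw [show j + 1 + n = j + n + 1 by ring, hφ, hφ, ih, this]
  have hφm : ∀ j, φ (j % n) = φ j := by
    intro j
    have h1 : ∀ q r, φ (r + n * q) = φ r := by
      intro q
      induction q with
      | zero => simp
      | succ q ih => intro r; rw [Nat.mul_succ, ← add_assoc, hφn, ih]
    conv_rhs => rw [← Nat.mod_add_div j n]
    rw [h1]
  have hinj : ∀ j j', (σ ^ j) i = (σ ^ j') i → φ j = φ j' := by
    intro j j' hjj
    have : j % n = j' % n := by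
      have := Function.iterate_eq_iterate_iff_of_lt_minimalPeriod (f := σ) (x := i)
        (m := j % n) (n := j' % n) (by rw [hk]; exact Nat.mod_lt _ (by have := i.2; omega))
        (by rw [hk]; exact Nat.mod_lt _ (by have := i.2; omega))
      rw [← this]
      have e : ∀ j, (σ)^[j % n] i = (σ)^[j] i := fun j => by
        have := Function.iterate_mod_minimalPeriod_eq (f := σ) (x := i) (n := j)
        rwa [hk] at this
      rw [e, e, Equiv.Perm.iterate_eq_pow, Equiv.Perm.iterate_eq_pow, hjj]
    rw [← hφm j, ← hφm j', this]
  have hex : ∀ l : Fin n, ∃ j : ℕ, (σ ^ j) i = l := fun l => (h' i l).exists_nat_pow_eq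
  choose J hJ using hex
  let x : SpinWreath Γ n := ⟨fun l => φ (J l), 1⟩
  have hx : perm n x = 1 := map_one (SpinSym.θ n)
  have hright : (x * v * x⁻¹).right = v.right := by
    simp [x]
  have hleft : (x * v * x⁻¹).left = w'.left := by
    have hxl : (x * v).left = (w' * x).left := by
      funext l
      rw [mul_left', mul_left', hx, inv_one, Equiv.Perm.one_apply]
      change φ (J l) * _ = _ * φ (J (σ⁻¹ l))
      have h1 : (σ ^ (J (σ⁻¹ l) + 1)) i = l := by
        rw [pow_succ', Equiv.Perm.mul_apply, hJ]
        exact σ.apply_symm_apply l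
      rw [hinj (J l) (J (σ⁻¹ l) + 1) (by rw [hJ, h1]), hφ, h1]
      group
    funext l
    rw [mul_left', hxl, mul_left', map_mul, hx, one_mul, hp, mul_assoc]
    have h2 := congrFun (congrArg SemidirectProduct.left (mul_inv_cancel x)) (σ⁻¹ l)
    rw [mul_left', hx, inv_one, Equiv.Perm.one_apply] at h2
    rw [h2]
    simp
  refine ⟨x, ?_⟩
  rcases SpinSym.eq_or_eq_z_mul (x := w'.right) (y := (x * v * x⁻¹).right)
    (by rw [hright]; exact hp.symm) with e | e
  · exact Or.inl (SemidirectProduct.ext hleft.symm e)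
  · right
    have := z_mul_mk (x * v * x⁻¹).left (x * v * x⁻¹).right
    exact (SemidirectProduct.ext (y := ⟨(x * v * x⁻¹).left, SpinSym.z n * (x * v * x⁻¹).right⟩)
      hleft.symm e).trans this.symm

/-- Inverting an element inverts its cycle products. -/
def cycInv (c : CycType Γ) : CycType Γ :=
  (c.1, Quotient.map (fun x : Γ => x⁻¹) (fun a b h => by
    obtain ⟨c, rfl⟩ := isConj_iff.mp h
    exact isConj_iff.mpr ⟨c, by group⟩) c.2)

theorem cycType_inv (w : SpinWreath Γ n) (i : Fin n) : cycType w⁻¹ i = cycInv (cycType w i) := by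
  have h : Function.minimalPeriod (perm n w⁻¹) i = Function.minimalPeriod (perm n w) i := by
    rw [Function.minimalPeriod_eq_minimalPeriod_iff]
    intro k
    simp only [Function.IsPeriodicPt, Function.IsFixedPt, Equiv.Perm.iterate_eq_pow, map_inv,
      inv_pow]
    rw [Equiv.Perm.inv_eq_iff_eq, eq_comm]
  refine Prod.ext h ?_
  change ConjClasses.mk _ = ConjClasses.mk (cycleProd w i)⁻¹
  congr 1
  rw [cycleProd, h, cycleProd, inv_pow]
  have hfix := pow_perm_fix w i
  set v := w ^ Function.minimalPeriod (perm n w) i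
  have h2 := congrFun (congrArg SemidirectProduct.left (mul_inv_cancel v)) i
  rw [mul_left', show (perm n v)⁻¹ i = i by rw [Equiv.Perm.inv_eq_iff_eq, hfix]] at h2
  exact (inv_eq_of_mul_eq_one_right h2).symm

theorem cycTypeProd_inv {R : Type*} [CommMonoid R] (p : CycType Γ → R) (w : SpinWreath Γ n) :
    cycTypeProd p w⁻¹ = cycTypeProd (fun c => p (cycInv c)) w := by
  have hs : ∀ i j, (perm n w).SameCycle i j ↔ (perm n w⁻¹).SameCycle i j := by
    intro i j
    rw [map_inv, Equiv.Perm.sameCycle_inv]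
  let e : Quotient (Equiv.Perm.SameCycle.setoid (perm n w)) ≃
      Quotient (Equiv.Perm.SameCycle.setoid (perm n w⁻¹)) := Quotient.congr (Equiv.refl _) hs
  refine (finprod_eq_of_bijective e e.bijective fun c => ?_).symm
  simp only [← cycType_inv]
  refine (comp_cycType_cycConst p w⁻¹).sameCycle
    (Quotient.exact (s := Equiv.Perm.SameCycle.setoid (perm n w⁻¹)) ?_)
  rw [Quotient.out_eq]
  conv_rhs => rw [← c.out_eq]
  rfl

variable [Finite Γ]

open Classical in
/-- The average over the full cycles of a function of the cycle product. -/
theorem sum_full (hn : 0 < n) (φ : Γ → ℂ) :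
    (n : ℂ) * (Nat.card Γ : ℂ) * ∑ w : SpinWreath Γ n,
      (if IsFullCycle (perm n w) then φ (cycleProd w ⟨0, hn⟩) else 0) =
      Nat.card (SpinWreath Γ n) * ∑ᶠ x, φ x := by
  have : Fintype Γ := Fintype.ofFinite Γ
  set o : Fin n := ⟨0, hn⟩ with ho
  -- translating the coordinate `0` by `h` translates the cycle product
  let s : Γ → SpinWreath Γ n := fun h => SemidirectProduct.inl (Pi.mulSingle o h)
  have hs : ∀ h, perm n (s h) = 1 := fun h => by simp [perm, s]
  have hsw : ∀ h w, perm n (s h * w) = perm n w := fun h w => by rw [map_mul, hs, one_mul]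
  have hcp : ∀ h w, IsFullCycle (perm n w) → cycleProd (s h * w) o = h * cycleProd w o := by
    intro h w hw
    have hk := (isFullCycle_iff o).mp hw
    have key : ∀ j, j < n → ((s h * w) ^ (j + 1)).left o = h * (w ^ (j + 1)).left o := by
      intro j
      induction j with
      | zero =>
        intro _
        rw [zero_add, pow_one, pow_one, mul_left', hs]
        simp [s]
      | succ j ih =>
        intro hj
        have e : ∀ u : SpinWreath Γ n, (u ^ (j + 1 + 1)).left o =
            (u ^ (j + 1)).left o * u.left (((perm n u) ^ (j + 1))⁻¹ o) := fun u => by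
          rw [pow_succ u (j + 1), mul_left', map_pow]
        rw [e, e, ih (by omega), hsw, mul_assoc, mul_left', hs]
        congr 2
        have hne : ((perm n w) ^ (j + 1))⁻¹ o ≠ o := by
          intro h
          rw [Equiv.Perm.inv_eq_iff_eq, ← Equiv.Perm.iterate_eq_pow] at h
          have := Function.IsPeriodicPt.minimalPeriod_le (n := j + 1) (by omega) h.symm
          omega
        have h0 : (s h).left (((perm n w) ^ (j + 1))⁻¹ o) = 1 := Pi.mulSingle_eq_of_ne hne _
        rw [h0, one_mul]
        rfl
    rw [cycleProd, cycleProd, hsw, hk]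
    obtain ⟨j, rfl⟩ : ∃ j, n = j + 1 := ⟨n - 1, by omega⟩
    exact key j (by omega)
  set T := ∑ w : SpinWreath Γ n, (if IsFullCycle (perm n w) then φ (cycleProd w o) else 0) with hT
  have h1 : ∀ h : Γ, T = ∑ w : SpinWreath Γ n,
      (if IsFullCycle (perm n w) then φ (h * cycleProd w o) else 0) := by
    intro h
    refine (Fintype.sum_equiv (Equiv.mulLeft (s h)) _ _ fun w => ?_).symm
    simp only [Equiv.coe_mulLeft, hsw]
    split_ifs with hw
    · rw [hcp h w hw]
    · rfl
  have h2 : (Nat.card Γ : ℂ) * T = (Finset.univ.filter fun w : SpinWreath Γ n =>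
      IsFullCycle (perm n w)).card * ∑ᶠ x, φ x := by
    have e1 : (Nat.card Γ : ℂ) * T = ∑ _h : Γ, T := by
      rw [Finset.sum_const, Finset.card_univ, nsmul_eq_mul, Nat.card_eq_fintype_card]
    rw [e1, Finset.sum_congr rfl fun h _ => h1 h, Finset.sum_comm]
    have e2 : ∀ w : SpinWreath Γ n, ∑ h : Γ,
        (if IsFullCycle (perm n w) then φ (h * cycleProd w o) else 0) =
        if IsFullCycle (perm n w) then ∑ᶠ x, φ x else 0 := by
      intro w
      split_ifs
      · rw [finsum_eq_sum_of_fintype]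
        exact Fintype.sum_equiv (Equiv.mulRight (cycleProd w o)) _ _ fun h => rfl
      · simp
    rw [Finset.sum_congr rfl fun w _ => e2 w, ← Finset.sum_filter, Finset.sum_const, nsmul_eq_mul]
  have h3 : (Finset.univ.filter fun w : SpinWreath Γ n => IsFullCycle (perm n w)).card * n =
      Nat.card (SpinWreath Γ n) := by
    have e : (Finset.univ.filter fun w : SpinWreath Γ n => IsFullCycle (perm n w)).card =
        ∑ σ ∈ Finset.univ.filter (fun σ : Equiv.Perm (Fin n) => IsFullCycle σ),
          (Finset.univ.filter fun w : SpinWreath Γ n => perm n w = σ).card := by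
      rw [Finset.card_eq_sum_card_fiberwise (f := perm n)
        (t := Finset.univ.filter (fun σ : Equiv.Perm (Fin n) => IsFullCycle σ))]
      · refine Finset.sum_congr rfl fun σ hσ => ?_
        congr 1
        ext w
        simp only [Finset.mem_filter, Finset.mem_univ, true_and] at hσ ⊢
        exact ⟨fun h => h.2, fun h => ⟨h ▸ hσ, h⟩⟩
      · intro w hw
        simpa using hw
    have hfib : ∀ σ : Equiv.Perm (Fin n),
        (Finset.univ.filter fun w : SpinWreath Γ n => perm n w = σ).card * n.factorial =
          Nat.card (SpinWreath Γ n) := by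
      intro σ
      have h0 : ∀ τ : Equiv.Perm (Fin n),
          (Finset.univ.filter fun w : SpinWreath Γ n => perm n w = τ).card =
          (Finset.univ.filter fun w : SpinWreath Γ n => perm n w = σ).card := by
        intro τ
        obtain ⟨x, hx⟩ := perm_surjective (Γ := Γ) n (σ * τ⁻¹)
        refine Finset.card_equiv (Equiv.mulLeft x) fun w => ?_
        simp only [Finset.mem_filter, Finset.mem_univ, true_and, Equiv.coe_mulLeft, map_mul, hx,
          mul_assoc]
        constructor
        · rintro rfl; simp
        · intro h
          have : τ⁻¹ * perm n w = 1 := mul_eq_left.mp h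
          exact (inv_mul_eq_one.mp this).symm
      have hU : Fintype.card (SpinWreath Γ n) = ∑ τ : Equiv.Perm (Fin n),
          (Finset.univ.filter fun w : SpinWreath Γ n => perm n w = τ).card := by
        rw [← Finset.card_univ]
        exact Finset.card_eq_sum_card_fiberwise (fun _ _ => Finset.mem_univ _)
      rw [Nat.card_eq_fintype_card, hU, Finset.sum_congr rfl fun τ _ => h0 τ, Finset.sum_const, Finset.card_univ, Fintype.card_perm,
        Fintype.card_fin, smul_eq_mul, mul_comm]
    have hconst : ∀ σ : Equiv.Perm (Fin n),
        (Finset.univ.filter fun w : SpinWreath Γ n => perm n w = σ).card =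
        (Finset.univ.filter fun w : SpinWreath Γ n => perm n w = 1).card := fun σ =>
      Nat.eq_of_mul_eq_mul_right n.factorial_pos ((hfib σ).trans (hfib 1).symm)
    rw [e, Finset.sum_congr rfl fun σ _ => hconst σ, Finset.sum_const, card_isFullCycle hn,
      smul_eq_mul, ← hfib 1]
    rw [← Nat.mul_factorial_pred hn.ne']
    ring
  rw [mul_assoc, h2, ← h3]
  push_cast
  ring

end WreathFull


/-! ### Substitutions and derivations of polynomial rings -/

section Taylor
variable {σ : Type*}

/-- A first-order deformation of the identity of a polynomial ring has a derivation as its linear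
part. -/
theorem mkDerivation_eq_coeff_one (ψ : MvPolynomial σ ℂ →ₐ[ℂ] Polynomial (MvPolynomial σ ℂ))
    (h : ∀ c, (ψ (MvPolynomial.X c)).coeff 0 = MvPolynomial.X c) (s : MvPolynomial σ ℂ) :
    MvPolynomial.mkDerivation ℂ (fun c => (ψ (MvPolynomial.X c)).coeff 1) s = (ψ s).coeff 1 := by
  have hC : ∀ a : ℂ, ψ (MvPolynomial.C a) = Polynomial.C (MvPolynomial.C a) := fun a =>
    ψ.commutes a
  suffices h' : (ψ s).coeff 0 = s ∧
      MvPolynomial.mkDerivation ℂ (fun c => (ψ (MvPolynomial.X c)).coeff 1) s = (ψ s).coeff 1 from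
    h'.2
  induction s using MvPolynomial.induction_on with
  | C a => simp [hC, Polynomial.coeff_C]
  | add p q hp hq => simp only [map_add, Polynomial.coeff_add, hp, hq, and_self]
  | mul_X p c hp =>
    rw [map_mul, Polynomial.mul_coeff_zero, Polynomial.mul_coeff_one, hp.1, h, Derivation.leibniz,
      MvPolynomial.mkDerivation_X, hp.2]
    refine ⟨rfl, ?_⟩
    simp only [smul_eq_mul]
    ring

/-- The substitution `X_c ↦ X_c + y^{d c} q_c`. -/
def taylor (d : σ → ℕ) (q : σ → MvPolynomial σ ℂ) :
    MvPolynomial σ ℂ →ₐ[ℂ] Polynomial (MvPolynomial σ ℂ) :=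
  MvPolynomial.aeval fun c =>
    Polynomial.C (MvPolynomial.X c) + Polynomial.X ^ d c * Polynomial.C (q c)

theorem taylor_X (d : σ → ℕ) (q : σ → MvPolynomial σ ℂ) (c : σ) :
    taylor d q (MvPolynomial.X c) =
      Polynomial.C (MvPolynomial.X c) + Polynomial.X ^ d c * Polynomial.C (q c) :=
  MvPolynomial.aeval_X _ _

theorem taylor_one_coeff (q : σ → MvPolynomial σ ℂ) (s : MvPolynomial σ ℂ) :
    (taylor (fun _ => 1) q s).coeff 1 = MvPolynomial.mkDerivation ℂ q s := by
  have h := mkDerivation_eq_coeff_one (taylor (fun _ => 1) q) (fun c => by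
    rw [taylor_X, Polynomial.coeff_add, Polynomial.coeff_C_zero, pow_one, Polynomial.mul_coeff_zero,
      Polynomial.coeff_X_zero, zero_mul, add_zero]) s
  rw [← h]
  congr 2
  funext c
  rw [taylor_X, Polynomial.coeff_add, Polynomial.coeff_C_succ, pow_one, Polynomial.coeff_mul_C,
    Polynomial.coeff_X_one, one_mul, zero_add]

/-- If only variables of degree `k` are shifted, the coefficient of `y ^ k` is a derivation. -/
theorem taylor_coeff_eq_mkDerivation {d : σ → ℕ} {q : σ → MvPolynomial σ ℂ} {k : ℕ} (hk : 0 < k)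
    (hq : ∀ c, d c ≠ k → q c = 0) (s : MvPolynomial σ ℂ) :
    (taylor d q s).coeff k = MvPolynomial.mkDerivation ℂ q s := by
  have h : taylor d q s = Polynomial.expand _ k (taylor (fun _ => 1) q s) := by
    induction s using MvPolynomial.induction_on with
    | C a =>
      have hC : ∀ (d : σ → ℕ), taylor d q (MvPolynomial.C a) = Polynomial.C (MvPolynomial.C a) :=
        fun d => (taylor d q).commutes a
      rw [hC, hC, Polynomial.expand_C]
    | add p r hp hr => rw [map_add, map_add, map_add, hp, hr]
    | mul_X p c hp =>
      rw [map_mul, map_mul, map_mul, hp, taylor_X, taylor_X]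
      by_cases hc : d c = k
      · simp [hc]
      · simp [hq c hc]
  have h1 := Polynomial.coeff_expand_mul hk (taylor (fun _ => 1) q s) 1
  rw [one_mul] at h1
  rw [h, h1, taylor_one_coeff]

/-- The logarithmic derivative of the exponential of a sum of commuting derivations. -/
theorem taylor_coeff_recursion (d : σ → ℕ) (q : σ → ℂ) (n : ℕ) (s : MvPolynomial σ ℂ) :
    (n : MvPolynomial σ ℂ) * (taylor d (fun c => MvPolynomial.C (q c)) s).coeff n =
      ∑ p ∈ Finset.HasAntidiagonal.antidiagonal n, (taylor d (fun c => MvPolynomial.C (q c))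
        (MvPolynomial.mkDerivation ℂ
          (fun c => MvPolynomial.C (if d c = p.2 then p.2 * q c else 0)) s)).coeff p.1 := by
  set T := taylor d (fun c => MvPolynomial.C (q c)) with hT
  have hX : ∀ (s : MvPolynomial σ ℂ) (c : σ) (n : ℕ), (T (s * MvPolynomial.X c)).coeff n =
      (T s).coeff n * MvPolynomial.X c +
        if d c ≤ n then (T s).coeff (n - d c) * MvPolynomial.C (q c) else 0 := by
    intro s c n
    rw [map_mul, hT, taylor_X, mul_add, Polynomial.coeff_add, Polynomial.coeff_mul_C,
      mul_left_comm, Polynomial.coeff_X_pow_mul', Polynomial.coeff_mul_C]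
  -- The difference of the two sides is compatible with multiplication by a variable, as `T` is
  -- multiplicative and the derivation satisfies the Leibniz rule.
  induction s using MvPolynomial.induction_on generalizing n with
  | C a =>
    have hC : T (MvPolynomial.C a) = Polynomial.C (MvPolynomial.C a) := T.commutes a
    rw [Finset.sum_eq_zero fun p _ => by rw [MvPolynomial.derivation_C, map_zero, Polynomial.coeff_zero], hC,
      Polynomial.coeff_C]
    split_ifs with h <;> simp [h]
  | add p q hp hq =>
    simp only [map_add, Polynomial.coeff_add, mul_add, hp, hq, Finset.sum_add_distrib]
  | mul_X s c ih =>
    have h1 : ∀ p : ℕ × ℕ, (T (MvPolynomial.mkDerivation ℂ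
        (fun c => MvPolynomial.C (if d c = p.2 then p.2 * q c else 0))
        (s * MvPolynomial.X c))).coeff p.1 =
        (T (MvPolynomial.mkDerivation ℂ
          (fun c => MvPolynomial.C (if d c = p.2 then p.2 * q c else 0)) s)).coeff p.1 *
            MvPolynomial.X c +
        (if d c ≤ p.1 then (T (MvPolynomial.mkDerivation ℂ
          (fun c => MvPolynomial.C (if d c = p.2 then p.2 * q c else 0)) s)).coeff (p.1 - d c) *
            MvPolynomial.C (q c) else 0) +
        (if d c = p.2 then (d c : MvPolynomial σ ℂ) * MvPolynomial.C (q c) * (T s).coeff p.1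
          else 0) := by
      intro p
      rw [Derivation.leibniz, MvPolynomial.mkDerivation_X, map_add, Polynomial.coeff_add,
        smul_eq_mul, smul_eq_mul, mul_comm (MvPolynomial.X c), hX, add_comm]
      congr 1
      split_ifs with h
      · have hC : ∀ a, T (MvPolynomial.C a) = Polynomial.C (MvPolynomial.C a) := T.commutes
        rw [map_mul, hC, Polynomial.coeff_mul_C, h]
        simp only [map_mul, map_natCast]
        ring
      · simp
    rw [Finset.sum_congr rfl fun p _ => h1 p, Finset.sum_add_distrib, Finset.sum_add_distrib,
      ← Finset.sum_mul, ← ih, hX, mul_add, add_assoc]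
    congr 1
    · ring
    · by_cases hn : d c ≤ n
      · rw [if_pos hn]
        obtain ⟨m, rfl⟩ := Nat.exists_eq_add_of_le hn
        have h2 : ∑ x ∈ Finset.HasAntidiagonal.antidiagonal (d c + m),
            (if d c = x.2 then (d c : MvPolynomial σ ℂ) * MvPolynomial.C (q c) * (T s).coeff x.1
              else 0) = (d c : MvPolynomial σ ℂ) * MvPolynomial.C (q c) * (T s).coeff m := by
          rw [Finset.sum_eq_single (m, d c)]
          · simp
          · rintro ⟨i, k⟩ hik hne
            rw [if_neg]
            rintro rfl
            rw [Finset.HasAntidiagonal.mem_antidiagonal] at hik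
            exact hne (Prod.ext (by simp only at hik ⊢; omega) rfl)
          · intro h
            exact absurd (Finset.HasAntidiagonal.mem_antidiagonal.mpr (by simp only; omega)) h
        have h3 : ∑ x ∈ Finset.HasAntidiagonal.antidiagonal (d c + m),
            (if d c ≤ x.1 then (T (MvPolynomial.mkDerivation ℂ
              (fun c => MvPolynomial.C (if d c = x.2 then x.2 * q c else 0)) s)).coeff (x.1 - d c) *
                MvPolynomial.C (q c) else 0) =
            ∑ x ∈ Finset.HasAntidiagonal.antidiagonal m, (T (MvPolynomial.mkDerivation ℂ
              (fun c => MvPolynomial.C (if d c = x.2 then x.2 * q c else 0)) s)).coeff x.1 *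
                MvPolynomial.C (q c) := by
          rw [← Finset.sum_filter]
          refine Finset.sum_bij' (fun x _ => (x.1 - d c, x.2)) (fun x _ => (d c + x.1, x.2))
            ?_ ?_ ?_ ?_ ?_
          · rintro ⟨i, k⟩ h
            simp only [Finset.mem_filter, Finset.HasAntidiagonal.mem_antidiagonal] at h ⊢
            omega
          · rintro ⟨i, k⟩ h
            simp only [Finset.mem_filter, Finset.HasAntidiagonal.mem_antidiagonal] at h ⊢
            omega
          · rintro ⟨i, k⟩ h
            simp only [Finset.mem_filter, Finset.HasAntidiagonal.mem_antidiagonal] at h ⊢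
            exact Prod.ext (by simp only; omega) rfl
          · rintro ⟨i, k⟩ h
            simp
          · rintro ⟨i, k⟩ h
            rfl
        rw [h2, h3, ← Finset.sum_mul, ← ih, Nat.add_sub_cancel_left]
        push_cast
        ring
      · rw [if_neg hn, mul_zero, Finset.sum_eq_zero, Finset.sum_eq_zero, add_zero]
        · rintro ⟨i, k⟩ h
          rw [Finset.HasAntidiagonal.mem_antidiagonal] at h
          rw [if_neg]
          simp only at h ⊢
          omega
        · rintro ⟨i, k⟩ h
          rw [Finset.HasAntidiagonal.mem_antidiagonal] at h
          rw [if_neg]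
          simp only at h ⊢
          omega

end Taylor


/-! ### Injectivity of the Frobenius characteristic -/

section Injectivity
variable {Γ : Type*} [Group Γ] {n m : ℕ}

open SpinWreath

theorem juxt_conj_left (x a : SpinWreath Γ n) (b : SpinWreath Γ m) (hb : sgn m b = 1) :
    juxt x 1 * juxt a b * (juxt x 1)⁻¹ = juxt (x * a * x⁻¹) b := by
  rw [mul_inv_eq_iff_eq_mul, juxt_mul, juxt_mul]
  · simp
  · exact SpinSym.embR_comm_embL_of_even_right _ _ hb
  · simp

theorem restrict_mem {F : SpinWreath Γ (n + m) → ℂ} (hF : F ∈ SuperSpin Γ (n + m))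
    {a : SpinWreath Γ n} (ha : sgn n a = 1) : (fun b => F (juxt a b)) ∈ SuperSpin Γ m := by
  refine ⟨fun x y => ?_, fun x => ?_, fun x hx => ?_⟩ <;> beta_reduce
  · rw [← conj_juxt x a y ha, hF.1]
  · rw [z_mul_juxt_right, hF.2.1]
  · exact hF.2.2 _ (by rw [sgn_juxt, ha, hx, one_mul])

theorem spinWreath_zero_cases (w : SpinWreath Γ 0) : w = 1 ∨ w = z 0 * 1 := by
  rcases SpinSym.eq_or_eq_z_mul (x := w.right) (y := 1) (Subsingleton.elim _ _) with h | h
  · exact Or.inl (SemidirectProduct.ext (Subsingleton.elim _ _) h)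
  · refine Or.inr (SemidirectProduct.ext (Subsingleton.elim _ _) ?_)
    rw [h]; simp [z]

variable [Finite Γ] {R : Type*} [CommRing R] [Algebra ℂ R]

theorem frob_restrict_conj (p : CycType Γ → R) {F : SpinWreath Γ (n + m) → ℂ}
    (hF : F ∈ SuperSpin Γ (n + m)) (x a : SpinWreath Γ n) :
    frob p (fun b => F (juxt (x * a * x⁻¹) b)) = frob p (fun b => F (juxt a b)) := by
  unfold frob
  congr 1
  refine Finset.sum_congr rfl fun b _ => ?_
  rcases Int.units_eq_one_or (sgn m b) with hb | hb
  · beta_reduce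
    rw [← juxt_conj_left x a b hb, hF.1]
  · rw [wreathX_odd b hb, mul_zero, mul_zero]

theorem frob_restrict_z (p : CycType Γ → R) {F : SpinWreath Γ (n + m) → ℂ}
    (hF : F ∈ SuperSpin Γ (n + m)) (a : SpinWreath Γ n) :
    frob p (fun b => F (juxt (z n * a) b)) = - frob p (fun b => F (juxt a b)) := by
  have : (fun b => F (juxt (z n * a) b)) = (-1 : ℂ) • fun b => F (juxt a b) := by
    funext b
    rw [z_mul_juxt_left, hF.2.1, Pi.smul_apply, smul_eq_mul, neg_one_mul]
  rw [this, frob_smul, neg_one_smul]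

theorem taylor_frob (q : CycType Γ → MvPolynomial (CycType Γ) ℂ) (F : SpinWreath Γ n → ℂ) :
    taylor Prod.fst q (frob MvPolynomial.X F) = frob (fun c =>
      Polynomial.C (MvPolynomial.X c) + Polynomial.X ^ c.1 * Polynomial.C (q c)) F := by
  rw [map_frob]
  simp only [taylor_X]

/-- A spin class function whose Frobenius characteristic vanishes takes the value `0` at all products
`juxt a b` with `a` over a full cycle, if this is known for spin class functions of lower degree. -/
theorem apply_juxt_full_eq_zero {F : SpinWreath Γ (n + m) → ℂ} (hF : F ∈ SuperSpin Γ (n + m))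
    (h0 : frob (MvPolynomial.X (R := ℂ)) F = 0) (hn : 0 < n)
    (ih : ∀ G ∈ SuperSpin Γ m, frob (MvPolynomial.X (R := ℂ)) G = 0 → G = 0)
    (a : SpinWreath Γ n) (ha : IsFullCycle (perm n a)) (b : SpinWreath Γ m) :
    F (juxt a b) = 0 := by
  classical
  rcases Int.units_eq_one_or (sgn n a) with hs | hs
  swap
  · rcases Int.units_eq_one_or (sgn m b) with hb | hb
    · exact hF.2.2 _ (by rw [sgn_juxt, hs, hb, mul_one])
    · exact apply_juxt_of_odd hF a b hs hb
  have hodd : Odd n := by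
    have h := sgn_of_full a ha
    rw [hs] at h
    by_contra h'
    have h2 : Odd (n - 1) := Nat.Even.sub_odd hn (Nat.not_odd_iff_even.mp h') odd_one
    rw [h2.neg_one_pow] at h
    exact absurd h (by decide)
  set G : SpinWreath Γ n → MvPolynomial (CycType Γ) ℂ :=
    fun a => frob MvPolynomial.X fun b => F (juxt a b) with hG
  let i : Fin n := ⟨0, hn⟩
  -- the derivative with respect to the variable of the cycle `a`
  let q : CycType Γ → MvPolynomial (CycType Γ) ℂ := fun c => if c = cycType a i then 1 else 0
  have hper := (isFullCycle_iff i).mp ha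
  have h1 : (taylor Prod.fst q (frob MvPolynomial.X F)).coeff n = 0 := by
    rw [h0, map_zero, Polynomial.coeff_zero]
  rw [taylor_frob, coeff_frob_add _ _ hF] at h1
  have h2 : ∀ a' : SpinWreath Γ n, wreathX a' • (cycTypeProd q a' * G a') =
      if IsFullCycle (perm n a') ∧ cycType a' i = cycType a i then wreathX a • G a else 0 := by
    intro a'
    have hq : ∀ c : CycType Γ, c.1 ≠ n → q c = 0 := by
      intro c hc
      refine if_neg fun h => hc ?_
      rw [h]
      exact hper
    by_cases hf : IsFullCycle (perm n a')
    · rw [cycTypeProd_of_full _ _ hf i]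
      by_cases ht : cycType a' i = cycType a i
      · rw [if_pos ⟨hf, ht⟩]
        have hq1 : q (cycType a' i) = 1 := if_pos ht
        rw [hq1, one_mul]
        obtain ⟨x, rfl | rfl⟩ := exists_conj_of_full ha hf i ht.symm
        · rw [wreathX_conj, hG]
          simp only [frob_restrict_conj _ hF]
        · rw [wreathX_z, wreathX_conj, hG]
          simp only [frob_restrict_z _ hF, frob_restrict_conj _ hF, smul_neg, neg_smul, neg_neg]
      · rw [if_neg (fun h => ht h.2)]
        have hq0 : q (cycType a' i) = 0 := if_neg ht
        rw [hq0, zero_mul, smul_zero]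
    · rw [if_neg (fun h => hf h.1), cycTypeProd_of_not_full q a' hq hn hf, zero_mul, smul_zero]
  rw [Finset.sum_congr rfl fun a' _ => h2 a', ← Finset.sum_filter, Finset.sum_const,
    ← Nat.cast_smul_eq_nsmul ℂ, smul_smul, smul_smul] at h1
  have h3 : G a = 0 := by
    refine (smul_eq_zero.mp h1).resolve_left (mul_ne_zero (mul_ne_zero ?_ ?_) ?_)
    · exact inv_ne_zero (card_ne_zero n)
    · refine Nat.cast_ne_zero.mpr (Finset.card_ne_zero_of_mem (a := a) ?_)
      exact Finset.mem_filter.mpr ⟨Finset.mem_univ _, ha, rfl⟩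
    · intro h
      have := wreathX_sq_of_full hodd a ha
      rw [h, zero_mul] at this
      exact two_ne_zero this.symm
  exact congrFun (ih _ (restrict_mem hF hs) h3) b

/-- The Frobenius characteristic is injective on spin class functions. -/
theorem frob_injective (n : ℕ) : ∀ F ∈ SuperSpin Γ n,
    frob (MvPolynomial.X (R := ℂ)) F = 0 → F = 0 := by
  classical
  induction n using Nat.strong_induction_on with
  | _ n ih =>
  intro F hF h0
  rcases Nat.eq_zero_or_pos n with rfl | hn
  · have h1 := spinWreath_zero_cases (Γ := Γ)
    have h2 : ∀ w : SpinWreath Γ 0, (F w * wreathX w) •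
        cycTypeProd (MvPolynomial.X (R := ℂ)) w = (F 1) • 1 := by
      intro w
      have hX : (wreathX (1 : SpinWreath Γ 0)) = 1 := (spinX_one 0).trans (pow_zero _)
      have hP : cycTypeProd (MvPolynomial.X (R := ℂ)) w = 1 := by
        have : IsEmpty (Quotient (Equiv.Perm.SameCycle.setoid (perm 0 w))) :=
          ⟨fun c => c.out.elim0⟩
        rw [cycTypeProd, cycProd, finprod_of_isEmpty]
      rw [hP]
      rcases h1 w with rfl | rfl
      · rw [hX, mul_one]
      · rw [hF.2.1, wreathX_z, hX]; simp
    rw [frob, Finset.sum_congr rfl fun w _ => h2 w, Finset.sum_const, Finset.card_univ,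
      ← Nat.card_eq_fintype_card, ← Nat.cast_smul_eq_nsmul ℂ, smul_smul,
      inv_mul_cancel₀ (card_ne_zero 0), one_smul] at h0
    have h3 : F 1 = 0 := (smul_eq_zero.mp h0).resolve_right one_ne_zero
    funext w
    rcases h1 w with rfl | rfl
    · exact h3
    · rw [hF.2.1, h3, neg_zero]; rfl
  · funext w
    -- the letters in the cycle of `0` are moved to the front
    set A : Finset (Fin n) := Finset.univ.filter ((perm n w).SameCycle ⟨0, hn⟩) with hA
    have hA0 : (⟨0, hn⟩ : Fin n) ∈ A := Finset.mem_filter.mpr ⟨Finset.mem_univ _, .refl _ _⟩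
    obtain ⟨k, hk⟩ : ∃ k, A.card = k := ⟨_, rfl⟩
    have hkn : k ≤ n := by
      rw [← hk]; simpa using Finset.card_le_univ A
    have hk0 : 0 < k := hk ▸ Finset.card_pos.mpr ⟨_, hA0⟩
    generalize h0n : (⟨0, hn⟩ : Fin n) = o at hA hA0
    clear h0n
    obtain ⟨m, rfl⟩ := Nat.exists_eq_add_of_le hkn
    set A₀ : Finset (Fin (k + m)) := Finset.univ.map (Fin.castAddEmb m) with hA₀
    have hc : Fintype.card {i // i ∈ A} = Fintype.card {i // i ∈ A₀} := by
      rw [Fintype.card_coe, Fintype.card_coe, hk, hA₀, Finset.card_map, Finset.card_univ,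
        Fintype.card_fin]
    let e := Fintype.equivOfCardEq hc
    obtain ⟨x, hx⟩ := perm_surjective (Γ := Γ) (k + m) e.extendSubtype
    have hxA : ∀ i, perm _ x i ∈ A₀ ↔ i ∈ A := by
      intro i
      rw [hx]
      by_cases h : i ∈ A
      · exact iff_of_true (e.extendSubtype_mem i h) h
      · exact iff_of_false (e.extendSubtype_not_mem i h) h
    have hmem : ∀ i, i ∈ A₀ ↔ (perm _ (x * w * x⁻¹)).SameCycle (perm _ x o) i := by
      intro i
      obtain ⟨j, rfl⟩ := (perm _ x).surjective i
      rw [hxA, map_mul, map_mul, map_inv, Equiv.Perm.sameCycle_conj, hA, Finset.mem_filter]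
      simp
    obtain ⟨a, b, hab⟩ := exists_juxt (x * w * x⁻¹) (fun i => by
      have h1 : Fin.castAdd m i ∈ A₀ := Finset.mem_map.mpr ⟨i, Finset.mem_univ _, rfl⟩
      have h2 : perm _ (x * w * x⁻¹) (Fin.castAdd m i) ∈ A₀ := by
        rw [hmem] at h1 ⊢
        exact Equiv.Perm.sameCycle_apply_right.mpr h1
      obtain ⟨j, _, hj⟩ := Finset.mem_map.mp h2
      exact ⟨j, hj.symm⟩)
    have hfull : IsFullCycle (perm k a) := by
      intro i j
      have h1 : ∀ i : Fin k, (perm _ (x * w * x⁻¹)).SameCycle (perm _ x o) (Fin.castAdd m i) :=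
        fun i => (hmem _).mp (Finset.mem_map.mpr ⟨i, Finset.mem_univ _, rfl⟩)
      have h2 := (h1 i).symm.trans (h1 j)
      rw [← hab, perm_juxt] at h2
      exact sameCycle_blockPerm_castAdd.mp h2
    have h := apply_juxt_full_eq_zero hF h0 hk0 (ih m (by omega)) a hfull b
    rw [hab, hF.1] at h
    exact h

end Injectivity


/-! ### Characteristics of the basic elements -/

section BasicElements
variable {Γ : Type*} [Group Γ] {n m : ℕ}

open SpinWreath

/-- The weight of a cycle in `χ_n(f)`: the value of `f` at its cycle product. -/
def chiWeight (f : ClassFn Γ) (c : CycType Γ) : ℂ := onClass f c.2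

/-- The weight of a cycle in `σ_k(f)`; only cycles of length `k` count. -/
def sigmaWeight (k : ℕ) (f : ClassFn Γ) (c : CycType Γ) : ℂ :=
  if c.1 = k then (k : ℂ) / 2 * onClass f c.2 else 0

/-- The shift of the power sum variables by which the contraction with an element acts, if that
element has the weights `u`. -/
def contractWeight (ξ : ClassFn Γ) (u : CycType Γ → ℂ) (c : CycType Γ) : ℂ :=
  onClass ξ (cycInv c).2 * u (cycInv c)

/-- A spin class function is of product form if it is the product of the normalized basic spin
character and of weights of the cycles. -/
def HasWeight (u : SuperSpin Γ n) (p : CycType Γ → ℂ) : Prop :=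
  ∀ w, u.1 w = wreathX w * cycTypeProd p w

theorem hasWeight_chi (n : ℕ) (f : ClassFn Γ) :
    HasWeight (parityFactor n • chi n f) (chiWeight f) := by
  intro w
  change parityFactor n * (eta f w * basicSpinChar n w.right) = _
  rw [eta_eq_cycTypeProd, wreathX, spinX]
  change parityFactor n * (cycTypeProd (chiWeight f) w * basicSpinChar n w.right) = _
  ring

theorem hasWeight_sigma (n : ℕ) (hn : Odd n) (f : ClassFn Γ) :
    HasWeight (sigma n hn f) (sigmaWeight n f) := by
  classical
  intro w
  change ((n : ℂ) / (Real.sqrt 2 : ℝ)) * eta f w * cycleSign n w = _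
  have h1 := cycleSign_eq hn w
  have h2 := sqrt_two_mul
  have h3 := sqrt_two_ne
  have h4 : ((n : ℂ) / (Real.sqrt 2 : ℝ)) * eta f w * cycleSign n w =
      n / 2 * eta f w * (cycleSign n w * (Real.sqrt 2 : ℝ)) := by
    rw [← h2]
    field_simp
  rw [h4, h1]
  by_cases h : IsFullCycle (perm n w)
  · have hp : (cycType w ⟨0, hn.pos⟩).1 = n := (isFullCycle_iff _).mp h
    rw [if_pos h, eta_eq_cycTypeProd, cycTypeProd_of_full _ w h ⟨0, hn.pos⟩,
      cycTypeProd_of_full _ w h ⟨0, hn.pos⟩, sigmaWeight, if_pos hp]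
    ring
  · rw [if_neg h, cycTypeProd_of_not_full (sigmaWeight n f) w (fun c hc => if_neg hc) hn.pos h, mul_zero, mul_zero]

variable [Finite Γ] {R : Type*} [CommRing R] [Algebra ℂ R]

theorem frob_of_hasWeight {u : SuperSpin Γ n} {u' : CycType Γ → ℂ} (hu : HasWeight u u')
    (p : CycType Γ → R) :
    frob p u.1 = frob (fun c => algebraMap ℂ R (u' c) * p c) (wreathX : SpinWreath Γ n → ℂ) := by
  unfold frob
  congr 1
  refine Finset.sum_congr rfl fun w _ => ?_
  rw [cycTypeProd_mul, ← map_cycTypeProd, hu, ← Algebra.smul_def, smul_smul]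
  congr 1
  ring

omit [Finite Γ] in
theorem cycTypeProd_algebraMap_mul (u : CycType Γ → ℂ) (w : SpinWreath Γ n) (r : R) :
    cycTypeProd (fun c => algebraMap ℂ R (u c)) w * r = cycTypeProd u w • r := by
  rw [← map_cycTypeProd, Algebra.smul_def]

/-- The Frobenius characteristic of a contraction with an element of product form. -/
theorem frob_pairLeft (ξ : ClassFn Γ) {u : SuperSpin Γ n} {u' : CycType Γ → ℂ}
    (hu : HasWeight u u') (p : CycType Γ → R) (F : SuperSpin Γ (n + m)) :
    frob p (pairLeft ξ m u F).1 = (frob (fun c => Polynomial.C (p c) +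
      Polynomial.X ^ c.1 * Polynomial.C (algebraMap ℂ R (contractWeight ξ u' c))) F.1).coeff n := by
  rw [coeff_frob_add _ _ F.2]
  have h1 : frob p (pairLeft ξ m u F).1 = (Nat.card (SpinWreath Γ n) : ℂ)⁻¹ •
      ∑ a : SpinWreath Γ n, (eta ξ a * u.1 a) • frob p (fun b => F.1 (juxt a⁻¹ b)) := by
    have h2 : (pairLeft ξ m u F).1 = (Nat.card (SpinWreath Γ n) : ℂ)⁻¹ •
        ∑ a : SpinWreath Γ n, (eta ξ a * u.1 a) • fun b => F.1 (juxt a⁻¹ b) := by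
      funext b
      change (Nat.card (SpinWreath Γ n) : ℂ)⁻¹ *
        ∑ᶠ a : SpinWreath Γ n, eta ξ a * u.1 a * F.1 (juxt a⁻¹ b) = _
      rw [finsum_eq_sum_of_fintype]
      simp
    rw [h2, frob_smul]
    congr 1
    have hsum : ∀ (s : Finset (SpinWreath Γ n)) (G : SpinWreath Γ n → SpinWreath Γ m → ℂ),
        frob p (∑ a ∈ s, G a) = ∑ a ∈ s, frob p (G a) := by
      classical
      intro s G
      induction s using Finset.induction_on with
      | empty => simp [frob]
      | insert a s ha ih => rw [Finset.sum_insert ha, Finset.sum_insert ha, frob_add, ih]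
    rw [hsum]
    exact Finset.sum_congr rfl fun a _ => frob_smul _ _ _
  rw [h1]
  congr 1
  -- The contraction evaluates at `a⁻¹`, the coefficient of the Frobenius characteristic at `a`.
  refine Fintype.sum_equiv (Equiv.inv _) _ _ fun a => ?_
  rw [Equiv.inv_apply, cycTypeProd_algebraMap_mul, smul_smul]
  congr 1
  have hp : cycTypeProd (contractWeight ξ u') a⁻¹ = eta ξ a * cycTypeProd u' a := by
    have hinv := cycTypeProd_inv (fun c => onClass ξ c.2 * u' c) a⁻¹
    rw [inv_inv] at hinv
    rw [eta_eq_cycTypeProd, ← cycTypeProd_mul, hinv]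
    rfl
  rw [hp, hu]
  rcases Int.units_eq_one_or (sgn n a) with h | h
  · rw [wreathX_inv a h]; ring
  · rw [wreathX_odd a h, wreathX_odd a⁻¹ (by rw [map_inv, h]; rfl)]; ring

/-! ### The recursion for the basic spin characters -/

omit [Finite Γ] in
theorem cycTypeProd_congr {R : Type*} [CommMonoid R] {p q : CycType Γ → R} (w : SpinWreath Γ n)
    (h : ∀ c : CycType Γ, 1 ≤ c.1 → c.1 ≤ n → p c = q c) : cycTypeProd p w = cycTypeProd q w := by
  classical
  refine cycProd_congr fun i => h _ ?_ ?_
  · change 0 < Function.minimalPeriod (perm n w) i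
    rw [← card_sameCycle]
    exact Finset.card_pos.mpr ⟨i, Finset.mem_filter.mpr ⟨Finset.mem_univ _, .refl _ _⟩⟩
  · change Function.minimalPeriod (perm n w) i ≤ n
    rw [← card_sameCycle]
    simpa using Finset.card_le_univ (Finset.univ.filter ((perm n w).SameCycle i))

theorem frob_congr {p q : CycType Γ → R} (F : SpinWreath Γ n → ℂ)
    (h : ∀ c : CycType Γ, 1 ≤ c.1 → c.1 ≤ n → p c = q c) : frob p F = frob q F := by
  unfold frob
  congr 1
  refine Finset.sum_congr rfl fun w _ => ?_
  rw [cycTypeProd_congr w h]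

omit [Finite Γ] in
/-- The lengths of the cycles add up to `n`. -/
theorem cycTypeProd_pow {R : Type*} [CommSemiring R] (y : R) (w : SpinWreath Γ n) :
    cycTypeProd (fun c => y ^ c.1) w = y ^ n := by
  classical
  have h := cycProd_add (perm n w) y (fun _ => (0 : R)) (fun _ => 1)
  simp only [zero_add, mul_one] at h
  change cycProd (perm n w) (fun i => y ^ Function.minimalPeriod (perm n w) i) = _
  rw [h, Finset.sum_eq_single Finset.univ]
  · have h1 : cycProd (perm n w) (fun _ => (1 : R)) = 1 := by simp [cycProd]
    simp [h1]
  · intro A _ hA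
    split_ifs with hinv
    · obtain ⟨i, hi⟩ : ∃ i, i ∉ A := by
        by_contra h
        push Not at h
        exact hA (Finset.eq_univ_of_forall h)
      refine mul_eq_zero_of_right _ (finprod_eq_zero _ (Quotient.mk _ i) ?_ (Set.toFinite _))
      have hc : CycConst (perm n w) (fun i => i ∈ A) := fun i => propext (hinv i)
      exact if_neg fun h => hi ((hc.out i).mp h)
    · rfl
  · intro h
    exact absurd (Finset.mem_univ _) h

/-- Frobenius characteristics are homogeneous: the Euler derivation multiplies them by their
degree. -/
theorem euler_frob (F : SpinWreath Γ n → ℂ) :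
    MvPolynomial.mkDerivation ℂ
      (fun c : CycType Γ => (c.1 : MvPolynomial (CycType Γ) ℂ) * MvPolynomial.X c)
      (frob MvPolynomial.X F) =
      (n : MvPolynomial (CycType Γ) ℂ) * frob MvPolynomial.X F := by
  -- The Euler derivation is the linear part of the rescaling of `p_c` by `(1 + y) ^ |c|`, which
  -- multiplies characteristics in degree `n` by `(1 + y) ^ n`.
  let ψ : MvPolynomial (CycType Γ) ℂ →ₐ[ℂ] Polynomial (MvPolynomial (CycType Γ) ℂ) :=
    MvPolynomial.aeval fun c => (1 + Polynomial.X) ^ c.1 * Polynomial.C (MvPolynomial.X c)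
  have hψ : ∀ c, ψ (MvPolynomial.X c) = (1 + Polynomial.X) ^ c.1 * Polynomial.C (MvPolynomial.X c) :=
    fun c => MvPolynomial.aeval_X _ _
  have h := mkDerivation_eq_coeff_one ψ (fun c => by
    rw [hψ, Polynomial.coeff_mul_C, Polynomial.coeff_one_add_X_pow]; simp) (frob MvPolynomial.X F)
  have h1 : (fun c => (ψ (MvPolynomial.X c)).coeff 1) =
      (fun c : CycType Γ => (c.1 : MvPolynomial (CycType Γ) ℂ) * MvPolynomial.X c) := by
    funext c
    rw [hψ, Polynomial.coeff_mul_C, Polynomial.coeff_one_add_X_pow]; simp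
  rw [h1] at h
  rw [h, map_frob]
  have h2 : frob (fun c => ψ (MvPolynomial.X c)) F =
      (1 + Polynomial.X) ^ n * Polynomial.C (frob MvPolynomial.X F) := by
    simp only [frob, ← Polynomial.smul_C, mul_smul_comm, map_sum, Finset.mul_sum]
    congr 1
    refine Finset.sum_congr rfl fun w _ => ?_
    congr 1
    simp only [hψ]
    rw [cycTypeProd_mul, cycTypeProd_pow, ← map_cycTypeProd]
  rw [h2, Polynomial.coeff_mul_C, Polynomial.coeff_one_add_X_pow]
  simp

/-- Derivations that only move power sum variables of even degree kill Frobenius characteristics: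
a full cycle of even length is odd. -/
theorem mkDerivation_frob_of_even {k : ℕ} (hk : Even k) (hk0 : 0 < k)
    (q : CycType Γ → MvPolynomial (CycType Γ) ℂ)
    (hq : ∀ c, c.1 ≠ k → q c = 0) {F : SpinWreath Γ n → ℂ} (hF : F ∈ SuperSpin Γ n) :
    MvPolynomial.mkDerivation ℂ q (frob MvPolynomial.X F) = 0 := by
  rw [← taylor_coeff_eq_mkDerivation (d := Prod.fst) hk0 hq, taylor_frob]
  rcases Nat.lt_or_ge n k with h | h
  · exact coeff_frob_add_of_lt _ _ h
  · obtain ⟨m, rfl⟩ := Nat.exists_eq_add_of_le h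
    rw [coeff_frob_add _ _ hF, Finset.sum_eq_zero, smul_zero]
    intro a _
    by_cases ha : IsFullCycle (perm k a)
    · rw [wreathX_odd, zero_smul]
      rw [sgn_of_full a ha, (Nat.Even.sub_odd hk0 hk odd_one).neg_one_pow]
    · rw [cycTypeProd_of_not_full q a hq hk0 ha, zero_mul, smul_zero]

theorem mkDerivation_frob_of_lt {k : ℕ} (q : CycType Γ → MvPolynomial (CycType Γ) ℂ)
    (hq : ∀ c, c.1 ≠ k → q c = 0) {F : SpinWreath Γ n → ℂ} (hk : n < k) :
    MvPolynomial.mkDerivation ℂ q (frob MvPolynomial.X F) = 0 := by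
  rw [← taylor_coeff_eq_mkDerivation (d := Prod.fst) (by omega) hq, taylor_frob]
  exact coeff_frob_add_of_lt _ _ hk

theorem mkDerivation_frob_wreathX {k : ℕ} (hk : 0 < k)
    (q : CycType Γ → MvPolynomial (CycType Γ) ℂ) (hq : ∀ c, c.1 ≠ k → q c = 0) :
    MvPolynomial.mkDerivation ℂ q (frob MvPolynomial.X (wreathX : SpinWreath Γ (k + m) → ℂ)) =
      frob q (wreathX : SpinWreath Γ k → ℂ) *
        frob MvPolynomial.X (wreathX : SpinWreath Γ m → ℂ) := by
  rw [← taylor_coeff_eq_mkDerivation (d := Prod.fst) hk hq, taylor_frob,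
    coeff_frob_add _ _ wreathX_mem]
  conv_rhs => rw [frob, smul_mul_assoc, Finset.sum_mul]
  congr 1
  refine Finset.sum_congr rfl fun a _ => ?_
  rcases Int.units_eq_one_or (sgn k a) with ha | ha
  · have h : (fun b : SpinWreath Γ m => wreathX (juxt a b)) = wreathX a • wreathX := by
      funext b
      rcases Int.units_eq_one_or (sgn m b) with hb | hb
      · exact wreathX_juxt a b ha hb
      · rw [wreathX_odd _ (by rw [sgn_juxt, ha, hb, one_mul]), Pi.smul_apply, wreathX_odd b hb,
          smul_zero]
    rw [h, frob_smul, mul_smul_comm, smul_smul, smul_mul_assoc]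
  · rw [wreathX_odd a ha]; simp

/-- The recursion for the Frobenius characteristics of basic spin characters, in terms of those of
the class functions supported at full cycles. -/
theorem frob_wreathX_recursion (n : ℕ) (f : CycType Γ → ℂ) :
    (n : MvPolynomial (CycType Γ) ℂ) *
      frob (fun c => MvPolynomial.C (f c) * MvPolynomial.X c) (wreathX : SpinWreath Γ n → ℂ) =
    ∑ p ∈ Finset.HasAntidiagonal.antidiagonal n, if Odd p.2 then
      frob (fun c => MvPolynomial.C (if c.1 = p.2 then p.2 * f c else 0) * MvPolynomial.X c)
        (wreathX : SpinWreath Γ p.2 → ℂ) *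
      frob (fun c => MvPolynomial.C (f c) * MvPolynomial.X c) (wreathX : SpinWreath Γ p.1 → ℂ)
      else 0 := by
  let q : ℕ → CycType Γ → MvPolynomial (CycType Γ) ℂ :=
    fun k c => if c.1 = k then (k : MvPolynomial (CycType Γ) ℂ) * MvPolynomial.X c else 0
  have hq : ∀ k c, c.1 ≠ k → q k c = 0 := fun k c h => if_neg h
  have key : (n : MvPolynomial (CycType Γ) ℂ) * frob MvPolynomial.X (wreathX : SpinWreath Γ n → ℂ) =
      ∑ p ∈ Finset.HasAntidiagonal.antidiagonal n, if Odd p.2 then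
        frob (q p.2) (wreathX : SpinWreath Γ p.2 → ℂ) *
        frob MvPolynomial.X (wreathX : SpinWreath Γ p.1 → ℂ) else 0 := by
    let F₀ : SpinWreath Γ n → ℂ := wreathX
    -- the Euler derivation, up to variables of degree larger than `n`
    have h1 : MvPolynomial.mkDerivation ℂ
        (fun c : CycType Γ => (c.1 : MvPolynomial (CycType Γ) ℂ) * MvPolynomial.X c)
        (frob MvPolynomial.X (wreathX : SpinWreath Γ n → ℂ)) =
        MvPolynomial.mkDerivation ℂ (∑ k ∈ Finset.range (n + 1), q k)
          (frob MvPolynomial.X (wreathX : SpinWreath Γ n → ℂ)) := by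
      refine (taylor_one_coeff _ _).symm.trans (Eq.trans (congrArg (fun t => Polynomial.coeff t 1) ?_)
        (taylor_one_coeff _ _))
      refine (map_frob _ _ _).trans (Eq.trans (frob_congr F₀ fun c _ hc => ?_)
        (map_frob _ _ _).symm)
      rw [taylor_X, taylor_X, Finset.sum_apply,
        Finset.sum_eq_single c.1]
      · simp [q]
      · intro k _ hk
        exact if_neg (Ne.symm hk)
      · intro h
        exact absurd (Finset.mem_range.mpr (by omega)) h
    have hsum : ∀ x, (∑ k ∈ Finset.range (n + 1), MvPolynomial.mkDerivation ℂ (q k)) x =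
        ∑ k ∈ Finset.range (n + 1), MvPolynomial.mkDerivation ℂ (q k) x := fun x =>
      (congrFun (map_sum (Derivation.coeFnAddMonoidHom (R := ℂ) (A := MvPolynomial (CycType Γ) ℂ)
        (M := MvPolynomial (CycType Γ) ℂ)) _ _) x).trans (Finset.sum_apply _ _ _)
    have h2 : MvPolynomial.mkDerivation ℂ (∑ k ∈ Finset.range (n + 1), q k) =
        ∑ k ∈ Finset.range (n + 1), MvPolynomial.mkDerivation ℂ (q k) := by
      refine MvPolynomial.derivation_ext fun c => ?_
      rw [MvPolynomial.mkDerivation_X, hsum, Finset.sum_apply]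
      exact Finset.sum_congr rfl fun k _ => (MvPolynomial.mkDerivation_X _ _ _).symm
    rw [← euler_frob, h1, h2, hsum,
      Finset.Nat.sum_antidiagonal_eq_sum_range_succ_mk, ← Finset.sum_range_reflect]
    refine Finset.sum_congr rfl fun i hi => ?_
    have hi' : i ≤ n := by have := Finset.mem_range.mp hi; omega
    have e : n + 1 - 1 - i = n - i := by omega
    rw [e]
    obtain ⟨k, rfl⟩ := Nat.exists_eq_add_of_le' hi'
    rw [Nat.add_sub_cancel]
    split_ifs with hk
    · exact mkDerivation_frob_wreathX hk.pos _ (hq k)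
    · rcases Nat.eq_zero_or_pos k with rfl | hk0
      · have : q 0 = 0 := by
          funext c
          simp [q]
        rw [this]
        have h0 : MvPolynomial.mkDerivation ℂ (0 : CycType Γ → MvPolynomial (CycType Γ) ℂ) = 0 :=
          MvPolynomial.derivation_ext fun c => by
            rw [MvPolynomial.mkDerivation_X]; rfl
        rw [h0]; rfl
      · exact mkDerivation_frob_of_even (Nat.not_odd_iff_even.mp hk) hk0 _ (hq k) wreathX_mem
  -- scaling the variables by the weights
  let φ : MvPolynomial (CycType Γ) ℂ →ₐ[ℂ] MvPolynomial (CycType Γ) ℂ :=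
    MvPolynomial.aeval fun c => MvPolynomial.C (f c) * MvPolynomial.X c
  have hφ : ∀ c, φ (MvPolynomial.X c) = MvPolynomial.C (f c) * MvPolynomial.X c :=
    fun c => MvPolynomial.aeval_X _ _
  have h := congrArg φ key
  rw [map_mul, map_natCast, map_frob, map_sum] at h
  simp only [hφ] at h
  rw [h]
  refine Finset.sum_congr rfl fun p _ => ?_
  split_ifs
  · rw [map_mul, map_frob, map_frob]
    simp only [hφ]
    congr 2
    funext c
    simp only [q]
    split_ifs
    · rw [map_mul, map_natCast, hφ, map_mul, map_natCast]; ring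
    · simp
  · exact map_zero φ

end BasicElements


/-! ### The operators on `R^-_Γ` under the Frobenius characteristic -/

section RMinusOperators
variable {Γ : Type*} [Group Γ] [Finite Γ] {n : ℕ}

open SpinWreath

/-- The Frobenius characteristic of the component of degree `N`. -/
def charComp (N : ℕ) : RMinus Γ →ₗ[ℂ] MvPolynomial (CycType Γ) ℂ where
  toFun x := frob MvPolynomial.X (x N).1
  map_add' x y := by rw [DirectSum.add_apply, Submodule.coe_add, frob_add]
  map_smul' c x := by
    rw [DirectSum.smul_apply, Submodule.coe_smul, frob_smul, RingHom.id_apply]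

theorem charComp_ext {x y : RMinus Γ} (h : ∀ N, charComp N x = charComp N y) : x = y := by
  refine DFinsupp.ext fun N => ?_
  have h1 : charComp N (x - y) = 0 := by rw [map_sub, h, sub_self]
  have h2 := frob_injective N _ ((x - y) N).2 h1
  have h3 : (x - y) N = 0 := Subtype.ext h2
  rw [DirectSum.sub_apply] at h3
  exact sub_eq_zero.mp h3

theorem charComp_lof (N m : ℕ) (F : SuperSpin Γ m) :
    charComp N (DirectSum.lof ℂ ℕ (fun k => SuperSpin Γ k) m F) =
      if m = N then frob MvPolynomial.X F.1 else 0 := by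
  change frob MvPolynomial.X (DirectSum.lof ℂ ℕ (fun k => SuperSpin Γ k) m F N).1 = _
  by_cases h : m = N
  · subst h
    rw [if_pos rfl, DirectSum.lof_apply]
  · rw [if_neg h, DirectSum.lof_eq_of, DirectSum.of_eq_of_ne _ _ _ (Ne.symm h)]
    simp [frob]

theorem charComp_creation (N : ℕ) (u : SuperSpin Γ n) (x : RMinus Γ) :
    charComp N (creation u x) =
      if n ≤ N then frob MvPolynomial.X u.1 * charComp (N - n) x else 0 := by
  induction x using DirectSum.induction_on with
  | zero => simp
  | add x y hx hy =>
    rw [map_add, map_add, hx, hy]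
    split_ifs
    · rw [map_add, mul_add]
    · rw [add_zero]
  | of m F =>
    rw [← DirectSum.lof_eq_of ℂ, creation, DirectSum.toModule_lof]
    simp only [LinearMap.comp_apply, charComp_lof]
    by_cases h : n + m = N
    · subst h
      rw [if_pos rfl, if_pos (Nat.le_add_right n m), if_pos (Nat.add_sub_cancel_left n m).symm]
      exact frob_indProd _ u.2 F.2
    · rw [if_neg h]
      split_ifs with h1 h2
      · omega
      · rw [mul_zero]
      · rfl

theorem charComp_annihilation (ξ : ClassFn Γ) {u : SuperSpin Γ n} {u' : CycType Γ → ℂ}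
    (hu : HasWeight u u') (N : ℕ) (x : RMinus Γ) :
    charComp N (annihilation ξ u x) =
      (taylor Prod.fst (fun c => MvPolynomial.C (contractWeight ξ u' c))
        (charComp (n + N) x)).coeff n := by
  have h1 : annihilation ξ u x N = pairLeft ξ N u (x (n + N)) := rfl
  change frob MvPolynomial.X (annihilation ξ u x N).1 = _
  rw [h1, frob_pairLeft ξ hu]
  change _ = (taylor Prod.fst _ (frob MvPolynomial.X (x (n + N)).1)).coeff n
  rw [taylor_frob]
  rfl

/-- The derivation by which `a_k(f)` acts. -/
def sigmaDer (ξ f : ClassFn Γ) (k : ℕ) :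
    Derivation ℂ (MvPolynomial (CycType Γ) ℂ) (MvPolynomial (CycType Γ) ℂ) :=
  MvPolynomial.mkDerivation ℂ fun c => MvPolynomial.C (contractWeight ξ (sigmaWeight k f) c)

omit [Finite Γ] in
theorem contractWeight_sigma_of_ne (ξ f : ClassFn Γ) {k : ℕ} {c : CycType Γ} (h : c.1 ≠ k) :
    contractWeight ξ (sigmaWeight k f) c = 0 := by
  have h' : (cycInv c).1 ≠ k := h
  rw [contractWeight, sigmaWeight, if_neg h', mul_zero]

theorem charComp_annihilation_sigma (ξ f : ClassFn Γ) (k : ℕ) (hk : Odd k) (N : ℕ) (x : RMinus Γ) :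
    charComp N (annihilation ξ (sigma k hk f) x) = sigmaDer ξ f k (charComp (k + N) x) := by
  rw [charComp_annihilation ξ (hasWeight_sigma k hk f), sigmaDer,
    taylor_coeff_eq_mkDerivation hk.pos]
  intro c hc
  rw [contractWeight_sigma_of_ne ξ f hc, map_zero]

theorem sigmaDer_charComp_of_lt (ξ f : ClassFn Γ) {k N : ℕ} (h : N < k) (x : RMinus Γ) :
    sigmaDer ξ f k (charComp N x) = 0 := by
  refine mkDerivation_frob_of_lt _ (fun c hc => ?_) h
  rw [contractWeight_sigma_of_ne ξ f hc, map_zero]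

omit [Finite Γ] in
theorem sigmaDer_comm (ξ f g : ClassFn Γ) (k l : ℕ) (s : MvPolynomial (CycType Γ) ℂ) :
    sigmaDer ξ f k (sigmaDer ξ g l s) = sigmaDer ξ g l (sigmaDer ξ f k s) := by
  have h : ⁅sigmaDer ξ f k, sigmaDer ξ g l⁆ = 0 := by
    refine MvPolynomial.derivation_ext fun c => ?_
    rw [Derivation.commutator_apply, sigmaDer, sigmaDer, MvPolynomial.mkDerivation_X,
      MvPolynomial.mkDerivation_X, MvPolynomial.derivation_C, MvPolynomial.derivation_C, sub_zero]
    rfl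
  have h1 := DFunLike.congr_fun h s
  rw [Derivation.commutator_apply] at h1
  exact sub_eq_zero.mp h1

/-- The value of a contraction of two basic elements of the Heisenberg algebra. -/
theorem sigmaDer_frob_sigma (ξ f g : ClassFn Γ) (k l : ℕ) (hk : Odd k) (hl : Odd l) :
    sigmaDer ξ f k (frob MvPolynomial.X (sigma l hl g).1) =
      if k = l then MvPolynomial.C ((k : ℂ) / 2 * weightedForm ξ f g) else 0 := by
  classical
  let o : Fin l := ⟨0, hl.pos⟩
  rw [frob_of_hasWeight (hasWeight_sigma l hl g)]
  have h1 : ∀ w : SpinWreath Γ l, sigmaDer ξ f k ((wreathX w * wreathX w) •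
      cycTypeProd (fun c => algebraMap ℂ (MvPolynomial (CycType Γ) ℂ) (sigmaWeight l g c) *
        MvPolynomial.X c) w) =
      MvPolynomial.C (if IsFullCycle (perm l w) then 2 * (sigmaWeight l g (cycType w o) *
        contractWeight ξ (sigmaWeight k f) (cycType w o)) else 0) := by
    intro w
    by_cases h : IsFullCycle (perm l w)
    · rw [if_pos h, cycTypeProd_of_full _ w h o, wreathX_sq_of_full hl w h, Derivation.map_smul,
        ← Algebra.smul_def, Derivation.map_smul, sigmaDer, MvPolynomial.mkDerivation_X,
        MvPolynomial.smul_eq_C_mul, MvPolynomial.smul_eq_C_mul, map_mul, map_mul]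
    · rw [if_neg h, cycTypeProd_of_not_full _ w _ hl.pos h, smul_zero, map_zero, map_zero]
      intro c hc
      rw [sigmaWeight, if_neg hc, map_zero, zero_mul]
  rw [frob, Derivation.map_smul, map_sum, Finset.sum_congr rfl fun w _ => h1 w, ← map_sum]
  split_ifs with hkl
  · subst hkl
    let φ : Γ → ℂ := fun x => 2 * ((k : ℂ) / 2 * g.1 x * (ξ.1 x⁻¹ * ((k : ℂ) / 2 * f.1 x⁻¹)))
    have h2 : ∀ w : SpinWreath Γ k, (if IsFullCycle (perm k w) then 2 * (sigmaWeight k g (cycType w o) *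
        contractWeight ξ (sigmaWeight k f) (cycType w o)) else 0) =
        if IsFullCycle (perm k w) then φ (cycleProd w ⟨0, hk.pos⟩) else 0 := by
      intro w
      by_cases h : IsFullCycle (perm k w)
      · have hp : (cycType w o).1 = k := (isFullCycle_iff _).mp h
        have hp' : (cycInv (cycType w o)).1 = k := hp
        rw [if_pos h, if_pos h, contractWeight, sigmaWeight, sigmaWeight, if_pos hp, if_pos hp']
        rfl
      · rw [if_neg h, if_neg h]
    have h3 := sum_full (Γ := Γ) hk.pos φ
    have h4 : ∑ᶠ x, φ x = (k : ℂ) * k / 2 * ((Nat.card Γ : ℂ) * weightedForm ξ f g) := by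
      have hc : (Nat.card Γ : ℂ) ≠ 0 := Nat.cast_ne_zero.mpr Nat.card_pos.ne'
      rw [weightedForm, mul_inv_cancel_left₀ hc, ← finsum_mul']
      refine finsum_eq_of_bijective _ (Equiv.inv Γ).bijective fun x => ?_
      simp only [φ, Equiv.inv_apply, inv_inv]
      ring
    rw [Finset.sum_congr rfl fun w _ => h2 w, MvPolynomial.smul_eq_C_mul, ← map_mul]
    congr 1
    have hc : (Nat.card Γ : ℂ) ≠ 0 := Nat.cast_ne_zero.mpr Nat.card_pos.ne'
    have hk0 : (k : ℂ) ≠ 0 := Nat.cast_ne_zero.mpr hk.pos.ne'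
    have hN := card_ne_zero (Γ := Γ) k
    rw [h4] at h3
    rw [inv_mul_eq_iff_eq_mul₀ hN]
    refine mul_left_cancel₀ (mul_ne_zero hk0 hc) (h3.trans ?_)
    ring
  · rw [Finset.sum_eq_zero, map_zero, smul_zero]
    intro w _
    split_ifs with h
    · have hp : (cycType w o).1 = l := (isFullCycle_iff _).mp h
      rw [contractWeight_sigma_of_ne ξ f (fun h' => hkl (h'.symm.trans hp)), mul_zero, mul_zero]
    · rfl

/-! ### The Heisenberg relations -/

/-- The creation operators `a_{-k}(f)`, set to be zero for even `k`. -/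
def aMinus (f : ClassFn Γ) (k : ℕ) : Module.End ℂ (RMinus Γ) :=
  if hk : Odd k then creation (sigma k hk f) else 0

/-- The annihilation operators `a_k(f)`, set to be zero for even `k`. -/
def aPlus (ξ f : ClassFn Γ) (k : ℕ) : Module.End ℂ (RMinus Γ) :=
  if hk : Odd k then annihilation ξ (sigma k hk f) else 0

theorem creation_comm {k l : ℕ} (u : SuperSpin Γ k) (v : SuperSpin Γ l) :
    creation u * creation v = creation v * creation u := by
  refine LinearMap.ext fun x => charComp_ext fun N => ?_
  simp only [Module.End.mul_apply, charComp_creation]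
  by_cases h : k + l ≤ N
  · rw [if_pos (by omega), if_pos (by omega), if_pos (by omega), if_pos (by omega),
      show N - k - l = N - l - k by omega]
    ring
  · split_ifs <;> first | omega | simp

theorem aMinus_comm (f g : ClassFn Γ) (k l : ℕ) :
    aMinus f k * aMinus g l = aMinus g l * aMinus f k := by
  unfold aMinus
  split_ifs
  · exact creation_comm _ _
  all_goals simp

theorem aPlus_comm (ξ f g : ClassFn Γ) (k l : ℕ) :
    aPlus ξ f k * aPlus ξ g l = aPlus ξ g l * aPlus ξ f k := by
  unfold aPlus
  split_ifs
  · refine LinearMap.ext fun x => charComp_ext fun N => ?_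
    simp only [Module.End.mul_apply, charComp_annihilation_sigma]
    rw [sigmaDer_comm, show l + (k + N) = k + (l + N) by omega]
  all_goals simp

theorem aPlus_aMinus (ξ f g : ClassFn Γ) (k l : ℕ) :
    aPlus ξ f k * aMinus g l - aMinus g l * aPlus ξ f k =
      (if k = l ∧ Odd k then (k : ℂ) / 2 * weightedForm ξ f g else 0) • 1 := by
  unfold aPlus aMinus
  by_cases hk : Odd k
  swap
  · simp [hk]
  by_cases hl : Odd l
  swap
  · rw [dif_neg hl, if_neg (fun h : k = l ∧ Odd k => hl (h.1 ▸ h.2))]; simp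
  rw [dif_pos hk, dif_pos hl]
  refine LinearMap.ext fun x => charComp_ext fun N => ?_
  simp only [LinearMap.sub_apply, Module.End.mul_apply, map_sub, charComp_creation,
    charComp_annihilation_sigma, LinearMap.smul_apply, Module.End.one_apply, map_smul]
  -- Annihilation is a derivation and creation is multiplication by the characteristic of `σ_l`, so the
  -- commutator is multiplication by the derivative of this characteristic.
  have hD : ∀ s, sigmaDer ξ f k (frob MvPolynomial.X (sigma l hl g).1 * s) =
      frob MvPolynomial.X (sigma l hl g).1 * sigmaDer ξ f k s +
        s * if k = l then MvPolynomial.C ((k : ℂ) / 2 * weightedForm ξ f g) else 0 := by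
    intro s
    rw [Derivation.leibniz, sigmaDer_frob_sigma ξ f g k l hk hl, smul_eq_mul, smul_eq_mul]
  by_cases h : l ≤ k + N
  · rw [if_pos h, hD]
    by_cases h2 : l ≤ N
    · rw [if_pos h2, show k + N - l = k + (N - l) by omega, add_sub_cancel_left]
      by_cases hkl : k = l
      · subst hkl
        rw [if_pos rfl, if_pos ⟨rfl, hk⟩, MvPolynomial.smul_eq_C_mul, mul_comm,
          show k + (N - k) = N by omega]
      · rw [if_neg hkl, if_neg (fun h' : k = l ∧ Odd k => hkl h'.1), mul_zero, zero_smul]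
    · rw [if_neg h2, sub_zero, sigmaDer_charComp_of_lt ξ f (by omega), mul_zero, zero_add]
      by_cases hkl : k = l
      · subst hkl
        rw [if_pos rfl, if_pos ⟨rfl, hk⟩, MvPolynomial.smul_eq_C_mul, mul_comm,
          show k + N - k = N by omega]
      · rw [if_neg hkl, if_neg (fun h' : k = l ∧ Odd k => hkl h'.1), mul_zero, zero_smul]
  · rw [if_neg h, if_neg (by omega), map_zero, sub_zero, if_neg (fun h' : k = l ∧ Odd k => h (by omega)), zero_smul]

/-! ### The recursions for the basic spin operators -/

theorem Hminus_mul_aMinus (f : ClassFn Γ) (n k : ℕ) :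
    Hminus f n * aMinus f k = aMinus f k * Hminus f n := by
  unfold aMinus
  split_ifs
  · exact creation_comm _ _
  · simp

theorem Hminus_recursion (f : ClassFn Γ) (n : ℕ) :
    (n : ℂ) • Hminus f n =
      ∑ p ∈ Finset.HasAntidiagonal.antidiagonal n, (2 : ℂ) • (Hminus f p.1 * aMinus f p.2) := by
  refine LinearMap.ext fun x => charComp_ext fun N => ?_
  have h1 : ∀ k, frob MvPolynomial.X (parityFactor k • chi k f).1 = frob (fun c : CycType Γ =>
      MvPolynomial.C (chiWeight f c) * MvPolynomial.X c) (wreathX : SpinWreath Γ k → ℂ) :=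
    fun k => frob_of_hasWeight (hasWeight_chi k f) _
  have hrec := frob_wreathX_recursion n (chiWeight f)
  rw [LinearMap.smul_apply, map_smul, LinearMap.sum_apply, map_sum, Hminus, charComp_creation, h1]
  by_cases h : n ≤ N
  · rw [if_pos h, MvPolynomial.smul_eq_C_mul, ← mul_assoc, map_natCast, hrec, Finset.sum_mul]
    refine Finset.sum_congr rfl fun p hp => ?_
    rw [Finset.HasAntidiagonal.mem_antidiagonal] at hp
    rw [Hminus_mul_aMinus, LinearMap.smul_apply, map_smul, Module.End.mul_apply, aMinus]
    split_ifs with hk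
    · rw [charComp_creation, if_pos (by omega), Hminus, charComp_creation, if_pos (by omega), h1,
        show N - p.2 - p.1 = N - n by omega,
        frob_of_hasWeight (hasWeight_sigma p.2 hk f), MvPolynomial.smul_eq_C_mul, ← mul_assoc,
        ← mul_assoc]
      congr 2
      have h2 : frob (fun c => MvPolynomial.C (if c.1 = p.2 then p.2 * chiWeight f c else 0) *
          MvPolynomial.X c) (wreathX : SpinWreath Γ p.2 → ℂ) =
          MvPolynomial.C 2 * frob (fun c => algebraMap ℂ (MvPolynomial (CycType Γ) ℂ)
            (sigmaWeight p.2 f c) * MvPolynomial.X c) (wreathX : SpinWreath Γ p.2 → ℂ) := by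
        -- the elements on both sides are supported at full cycles
        rw [← MvPolynomial.smul_eq_C_mul, frob, frob,
          smul_comm (2 : ℂ) (_ : ℂ) (_ : MvPolynomial (CycType Γ) ℂ)]
        simp only [Finset.smul_sum]
        refine Finset.sum_congr rfl fun (w : SpinWreath Γ p.2) _ => congrArg _ ?_
        rw [smul_comm (2 : ℂ) (_ : ℂ) (_ : MvPolynomial (CycType Γ) ℂ)]
        refine congrArg _ ?_
        by_cases hw : IsFullCycle (perm p.2 w)
        · rw [cycTypeProd_of_full _ w hw ⟨0, hk.pos⟩, cycTypeProd_of_full _ w hw ⟨0, hk.pos⟩]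
          have hp : (cycType w ⟨0, hk.pos⟩).1 = p.2 := (isFullCycle_iff _).mp hw
          rw [if_pos hp, sigmaWeight, if_pos hp, MvPolynomial.algebraMap_eq,
            MvPolynomial.smul_eq_C_mul, ← mul_assoc, ← map_mul, chiWeight]
          congr 2
          ring
        · rw [cycTypeProd_of_not_full _ w _ hk.pos hw, cycTypeProd_of_not_full _ w _ hk.pos hw,
            smul_zero]
          · intro c hc
            rw [sigmaWeight, if_neg hc, map_zero, zero_mul]
          · intro c hc
            rw [if_neg hc, map_zero, zero_mul]
      exact h2
    · rw [zero_mul, LinearMap.zero_apply, map_zero, smul_zero]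
  · rw [if_neg h, smul_zero, Finset.sum_eq_zero]
    intro p hp
    rw [Finset.HasAntidiagonal.mem_antidiagonal] at hp
    rw [Hminus_mul_aMinus, LinearMap.smul_apply, map_smul, Module.End.mul_apply, aMinus]
    split_ifs with hk
    · rw [charComp_creation]
      split_ifs
      · rw [Hminus, charComp_creation, if_neg (by omega), mul_zero, smul_zero]
      · rw [smul_zero]
    · rw [LinearMap.zero_apply, map_zero, smul_zero]

omit [Finite Γ] in
theorem mkDerivation_recursion (ξ f : ClassFn Γ) (k : ℕ) :
    MvPolynomial.mkDerivation ℂ (fun c : CycType Γ => MvPolynomial.C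
      (if c.1 = k then k * contractWeight ξ (chiWeight f) c else 0)) =
      (2 : ℂ) • sigmaDer ξ f k := by
  refine MvPolynomial.derivation_ext fun c => ?_
  rw [Derivation.smul_apply, sigmaDer, MvPolynomial.mkDerivation_X, MvPolynomial.mkDerivation_X,
    MvPolynomial.smul_eq_C_mul, ← map_mul]
  congr 1
  split_ifs with h
  · have h' : (cycInv c).1 = k := h
    rw [contractWeight, contractWeight, sigmaWeight, if_pos h', chiWeight]
    ring
  · rw [contractWeight_sigma_of_ne ξ f h, mul_zero]

theorem charComp_Hplus (ξ f : ClassFn Γ) (n N : ℕ) (x : RMinus Γ) :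
    charComp N (Hplus ξ f n x) =
      (taylor Prod.fst (fun c => MvPolynomial.C (contractWeight ξ (chiWeight f) c))
        (charComp (n + N) x)).coeff n :=
  charComp_annihilation ξ (hasWeight_chi n f) N x

/-- Contractions with elements of even length vanish, which is consistent with the convention for
`a_k(f)` with `k` even. -/
theorem charComp_aPlus (ξ f : ClassFn Γ) (k N : ℕ) (x : RMinus Γ) :
    charComp N (aPlus ξ f k x) = sigmaDer ξ f k (charComp (k + N) x) := by
  rw [aPlus]
  split_ifs with hk
  · exact charComp_annihilation_sigma ξ f k hk N x
  · rw [LinearMap.zero_apply, map_zero]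
    rcases Nat.eq_zero_or_pos k with h0 | h0
    · have h1 : sigmaDer ξ f k = 0 := by
        refine MvPolynomial.derivation_ext fun c => ?_
        rw [sigmaDer, MvPolynomial.mkDerivation_X, contractWeight, sigmaWeight, h0]
        simp
      rw [h1, Derivation.zero_apply]
    · exact (mkDerivation_frob_of_even (Nat.not_odd_iff_even.mp hk) h0 _ (fun c hc => by
          rw [contractWeight_sigma_of_ne ξ f hc, map_zero]) (x (k + N)).2).symm

theorem Hplus_recursion (ξ f : ClassFn Γ) (n : ℕ) :
    (n : ℂ) • Hplus ξ f n =
      ∑ p ∈ Finset.HasAntidiagonal.antidiagonal n, (2 : ℂ) • (Hplus ξ f p.1 * aPlus ξ f p.2) := by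
  refine LinearMap.ext fun x => charComp_ext fun N => ?_
  have hrec := taylor_coeff_recursion Prod.fst (contractWeight ξ (chiWeight f)) n (charComp (n + N) x)
  rw [LinearMap.smul_apply, map_smul, LinearMap.sum_apply, map_sum, charComp_Hplus,
    MvPolynomial.smul_eq_C_mul, map_natCast]
  refine hrec.trans (Finset.sum_congr rfl fun p hp => ?_)
  rw [Finset.HasAntidiagonal.mem_antidiagonal] at hp
  rw [LinearMap.smul_apply, map_smul, Module.End.mul_apply, charComp_Hplus, charComp_aPlus,
    mkDerivation_recursion, Derivation.smul_apply, map_smul, Polynomial.coeff_smul,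
    show p.2 + (p.1 + N) = n + N by omega]

/-! ### Constant terms and local finiteness -/

theorem frob_wreathX_zero {R : Type*} [CommRing R] [Algebra ℂ R] (p : CycType Γ → R) :
    frob p (wreathX : SpinWreath Γ 0 → ℂ) = 1 := by
  have hX : wreathX (1 : SpinWreath Γ 0) = 1 := (spinX_one 0).trans (pow_zero _)
  have h2 : ∀ w : SpinWreath Γ 0, (wreathX w * wreathX w) • cycTypeProd p w = 1 := by
    intro w
    have hP : cycTypeProd p w = 1 := by
      have : IsEmpty (Quotient (Equiv.Perm.SameCycle.setoid (perm 0 w))) := ⟨fun c => c.out.elim0⟩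
      rw [cycTypeProd, cycProd, finprod_of_isEmpty]
    rw [hP]
    rcases spinWreath_zero_cases w with rfl | rfl
    · rw [hX, mul_one, one_smul]
    · rw [wreathX_z, hX, neg_mul_neg, mul_one, one_smul]
  rw [frob, Finset.sum_congr rfl fun w _ => h2 w, Finset.sum_const, Finset.card_univ,
    ← Nat.card_eq_fintype_card, ← Nat.cast_smul_eq_nsmul ℂ, smul_smul,
    inv_mul_cancel₀ (card_ne_zero 0), one_smul]

theorem Hminus_zero (f : ClassFn Γ) : Hminus f 0 = 1 := by
  refine LinearMap.ext fun x => charComp_ext fun N => ?_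
  rw [Hminus, charComp_creation, if_pos (Nat.zero_le N), frob_of_hasWeight (hasWeight_chi 0 f),
    frob_wreathX_zero, one_mul]
  rfl

theorem Hplus_zero (ξ f : ClassFn Γ) : Hplus ξ f 0 = 1 := by
  refine LinearMap.ext fun x => charComp_ext fun N => ?_
  rw [charComp_Hplus, Nat.zero_add, Module.End.one_apply]
  change (taylor Prod.fst _ (frob MvPolynomial.X (x N).1)).coeff 0 = frob MvPolynomial.X (x N).1
  -- variables of degree `0` do not occur
  rw [taylor_frob, frob_congr (q := fun c => Polynomial.C (MvPolynomial.X c) + Polynomial.X ^ c.1 *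
    Polynomial.C (if c.1 = 0 then 0 else MvPolynomial.C (contractWeight ξ (chiWeight f) c))) _
    fun c hc _ => by rw [if_neg (by omega)]]
  have h : ∀ s : Polynomial (MvPolynomial (CycType Γ) ℂ), s.coeff 0 =
      ((Polynomial.aeval (0 : MvPolynomial (CycType Γ) ℂ)).restrictScalars ℂ) s := fun s => by
    rw [AlgHom.restrictScalars_apply, Polynomial.coeff_zero_eq_aeval_zero]
  rw [h, map_frob]
  congr 1
  funext c
  rw [← h, Polynomial.coeff_add, Polynomial.coeff_C_zero, Polynomial.mul_coeff_zero]
  split_ifs with h0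
  · simp
  · rw [Polynomial.coeff_X_pow, if_neg (Ne.symm h0), zero_mul, add_zero]

theorem annihilation_eventually_zero (ξ : ClassFn Γ) (x : RMinus Γ) :
    ∃ N, ∀ n, N < n → ∀ u : SuperSpin Γ n, annihilation ξ u x = 0 := by
  classical
  refine ⟨(DFinsupp.support x).sup id, fun n hn u => DFinsupp.ext fun m => ?_⟩
  have h1 : annihilation ξ u x m = pairLeft ξ m u (x (n + m)) := rfl
  have h2 : x (n + m) = 0 := by
    by_contra h
    have := Finset.le_sup (f := id) (DFinsupp.mem_support_iff.mpr h)
    simp only [id] at this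
    omega
  rw [h1, h2, map_zero]
  rfl

end RMinusOperators


/-! ### The power series `((1 + t) / (1 - t)) ^ a` -/

section Euler
variable {R : Type*} [Ring R] [Algebra ℂ R]

/-- The Euler operator `t d/dt` on power series over a possibly noncommutative ring. -/
def eulerOp (f : PowerSeries R) : PowerSeries R :=
  PowerSeries.mk fun n => (n : ℂ) • PowerSeries.coeff n f

theorem coeff_eulerOp (f : PowerSeries R) (n : ℕ) :
    PowerSeries.coeff n (eulerOp f) = (n : ℂ) • PowerSeries.coeff n f :=
  PowerSeries.coeff_mk _ _

theorem eulerOp_add (f g : PowerSeries R) : eulerOp (f + g) = eulerOp f + eulerOp g := by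
  ext n; simp [coeff_eulerOp]

theorem eulerOp_sub (f g : PowerSeries R) : eulerOp (f - g) = eulerOp f - eulerOp g := by
  ext n; simp [coeff_eulerOp, smul_sub]

theorem eulerOp_C (r : R) : eulerOp (PowerSeries.C r) = 0 := by
  ext n
  rw [coeff_eulerOp, PowerSeries.coeff_C]
  split_ifs with h <;> simp [h]

theorem eulerOp_one : eulerOp (1 : PowerSeries R) = 0 := by
  rw [← map_one (PowerSeries.C (R := R)), eulerOp_C]

theorem eulerOp_mul (f g : PowerSeries R) : eulerOp (f * g) = eulerOp f * g + f * eulerOp g := by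
  ext n
  rw [coeff_eulerOp, map_add, PowerSeries.coeff_mul, PowerSeries.coeff_mul, PowerSeries.coeff_mul,
    Finset.smul_sum, ← Finset.sum_add_distrib]
  refine Finset.sum_congr rfl fun p hp => ?_
  rw [Finset.HasAntidiagonal.mem_antidiagonal] at hp
  rw [coeff_eulerOp, coeff_eulerOp, ← hp, smul_mul_assoc, mul_smul_comm, Nat.cast_add, add_smul]

theorem eulerOp_C_mul (r : R) (f : PowerSeries R) :
    eulerOp (PowerSeries.C r * f) = PowerSeries.C r * eulerOp f := by
  rw [eulerOp_mul, eulerOp_C, zero_mul, zero_add]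

theorem eulerOp_mul_C (r : R) (f : PowerSeries R) :
    eulerOp (f * PowerSeries.C r) = eulerOp f * PowerSeries.C r := by
  rw [eulerOp_mul, eulerOp_C, mul_zero, add_zero]

/-- Uniqueness of solutions of the linear differential equation `t f' = 2 A f`. -/
theorem eq_zero_of_eulerOp {A f : PowerSeries R} (hA : PowerSeries.coeff 0 A = 0)
    (hf : PowerSeries.coeff 0 f = 0) (h : eulerOp f = 2 * (A * f)) : f = 0 := by
  ext n
  induction n using Nat.strong_induction_on with
  | _ n ih =>
  rcases Nat.eq_zero_or_pos n with rfl | hn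
  · rw [hf, map_zero]
  · have h1 : (n : ℂ) • PowerSeries.coeff n f = 0 := by
      rw [← coeff_eulerOp, h, two_mul, map_add, PowerSeries.coeff_mul, Finset.sum_eq_zero, add_zero]
      intro p hp
      rw [Finset.HasAntidiagonal.mem_antidiagonal] at hp
      rcases Nat.eq_zero_or_pos p.1 with h0 | h0
      · rw [h0, hA, zero_mul]
      · rw [ih p.2 (by omega), map_zero, mul_zero]
    rw [map_zero]
    exact (smul_eq_zero.mp h1).resolve_left (Nat.cast_ne_zero.mpr hn.ne')

end Euler

section Ratio
open PowerSeries

/-- The unit `(1 + t) / (1 - t)` of the ring of power series. -/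
def ratioUnit : (PowerSeries ℂ)ˣ where
  val := (1 + X) * PowerSeries.mk (fun _ => 1)
  inv := (1 - X) * PowerSeries.mk (fun n => (-1) ^ n)
  val_inv := by
    have h1 : (1 - X) * PowerSeries.mk (fun _ => (1 : ℂ)) = 1 := by
      rw [mul_comm]; exact PowerSeries.mk_one_mul_one_sub_eq_one ℂ
    have h2 : (1 + X) * PowerSeries.mk (fun n => (-1 : ℂ) ^ n) = 1 := by
      ext n
      rw [add_mul, one_mul, map_add, coeff_mk, coeff_one]
      cases n with
      | zero => simp
      | succ n => rw [coeff_succ_X_mul, coeff_mk, pow_succ]; simp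
    calc _ = ((1 - X) * PowerSeries.mk (fun _ => (1 : ℂ))) *
        ((1 + X) * PowerSeries.mk (fun n => (-1 : ℂ) ^ n)) := by ring
      _ = 1 := by rw [h1, h2, one_mul]
  inv_val := by
    have h1 : (1 - X) * PowerSeries.mk (fun _ => (1 : ℂ)) = 1 := by
      rw [mul_comm]; exact PowerSeries.mk_one_mul_one_sub_eq_one ℂ
    have h2 : (1 + X) * PowerSeries.mk (fun n => (-1 : ℂ) ^ n) = 1 := by
      ext n
      rw [add_mul, one_mul, map_add, coeff_mk, coeff_one]
      cases n with
      | zero => simp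
      | succ n => rw [coeff_succ_X_mul, coeff_mk, pow_succ]; simp
    calc _ = ((1 - X) * PowerSeries.mk (fun _ => (1 : ℂ))) *
        ((1 + X) * PowerSeries.mk (fun n => (-1 : ℂ) ^ n)) := by ring
      _ = 1 := by rw [h1, h2, one_mul]

theorem one_sub_mul_ratioUnit : (1 - X) * (ratioUnit : PowerSeries ℂ) = 1 + X := by
  have h1 : PowerSeries.mk (fun _ => (1 : ℂ)) * (1 - X) = 1 :=
    PowerSeries.mk_one_mul_one_sub_eq_one ℂ
  calc _ = (1 + X) * (PowerSeries.mk (fun _ => (1 : ℂ)) * (1 - X)) := by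
        change (1 - X) * ((1 + X) * PowerSeries.mk (fun _ => 1)) = _; ring
    _ = 1 + X := by rw [h1, mul_one]

theorem one_add_mul_ratioUnit_inv : (1 + X) * (↑ratioUnit⁻¹ : PowerSeries ℂ) = 1 - X := by
  rw [← one_sub_mul_ratioUnit, mul_assoc, Units.mul_inv, mul_one]

/-- The coefficients of `((1 + t) / (1 - t)) ^ a`. -/
def ratioCoeff (a : ℤ) (n : ℕ) : ℂ := coeff n (↑(ratioUnit ^ a) : PowerSeries ℂ)

/-- The power series `∑ t ^ j` over odd `j`. -/
def oddSeries : PowerSeries ℂ := PowerSeries.mk fun n => if Odd n then 1 else 0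

theorem one_sub_sq_mul_oddSeries : (1 - X ^ 2) * oddSeries = X := by
  ext n
  rw [sub_mul, one_mul, map_sub, oddSeries, coeff_mk, coeff_X_pow_mul', coeff_X]
  rcases n with _ | _ | n
  · simp
  · simp
  · have h1 : Odd (n + 1 + 1) ↔ Odd n := by rw [Nat.odd_add_one, Nat.odd_add_one, not_not]
    have h2 : n + 1 + 1 ≠ 1 := by omega
    have h3 : 2 ≤ n + 1 + 1 := by omega
    rw [if_pos h3, coeff_mk, if_neg h2, show n + 1 + 1 - 2 = n by omega]
    simp only [h1, sub_self]

theorem eulerOp_ratioUnit_zpow (a : ℤ) : eulerOp (↑(ratioUnit ^ a) : PowerSeries ℂ) =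
    2 * ((C (a : ℂ) * oddSeries) * ↑(ratioUnit ^ a)) := by
  have hX : eulerOp (X : PowerSeries ℂ) = X := by
    ext n
    rw [coeff_eulerOp, coeff_X]
    split_ifs with h <;> simp [h]
  have h1 : (1 - X : PowerSeries ℂ) ≠ 0 := by
    intro h
    have := congrArg (coeff 0) h
    simp at this
  have h2 : (1 + X : PowerSeries ℂ) ≠ 0 := by
    intro h
    have := congrArg (coeff 0) h
    simp at this
  have hO := one_sub_sq_mul_oddSeries
  have hu : eulerOp (ratioUnit : PowerSeries ℂ) = 2 * (oddSeries * ↑ratioUnit) := by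
    have h := congrArg eulerOp one_sub_mul_ratioUnit
    rw [eulerOp_mul, eulerOp_sub, eulerOp_add, eulerOp_one, hX, zero_sub, zero_add] at h
    refine mul_left_cancel₀ (mul_ne_zero h1 h2) ?_
    have h' := one_sub_mul_ratioUnit
    linear_combination (1 + X) * h - 2 * (ratioUnit : PowerSeries ℂ) * hO - X * h'
  have hv : eulerOp (↑ratioUnit⁻¹ : PowerSeries ℂ) = -(2 * (oddSeries * ↑ratioUnit⁻¹)) := by
    have h := congrArg eulerOp (ratioUnit.mul_inv)
    rw [eulerOp_mul, eulerOp_one, hu] at h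
    refine ratioUnit.isUnit.mul_left_cancel ?_
    have := ratioUnit.mul_inv
    linear_combination h
  induction a using Int.induction_on with
  | zero => simp [eulerOp_one]
  | succ a ih =>
    rw [zpow_add_one, Units.val_mul, eulerOp_mul, ih, hu]
    push_cast
    rw [map_add, map_one]
    ring
  | pred a ih =>
    rw [zpow_sub_one, Units.val_mul, eulerOp_mul, ih, hv]
    push_cast
    rw [map_sub, map_one]
    ring

theorem ratioCoeff_zero (a : ℤ) : ratioCoeff a 0 = 1 := by
  have h : ∀ u : (PowerSeries ℂ)ˣ, coeff 0 (u : PowerSeries ℂ) = 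
      (Units.map (constantCoeff (R := ℂ)).toMonoidHom u : ℂ) := fun u => by simp
  have h1 : Units.map (constantCoeff (R := ℂ)).toMonoidHom ratioUnit = 1 := by
    ext
    simp [ratioUnit]
  rw [ratioCoeff, h, map_zpow, h1, one_zpow, Units.val_one]

theorem ratioCoeff_recursion (a : ℤ) (n : ℕ) : (n : ℂ) * ratioCoeff a n =
    ∑ p ∈ Finset.HasAntidiagonal.antidiagonal n,
      2 * (if Odd p.1 then (a : ℂ) else 0) * ratioCoeff a p.2 := by
  have h := congrArg (coeff n) (eulerOp_ratioUnit_zpow a)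
  rw [coeff_eulerOp, smul_eq_mul] at h
  rw [ratioCoeff, h, ← map_ofNat (C (R := ℂ)) 2, coeff_C_mul, coeff_mul, Finset.mul_sum]
  refine Finset.sum_congr rfl fun p _ => ?_
  rw [coeff_C_mul, oddSeries, coeff_mk, mul_ite, mul_one, mul_zero, mul_assoc]
  rfl

theorem ratioCoeff_neg (a : ℤ) (n : ℕ) : ratioCoeff (-a) n = (-1) ^ n * ratioCoeff a n := by
  have h : Units.map (evalNegHom (A := ℂ)).toMonoidHom ratioUnit = ratioUnit⁻¹ := by
    rw [_root_.eq_inv_iff_mul_eq_one]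
    ext1
    have h1 := congrArg (evalNegHom (A := ℂ)) one_sub_mul_ratioUnit
    rw [map_mul, map_sub, map_add, map_one, evalNegHom_X, sub_neg_eq_add, ← sub_eq_add_neg] at h1
    have h2 := one_sub_mul_ratioUnit
    have h3 : IsUnit (1 + X : PowerSeries ℂ) := by
      rw [PowerSeries.isUnit_iff_constantCoeff]; simp
    refine h3.mul_left_cancel ?_
    change (1 + X) * (evalNegHom (ratioUnit : PowerSeries ℂ) * (ratioUnit : PowerSeries ℂ)) =
      (1 + X) * 1
    rw [← mul_assoc, h1, h2, mul_one]
  have h1 : (↑(ratioUnit ^ (-a)) : PowerSeries ℂ) = evalNegHom (↑(ratioUnit ^ a) : PowerSeries ℂ) := by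
    rw [zpow_neg, ← inv_zpow, ← h, ← map_zpow]
    rfl
  rw [ratioCoeff, h1, evalNegHom, coeff_rescale, ratioCoeff]

end Ratio

/-! ### The structure constants of the commutators -/

section Structure
open PowerSeries

/-- The coefficients of `((1 - t) / (1 + t)) ^ a`, extended by zero to negative degrees. -/
def normalCoeff (a j : ℤ) : ℂ := if 0 ≤ j then ratioCoeff (-a) j.toNat else 0

/-- The structure constants of the commutator of two vertex operators: the coefficients of the
difference of the expansions of `((1 - t) / (1 + t)) ^ a` at zero and at infinity. -/
def commCoeff (a j : ℤ) : ℂ := normalCoeff a j - (-1 : ℂ) ^ a * normalCoeff a (-j)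

theorem coeff_one_add_X_pow' (a n : ℕ) :
    coeff n ((1 + X : PowerSeries ℂ) ^ a) = (a.choose n : ℂ) := by
  have h : ((1 + X : PowerSeries ℂ) ^ a) =
      (((1 + Polynomial.X) ^ a : Polynomial ℂ) : PowerSeries ℂ) := by simp
  rw [h, Polynomial.coeff_coe, Polynomial.coeff_one_add_X_pow]

theorem sum_choose_mul_ratioCoeff (s : ℂ) (f g : PowerSeries ℂ) (m : ℕ)
    (h : (1 + C s * X) ^ m * f = g) (j : ℤ) :
    ∑ r ∈ Finset.range (m + 1), s ^ r * (m.choose r : ℂ) *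
      (if 0 ≤ j - r then coeff (j - r).toNat f else 0) = if 0 ≤ j then coeff j.toNat g else 0 := by
  by_cases hj : 0 ≤ j
  · obtain ⟨n, rfl⟩ := Int.eq_ofNat_of_zero_le hj
    rw [if_pos hj, Int.toNat_natCast, ← h, add_comm (1 : PowerSeries ℂ), add_pow, Finset.sum_mul, map_sum]
    refine Finset.sum_congr rfl fun r _ => ?_
    have e : (C s * X) ^ r * 1 ^ (m - r) * (m.choose r : PowerSeries ℂ) * f =
        X ^ r * (C (s ^ r * (m.choose r : ℂ)) * f) := by
      rw [one_pow, mul_pow, map_mul, map_pow, map_natCast]; ring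
    rw [e, coeff_X_pow_mul', coeff_C_mul]
    by_cases hr : r ≤ n
    · rw [if_pos (by omega), if_pos hr, show ((n : ℤ) - r).toNat = n - r by omega]
    · rw [if_neg (by omega), if_neg hr, mul_zero]
  · rw [if_neg hj, Finset.sum_eq_zero]
    intro r _
    rw [if_neg (by omega), mul_zero]

theorem normalCoeff_sum_nonneg (a : ℕ) (j : ℤ) :
    ∑ r ∈ Finset.range (a + 1), (a.choose r : ℂ) * normalCoeff a (j - r) =
      if 0 ≤ j then (-1) ^ j.toNat * (a.choose j.toNat : ℂ) else 0 := by
  have h : (1 + C (1 : ℂ) * X) ^ a * (↑(ratioUnit ^ (-(a : ℤ))) : PowerSeries ℂ) =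
      (1 - X) ^ a := by
    rw [map_one, one_mul, zpow_neg, zpow_natCast, ← inv_pow, Units.val_pow_eq_pow_val, ← mul_pow,
      one_add_mul_ratioUnit_inv]
  have h1 := sum_choose_mul_ratioCoeff 1 _ _ a h j
  simp only [one_pow, one_mul] at h1
  refine h1.trans ?_
  split_ifs
  · rw [show (1 - X : PowerSeries ℂ) = evalNegHom (1 + X) by
      rw [map_add, map_one, evalNegHom_X, sub_eq_add_neg], ← map_pow, evalNegHom, coeff_rescale,
      coeff_one_add_X_pow']
  · rfl

theorem normalCoeff_sum_neg (a : ℕ) (j : ℤ) :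
    ∑ r ∈ Finset.range (a + 1), (-1) ^ r * (a.choose r : ℂ) * normalCoeff (-a) (j - r) =
      if 0 ≤ j then (a.choose j.toNat : ℂ) else 0 := by
  have h : (1 + C (-1 : ℂ) * X) ^ a * (↑(ratioUnit ^ (-(-(a : ℤ)))) : PowerSeries ℂ) =
      (1 + X) ^ a := by
    rw [map_neg, map_one, neg_one_mul, neg_neg, zpow_natCast, Units.val_pow_eq_pow_val, ← mul_pow,
      ← sub_eq_add_neg, one_sub_mul_ratioUnit]
  refine (sum_choose_mul_ratioCoeff (-1) _ _ a h j).trans ?_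
  split_ifs
  · rw [coeff_one_add_X_pow']
  · rfl

/-- The Serre relations for the structure constants, for a nonnegative form value: both products
contribute the coefficients of `(1 - t) ^ a`. -/
theorem commCoeff_serre_nonneg (a : ℕ) (j : ℤ) :
    ∑ s ∈ Finset.range (a + 1), (a.choose s : ℂ) * commCoeff a (j + s) = 0 := by
  have h1 : ∑ s ∈ Finset.range (a + 1), (a.choose s : ℂ) * normalCoeff a (j + s) =
      if 0 ≤ j + a then (-1) ^ (j + a).toNat * (a.choose (j + a).toNat : ℂ) else 0 := by
    rw [← normalCoeff_sum_nonneg, ← Finset.sum_range_reflect]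
    refine Finset.sum_congr rfl fun s hs => ?_
    have hs' : s ≤ a := by have := Finset.mem_range.mp hs; omega
    rw [show a + 1 - 1 - s = a - s by omega, Nat.choose_symm hs']
    congr 2
    omega
  have h2 : ∑ s ∈ Finset.range (a + 1), (a.choose s : ℂ) * normalCoeff a (-(j + s)) =
      if 0 ≤ -j then (-1) ^ (-j).toNat * (a.choose (-j).toNat : ℂ) else 0 := by
    rw [← normalCoeff_sum_nonneg]
    refine Finset.sum_congr rfl fun s _ => ?_
    rw [neg_add, ← sub_eq_add_neg]
  have h3 : ∀ s : ℕ, (a.choose s : ℂ) * commCoeff a (j + s) = (a.choose s : ℂ) *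
      normalCoeff a (j + s) - (-1 : ℂ) ^ (a : ℤ) * ((a.choose s : ℂ) * normalCoeff a (-(j + s))) := by
    intro s
    rw [commCoeff]; ring
  simp only [h3]
  rw [Finset.sum_sub_distrib, ← Finset.mul_sum, h1, h2, zpow_natCast]
  rcases lt_trichotomy 0 (-j) with hj | hj | hj
  · obtain ⟨k, rfl⟩ : ∃ k : ℕ, j = -k := ⟨(-j).toNat, by omega⟩
    rw [neg_neg, if_pos (by omega : (0 : ℤ) ≤ k), Int.toNat_natCast]
    by_cases hk : k ≤ a
    · obtain ⟨m, rfl⟩ := Nat.exists_eq_add_of_le hk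
      rw [if_pos (by omega), show (-(k : ℤ) + ((k + m : ℕ) : ℤ)).toNat = m by omega,
        ← Nat.choose_symm_add, pow_add]
      have : ((-1 : ℂ) ^ k) * (-1) ^ k = 1 := by rw [← mul_pow]; simp
      linear_combination (-(-1 : ℂ) ^ m * ((k + m).choose k : ℂ)) * this
    · rw [if_neg (show ¬ 0 ≤ -(k : ℤ) + a by omega),
        Nat.choose_eq_zero_of_lt (show a < k by omega)]
      simp
  · have : j = 0 := by omega
    subst this
    simp
  · rw [if_neg (show ¬ 0 ≤ -j by omega), if_pos (show 0 ≤ j + a by omega),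
      Nat.choose_eq_zero_of_lt (show a < (j + a).toNat by omega)]
    simp

/-- The Serre relations for the structure constants, for a negative form value. -/
theorem commCoeff_serre_neg (a : ℕ) (j : ℤ) :
    ∑ s ∈ Finset.range (a + 1), (-1) ^ s * (a.choose s : ℂ) * commCoeff (-a) (j + s) = 0 := by
  -- Both expansions, multiplied by the polynomial, give `(1 + t) ^ a` up to a sign and a shift.
  have h1 : ∑ s ∈ Finset.range (a + 1), (-1) ^ s * (a.choose s : ℂ) * normalCoeff (-a) (j + s) =
      (-1) ^ a * if 0 ≤ j + a then (a.choose (j + a).toNat : ℂ) else 0 := by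
    rw [← normalCoeff_sum_neg, ← Finset.sum_range_reflect, Finset.mul_sum]
    refine Finset.sum_congr rfl fun s hs => ?_
    have hs' : s ≤ a := by have := Finset.mem_range.mp hs; omega
    obtain ⟨m, rfl⟩ := Nat.exists_eq_add_of_le hs'
    have h : ((-1 : ℂ) ^ s) * (-1) ^ s = 1 := by rw [← mul_pow]; simp
    rw [show s + m + 1 - 1 - s = m by omega, ← Nat.choose_symm_add,
      show j + ((s + m : ℕ) : ℤ) - (s : ℤ) = j + (m : ℤ) by push_cast; ring, pow_add]
    linear_combination (-(-1 : ℂ) ^ m * ((s + m).choose s : ℂ) * 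
      normalCoeff (-((s + m : ℕ) : ℤ)) (j + m)) * h
  have h2 : ∑ s ∈ Finset.range (a + 1), (-1) ^ s * (a.choose s : ℂ) * normalCoeff (-a) (-(j + s)) =
      if 0 ≤ -j then (a.choose (-j).toNat : ℂ) else 0 := by
    rw [← normalCoeff_sum_neg]
    refine Finset.sum_congr rfl fun s _ => ?_
    rw [neg_add, ← sub_eq_add_neg]
  have h3 : ∀ s : ℕ, (-1) ^ s * (a.choose s : ℂ) * commCoeff (-a) (j + s) =
      (-1) ^ s * (a.choose s : ℂ) * normalCoeff (-a) (j + s) -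
      (-1 : ℂ) ^ (a : ℤ) * ((-1) ^ s * (a.choose s : ℂ) * normalCoeff (-a) (-(j + s))) := by
    intro s
    have h : (-1 : ℂ) ^ (-(a : ℤ)) = (-1) ^ (a : ℤ) := by
      rw [zpow_neg, ← inv_zpow, inv_neg, inv_one]
    rw [commCoeff, h]; ring
  simp only [h3]
  rw [Finset.sum_sub_distrib, ← Finset.mul_sum, h1, h2, zpow_natCast, ← mul_sub]
  refine mul_eq_zero_of_right _ (sub_eq_zero.mpr ?_)
  rcases lt_trichotomy 0 (-j) with hj | hj | hj
  · obtain ⟨k, rfl⟩ : ∃ k : ℕ, j = -k := ⟨(-j).toNat, by omega⟩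
    rw [neg_neg, if_pos (by omega : (0 : ℤ) ≤ k), Int.toNat_natCast]
    by_cases hk : k ≤ a
    · obtain ⟨m, rfl⟩ := Nat.exists_eq_add_of_le hk
      rw [if_pos (by omega), show (-(k : ℤ) + ((k + m : ℕ) : ℤ)).toNat = m by omega,
        ← Nat.choose_symm_add]
    · rw [if_neg (show ¬ 0 ≤ -(k : ℤ) + a by omega),
        Nat.choose_eq_zero_of_lt (show a < k by omega)]
      simp
  · have : j = 0 := by omega
    subst this
    simp
  · rw [if_neg (show ¬ 0 ≤ -j by omega), if_pos (show 0 ≤ j + a by omega),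
      Nat.choose_eq_zero_of_lt (show a < (j + a).toNat by omega)]
    simp

/-- The case of exponent `2`: the coefficients of a derivative of the delta function. -/
theorem commCoeff_two (j : ℤ) : commCoeff 2 j = 4 * (-1 : ℂ) ^ j * j := by
  have hrec : ∀ j : ℤ, commCoeff 2 j + 2 * commCoeff 2 (j + 1) + commCoeff 2 (j + 2) = 0 := by
    intro j
    have h := commCoeff_serre_nonneg 2 j
    simpa [Finset.sum_range_succ] using h
  have h0 : commCoeff 2 0 = 0 := by
    simp [commCoeff]
  have h1 : commCoeff 2 1 = -4 := by
    have h := normalCoeff_sum_nonneg 2 1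
    have hc : normalCoeff 2 0 = 1 := by rw [normalCoeff, if_pos le_rfl]; exact ratioCoeff_zero _
    have hm : normalCoeff 2 (-1) = 0 := if_neg (by norm_num)
    simp [Finset.sum_range_succ, hc, hm] at h
    rw [commCoeff, hm]
    linear_combination h
  have hz : ∀ j : ℤ, (-1 : ℂ) ^ (j + 1) = -(-1) ^ j := fun j => by
    rw [zpow_add_one₀ (by norm_num)]; ring
  -- The Serre relation is a two-step recursion, which the right-hand side satisfies as well.
  suffices key : ∀ j : ℤ, commCoeff 2 j = 4 * (-1 : ℂ) ^ j * j ∧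
      commCoeff 2 (j + 1) = 4 * (-1 : ℂ) ^ (j + 1) * (j + 1 : ℤ) from (key j).1
  intro j
  induction j using Int.induction_on with
  | zero => simp [h0, h1]
  | succ j ih =>
    refine ⟨by simpa using ih.2, ?_⟩
    have h := hrec j
    rw [show (j : ℤ) + 1 + 1 = j + 2 by ring]
    have hz2 : (-1 : ℂ) ^ ((j : ℤ) + 2) = (-1) ^ (j : ℤ) := by
      rw [show (j : ℤ) + 2 = j + 1 + 1 by ring, hz, hz, neg_neg]
    rw [ih.1, ih.2, hz] at h
    rw [hz2]
    push_cast at h ⊢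
    linear_combination h
  | pred j ih =>
    have e : -(j : ℤ) - 1 + 1 = -j := by ring
    refine ⟨?_, by rw [e]; exact ih.1⟩
    have h := hrec (-(j : ℤ) - 1)
    rw [e, show -(j : ℤ) - 1 + 2 = -j + 1 by ring, ih.1, ih.2, hz] at h
    have hz2 : (-1 : ℂ) ^ (-(j : ℤ) - 1) = -(-1) ^ (-(j : ℤ)) := by
      have := hz (-(j : ℤ) - 1)
      rw [e] at this
      rw [this, neg_neg]
    rw [hz2]
    push_cast at h ⊢
    linear_combination h

end Structure


/-! ### Exponentials of Heisenberg operators -/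

section IsExp
variable {R : Type*} [Ring R] [Algebra ℂ R]

/-- The family `Q` is the exponential of the odd, commuting family `a`, in the sense that
`Q(y) = ∑ Q_n y^n` solves `y Q'(y) = 2 Q(y) a(y)` with constant term `1`. -/
structure IsExp (a Q : ℕ → R) : Prop where
  zero : Q 0 = 1
  even : ∀ k, ¬ Odd k → a k = 0
  comm : ∀ k l, a k * a l = a l * a k
  recursion : ∀ n : ℕ, (n : ℂ) • Q n =
    ∑ p ∈ Finset.HasAntidiagonal.antidiagonal n, (2 : ℂ) • (Q p.1 * a p.2)

namespace IsExp
variable {a Q : ℕ → R}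

theorem a_zero (h : IsExp a Q) : a 0 = 0 := h.even 0 (by simp)

/-- Operators commuting with a family commute with its exponential. -/
theorem commute (h : IsExp a Q) {u : R} (hu : ∀ k, u * a k = a k * u) (n : ℕ) :
    u * Q n = Q n * u := by
  induction n using Nat.strong_induction_on with
  | _ n ih =>
  rcases Nat.eq_zero_or_pos n with rfl | hn
  · rw [h.zero, mul_one, one_mul]
  · have h1 : (n : ℂ) • (u * Q n - Q n * u) = 0 := by
      rw [smul_sub, ← mul_smul_comm, ← smul_mul_assoc, h.recursion, Finset.mul_sum, Finset.sum_mul,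
        ← Finset.sum_sub_distrib, Finset.sum_eq_zero]
      intro p hp
      rw [Finset.HasAntidiagonal.mem_antidiagonal] at hp
      rcases Nat.eq_zero_or_pos p.2 with h0 | h0
      · rw [h0, h.a_zero]; simp
      · rw [mul_smul_comm, smul_mul_assoc, ← mul_assoc, ih p.1 (by omega), mul_assoc, hu,
          mul_assoc, sub_self]
    exact sub_eq_zero.mp ((smul_eq_zero.mp h1).resolve_left (Nat.cast_ne_zero.mpr hn.ne'))

theorem commute_a (h : IsExp a Q) (k n : ℕ) : a k * Q n = Q n * a k :=
  h.commute (fun l => h.comm k l) n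

theorem eulerOp_mk (h : IsExp a Q) :
    eulerOp (PowerSeries.mk Q) = 2 * (PowerSeries.mk a * PowerSeries.mk Q) := by
  ext n
  rw [coeff_eulerOp, PowerSeries.coeff_mk, h.recursion, two_mul, map_add, ← two_smul ℂ,
    PowerSeries.coeff_mul, ← Finset.smul_sum, ← Finset.Nat.sum_antidiagonal_swap]
  congr 1
  refine Finset.sum_congr rfl fun p _ => ?_
  rw [PowerSeries.coeff_mk, PowerSeries.coeff_mk, h.commute_a]
  rfl

/-- Heisenberg operators act on exponentials of dual Heisenberg operators by shifts. -/
theorem bracket (h : IsExp a Q) {u : R} {k : ℕ} {b : ℂ} (hk : 0 < k)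
    (hu : ∀ l, u * a l - a l * u = (if k = l then (k : ℂ) / 2 * b else 0) • 1) (n : ℕ) :
    u * Q n - Q n * u = if k ≤ n then b • Q (n - k) else 0 := by
  let q := PowerSeries.mk Q
  let A := PowerSeries.mk a
  let U : PowerSeries R := PowerSeries.C u
  let r : PowerSeries R := PowerSeries.X ^ k
  have hr : ∀ f : PowerSeries R, r * f = f * r := fun f => (PowerSeries.commute_X_pow f k).eq.symm
  let β : PowerSeries R := PowerSeries.C (algebraMap ℂ R b)
  have hβ : ∀ f : PowerSeries R, β * f = f * β := fun f => by
    ext m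
    rw [PowerSeries.coeff_C_mul, PowerSeries.coeff_mul_C, Algebra.commutes]
  have hq : eulerOp q = 2 * (A * q) := h.eulerOp_mk
  have hdr : eulerOp r = PowerSeries.C (algebraMap ℂ R k) * r := by
    ext m
    rw [coeff_eulerOp, PowerSeries.coeff_C_mul, PowerSeries.coeff_X_pow]
    split_ifs with hm
    · rw [hm, Algebra.smul_def]
    · simp
  have hUA : 2 * (U * A - A * U) = β * eulerOp r := by
    rw [hdr]
    ext m
    rw [two_mul, map_add, map_sub, PowerSeries.coeff_C_mul, PowerSeries.coeff_mul_C,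
      PowerSeries.coeff_mk, hu, PowerSeries.coeff_C_mul, PowerSeries.coeff_C_mul,
      PowerSeries.coeff_X_pow, ← add_smul]
    by_cases hm : k = m
    · rw [if_pos hm, if_pos hm.symm, mul_one, ← map_mul, Algebra.algebraMap_eq_smul_one]
      congr 1
      ring
    · rw [if_neg hm, if_neg (Ne.symm hm)]; simp
  -- The difference satisfies the differential equation of the exponential with initial value zero.
  have key : U * q - q * U - β * (r * q) = 0 := by
    refine eq_zero_of_eulerOp (A := A) ?_ ?_ ?_
    · rw [PowerSeries.coeff_mk, h.a_zero]
    · rw [map_sub, map_sub, PowerSeries.coeff_C_mul, PowerSeries.coeff_mul_C,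
        PowerSeries.coeff_C_mul, PowerSeries.coeff_X_pow_mul', if_neg (by omega),
        PowerSeries.coeff_mk, h.zero]
      simp
    · have e2 : ∀ f : PowerSeries R, f * 2 = 2 * f := fun f => by rw [mul_two, two_mul]
      rw [eulerOp_sub, eulerOp_sub, eulerOp_C_mul, eulerOp_mul_C, eulerOp_C_mul, eulerOp_mul, hq]
      have e3 : β * (eulerOp r * q + r * (2 * (A * q))) =
          2 * (U * A - A * U) * q + 2 * (A * (β * (r * q))) := by
        rw [hUA, mul_add, mul_assoc]
        congr 1
        rw [← mul_assoc r 2, e2, mul_assoc 2, ← mul_assoc β 2, e2, mul_assoc 2, ← mul_assoc A β,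
          ← hβ A, mul_assoc β A, ← mul_assoc A r q, ← hr A, mul_assoc r A]
      rw [e3, ← mul_assoc U 2, e2, mul_assoc 2]
      noncomm_ring
  have h1 := congrArg (PowerSeries.coeff n) key
  rw [map_sub, map_sub, map_zero, PowerSeries.coeff_C_mul, PowerSeries.coeff_mul_C,
    PowerSeries.coeff_C_mul, PowerSeries.coeff_X_pow_mul', PowerSeries.coeff_mk, sub_eq_zero] at h1
  rw [h1]
  split_ifs
  · rw [PowerSeries.coeff_mk, Algebra.smul_def]
  · rw [mul_zero]

/-- Normal ordering of a product of an exponential with operators on which the Heisenberg operators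
act by shifts. -/
theorem exchange (h : IsExp a Q) {P : ℤ → R} {b : ℤ}
    (hP : ∀ (k : ℕ) (p : ℤ), a k * P p - P p * a k = if Odd k then (b : ℂ) • P (p - k) else 0)
    (k : ℕ) (p : ℤ) : Q k * P p = ∑ x ∈ Finset.HasAntidiagonal.antidiagonal k,
      ratioCoeff b x.1 • (P (p - x.1) * Q x.2) := by
  let q := PowerSeries.mk Q
  let A := PowerSeries.mk a
  let W : PowerSeries R := PowerSeries.mk fun r => ratioCoeff b r • P (p - r)
  have hq : eulerOp q = 2 * (A * q) := h.eulerOp_mk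
  have e2 : ∀ f : PowerSeries R, f * 2 = 2 * f := fun f => by rw [mul_two, two_mul]
  -- The differential equation that is satisfied by conjugates of a constant by the exponential.
  have hW : eulerOp W = 2 * (A * W - W * A) := by
    ext n
    rw [coeff_eulerOp, PowerSeries.coeff_mk, smul_smul, ratioCoeff_recursion, Finset.sum_smul,
      two_mul, map_add, ← two_smul ℂ, map_sub, PowerSeries.coeff_mul, PowerSeries.coeff_mul,
      ← Finset.Nat.sum_antidiagonal_swap (f := fun p => PowerSeries.coeff p.1 W * _),
      ← Finset.sum_sub_distrib, Finset.smul_sum]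
    refine Finset.sum_congr rfl fun x hx => ?_
    rw [Finset.HasAntidiagonal.mem_antidiagonal] at hx
    simp only [Prod.fst_swap, Prod.snd_swap]
    rw [PowerSeries.coeff_mk, PowerSeries.coeff_mk, mul_smul_comm, smul_mul_assoc, ← smul_sub, hP,
      ← hx]
    split_ifs
    · rw [smul_smul, smul_smul, show p - ((x.1 + x.2 : ℕ) : ℤ) = p - x.2 - x.1 by push_cast; ring]
      congr 1
      ring
    · simp
  have key : q * PowerSeries.C (P p) - W * q = 0 := by
    refine eq_zero_of_eulerOp (A := A) ?_ ?_ ?_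
    · rw [PowerSeries.coeff_mk, h.a_zero]
    · rw [map_sub, PowerSeries.coeff_mul_C, PowerSeries.coeff_mul, Finset.Nat.antidiagonal_zero,
        Finset.sum_singleton, PowerSeries.coeff_mk, PowerSeries.coeff_mk, h.zero, ratioCoeff_zero]
      simp
    · rw [eulerOp_sub, eulerOp_mul_C, eulerOp_mul, hq, hW, ← mul_assoc W 2, e2]
      noncomm_ring
  have h1 := congrArg (PowerSeries.coeff k) (sub_eq_zero.mp key)
  rw [PowerSeries.coeff_mul_C, PowerSeries.coeff_mk, PowerSeries.coeff_mul] at h1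
  rw [h1]
  refine Finset.sum_congr rfl fun x _ => ?_
  rw [PowerSeries.coeff_mk, PowerSeries.coeff_mk, smul_mul_assoc]

/-- The exponential `Q(-y)` is inverse to `Q(y)`. -/
theorem inverse (h : IsExp a Q) : PowerSeries.mk Q *
    PowerSeries.mk (fun n => (-1 : ℂ) ^ n • Q n) = 1 ∧
    eulerOp (PowerSeries.mk (fun n => (-1 : ℂ) ^ n • Q n)) =
      -(2 * (PowerSeries.mk a * PowerSeries.mk (fun n => (-1 : ℂ) ^ n • Q n))) := by
  let q := PowerSeries.mk Q
  let q' := PowerSeries.mk (fun n => (-1 : ℂ) ^ n • Q n)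
  let A := PowerSeries.mk a
  have hq : eulerOp q = 2 * (A * q) := h.eulerOp_mk
  have hq' : eulerOp q' = -(2 * (A * q')) := by
    ext n
    rw [coeff_eulerOp, PowerSeries.coeff_mk, smul_comm, h.recursion, two_mul, map_neg, map_add,
      ← two_smul ℂ, PowerSeries.coeff_mul, ← Finset.smul_sum, smul_comm, ← smul_neg]
    congr 1
    rw [← Finset.Nat.sum_antidiagonal_swap, Finset.smul_sum, ← Finset.sum_neg_distrib]
    refine Finset.sum_congr rfl fun x hx => ?_
    rw [Finset.HasAntidiagonal.mem_antidiagonal] at hx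
    simp only [Prod.fst_swap, Prod.snd_swap]
    rw [PowerSeries.coeff_mk, PowerSeries.coeff_mk, ← h.commute_a, mul_smul_comm, ← hx, pow_add,
      mul_smul]
    by_cases ho : Odd x.1
    · rw [ho.neg_one_pow, neg_one_smul]
    · rw [h.even _ ho]; simp
  have hA : ∀ n, PowerSeries.coeff n (A * q) = PowerSeries.coeff n (q * A) := fun n => by
    rw [PowerSeries.coeff_mul, PowerSeries.coeff_mul, ← Finset.Nat.sum_antidiagonal_swap]
    refine Finset.sum_congr rfl fun x _ => ?_
    simp only [Prod.fst_swap, Prod.snd_swap]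
    rw [PowerSeries.coeff_mk, PowerSeries.coeff_mk, h.commute_a]
  have hA' : A * q = q * A := PowerSeries.ext hA
  have key : q * q' - 1 = 0 := by
    refine eq_zero_of_eulerOp (A := 0) (map_zero _) ?_ ?_
    · rw [map_sub, PowerSeries.coeff_mul, Finset.Nat.antidiagonal_zero, Finset.sum_singleton,
        PowerSeries.coeff_mk, PowerSeries.coeff_mk, h.zero]
      simp
    · rw [eulerOp_sub, eulerOp_one, eulerOp_mul, hq, hq', hA']
      have e2 : ∀ f : PowerSeries R, f * 2 = 2 * f := fun f => by rw [mul_two, two_mul]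
      rw [mul_neg, ← mul_assoc q 2, e2]
      noncomm_ring
  exact ⟨sub_eq_zero.mp key, hq'⟩

theorem sum_inverse (h : IsExp a Q) (n : ℕ) :
    ∑ x ∈ Finset.HasAntidiagonal.antidiagonal n, (-1 : ℂ) ^ x.2 • (Q x.1 * Q x.2) =
      if n = 0 then 1 else 0 := by
  have h1 := congrArg (PowerSeries.coeff n) h.inverse.1
  rw [PowerSeries.coeff_mul, PowerSeries.coeff_one] at h1
  rw [← h1]
  refine Finset.sum_congr rfl fun x _ => ?_
  rw [PowerSeries.coeff_mk, PowerSeries.coeff_mk, mul_smul_comm]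

theorem sum_inverse_euler (h : IsExp a Q) (n : ℕ) :
    ∑ x ∈ Finset.HasAntidiagonal.antidiagonal n,
      ((-1 : ℂ) ^ x.2 * x.2) • (Q x.1 * Q x.2) = (-2 : ℂ) • a n := by
  let q := PowerSeries.mk Q
  let q' := PowerSeries.mk (fun n => (-1 : ℂ) ^ n • Q n)
  let A := PowerSeries.mk a
  have hA' : q * A = A * q := by
    ext n
    rw [PowerSeries.coeff_mul, PowerSeries.coeff_mul, ← Finset.Nat.sum_antidiagonal_swap]
    refine Finset.sum_congr rfl fun x _ => ?_
    simp only [Prod.fst_swap, Prod.snd_swap]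
    rw [PowerSeries.coeff_mk, PowerSeries.coeff_mk, h.commute_a]
  have e2 : ∀ f : PowerSeries R, f * 2 = 2 * f := fun f => by rw [mul_two, two_mul]
  have h1 : q * eulerOp q' = -(2 * A) := by
    rw [h.inverse.2, mul_neg, ← mul_assoc q 2, e2, mul_assoc 2, ← mul_assoc q, hA', mul_assoc A,
      h.inverse.1, mul_one]
  have h2 := congrArg (PowerSeries.coeff n) h1
  rw [PowerSeries.coeff_mul, map_neg, two_mul, map_add, PowerSeries.coeff_mk, ← two_smul ℂ,
    ← neg_smul] at h2
  rw [← h2]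
  refine Finset.sum_congr rfl fun x _ => ?_
  rw [coeff_eulerOp, PowerSeries.coeff_mk, PowerSeries.coeff_mk, smul_smul, mul_smul_comm, mul_comm]

end IsExp
end IsExp


/-! ### Products of twisted vertex operators -/

/-- Families of Heisenberg operators `a_{-k}`, `a_k` (`k > 0` odd), together with their exponentials
`P` (of the creation operators) and `Q` (of the annihilation operators), on a space on which the
exponentials of the annihilation operators are locally finite. -/
structure VertexSystem (I V : Type*) [AddCommGroup V] [Module ℂ V] where
  /-- The creation operators. -/
  am : I → ℕ → Module.End ℂ V
  /-- The annihilation operators. -/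
  ap : I → ℕ → Module.End ℂ V
  /-- The exponentials of the creation operators. -/
  P : I → ℕ → Module.End ℂ V
  /-- The exponentials of the annihilation operators. -/
  Q : I → ℕ → Module.End ℂ V
  /-- The form giving the commutators. -/
  B : I → I → ℤ
  B_symm : ∀ i j, B i j = B j i
  isExp_am : ∀ i, IsExp (am i) (P i)
  isExp_ap : ∀ i, IsExp (ap i) (Q i)
  am_comm : ∀ i j k l, am i k * am j l = am j l * am i k
  ap_comm : ∀ i j k l, ap i k * ap j l = ap j l * ap i k
  ap_am : ∀ i j k l, ap i k * am j l - am j l * ap i k =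
    (if k = l ∧ Odd k then (k : ℂ) / 2 * (B i j : ℂ) else 0) • 1
  locally_finite : ∀ v, ∃ N, ∀ i n, N < n → Q i n v = 0

namespace VertexSystem
variable {I V : Type*} [AddCommGroup V] [Module ℂ V] (W : VertexSystem I V)

/-- The operators `P`, extended by zero to negative indices. -/
def Pz (i : I) (p : ℤ) : Module.End ℂ V := if 0 ≤ p then W.P i p.toNat else 0

/-- The operators `Q`, extended by zero to negative indices. -/
def Qz (i : I) (p : ℤ) : Module.End ℂ V := if 0 ≤ p then W.Q i p.toNat else 0

/-- The Heisenberg operators `a_m`, `m ∈ ℤ`, which vanish for even `m`. -/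
def az (i : I) (m : ℤ) : Module.End ℂ V := if 0 ≤ m then W.ap i m.toNat else W.am i (-m).toNat

theorem Pz_of_neg {i : I} {p : ℤ} (hp : p < 0) : W.Pz i p = 0 := if_neg (by omega)

theorem Qz_of_neg {i : I} {p : ℤ} (hp : p < 0) : W.Qz i p = 0 := if_neg (by omega)

theorem Pz_natCast (i : I) (n : ℕ) : W.Pz i n = W.P i n := by simp [Pz]

theorem Qz_natCast (i : I) (n : ℕ) : W.Qz i n = W.Q i n := by simp [Qz]

theorem P_comm (i j : I) (m n : ℕ) : W.P i m * W.P j n = W.P j n * W.P i m :=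
  (W.isExp_am j).commute (fun k => ((W.isExp_am i).commute (fun l => W.am_comm j i k l) m).symm) n

theorem Q_comm (i j : I) (m n : ℕ) : W.Q i m * W.Q j n = W.Q j n * W.Q i m :=
  (W.isExp_ap j).commute (fun k => ((W.isExp_ap i).commute (fun l => W.ap_comm j i k l) m).symm) n

theorem Pz_comm (i j : I) (p q : ℤ) : W.Pz i p * W.Pz j q = W.Pz j q * W.Pz i p := by
  unfold Pz
  split_ifs <;> simp [W.P_comm i j]

theorem Qz_comm (i j : I) (p q : ℤ) : W.Qz i p * W.Qz j q = W.Qz j q * W.Qz i p := by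
  unfold Qz
  split_ifs <;> simp [W.Q_comm i j]

theorem am_Pz (i j : I) (k : ℕ) (p : ℤ) : W.am i k * W.Pz j p = W.Pz j p * W.am i k := by
  unfold Pz
  split_ifs
  · exact (W.isExp_am j).commute (fun l => W.am_comm i j k l) _
  · simp

theorem ap_Qz (i j : I) (k : ℕ) (p : ℤ) : W.ap i k * W.Qz j p = W.Qz j p * W.ap i k := by
  unfold Qz
  split_ifs
  · exact (W.isExp_ap j).commute (fun l => W.ap_comm i j k l) _
  · simp

theorem ap_Pz (i j : I) (k : ℕ) (p : ℤ) : W.ap i k * W.Pz j p - W.Pz j p * W.ap i k =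
    if Odd k then (W.B i j : ℂ) • W.Pz j (p - k) else 0 := by
  by_cases hk : Odd k
  · have h := (W.isExp_am j).bracket (u := W.ap i k) (b := W.B i j) hk.pos (fun l => by
      rw [W.ap_am]
      simp only [hk, and_true])
    rw [if_pos hk]
    by_cases hp : 0 ≤ p
    · obtain ⟨n, rfl⟩ := Int.eq_ofNat_of_zero_le hp
      rw [Pz_natCast, h]
      by_cases hn : k ≤ n
      · obtain ⟨m, rfl⟩ := Nat.exists_eq_add_of_le hn
        rw [if_pos hn, Nat.add_sub_cancel_left, Nat.cast_add, add_sub_cancel_left, Pz_natCast]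
      · rw [if_neg hn, Pz_of_neg _ (by omega), smul_zero]
    · rw [Pz_of_neg _ (by omega), Pz_of_neg _ (by omega)]; simp
  · rw [if_neg hk, (W.isExp_ap i).even k hk]; simp

theorem am_Qz (i j : I) (k : ℕ) (p : ℤ) : W.am i k * W.Qz j p - W.Qz j p * W.am i k =
    if Odd k then (-(W.B i j : ℂ)) • W.Qz j (p - k) else 0 := by
  by_cases hk : Odd k
  · have h := (W.isExp_ap j).bracket (u := W.am i k) (b := -W.B i j) hk.pos (fun l => by
      have h1 := W.ap_am j i l k
      rw [W.B_symm j i] at h1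
      rw [← neg_sub, h1, ← neg_smul]
      congr 1
      by_cases hkl : k = l
      · subst hkl
        rw [if_pos ⟨rfl, hk⟩, if_pos rfl]; ring
      · rw [if_neg hkl, if_neg (fun h' : l = k ∧ Odd l => hkl h'.1.symm), neg_zero])
    rw [if_pos hk]
    by_cases hp : 0 ≤ p
    · obtain ⟨n, rfl⟩ := Int.eq_ofNat_of_zero_le hp
      rw [Qz_natCast, h]
      by_cases hn : k ≤ n
      · obtain ⟨m, rfl⟩ := Nat.exists_eq_add_of_le hn
        rw [if_pos hn, Nat.add_sub_cancel_left, Nat.cast_add, add_sub_cancel_left, Qz_natCast]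
      · rw [if_neg hn, Qz_of_neg _ (by omega), smul_zero]
    · rw [Qz_of_neg _ (by omega), Qz_of_neg _ (by omega)]; simp
  · rw [if_neg hk, (W.isExp_am i).even k hk]; simp

/-- Exchange of the exponentials of annihilation and creation operators. The coefficients are those of
`((1 + t) / (1 - t)) ^ B i j`. -/
theorem Qz_Pz (i j : I) (k p : ℤ) (w : V) : W.Qz i k (W.Pz j p w) = ∑ᶠ r : ℤ,
    (if 0 ≤ r then ratioCoeff (W.B i j) r.toNat else 0) • W.Pz j (p - r) (W.Qz i (k - r) w) := by
  by_cases hk : 0 ≤ k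
  · obtain ⟨n, rfl⟩ := Int.eq_ofNat_of_zero_le hk
    have h := (W.isExp_ap i).exchange (P := W.Pz j) (b := W.B i j) (W.ap_Pz i j) n p
    have h1 := LinearMap.congr_fun h w
    rw [Qz_natCast]
    refine h1.trans ?_
    rw [LinearMap.sum_apply, Finset.Nat.sum_antidiagonal_eq_sum_range_succ_mk]
    have hs : (Function.support fun r : ℤ => (if 0 ≤ r then ratioCoeff (W.B i j) r.toNat else 0) •
        W.Pz j (p - r) (W.Qz i (n - r) w)) ⊆
        (((Finset.range (n + 1)).map Nat.castEmbedding : Finset ℤ) : Set ℤ) := by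
      intro r hr
      by_contra h0
      refine hr ?_
      beta_reduce
      by_cases h1 : 0 ≤ r
      · obtain ⟨m, rfl⟩ := Int.eq_ofNat_of_zero_le h1
        have h2 : ¬ m ≤ n := fun h2 => h0 (by
          rw [Finset.mem_coe, Finset.mem_map]
          exact ⟨m, Finset.mem_range.mpr (by omega), rfl⟩)
        rw [Qz_of_neg W (by omega)]; simp
      · rw [if_neg h1, zero_smul]
    rw [finsum_eq_sum_of_support_subset _ hs, Finset.sum_map]
    refine Finset.sum_congr rfl fun r hr => ?_
    have hr' : r ≤ n := by have := Finset.mem_range.mp hr; omega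
    have e : (n : ℤ) - (Nat.castEmbedding r : ℤ) = ((n - r : ℕ) : ℤ) := by
      rw [Nat.castEmbedding_apply]; omega
    rw [e, Qz_natCast, Nat.castEmbedding_apply, if_pos (by omega), Int.toNat_natCast]
    rfl
  · rw [Qz_of_neg W (by omega), LinearMap.zero_apply, finsum_eq_zero_of_forall_eq_zero]
    intro r
    by_cases h1 : 0 ≤ r
    · rw [Qz_of_neg W (by omega)]; simp
    · rw [if_neg h1, zero_smul]

theorem finite_support_of_imp {α M N : Type*} [Zero M] [Zero N] {f : α → M} {g : α → N}
    (hf : (Function.support f).Finite) (h : ∀ x, f x = 0 → g x = 0) :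
    (Function.support g).Finite :=
  hf.subset fun x hx h0 => hx (h x h0)

theorem exists_bound (v : V) : ∃ N : ℤ, ∀ i k, N < k → W.Qz i k v = 0 := by
  obtain ⟨N, hN⟩ := W.locally_finite v
  refine ⟨N, fun i k hk => ?_⟩
  rw [Qz, if_pos (by omega), hN i k.toNat (by omega)]

/-- The summands of a component of a vertex operator applied to a vector. -/
def summand (i : I) (n : ℤ) (v : V) (k : ℤ) : V := (-1 : ℂ) ^ k • W.Pz i (k - n) (W.Qz i k v)

theorem summand_finite (i : I) (n : ℤ) (v : V) : (Function.support (W.summand i n v)).Finite := by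
  obtain ⟨N, hN⟩ := W.exists_bound v
  refine (Set.finite_Icc 0 N).subset fun k hk => ?_
  by_contra h
  refine hk ?_
  rw [Set.mem_Icc, not_and_or] at h
  rw [summand]
  rcases h with h | h
  · rw [Qz_of_neg W (by omega)]; simp
  · rw [hN i k (by omega)]; simp

/-- The component `X_n` of the twisted vertex operator `P(z) Q(-z⁻¹)`, the coefficient of
`z ^ (-n)`. -/
def X (i : I) (n : ℤ) : Module.End ℂ V where
  toFun v := ∑ᶠ k : ℤ, W.summand i n v k
  map_add' v w := by
    rw [← finsum_add_distrib (W.summand_finite i n v) (W.summand_finite i n w)]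
    refine finsum_congr fun k => ?_
    rw [summand, summand, summand, map_add, map_add, smul_add]
  map_smul' c v := by
    rw [RingHom.id_apply, smul_finsum' c (W.summand_finite i n v)]
    refine finsum_congr fun k => ?_
    rw [summand, summand, map_smul, map_smul, smul_comm]

theorem X_apply (i : I) (n : ℤ) (v : V) : W.X i n v = ∑ᶠ k : ℤ, W.summand i n v k := rfl

/-- Heisenberg operators act on the components of vertex operators by shifts. -/
theorem az_X (i j : I) {m : ℤ} (hm : Odd m) (n : ℤ) :
    W.az i m * W.X j n - W.X j n * W.az i m = (W.B i j : ℂ) • W.X j (n + m) := by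
  refine LinearMap.ext fun v => ?_
  rw [LinearMap.sub_apply, Module.End.mul_apply, Module.End.mul_apply, LinearMap.smul_apply, X_apply,
    X_apply, X_apply, map_finsum _ (W.summand_finite j n v),
    ← finsum_sub_distrib ((W.summand_finite j n v).subset fun k hk h => hk (by rw [h, map_zero]))
      (W.summand_finite j n _), smul_finsum' _ (W.summand_finite j _ v)]
  by_cases h0 : 0 ≤ m
  · obtain ⟨k, rfl⟩ := Int.eq_ofNat_of_zero_le h0
    have hk : Odd k := by exact_mod_cast hm
    refine finsum_congr fun r => ?_
    have h1 := LinearMap.congr_fun (W.ap_Pz i j k (r - n)) (W.Qz j r v)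
    have h2 := LinearMap.congr_fun (W.ap_Qz i j k r) v
    rw [if_pos hk] at h1
    simp only [LinearMap.sub_apply, Module.End.mul_apply, LinearMap.smul_apply] at h1 h2
    rw [summand, summand, summand, az, if_pos h0, Int.toNat_natCast, map_smul, ← smul_sub, ← h2, h1,
      smul_comm, sub_sub]
  · obtain ⟨k, rfl⟩ : ∃ k : ℕ, m = -k := ⟨(-m).toNat, by omega⟩
    have hk : Odd k := by
      have := hm.neg
      rw [neg_neg] at this
      exact_mod_cast this
    rw [← finsum_comp_equiv (Equiv.subRight (k : ℤ)) 
      (f := fun r => (W.B i j : ℂ) • W.summand j (n + -k) v r)]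
    refine finsum_congr fun r => ?_
    have h1 := LinearMap.congr_fun (W.am_Qz i j k r) v
    have h2 := fun w => LinearMap.congr_fun (W.am_Pz i j k (r - n)) w
    rw [if_pos hk] at h1
    simp only [LinearMap.sub_apply, Module.End.mul_apply, LinearMap.smul_apply] at h1 h2
    have hs : (-1 : ℂ) ^ (r - k) = -(-1) ^ r := by
      rw [zpow_sub₀ (by norm_num), zpow_natCast, hk.neg_one_pow, div_neg, div_one]
    rw [summand, summand, summand, az, if_neg h0, neg_neg, Int.toNat_natCast, map_smul, ← smul_sub,
      h2, ← map_sub, h1, Equiv.subRight_apply, hs, show r - (k : ℤ) - (n + -k) = r - n by ring,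
      map_smul, smul_smul, smul_smul]
    congr 1
    ring

/-- The summands of the product of two vertex operators of total degree `K`, in normal order. -/
def term (i j : I) (K : ℤ) (v : V) (t : ℤ × ℤ × ℤ) : V :=
  (-1 : ℂ) ^ (t.2.1 + t.2.2) • W.Pz i (t.2.1 - K + t.1) (W.Pz j (t.2.2 - t.1)
    (W.Qz i t.2.1 (W.Qz j t.2.2 v)))

theorem term_finite (i j : I) (K : ℤ) (v : V) : (Function.support (W.term i j K v)).Finite := by
  obtain ⟨N, hN⟩ := W.exists_bound v
  refine ((Set.finite_Icc (K - N) N).prod ((Set.finite_Icc 0 N).prod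
    (Set.finite_Icc 0 N))).subset fun t ht => ?_
  by_contra h
  refine ht ?_
  have hcomm := LinearMap.congr_fun (W.Qz_comm i j t.2.1 t.2.2) v
  have hcomm' := LinearMap.congr_fun (W.Pz_comm i j (t.2.1 - K + t.1) (t.2.2 - t.1))
    (W.Qz i t.2.1 (W.Qz j t.2.2 v))
  simp only [Module.End.mul_apply] at hcomm hcomm'
  by_cases h1 : N < t.2.1
  · rw [term, hcomm, hN i _ h1]; simp
  by_cases h2 : N < t.2.2
  · rw [term, hN j _ h2]; simp
  by_cases h3 : t.2.1 < 0
  · rw [term, Qz_of_neg W h3]; simp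
  by_cases h4 : t.2.2 < 0
  · rw [term, Qz_of_neg W h4]; simp
  by_cases h5 : t.2.2 - t.1 < 0
  · rw [term, Pz_of_neg W h5]; simp
  by_cases h6 : t.2.1 - K + t.1 < 0
  · rw [term, Pz_of_neg W h6]; simp
  exact absurd (by simp only [Set.mem_prod, Set.mem_Icc]; omega) h

theorem smul_term_finite (i j : I) (K : ℤ) (v : V) (c : ℤ × ℤ × ℤ → ℂ) :
    (Function.support fun t => c t • W.term i j K v t).Finite :=
  (W.term_finite i j K v).subset fun t ht h => ht (by beta_reduce; rw [h, smul_zero])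

/-- Normal ordering of the product of two components of vertex operators. -/
theorem X_X (i j : I) (n l : ℤ) (v : V) : W.X i n (W.X j l v) =
    ∑ᶠ t : ℤ × ℤ × ℤ, normalCoeff (W.B i j) (t.1 - l) • W.term i j (n + l) v t := by
  -- The annihilation degree `s` of the first factor to act, that of the second one `k`, and the number
  -- `r` of degrees lost in the exchange determine the index `(l + r, k - r, s)` of a normally ordered
  -- term.
  let e : ℤ × ℤ × ℤ ≃ ℤ × ℤ × ℤ :=
    { toFun := fun x => (l + x.2.2, x.2.1 - x.2.2, x.1)
      invFun := fun t => (t.2.2, t.2.1 + (t.1 - l), t.1 - l)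
      left_inv := fun x => by ext <;> simp
      right_inv := fun t => by ext <;> simp }
  have hfin := W.smul_term_finite i j (n + l) v fun t => normalCoeff (W.B i j) (t.1 - l)
  rw [← finsum_comp_equiv e, finsum_curry₃]
  rotate_left
  · exact hfin.preimage e.injective.injOn
  rw [X_apply W j, map_finsum _ (W.summand_finite j l v)]
  refine finsum_congr fun s => ?_
  rw [X_apply]
  refine finsum_congr fun k => ?_
  rw [summand, summand, map_smul, map_smul, Qz_Pz, smul_comm]
  have hf : (Function.support fun r : ℤ => (if 0 ≤ r then ratioCoeff (W.B i j) r.toNat else 0) •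
      W.Pz j (s - l - r) (W.Qz i (k - r) (W.Qz j s v))).Finite := by
    refine (Set.finite_Icc 0 k).subset fun r hr => ?_
    by_contra h
    refine hr ?_
    rw [Set.mem_Icc, not_and_or] at h
    beta_reduce
    rcases h with h | h
    · rw [if_neg h, zero_smul]
    · rw [Qz_of_neg W (by omega)]; simp
  rw [map_finsum _ hf, smul_finsum' _ (finite_support_of_imp hf fun r h => by rw [h, map_zero]),
    smul_finsum' _ (finite_support_of_imp hf fun r h => by rw [h, map_zero, smul_zero])]
  refine finsum_congr fun r => ?_
  change _ = normalCoeff (W.B i j) (l + r - l) • W.term i j (n + l) v (l + r, k - r, s)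
  rw [term, add_sub_cancel_left, normalCoeff, map_smul]
  by_cases h0 : 0 ≤ r
  · obtain ⟨p, rfl⟩ := Int.eq_ofNat_of_zero_le h0
    rw [if_pos h0, if_pos h0, Int.toNat_natCast, ratioCoeff_neg, smul_smul, smul_smul, smul_smul,
      show k - (p : ℤ) - (n + l) + (l + p) = k - n by ring, show s - (l + (p : ℤ)) = s - l - p by ring]
    congr 1
    have hp : (-1 : ℂ) ^ p * (-1) ^ p = 1 := by rw [← mul_pow]; norm_num
    have h1 : (-1 : ℂ) ^ (k - p + s) * (-1) ^ p = (-1) ^ k * (-1) ^ s := by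
      rw [← zpow_natCast, ← zpow_add₀ (by norm_num), ← zpow_add₀ (by norm_num)]
      congr 1; ring
    calc _ = (-1 : ℂ) ^ k * (-1) ^ s * ratioCoeff (W.B i j) p := by ring
      _ = _ := by rw [← h1]; ring
  · rw [if_neg h0, if_neg h0]; simp

theorem term_swap (i j : I) (K : ℤ) (v : V) (t : ℤ × ℤ × ℤ) :
    W.term j i K v (K - t.1, t.2.2, t.2.1) = W.term i j K v t := by
  have h1 := LinearMap.congr_fun (W.Qz_comm i j t.2.1 t.2.2) v
  have h2 := LinearMap.congr_fun (W.Pz_comm i j (t.2.1 - K + t.1) (t.2.2 - t.1))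
    (W.Qz i t.2.1 (W.Qz j t.2.2 v))
  simp only [Module.End.mul_apply] at h1 h2
  simp only [term]
  rw [h2, h1, add_comm t.2.2, show t.2.2 - K + (K - t.1) = t.2.2 - t.1 by ring,
    show t.2.1 - (K - t.1) = t.2.1 - K + t.1 by ring]

/-- The (signed) commutator of two vertex operators of fixed total degree is a sum of normally
ordered products, with coefficients in which the degrees enter only through an index shift. -/
theorem X_bracket (i j : I) (n l : ℤ) (v : V) :
    W.X i n (W.X j l v) - (-1 : ℂ) ^ W.B i j • W.X j l (W.X i n v) =
    ∑ᶠ t : ℤ × ℤ × ℤ, commCoeff (W.B i j) (t.1 - l) • W.term i j (n + l) v t := by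
  -- Normally ordered products do not depend on the order of the two factors, which exchanges the roles
  -- of the indices.
  let e : ℤ × ℤ × ℤ ≃ ℤ × ℤ × ℤ :=
    { toFun := fun t => (n + l - t.1, t.2.2, t.2.1)
      invFun := fun t => (n + l - t.1, t.2.2, t.2.1)
      left_inv := fun x => by ext <;> simp
      right_inv := fun t => by ext <;> simp }
  have hfin := (W.smul_term_finite j i (l + n) v fun t => normalCoeff (W.B j i) (t.1 - n)).preimage
      e.injective.injOn
  rw [X_X W j i, ← finsum_comp_equiv e
    (f := fun t => normalCoeff (W.B j i) (t.1 - n) • W.term j i (l + n) v t), X_X W i j,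
    smul_finsum' _ hfin, ← finsum_sub_distrib (W.smul_term_finite _ _ _ _ _)
      (finite_support_of_imp hfin fun t h => by
        beta_reduce at h ⊢
        rw [h, smul_zero])]
  refine finsum_congr fun t => ?_
  change _ - _ • normalCoeff (W.B j i) (n + l - t.1 - n) •
    W.term j i (l + n) v (n + l - t.1, t.2.2, t.2.1) = _
  rw [add_comm l n, term_swap, W.B_symm j i, smul_smul, ← sub_smul, commCoeff,
    show n + l - t.1 - n = -(t.1 - l) by ring]

/-- A linear combination of signed commutators of fixed total degree vanishes as soon as the
corresponding combinations of coefficients do. -/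
theorem sum_bracket_eq_zero (i j : I) (n l : ℤ) (N : ℕ) (c : ℕ → ℂ)
    (hc : ∀ p : ℤ, ∑ s ∈ Finset.range N, c s * commCoeff (W.B i j) (p + s) = 0) :
    ∑ s ∈ Finset.range N, c s • (W.X i (n + s) * W.X j (l - s) -
      (-1 : ℂ) ^ W.B i j • (W.X j (l - s) * W.X i (n + s))) = 0 := by
  refine LinearMap.ext fun v => ?_
  rw [LinearMap.sum_apply, LinearMap.zero_apply]
  have h1 : ∀ s ∈ Finset.range N, (c s • (W.X i (n + s) * W.X j (l - s) -
      (-1 : ℂ) ^ W.B i j • (W.X j (l - s) * W.X i (n + s)))) v =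
      ∑ᶠ t : ℤ × ℤ × ℤ, (c s * commCoeff (W.B i j) (t.1 - l + s)) • W.term i j (n + l) v t := by
    intro s _
    rw [LinearMap.smul_apply, LinearMap.sub_apply, LinearMap.smul_apply, Module.End.mul_apply,
      Module.End.mul_apply, X_bracket, smul_finsum' _ (W.smul_term_finite _ _ _ _ _)]
    refine finsum_congr fun t => ?_
    rw [smul_smul, show n + (s : ℤ) + (l - s) = n + l by ring,
      show t.1 - (l - (s : ℤ)) = t.1 - l + s by ring]
  rw [Finset.sum_congr rfl h1, ← finsum_sum_comm _ _ fun s _ => W.smul_term_finite _ _ _ _ _]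
  refine finsum_eq_zero_of_forall_eq_zero fun t => ?_
  rw [← Finset.sum_smul, hc, zero_smul]

end VertexSystem

namespace VertexSystem
variable {I V : Type*} [AddCommGroup V] [Module ℂ V] (W : VertexSystem I V)

/-! ### The commutators of vertex operators of one root -/

/-- The coefficients of the product of `∑ R n zⁿ` with `∑ c n R n zⁿ`, extended by zero. -/
def conv (R : ℕ → Module.End ℂ V) (c : ℤ → ℂ) (m : ℤ) : Module.End ℂ V :=
  if 0 ≤ m then ∑ x ∈ Finset.HasAntidiagonal.antidiagonal m.toNat, c x.2 • (R x.1 * R x.2) else 0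

theorem conv_finite {R : ℕ → Module.End ℂ V} {F : ℤ → Module.End ℂ V}
    (hF : ∀ p, F p = if 0 ≤ p then R p.toNat else 0) (c : ℤ → ℂ) (m : ℤ) (w : V) :
    (Function.support fun q => c q • F (m - q) (F q w)).Finite := by
  refine (Set.finite_Icc 0 m).subset fun q hq => ?_
  by_contra h
  refine hq ?_
  rw [Set.mem_Icc, not_and_or] at h
  beta_reduce
  rcases h with h | h
  · rw [hF q, if_neg h]; simp
  · rw [hF (m - q), if_neg (by omega)]; simp

theorem finsum_conv {R : ℕ → Module.End ℂ V} {F : ℤ → Module.End ℂ V}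
    (hF : ∀ p, F p = if 0 ≤ p then R p.toNat else 0) (c : ℤ → ℂ) (m : ℤ) (w : V) :
    ∑ᶠ q : ℤ, c q • F (m - q) (F q w) = conv R c m w := by
  by_cases hm : 0 ≤ m
  · obtain ⟨n, rfl⟩ := Int.eq_ofNat_of_zero_le hm
    rw [conv, if_pos hm, LinearMap.sum_apply, Int.toNat_natCast,
      ← Finset.Nat.sum_antidiagonal_swap, Finset.Nat.sum_antidiagonal_eq_sum_range_succ_mk]
    have hs : (Function.support fun q : ℤ => c q • F (n - q) (F q w)) ⊆
        (((Finset.range (n + 1)).map Nat.castEmbedding : Finset ℤ) : Set ℤ) := by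
      intro q hq
      by_contra h0
      refine hq ?_
      beta_reduce
      by_cases h1 : 0 ≤ q
      · obtain ⟨p, rfl⟩ := Int.eq_ofNat_of_zero_le h1
        have h2 : ¬ p ≤ n := fun h2 => h0 (by
          rw [Finset.mem_coe, Finset.mem_map]
          exact ⟨p, Finset.mem_range.mpr (by omega), rfl⟩)
        rw [hF (n - p), if_neg (by omega)]; simp
      · rw [hF q, if_neg h1]; simp
    rw [finsum_eq_sum_of_support_subset _ hs, Finset.sum_map]
    refine Finset.sum_congr rfl fun r hr => ?_
    have hr' : r ≤ n := by have := Finset.mem_range.mp hr; omega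
    have e : (n : ℤ) - (Nat.castEmbedding r : ℤ) = ((n - r : ℕ) : ℤ) := by
      rw [Nat.castEmbedding_apply]; omega
    rw [e, hF, hF, Nat.castEmbedding_apply, if_pos (by omega), if_pos (by omega), Int.toNat_natCast,
      Int.toNat_natCast]
    rfl
  · rw [conv, if_neg hm, LinearMap.zero_apply]
    refine finsum_eq_zero_of_forall_eq_zero fun q => ?_
    by_cases h1 : 0 ≤ q
    · rw [hF (m - q), if_neg (by omega)]; simp
    · rw [hF q, if_neg h1]; simp

theorem conv_sign {a R : ℕ → Module.End ℂ V} (h : IsExp a R) (m : ℤ) :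
    conv R (fun q => (-1) ^ q) m = if m = 0 then 1 else 0 := by
  by_cases hm : 0 ≤ m
  · obtain ⟨n, rfl⟩ := Int.eq_ofNat_of_zero_le hm
    rw [conv, if_pos hm, Int.toNat_natCast]
    refine Eq.trans ?_ ((h.sum_inverse n).trans ?_)
    · exact Finset.sum_congr rfl fun x _ => by rw [zpow_natCast]
    · simp
  · rw [conv, if_neg hm, if_neg (by omega)]

theorem conv_sign_euler {a R : ℕ → Module.End ℂ V} (h : IsExp a R) (m : ℤ) :
    conv R (fun q => (-1) ^ q * q) m = if 0 ≤ m then (-2 : ℂ) • a m.toNat else 0 := by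
  by_cases hm : 0 ≤ m
  · obtain ⟨n, rfl⟩ := Int.eq_ofNat_of_zero_le hm
    rw [conv, if_pos hm, if_pos hm, Int.toNat_natCast]
    refine Eq.trans ?_ (h.sum_inverse_euler n)
    exact Finset.sum_congr rfl fun x _ => by rw [zpow_natCast, Int.cast_natCast]
  · rw [conv, if_neg hm, if_neg hm]

/-- After reindexing by the total degree `M` of the annihilation part, a weighted sum of normally
ordered products of two vertex operators of the same root factors. -/
theorem finsum_term (i : I) (K : ℤ) (v : V) (c d : ℤ → ℂ) :
    ∑ᶠ t : ℤ × ℤ × ℤ, (c (t.2.2 - t.1) * d t.2.2) • W.term i i K v t =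
      ∑ᶠ M : ℤ, (-1 : ℂ) ^ M • conv (W.P i) c (M - K) (conv (W.Q i) d M v) := by
  -- With `p = q - t.1` and `M` the total degree of the two annihilation parts.
  let e : ℤ × ℤ × ℤ ≃ ℤ × ℤ × ℤ :=
    { toFun := fun x => (x.2.2 - x.2.1, x.1 - x.2.2, x.2.2)
      invFun := fun t => (t.2.1 + t.2.2, t.2.2 - t.1, t.2.2)
      left_inv := fun x => by ext <;> simp
      right_inv := fun t => by ext <;> simp }
  rw [← finsum_comp_equiv e, finsum_curry₃]
  rotate_left
  · exact (W.smul_term_finite i i K v fun t => c (t.2.2 - t.1) * d t.2.2).preimage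
      e.injective.injOn
  refine finsum_congr fun M => ?_
  have hQ := conv_finite (R := W.Q i) (F := W.Qz i) (fun p => rfl) d M v
  rw [← finsum_conv (F := W.Pz i) (fun p => rfl), ← finsum_conv (F := W.Qz i) (fun p => rfl),
    smul_finsum' _ (conv_finite (R := W.P i) (F := W.Pz i) (fun p => rfl) _ _ _)]
  refine finsum_congr fun p => ?_
  rw [map_finsum _ hQ, map_finsum _ (finite_support_of_imp hQ fun q h => by rw [h, map_zero]),
    smul_finsum' _ (finite_support_of_imp hQ fun q h => by rw [h, map_zero, map_zero]),
    smul_finsum' _ (finite_support_of_imp hQ fun q h => by rw [h, map_zero, map_zero, smul_zero])]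
  refine finsum_congr fun q => ?_
  change (c (q - (q - p)) * d q) • W.term i i K v (q - p, M - q, q) = _
  simp only [term]
  rw [map_smul, map_smul, smul_smul, smul_smul, smul_smul, sub_sub_cancel, sub_add_cancel,
    show M - q - K + (q - p) = M - K - p by ring]
  congr 1
  ring

theorem finsum_sign_term (i : I) (K : ℤ) (v : V) :
    ∑ᶠ t : ℤ × ℤ × ℤ, (-1 : ℂ) ^ t.1 • W.term i i K v t = if K = 0 then v else 0 := by
  have h := W.finsum_term i K v (fun q => (-1) ^ q) (fun q => (-1) ^ q)
  have h1 : ∀ t : ℤ × ℤ × ℤ, (-1 : ℂ) ^ (t.2.2 - t.1) * (-1) ^ t.2.2 = (-1) ^ t.1 := fun t => by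
    rw [← zpow_add₀ (by norm_num), show t.2.2 - t.1 + t.2.2 = 2 * t.2.2 + -t.1 by ring,
      zpow_add₀ (by norm_num), zpow_mul, zpow_neg, ← inv_zpow]
    norm_num
  simp only [h1] at h
  rw [h, finsum_eq_single _ 0]
  · rw [conv_sign (W.isExp_ap i), conv_sign (W.isExp_am i), if_pos rfl]
    by_cases hK : K = 0
    · subst hK; simp
    · rw [if_neg (by omega), if_neg hK]; simp
  · intro M hM
    rw [conv_sign (W.isExp_ap i), if_neg hM]; simp

theorem finsum_sign_euler_term (i : I) (K : ℤ) (v : V) :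
    ∑ᶠ t : ℤ × ℤ × ℤ, ((-1 : ℂ) ^ t.1 * t.1) • W.term i i K v t = (2 : ℂ) • W.az i K v := by
  have h := W.finsum_term i K v (fun q => (-1) ^ q) (fun q => (-1) ^ q * q)
  have h' := W.finsum_term i K v (fun q => (-1) ^ q * q) (fun q => (-1) ^ q)
  have h1 : ∀ t : ℤ × ℤ × ℤ, (-1 : ℂ) ^ (t.2.2 - t.1) * (-1) ^ t.2.2 = (-1) ^ t.1 := fun t => by
    rw [← zpow_add₀ (by norm_num), show t.2.2 - t.1 + t.2.2 = 2 * t.2.2 + -t.1 by ring,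
      zpow_add₀ (by norm_num), zpow_mul, zpow_neg, ← inv_zpow]
    norm_num
  -- Splitting `t.1` as `t.2.2 - (t.2.2 - t.1)` puts the Euler factor on the annihilation part, or on
  -- the creation part.
  have h2 : ∀ t : ℤ × ℤ × ℤ, ((-1 : ℂ) ^ t.1 * t.1) • W.term i i K v t =
      ((-1 : ℂ) ^ (t.2.2 - t.1) * ((-1) ^ t.2.2 * (t.2.2 : ℂ))) • W.term i i K v t -
      ((-1 : ℂ) ^ (t.2.2 - t.1) * ((t.2.2 - t.1 : ℤ) : ℂ) * (-1) ^ t.2.2) • W.term i i K v t := by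
    intro t
    rw [← sub_smul]
    congr 1
    rw [← h1 t]
    push_cast
    ring
  rw [finsum_congr h2, finsum_sub_distrib (W.smul_term_finite _ _ _ _ _)
    (W.smul_term_finite _ _ _ _ _), h, h', finsum_eq_single _ K, finsum_eq_single _ 0]
  · rw [conv_sign (W.isExp_ap i), conv_sign (W.isExp_am i), conv_sign_euler (W.isExp_ap i),
      conv_sign_euler (W.isExp_am i), if_pos rfl, if_pos (sub_self K), zero_sub, zpow_zero, one_smul,
      Module.End.one_apply, Module.End.one_apply, az]
    by_cases hK : 0 ≤ K
    · obtain ⟨n, rfl⟩ := Int.eq_ofNat_of_zero_le hK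
      rw [if_pos hK, if_pos hK, Int.toNat_natCast, zpow_natCast]
      have h3 : (if 0 ≤ -(n : ℤ) then (-2 : ℂ) • W.am i (-(n : ℤ)).toNat else 0) = 0 := by
        split_ifs with h0
        · obtain rfl : n = 0 := by omega
          simp [(W.isExp_am i).a_zero]
        · rfl
      rw [h3, LinearMap.zero_apply, sub_zero, LinearMap.smul_apply, smul_smul]
      by_cases hn : Odd n
      · rw [hn.neg_one_pow]; norm_num
      · rw [(W.isExp_ap i).even n hn]; simp
    · rw [if_neg hK, if_neg hK, if_pos (by omega), LinearMap.zero_apply, smul_zero, zero_sub,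
        LinearMap.smul_apply, neg_smul, neg_neg]
  · intro M hM
    rw [conv_sign (W.isExp_ap i), if_neg hM]; simp
  · intro M hM
    rw [conv_sign (W.isExp_am i), if_neg (by omega)]; simp

/-- Components of the vertex operator of a root of norm two have Heisenberg operators as their
commutators. -/
theorem X_X_self {i : I} (hi : W.B i i = 2) (n l : ℤ) :
    W.X i n * W.X i l - W.X i l * W.X i n = ((-1 : ℂ) ^ l * 8) • (W.az i (n + l) +
      (if n = -l then (n : ℂ) / 2 else 0) • 1) := by
  refine LinearMap.ext fun v => ?_
  have h := W.X_bracket i i n l v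
  rw [hi, show (-1 : ℂ) ^ (2 : ℤ) = 1 by norm_num, one_smul] at h
  have h1 : ∀ t : ℤ × ℤ × ℤ, commCoeff 2 (t.1 - l) • W.term i i (n + l) v t =
      (4 * (-1 : ℂ) ^ l) • ((-1 : ℂ) ^ t.1 * t.1) • W.term i i (n + l) v t -
      (4 * (-1 : ℂ) ^ l * l) • (-1 : ℂ) ^ t.1 • W.term i i (n + l) v t := by
    intro t
    rw [commCoeff_two, smul_smul, smul_smul, ← sub_smul, zpow_sub₀ (by norm_num),
      div_eq_mul_inv, ← inv_zpow, show (-1 : ℂ)⁻¹ = -1 by norm_num]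
    congr 1
    push_cast
    ring
  have hf1 := W.smul_term_finite i i (n + l) v fun t => (-1 : ℂ) ^ t.1 * t.1
  have hf2 := W.smul_term_finite i i (n + l) v fun t => (-1 : ℂ) ^ t.1
  rw [finsum_congr h1, finsum_sub_distrib
    (finite_support_of_imp hf1 fun t h => by rw [h, smul_zero])
    (finite_support_of_imp hf2 fun t h => by rw [h, smul_zero]), ← smul_finsum' _ hf1,
    ← smul_finsum' _ hf2, finsum_sign_term, finsum_sign_euler_term] at h
  rw [LinearMap.sub_apply, Module.End.mul_apply, Module.End.mul_apply, h, LinearMap.smul_apply,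
    LinearMap.add_apply, LinearMap.smul_apply, Module.End.one_apply, smul_add, smul_smul, smul_smul,
    sub_eq_add_neg]
  congr 1
  · congr 1; ring
  · by_cases hn : n = -l
    · rw [if_pos (by omega), if_pos hn, ← neg_smul, hn]
      congr 1
      push_cast
      ring
    · rw [if_neg (by omega), if_neg hn]; simp

/-- The Heisenberg relations. -/
theorem az_az (i j : I) {m : ℤ} (hm : Odd m) (l : ℤ) :
    W.az i m * W.az j l - W.az j l * W.az i m =
      (if m = -l then (m : ℂ) / 2 * (W.B i j : ℂ) else 0) • 1 := by
  have hodd : ∀ k : ℕ, (m = k ∨ m = -k) → Odd k := by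
    rintro k (rfl | rfl)
    · exact_mod_cast hm
    · have := hm.neg
      rw [neg_neg] at this
      exact_mod_cast this
  by_cases h1 : 0 ≤ m <;> by_cases h2 : 0 ≤ l
  · rw [az, az, if_pos h1, if_pos h2, W.ap_comm, sub_self, if_neg, zero_smul]
    rintro rfl
    obtain rfl : l = 0 := by omega
    exact absurd hm (by decide)
  · obtain ⟨k, rfl⟩ := Int.eq_ofNat_of_zero_le h1
    obtain ⟨q, rfl⟩ : ∃ q : ℕ, l = -q := ⟨(-l).toNat, by omega⟩
    rw [az, az, if_pos h1, if_neg h2, W.ap_am, neg_neg, Int.toNat_natCast, Int.toNat_natCast]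
    congr 1
    refine if_congr ?_ rfl rfl
    rw [Nat.cast_inj]
    exact and_iff_left (hodd k (Or.inl rfl))
  · obtain ⟨k, rfl⟩ : ∃ q : ℕ, m = -q := ⟨(-m).toNat, by omega⟩
    obtain ⟨q, rfl⟩ := Int.eq_ofNat_of_zero_le h2
    rw [az, az, if_neg h1, if_pos h2, neg_neg, Int.toNat_natCast, Int.toNat_natCast, ← neg_sub,
      W.ap_am, ← neg_smul, W.B_symm j i]
    congr 1
    by_cases h : q = k
    · subst h
      rw [if_pos ⟨rfl, hodd q (Or.inr rfl)⟩, if_pos rfl]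
      push_cast
      ring
    · rw [if_neg fun h' => h h'.1, if_neg (by omega), neg_zero]
  · rw [az, az, if_neg h1, if_neg h2, W.am_comm, sub_self, if_neg (by omega), zero_smul]

end VertexSystem


/-! ### The McKay matrix -/

section SpecialLinear

open Matrix

variable {Γ : Subgroup (SpecialLinearGroup (Fin 2) ℂ)}

/-- The matrix of an element of `Γ`. -/
def toMat (x : Γ) : Matrix (Fin 2) (Fin 2) ℂ := (x : SpecialLinearGroup (Fin 2) ℂ).1

theorem toMat_one : toMat (1 : Γ) = 1 := rfl

theorem toMat_mul (x y : Γ) : toMat (x * y) = toMat x * toMat y := rfl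

theorem toMat_pow (x : Γ) (n : ℕ) : toMat (x ^ n) = toMat x ^ n := by
  induction n with
  | zero => rfl
  | succ n ih => rw [pow_succ, toMat_mul, ih, pow_succ]

theorem toMat_injective : Function.Injective (toMat : Γ → Matrix (Fin 2) (Fin 2) ℂ) :=
  fun _ _ h => Subtype.ext (Subtype.ext h)

theorem det_toMat (x : Γ) : (toMat x).det = 1 := (x : SpecialLinearGroup (Fin 2) ℂ).2

theorem mcKay_apply (x : Γ) : (mcKay Γ).1 x = 2 - (toMat x).trace := rfl

theorem trace_toMat_inv (x : Γ) : (toMat x⁻¹).trace = (toMat x).trace := by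
  have h : toMat x⁻¹ = (toMat x).adjugate :=
    Matrix.SpecialLinearGroup.coe_inv (x : SpecialLinearGroup (Fin 2) ℂ)
  rw [h, adjugate_fin_two, trace_fin_two, trace_fin_two]
  simp [add_comm]

/-- The Cayley–Hamilton identity for a matrix of determinant one. -/
theorem toMat_sq (x : Γ) : toMat x * toMat x = (toMat x).trace • toMat x - 1 := by
  have h := det_toMat x
  rw [det_fin_two] at h
  ext i j
  fin_cases i <;> fin_cases j <;>
    simp [Matrix.mul_apply, Fin.sum_univ_two, trace_fin_two] <;>
    first | ring1 | linear_combination -h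

theorem trace_sq (x : Γ) : (toMat x).trace * (toMat x).trace = (toMat (x * x)).trace + 2 := by
  rw [toMat_mul, toMat_sq, trace_sub, trace_smul, trace_one, smul_eq_mul]
  simp

/-- The defining two-dimensional representation. -/
def stdRep (Γ : Subgroup (SpecialLinearGroup (Fin 2) ℂ)) : Representation ℂ Γ (Fin 2 → ℂ) where
  toFun x := Matrix.toLin' (toMat x)
  map_one' := Matrix.toLin'_one
  map_mul' _ _ := Matrix.toLin'_mul _ _

theorem stdRep_character (x : Γ) : (stdRep Γ).character x = (toMat x).trace :=
  Matrix.trace_toLin'_eq _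

variable [Finite Γ]

/-- Elements of finite order are semisimple. -/
theorem eq_one_of_trace (x : Γ) (h : (toMat x).trace = 2) : x = 1 := by
  have hN : (toMat x - 1) * (toMat x - 1) = 0 := by
    rw [sub_mul, mul_sub, mul_sub, toMat_sq, h, mul_one, one_mul, mul_one, two_smul]
    abel
  have hp : ∀ n : ℕ, toMat x ^ n = 1 + (n : ℂ) • (toMat x - 1) := by
    intro n
    induction n with
    | zero => simp
    | succ n ih =>
      have : toMat x = 1 + (toMat x - 1) := by abel
      rw [pow_succ, ih]
      nth_rewrite 2 [this]
      rw [mul_add, mul_one, add_mul _ _ (toMat x - 1), smul_mul_assoc, hN, smul_zero, one_mul, add_zero,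
        Nat.cast_succ, add_smul, one_smul, add_assoc]
  have h1 := hp (orderOf x)
  rw [← toMat_pow, pow_orderOf_eq_one, toMat_one, left_eq_add, smul_eq_zero] at h1
  rcases h1 with h1 | h1
  · exact absurd (Nat.cast_eq_zero.mp h1) (orderOf_pos x).ne'
  · exact toMat_injective (sub_eq_zero.mp h1)

/-- A nontrivial finite subgroup of `SL₂(ℂ)` has no invariant vectors. -/
theorem sum_trace_eq_zero [Fintype Γ] [Nontrivial Γ] : ∑ x : Γ, (toMat x).trace = 0 := by
  obtain ⟨x, hx⟩ := exists_ne (1 : Γ)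
  -- The sum is fixed by multiplication by `x`, and `x - 1` is invertible since `tr x ≠ 2`.
  have h1 : (toMat x - 1) * ∑ y : Γ, toMat y = 0 := by
    rw [sub_mul, one_mul, Finset.mul_sum, sub_eq_zero]
    exact Fintype.sum_equiv (Equiv.mulLeft x) _ _ fun y => rfl
  have h2 : (toMat x - 1).det = 2 - (toMat x).trace := by
    have h := det_toMat x
    rw [det_fin_two] at h
    simp [det_fin_two, trace_fin_two]
    linear_combination h
  have h3 : IsUnit (toMat x - 1) := by
    rw [isUnit_iff_isUnit_det, h2, isUnit_iff_ne_zero, sub_ne_zero]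
    exact fun h => hx (eq_one_of_trace x h.symm)
  have h4 := (h3.mul_right_eq_zero).mp h1
  rw [← trace_sum, h4, trace_zero]

/-- The only element of order two in `SL₂(ℂ)` is the negative of the identity. -/
theorem odd_card_or_neg_one : Odd (Nat.card Γ) ∨ ∃ z : Γ, toMat z = -1 := by
  by_contra! h
  obtain ⟨h1, h2⟩ := h
  rw [Nat.not_odd_iff_even, even_iff_two_dvd] at h1
  have := Fact.mk Nat.prime_two
  obtain ⟨x, hx⟩ := exists_prime_orderOf_dvd_card' 2 h1
  have hx1 : x ≠ 1 := fun h => by rw [h, orderOf_one] at hx; omega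
  have h3 : toMat x * toMat x = 1 := by
    rw [← toMat_mul, ← pow_two, orderOf_dvd_iff_pow_eq_one.mp hx.dvd, toMat_one]
  have h4 := toMat_sq x
  rw [h3, eq_sub_iff_add_eq] at h4
  have h5 : (toMat x).trace * (toMat x).trace = 4 := by
    rw [trace_sq, toMat_mul, h3, trace_one]; norm_num
  have h6 : (toMat x).trace = -2 := by
    have : ((toMat x).trace - 2) * ((toMat x).trace + 2) = 0 := by linear_combination h5
    rcases mul_eq_zero.mp this with h | h
    · exact absurd (eq_one_of_trace x (sub_eq_zero.mp h)) hx1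
    · exact eq_neg_of_add_eq_zero_left h
  refine h2 x ?_
  rw [h6, ← two_smul ℂ, neg_smul, ← smul_neg] at h4
  rw [smul_right_injective _ (two_ne_zero (α := ℂ)) h4, neg_neg]

omit [Finite Γ] in
theorem commute_of_commute_nonscalar {T A B : Matrix (Fin 2) (Fin 2) ℂ}
    (hT : ∀ c : ℂ, T ≠ c • (1 : Matrix (Fin 2) (Fin 2) ℂ))
    (hA : A * T = T * A) (hB : B * T = T * B) : A * B = B * A := by
  have hT' : T 0 1 ≠ 0 ∨ T 1 0 ≠ 0 ∨ T 0 0 - T 1 1 ≠ 0 := by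
    by_contra! h
    refine hT (T 0 0) ?_
    ext i j
    fin_cases i <;> fin_cases j <;> simp [h.1, h.2.1, sub_eq_zero.mp h.2.2]
  -- Two matrices commute if and only if the vectors of their entries `M 0 1`, `M 1 0` and
  -- `M 0 0 - M 1 1` are parallel.
  have e : ∀ {M N : Matrix (Fin 2) (Fin 2) ℂ}, M * N = N * M ↔
      M 0 1 * N 1 0 = N 0 1 * M 1 0 ∧ (M 0 0 - M 1 1) * N 0 1 = (N 0 0 - N 1 1) * M 0 1 ∧
      (M 0 0 - M 1 1) * N 1 0 = (N 0 0 - N 1 1) * M 1 0 := by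
    intro M N
    rw [← Matrix.ext_iff]
    simp only [Fin.forall_fin_two, Matrix.mul_apply, Fin.sum_univ_two, Fin.isValue]
    constructor
    · rintro ⟨⟨h1, h2⟩, h3, h4⟩
      refine ⟨?_, ?_, ?_⟩
      · linear_combination h1
      · linear_combination h2
      · linear_combination -h3
    · rintro ⟨h1, h2, h3⟩
      refine ⟨⟨?_, ?_⟩, ?_, ?_⟩
      · linear_combination h1
      · linear_combination h2
      · linear_combination -h3
      · linear_combination -h1
  rw [e] at hA hB ⊢
  obtain ⟨a1, a2, a3⟩ := hA
  obtain ⟨b1, b2, b3⟩ := hB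
  rcases hT' with h | h | h
  · refine ⟨mul_left_cancel₀ h ?_, mul_left_cancel₀ h ?_, mul_left_cancel₀ h ?_⟩
    · linear_combination B 0 1 * a1 - A 0 1 * b1
    · linear_combination B 0 1 * a2 - A 0 1 * b2
    · grind
  · refine ⟨mul_left_cancel₀ h ?_, mul_left_cancel₀ h ?_, mul_left_cancel₀ h ?_⟩ <;> grind
  · refine ⟨mul_left_cancel₀ h ?_, mul_left_cancel₀ h ?_, mul_left_cancel₀ h ?_⟩ <;> grind

end SpecialLinear


section McKayMatrix

open Matrix

variable {Γ : Subgroup (SpecialLinearGroup (Fin 2) ℂ)} [Finite Γ]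

/-- A central element acts on an irreducible representation by a scalar. -/
theorem exists_scalar_of_central {G V : Type*} [Group G] [AddCommGroup V] [Module ℂ V]
    [FiniteDimensional ℂ V] (ρ : Representation ℂ G V) [ρ.IsIrreducible] {z : G}
    (hz : ∀ x, z * x = x * z) : ∃ c : ℂ, ρ z = c • 1 := by
  let T : ρ.IntertwiningMap ρ := ⟨ρ z, fun g => by
    rw [← Module.End.mul_eq_comp, ← Module.End.mul_eq_comp, ← map_mul, ← map_mul, hz]⟩
  obtain ⟨c, hc⟩ := (Representation.IsIrreducible.algebraMap_intertwiningMap_bijective_of_isAlgClosed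
    (ρ := ρ)).2 T
  refine ⟨c, LinearMap.ext fun v => ?_⟩
  exact (congrArg (fun f : ρ.IntertwiningMap ρ => f v) hc).symm

/-- A finite subgroup of `SL₂(ℂ)` of odd order is abelian, as its defining representation is not
irreducible. -/
theorem mul_comm_of_odd_card [Nontrivial Γ] (h : Odd (Nat.card Γ)) (x y : Γ) :
    x * y = y * x := by
  classical
  let _ := Fintype.ofFinite Γ
  have hcard : (Nat.card Γ : ℂ) ≠ 0 := Nat.cast_ne_zero.mpr Nat.card_pos.ne'
  let _ : Invertible (Nat.card Γ : ℂ) := invertibleOfNonzero hcard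
  have h1 := Representation.card_inv_mul_sum_char_mul_char_eq_finrank (stdRep Γ) (stdRep Γ)
  simp only [stdRep_character, trace_toMat_inv, trace_sq] at h1
  -- As `(tr x)² = tr (x²) + 2`, the dimension of the endomorphism algebra is `2` plus the average of
  -- `tr (x²)`. Squaring is bijective in odd order, so that this average is that of `tr x`, zero.
  have hsq : Function.Bijective fun x : Γ => x * x := by
    have := (powCoprime (G := Γ) (n := 2) (Nat.coprime_two_right.mpr h)).bijective
    convert this using 2 with x
    exact (pow_two x).symm
  have h2 : ∑ x : Γ, (toMat (x * x)).trace = 0 := by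
    rw [← sum_trace_eq_zero (Γ := Γ)]
    exact Fintype.sum_bijective _ hsq _ _ fun x => rfl
  rw [Finset.sum_add_distrib, h2, zero_add, Finset.sum_const, Finset.card_univ,
    ← Nat.card_eq_fintype_card, nsmul_eq_mul, inv_mul_cancel_left₀ hcard] at h1
  -- A non-scalar endomorphism has a commutative commutant among the matrices of size two.
  have h3 : ∃ T : (stdRep Γ).IntertwiningMap (stdRep Γ), ∀ c : ℂ, T ≠ c • 1 := by
    by_contra! h0
    have := finrank_le_one (R := ℂ) (1 : (stdRep Γ).IntertwiningMap (stdRep Γ))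
      fun T => (h0 T).imp fun c hc => hc.symm
    have h4 : Module.finrank ℂ ((stdRep Γ).IntertwiningMap (stdRep Γ)) = 2 := by
      exact_mod_cast h1.symm
    omega
  obtain ⟨T, hT⟩ := h3
  have hM : ∀ x : Γ, toMat x * LinearMap.toMatrix' T.toLinearMap =
      LinearMap.toMatrix' T.toLinearMap * toMat x := by
    intro x
    have h4 := congrArg LinearMap.toMatrix' (T.isIntertwining' x)
    rw [LinearMap.toMatrix'_comp, LinearMap.toMatrix'_comp] at h4
    change _ * LinearMap.toMatrix' (Matrix.toLin' (toMat x)) =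
      LinearMap.toMatrix' (Matrix.toLin' (toMat x)) * _ at h4
    rw [LinearMap.toMatrix'_toLin'] at h4
    exact h4.symm
  refine toMat_injective ?_
  rw [toMat_mul, toMat_mul]
  refine commute_of_commute_nonscalar (T := LinearMap.toMatrix' T.toLinearMap) ?_ (hM x) (hM y)
  intro c hc
  refine hT c (Representation.IntertwiningMap.ext ?_)
  have h5 := congrArg Matrix.toLin' hc
  rw [Matrix.toLin'_toMatrix', map_smul, Matrix.toLin'_one] at h5
  exact h5

/-- The McKay matrix has no loops: no irreducible representation is contained in its product with
the defining representation. -/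
theorem sum_trace_mul_char_eq_zero [Nontrivial Γ] [Fintype Γ] {V : Type*} [AddCommGroup V]
    [Module ℂ V] [FiniteDimensional ℂ V] (ρ : Representation ℂ Γ V) [ρ.IsIrreducible] :
    ∑ x : Γ, (toMat x).trace * (ρ.character x * ρ.character x⁻¹) = 0 := by
  rcases odd_card_or_neg_one (Γ := Γ) with h | ⟨z, hz⟩
  · have hcomm := mul_comm_of_odd_card h
    have h1 : Module.finrank ℂ V = 1 := by
      have : IsMulCommutative Γ := ⟨⟨hcomm⟩⟩
      exact Representation.IsIrreducible.finrank_eq_one_of_isMulCommutative ρ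
    have h2 : ∀ x : Γ, ρ.character x * ρ.character x⁻¹ = 1 := by
      intro x
      obtain ⟨c, hc⟩ := exists_scalar_of_central ρ (hcomm x)
      obtain ⟨d, hd⟩ := exists_scalar_of_central ρ (hcomm x⁻¹)
      have h3 : ρ.character (x * x⁻¹) = c * d := by
        rw [Representation.character, map_mul, hc, hd, smul_mul_smul_comm, one_mul, map_smul,
          LinearMap.trace_one, h1]
        simp
      rw [mul_inv_cancel, Representation.char_one, h1] at h3
      rw [Representation.character, Representation.character, hc, hd, map_smul, map_smul,
        LinearMap.trace_one, h1]
      simp only [Nat.cast_one, smul_eq_mul, mul_one] at h3 ⊢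
      exact h3.symm
    simp only [h2, mul_one]
    exact sum_trace_eq_zero
  · have hcentral : ∀ x, z * x = x * z := fun x => toMat_injective (by
      rw [toMat_mul, toMat_mul, hz, neg_one_mul, mul_neg_one])
    have hzz : z * z = 1 := toMat_injective (by rw [toMat_mul, hz, toMat_one]; simp)
    obtain ⟨c, hc⟩ := exists_scalar_of_central ρ hcentral
    have h1 : ∀ x, ρ.character (z * x) = c * ρ.character x := fun x => by
      rw [Representation.character, map_mul, hc, smul_one_mul, map_smul]
      rfl
    have h2 : ∀ x, (z * x)⁻¹ = z * x⁻¹ := fun x => by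
      rw [_root_.mul_inv_rev, inv_eq_of_mul_eq_one_left hzz, hcentral]
    have h3 : ∀ x, c * (c * ρ.character x) = ρ.character x := fun x => by
      rw [← h1, ← h1, ← mul_assoc, hzz, one_mul]
    have h4 := Fintype.sum_equiv (Equiv.mulLeft z)
      (fun x : Γ => (toMat (z * x)).trace * (ρ.character (z * x) * ρ.character (z * x)⁻¹))
      (fun x : Γ => (toMat x).trace * (ρ.character x * ρ.character x⁻¹)) fun x => rfl
    have h5 : ∀ x : Γ, (toMat (z * x)).trace * (ρ.character (z * x) * ρ.character (z * x)⁻¹) =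
        -((toMat x).trace * (ρ.character x * ρ.character x⁻¹)) := by
      intro x
      rw [toMat_mul, hz, neg_one_mul, trace_neg, h2, h1, h1]
      linear_combination -(toMat x).trace * ρ.character x⁻¹ * h3 x
    rw [Finset.sum_congr rfl fun x _ => h5 x, Finset.sum_neg_distrib] at h4
    exact neg_eq_self.mp h4

theorem weightedForm_eq_sum {G : Type*} [Group G] [Fintype G] (ξ f g : ClassFn G) :
    weightedForm ξ f g = (Nat.card G : ℂ)⁻¹ * ∑ x : G, ξ.1 x * f.1 x * g.1 x⁻¹ := by
  rw [weightedForm, finsum_eq_sum_of_fintype]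

theorem weightedForm_mcKay_symm (f g : ClassFn Γ) :
    weightedForm (mcKay Γ) f g = weightedForm (mcKay Γ) g f := by
  let _ := Fintype.ofFinite Γ
  rw [weightedForm_eq_sum, weightedForm_eq_sum]
  congr 1
  refine Fintype.sum_equiv (Equiv.inv Γ) _ _ fun x => ?_
  rw [Equiv.inv_apply, inv_inv, mcKay_apply, mcKay_apply, trace_toMat_inv]
  ring

omit [Finite Γ] in
theorem weightedForm_mcKay_character [Fintype Γ] (f g : ClassFn Γ) :
    weightedForm (mcKay Γ) f g = 2 * ((Nat.card Γ : ℂ)⁻¹ * ∑ x : Γ, f.1 x * g.1 x⁻¹) -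
      (Nat.card Γ : ℂ)⁻¹ * ∑ x : Γ, (toMat x).trace * (f.1 x * g.1 x⁻¹) := by
  rw [weightedForm_eq_sum, mul_left_comm, ← mul_sub, Finset.mul_sum _ _ 2, ← Finset.sum_sub_distrib]
  congr 1
  refine Finset.sum_congr rfl fun x _ => ?_
  rw [mcKay_apply]
  ring

theorem exists_int_weightedForm (i j : IrrChar Γ) :
    ∃ a : ℤ, weightedForm (mcKay Γ) i.1 j.1 = a := by
  classical
  let _ := Fintype.ofFinite Γ
  have hcard : (Nat.card Γ : ℂ) ≠ 0 := Nat.cast_ne_zero.mpr Nat.card_pos.ne'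
  let _ : Invertible (Nat.card Γ : ℂ) := invertibleOfNonzero hcard
  obtain ⟨d, ρ, hρ, hi⟩ := i.2
  obtain ⟨d', σ, hσ, hj⟩ := j.2
  have h1 := Representation.card_inv_mul_sum_char_mul_char_eq_finrank σ ρ
  have h2 := Representation.card_inv_mul_sum_char_mul_char_eq_finrank σ ((stdRep Γ).tprod ρ)
  simp only [Representation.char_tensor, Pi.mul_apply, stdRep_character, mul_assoc] at h2
  refine ⟨2 * Module.finrank ℂ (σ.IntertwiningMap ρ) -
    Module.finrank ℂ (σ.IntertwiningMap ((stdRep Γ).tprod ρ)), ?_⟩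
  rw [weightedForm_mcKay_character]
  rw [hi, hj, h1, h2]
  push_cast
  rfl

theorem weightedForm_self [Nontrivial Γ] (i : IrrChar Γ) :
    weightedForm (mcKay Γ) i.1 i.1 = 2 := by
  classical
  let _ := Fintype.ofFinite Γ
  have hcard : (Nat.card Γ : ℂ) ≠ 0 := Nat.cast_ne_zero.mpr Nat.card_pos.ne'
  let _ : Invertible (Nat.card Γ : ℂ) := invertibleOfNonzero hcard
  obtain ⟨d, ρ, hρ, hi⟩ := i.2
  have h1 := Representation.card_inv_mul_sum_char_mul_char_eq_finrank ρ ρ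
  rw [Representation.IsIrreducible.finrank_intertwiningMap_self] at h1
  rw [weightedForm_mcKay_character]
  rw [hi, h1, sum_trace_mul_char_eq_zero]
  simp

theorem toClassFn_toRZ {G : Type*} [Group G] (i : IrrChar G) : i.toRZ.toClassFn = i.1 := by
  simp [IrrChar.toRZ, RZ.toClassFn]

theorem formMatrix_cast (i j : IrrChar Γ) :
    (formMatrix (mcKay Γ) i j : ℂ) = weightedForm (mcKay Γ) i.1 j.1 := by
  obtain ⟨a, ha⟩ := exists_int_weightedForm i j
  rw [formMatrix, latticeForm, toClassFn_toRZ, toClassFn_toRZ, ha]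
  simp

theorem formMatrix_symm (i j : IrrChar Γ) :
    formMatrix (mcKay Γ) i j = formMatrix (mcKay Γ) j i := by
  rw [formMatrix, latticeForm, toClassFn_toRZ, toClassFn_toRZ, weightedForm_mcKay_symm]
  rw [formMatrix, latticeForm, toClassFn_toRZ, toClassFn_toRZ]

theorem formMatrix_self [Nontrivial Γ] (i : IrrChar Γ) : formMatrix (mcKay Γ) i i = 2 := by
  have h := formMatrix_cast i i
  rw [weightedForm_self] at h
  exact_mod_cast h

end McKayMatrix


/-! ### The vertex operators of negative roots -/

section Negation

open SpinWreath

namespace IsExp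
variable {R : Type*} [Ring R] [Algebra ℂ R] {a Q Q' : ℕ → R}

theorem unique (h : IsExp a Q) (h' : IsExp a Q') (n : ℕ) : Q n = Q' n := by
  induction n using Nat.strong_induction_on with
  | _ n ih =>
  rcases Nat.eq_zero_or_pos n with rfl | hn
  · rw [h.zero, h'.zero]
  · refine smul_right_injective R (Nat.cast_ne_zero.mpr hn.ne' : (n : ℂ) ≠ 0) ?_
    beta_reduce
    rw [h.recursion, h'.recursion]
    refine Finset.sum_congr rfl fun p hp => ?_
    rw [Finset.HasAntidiagonal.mem_antidiagonal] at hp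
    rcases Nat.eq_zero_or_pos p.2 with h0 | h0
    · rw [h0, h.a_zero, mul_zero, mul_zero]
    · rw [ih p.1 (by omega)]

/-- Negating the exponent amounts to the substitution of `-z` for `z`, as only odd powers of `z`
occur in it. -/
theorem neg (h : IsExp a Q) : IsExp (fun k => -a k) (fun n => (-1 : ℂ) ^ n • Q n) where
  zero := by rw [pow_zero, one_smul, h.zero]
  even k hk := by rw [h.even k hk, neg_zero]
  comm k l := by rw [neg_mul_neg, neg_mul_neg, h.comm]
  recursion n := by
    rw [smul_comm, h.recursion, Finset.smul_sum]
    refine Finset.sum_congr rfl fun p hp => ?_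
    rw [Finset.HasAntidiagonal.mem_antidiagonal] at hp
    by_cases hk : Odd p.2
    · rw [← hp, pow_add, hk.neg_one_pow, mul_neg_one, neg_smul, mul_neg, smul_mul_assoc, smul_neg,
        smul_comm]
    · rw [h.even _ hk]; simp

end IsExp

variable {Γ : Type*} [Group Γ]

theorem sigma_neg {n : ℕ} (hn : Odd n) (f : ClassFn Γ) :
    sigma n hn (-f) = (-1 : ℂ) • sigma n hn f := by
  refine Subtype.ext (funext fun w => ?_)
  rw [Submodule.coe_smul, Pi.smul_apply, smul_eq_mul, hasWeight_sigma, hasWeight_sigma]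
  by_cases h : IsFullCycle (perm n w)
  · have h1 : ∀ c : ConjClasses Γ, onClass (-f) c = -onClass f c := fun c => by
      induction c using Quotient.inductionOn
      rfl
    rw [cycTypeProd_of_full _ w h ⟨0, hn.pos⟩, cycTypeProd_of_full _ w h ⟨0, hn.pos⟩, sigmaWeight,
      sigmaWeight]
    split_ifs
    · rw [h1]; ring
    · ring
  · rw [cycTypeProd_of_not_full (sigmaWeight n _) w (fun c hc => if_neg hc) hn.pos h,
      cycTypeProd_of_not_full (sigmaWeight n _) w (fun c hc => if_neg hc) hn.pos h]
    ring

variable [Finite Γ]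

theorem creation_smul {n : ℕ} (c : ℂ) (u : SuperSpin Γ n) :
    creation (c • u) = c • creation u := by
  refine LinearMap.ext fun x => charComp_ext fun N => ?_
  rw [LinearMap.smul_apply, map_smul, charComp_creation, charComp_creation]
  split_ifs
  · rw [Submodule.coe_smul, frob_smul, smul_mul_assoc]
  · rw [smul_zero]

theorem annihilation_smul (ξ : ClassFn Γ) {n : ℕ} (c : ℂ) (u : SuperSpin Γ n) :
    annihilation ξ (c • u) = c • annihilation ξ u := by
  refine LinearMap.ext fun x => DFinsupp.ext fun m => Subtype.ext (funext fun b => ?_)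
  let _ := Fintype.ofFinite (SpinWreath Γ n)
  change (Nat.card (SpinWreath Γ n) : ℂ)⁻¹ *
      ∑ᶠ a : SpinWreath Γ n, eta ξ a * (c * u.1 a) * (x (n + m)).1 (juxt a⁻¹ b) =
    c * ((Nat.card (SpinWreath Γ n) : ℂ)⁻¹ *
      ∑ᶠ a : SpinWreath Γ n, eta ξ a * u.1 a * (x (n + m)).1 (juxt a⁻¹ b))
  rw [finsum_eq_sum_of_fintype, finsum_eq_sum_of_fintype, mul_left_comm c, Finset.mul_sum _ _ c]
  congr 1
  exact Finset.sum_congr rfl fun a _ => by ring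

theorem aMinus_neg (f : ClassFn Γ) (k : ℕ) : aMinus (-f) k = -aMinus f k := by
  unfold aMinus
  split_ifs with hk
  · rw [sigma_neg, creation_smul]
    exact neg_one_smul ℂ (creation (sigma k hk f))
  · rw [neg_zero]

theorem aPlus_neg (ξ f : ClassFn Γ) (k : ℕ) : aPlus ξ (-f) k = -aPlus ξ f k := by
  unfold aPlus
  split_ifs with hk
  · rw [sigma_neg, annihilation_smul]
    exact neg_one_smul ℂ (annihilation ξ (sigma k hk f))
  · rw [neg_zero]

theorem isExp_Hminus (f : ClassFn Γ) : IsExp (aMinus f) (Hminus f) where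
  zero := Hminus_zero f
  even _ hk := dif_neg hk
  comm := aMinus_comm f f
  recursion := Hminus_recursion f

theorem isExp_Hplus (ξ f : ClassFn Γ) : IsExp (aPlus ξ f) (Hplus ξ f) where
  zero := Hplus_zero ξ f
  even _ hk := dif_neg hk
  comm := aPlus_comm ξ f f
  recursion := Hplus_recursion ξ f

theorem Hminus_neg (f : ClassFn Γ) (n : ℕ) : Hminus (-f) n = (-1 : ℂ) ^ n • Hminus f n := by
  have h := (isExp_Hminus f).neg
  rw [show (fun k => -aMinus f k) = aMinus (-f) from funext fun k => (aMinus_neg f k).symm] at h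
  exact (isExp_Hminus (-f)).unique h n

theorem Hplus_neg (ξ f : ClassFn Γ) (n : ℕ) : Hplus ξ (-f) n = (-1 : ℂ) ^ n • Hplus ξ f n := by
  have h := (isExp_Hplus ξ f).neg
  rw [show (fun k => -aPlus ξ f k) = aPlus ξ (-f) from funext fun k => (aPlus_neg ξ f k).symm] at h
  exact (isExp_Hplus ξ (-f)).unique h n

theorem vertexCoeff_neg (ξ f : ClassFn Γ) (n : ℤ) :
    vertexCoeff ξ (-f) n = (-1 : ℂ) ^ n • vertexCoeff ξ f n := by
  refine DirectSum.linearMap_ext ℂ fun m => LinearMap.ext fun F => ?_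
  rw [LinearMap.comp_apply, LinearMap.comp_apply, LinearMap.smul_apply, vertexCoeff, vertexCoeff,
    DirectSum.toModule_lof, DirectSum.toModule_lof, LinearMap.sum_apply, LinearMap.sum_apply,
    Finset.smul_sum]
  refine Finset.sum_congr rfl fun k _ => ?_
  split_ifs with h
  · simp only [LinearMap.comp_apply, LinearMap.smul_apply, Module.End.mul_apply, Hminus_neg,
      Hplus_neg, map_smul, smul_smul]
    congr 1
    obtain ⟨j, hj⟩ := Int.eq_ofNat_of_zero_le (show 0 ≤ (k : ℤ) - n by omega)
    have hn : n = k - j := by omega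
    rw [hj, Int.toNat_natCast, hn, zpow_sub₀ (by norm_num), zpow_natCast, zpow_natCast,
      div_eq_mul_inv, ← inv_pow, show (-1 : ℂ)⁻¹ = -1 by norm_num]
    ring
  · simp

end Negation


/-! ### The vertex operators on the Fock space -/

section Fock

variable {Γ : Subgroup (Matrix.SpecialLinearGroup (Fin 2) ℂ)} [Finite Γ]

variable (Γ) in
/-- The Heisenberg operators of the irreducible characters and their exponentials on `R^-_Γ`. -/
def mcKaySystem : VertexSystem (IrrChar Γ) (RMinus Γ) where
  am i := aMinus i.1
  ap i := aPlus (mcKay Γ) i.1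
  P i := Hminus i.1
  Q i := Hplus (mcKay Γ) i.1
  B := formMatrix (mcKay Γ)
  B_symm := formMatrix_symm
  isExp_am i := isExp_Hminus i.1
  isExp_ap i := isExp_Hplus (mcKay Γ) i.1
  am_comm i j := aMinus_comm i.1 j.1
  ap_comm i j := aPlus_comm (mcKay Γ) i.1 j.1
  ap_am i j k l := by
    rw [aPlus_aMinus, formMatrix_cast]
  locally_finite v := by
    obtain ⟨N, hN⟩ := annihilation_eventually_zero (mcKay Γ) v
    exact ⟨N, fun i n hn => hN n hn _⟩

theorem annihilation_lof_of_lt {G : Type*} [Group G] [Finite G] (ξ : ClassFn G) {n m : ℕ} (h : m < n)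
    (u : SuperSpin G n) (F : SuperSpin G m) :
    annihilation ξ u (DirectSum.lof ℂ ℕ (fun k => SuperSpin G k) m F) = 0 := by
  refine DFinsupp.ext fun N => ?_
  have h1 : annihilation ξ u (DirectSum.lof ℂ ℕ (fun k => SuperSpin G k) m F) N =
    pairLeft ξ N u (DirectSum.lof ℂ ℕ (fun k => SuperSpin G k) m F (n + N)) := rfl
  have h2 : DirectSum.lof ℂ ℕ (fun k => SuperSpin G k) m F (n + N) = 0 :=
    DirectSum.of_eq_of_ne _ _ _ (by omega)
  rw [h1, h2, map_zero]
  rfl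

theorem vertexCoeff_eq_X (i : IrrChar Γ) (n : ℤ) :
    vertexCoeff (mcKay Γ) i.1 n = (mcKaySystem Γ).X i n := by
  refine DirectSum.linearMap_ext ℂ fun m => LinearMap.ext fun F => ?_
  rw [LinearMap.comp_apply, LinearMap.comp_apply, vertexCoeff, DirectSum.toModule_lof,
    LinearMap.sum_apply, VertexSystem.X_apply]
  set v := DirectSum.lof ℂ ℕ (fun k => SuperSpin Γ k) m F with hv
  -- Contraction with an element of degree greater than `m` kills degree `m`.
  have hs : (Function.support ((mcKaySystem Γ).summand i n v)) ⊆
      (((Finset.range (m + 1)).map Nat.castEmbedding : Finset ℤ) : Set ℤ) := by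
    intro k hk
    by_contra h0
    refine hk ?_
    rw [VertexSystem.summand]
    by_cases h1 : 0 ≤ k
    · obtain ⟨p, rfl⟩ := Int.eq_ofNat_of_zero_le h1
      have h2 : m < p := by
        by_contra h2
        refine h0 ?_
        rw [Finset.mem_coe, Finset.mem_map]
        exact ⟨p, Finset.mem_range.mpr (by omega), rfl⟩
      rw [VertexSystem.Qz_natCast]
      have h3 : (mcKaySystem Γ).Q i p v = 0 := annihilation_lof_of_lt _ h2 _ _
      rw [h3, map_zero, smul_zero]
    · rw [VertexSystem.Qz_of_neg _ (by omega)]; simp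
  rw [finsum_eq_sum_of_support_subset _ hs, Finset.sum_map]
  refine Finset.sum_congr rfl fun k _ => ?_
  rw [VertexSystem.summand, Nat.castEmbedding_apply, VertexSystem.Qz_natCast, zpow_natCast,
    VertexSystem.Pz]
  by_cases h : n ≤ k
  · rw [if_pos h, if_pos (by omega)]
    rfl
  · rw [if_neg h, if_neg (by omega)]; simp

theorem heisenberg_eq_az (i : IrrChar Γ) (m : ℤ) (hm : Odd m) :
    heisenberg (mcKay Γ) i.1 m hm = (mcKaySystem Γ).az i m := by
  have h1 : ∀ (k l : ℕ) (hk : Odd k), k = l →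
      creation (sigma k hk i.1) = (mcKaySystem Γ).am i l := by
    rintro k _ hk rfl
    change _ = aMinus i.1 k
    rw [aMinus, dif_pos hk]
  have h2 : ∀ (k l : ℕ) (hk : Odd k), k = l →
      annihilation (mcKay Γ) (sigma k hk i.1) = (mcKaySystem Γ).ap i l := by
    rintro k _ hk rfl
    change _ = aPlus (mcKay Γ) i.1 k
    rw [aPlus, dif_pos hk]
  rw [heisenberg, VertexSystem.az]
  by_cases h : 0 ≤ m
  · rw [if_neg (by omega), if_pos h]
    exact h2 _ _ _ (by omega)
  · rw [if_pos (by omega), if_neg h]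
    exact h1 _ _ _ (by omega)

end Fock

/-! ### The cocycle -/

section Cocycle

theorem bar_add_self {G : Type*} [Group G] (α : RZ G) : (α + α).bar = 1 := by
  refine congrArg Multiplicative.ofAdd ?_
  rw [QuotientAddGroup.eq_zero_iff]
  exact ⟨α, two_nsmul α⟩

theorem bar_neg {G : Type*} [Group G] (α : RZ G) : (-α).bar = α.bar := by
  refine congrArg Multiplicative.ofAdd ?_
  rw [QuotientAddGroup.eq]
  exact ⟨α, by simp [two_nsmul]⟩

variable {Γ : Subgroup (Matrix.SpecialLinearGroup (Fin 2) ℂ)}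
    {E : Type*} [Group E] {S : GroupExtension ℤˣ E (Multiplicative (RF2 Γ))}
    (e : S.Section) {M : Type*} [AddCommGroup M] [Module ℂ M]
    (ρ : Representation ℂ E M) (hneg : ρ (S.inl (-1)) = -1)

include hneg in
theorem rep_inl_zpow (a : ℤ) : ρ (S.inl ((-1) ^ a)) = (-1 : ℂ) ^ a • 1 := by
  rcases Int.even_or_odd a with h | h
  · rw [h.neg_one_zpow, h.neg_one_zpow, map_one, map_one, one_smul]
  · rw [h.neg_one_zpow, h.neg_one_zpow, hneg, neg_smul, one_smul]

include hneg in
theorem rep_section_comm [Finite Γ] [Nontrivial Γ] (hS : IsSpinExtension (mcKay Γ) S) (i j : IrrChar Γ) :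
    ρ (e i.toRZ.bar) * ρ (e j.toRZ.bar) =
      (-1 : ℂ) ^ formMatrix (mcKay Γ) i j • (ρ (e j.toRZ.bar) * ρ (e i.toRZ.bar)) := by
  have h := hS.commutator (e i.toRZ.bar) (e j.toRZ.bar) i.toRZ j.toRZ (e.rightHom_section _)
    (e.rightHom_section _)
  rw [mul_inv_eq_iff_eq_mul, mul_inv_eq_iff_eq_mul] at h
  -- The diagonal entries are `2`, hence `c₁` agrees with the form modulo `2`.
  have hc : c₁ (mcKay Γ) i.toRZ j.toRZ = formMatrix (mcKay Γ) i j + 2 * 2 := by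
    have h1 : c₁ (mcKay Γ) i.toRZ j.toRZ = formMatrix (mcKay Γ) i j +
      formMatrix (mcKay Γ) i i * formMatrix (mcKay Γ) j j := rfl
    rw [h1, formMatrix_self, formMatrix_self]
  rw [← map_mul, h, map_mul, map_mul, rep_inl_zpow ρ hneg, hc, zpow_add₀ (by norm_num), mul_assoc,
    smul_mul_assoc, one_mul]
  norm_num

/-- The cocycle of the section is trivial on the diagonal elements at the irreducible characters. -/
theorem cocycle_self (he : e 1 = 1) (hsq : ∀ i : IrrChar Γ, e i.toRZ.bar * e i.toRZ.bar = 1)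
    {ε : RZ Γ → RZ Γ → ℤˣ}
    (hε : ∀ α β, e α.bar * e β.bar = S.inl (ε α β) * e (α + β).bar) (i : IrrChar Γ) :
    ε i.toRZ i.toRZ = 1 := by
  have h := hε i.toRZ i.toRZ
  rw [hsq, bar_add_self, he, mul_one, ← map_one S.inl] at h
  exact (S.inl_injective h).symm

end Cocycle


/-! ### Representations of the twisted toroidal Lie algebra -/

open ToroidalGen

theorem Toroidal.exists_lieHom {I L : Type*} [LieRing L] [LieAlgebra ℂ L] (A : I → I → ℤ)
    (f : ToroidalGen I → L) (h : ∀ x, ToroidalRel A x → FreeLieAlgebra.lift ℂ f x = 0) :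
    ∃ V : Toroidal A →ₗ⁅ℂ⁆ L, ∀ g, V (Toroidal.gen A g) = f g := by
  let J : LieIdeal ℂ (FreeLieAlgebra ℂ (ToroidalGen I)) :=
    LieSubmodule.lieSpan ℂ (FreeLieAlgebra ℂ (ToroidalGen I)) (Set.ofPred (ToroidalRel A))
  have hJ : J ≤ (FreeLieAlgebra.lift ℂ f).ker :=
    LieSubmodule.lieSpan_le.mpr fun x hx => LieHom.mem_ker.mpr (h x hx)
  let V : (FreeLieAlgebra ℂ (ToroidalGen I) ⧸ J) →ₗ[ℂ] L :=
    Submodule.liftQ J.toSubmodule (FreeLieAlgebra.lift ℂ f : FreeLieAlgebra ℂ (ToroidalGen I) →ₗ[ℂ] L)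
      fun x hx => LieHom.mem_ker.mp (hJ hx)
  have hV : ∀ x, V (LieSubmodule.Quotient.mk x) = FreeLieAlgebra.lift ℂ f x := fun x => rfl
  refine ⟨{ V with map_lie' := fun {x y} => ?_ }, fun g => ?_⟩
  · obtain ⟨x, rfl⟩ := Submodule.Quotient.mk_surjective _ x
    obtain ⟨y, rfl⟩ := Submodule.Quotient.mk_surjective _ y
    exact (FreeLieAlgebra.lift ℂ f).map_lie x y
  · exact (hV _).trans (FreeLieAlgebra.lift_of_apply f g)

theorem VertexSystem.az_of_not_odd {I V : Type*} [AddCommGroup V] [Module ℂ V] (W : VertexSystem I V)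
    (i : I) {m : ℤ} (hm : ¬ Odd m) : W.az i m = 0 := by
  rw [VertexSystem.az]
  split_ifs with h
  · refine (W.isExp_ap i).even _ fun h1 => hm ?_
    rw [← Int.toNat_of_nonneg h]
    exact_mod_cast h1
  · refine (W.isExp_am i).even _ fun h1 => hm ?_
    have h2 : Odd (((-m).toNat : ℕ) : ℤ) := by exact_mod_cast h1
    rw [Int.toNat_of_nonneg (by omega)] at h2
    simpa using h2.neg

theorem map_sum_smul_left {ι V L : Type*} [AddCommGroup V] [Module ℂ V] [AddCommGroup L]
    [Module ℂ L] (s : Finset ι) (c : ι → ℂ) (F : ι → Module.End ℂ V) (g : Module.End ℂ L) :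
    ∑ x ∈ s, c x • TensorProduct.map (F x) g = TensorProduct.map (∑ x ∈ s, c x • F x) g := by
  have h := map_sum ((TensorProduct.mapBilinear (RingHom.id ℂ) V L V L).flip g) (fun x => c x • F x) s
  refine Eq.trans ?_ h.symm
  refine Finset.sum_congr rfl fun x _ => ?_
  exact (TensorProduct.map_smul_left (c x) (F x) g).symm

theorem map_sub_left {V L : Type*} [AddCommGroup V] [Module ℂ V] [AddCommGroup L]
    [Module ℂ L] (F F' : Module.End ℂ V) (g : Module.End ℂ L) :
    TensorProduct.map (F - F') g = TensorProduct.map F g - TensorProduct.map F' g :=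
  map_sub ((TensorProduct.mapBilinear (RingHom.id ℂ) V L V L).flip g) F F'

/-- Vertex operators, twisted by operators `T i` which commute up to the signs `(-1) ^ B i j`,
represent the twisted toroidal Lie algebra. -/
theorem VertexSystem.exists_lieHom {I V L : Type*} [AddCommGroup V] [Module ℂ V] [AddCommGroup L]
    [Module ℂ L] (W : VertexSystem I V) (hB : ∀ i, W.B i i = 2) (T : I → Module.End ℂ L)
    (hT : ∀ i, T i * T i = 1)
    (hTT : ∀ i j, T i * T j = (-1 : ℂ) ^ W.B i j • (T j * T i)) :
    ∃ φ : Toroidal W.B →ₗ⁅ℂ⁆ Module.End ℂ (V ⊗[ℂ] L),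
      (∀ i n, φ (Toroidal.gen _ (.xPos i n)) = TensorProduct.map (W.X i n) (T i)) ∧
      (∀ i n, φ (Toroidal.gen _ (.xNeg i n)) =
        (-1 : ℂ) ^ n • TensorProduct.map (W.X i n) (T i)) ∧
      (∀ i m hm, φ (Toroidal.gen _ (.h i m hm)) = TensorProduct.map (W.az i m) LinearMap.id) ∧
      φ (Toroidal.gen _ .C) = 1 := by
  let f : ToroidalGen I → Module.End ℂ (V ⊗[ℂ] L) := fun g => match g with
    | .C => 1
    | .h i m _ => TensorProduct.map (W.az i m) 1
    | .xPos i n => TensorProduct.map (W.X i n) (T i)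
    | .xNeg i n => (-1 : ℂ) ^ n • TensorProduct.map (W.X i n) (T i)
  have hC : FreeLieAlgebra.lift ℂ f freeC = 1 := FreeLieAlgebra.lift_of_apply f _
  have hX : ∀ i n, FreeLieAlgebra.lift ℂ f (freeX i n) = TensorProduct.map (W.X i n) (T i) :=
    fun i n => FreeLieAlgebra.lift_of_apply f _
  have hY : ∀ i n, FreeLieAlgebra.lift ℂ f (freeY i n) =
      (-1 : ℂ) ^ n • TensorProduct.map (W.X i n) (T i) :=
    fun i n => FreeLieAlgebra.lift_of_apply f _
  have hH : ∀ i m, FreeLieAlgebra.lift ℂ f (freeH i m) = TensorProduct.map (W.az i m) 1 := by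
    intro i m
    rw [freeH]
    split_ifs with hm
    · exact FreeLieAlgebra.lift_of_apply f _
    · rw [map_zero, W.az_of_not_odd i hm, TensorProduct.map_zero_left]
  -- brackets of twisted vertex operators
  have hXX : ∀ i j n l, ⁅TensorProduct.map (W.X i n) (T i), TensorProduct.map (W.X j l) (T j)⁆ =
      TensorProduct.map (W.X i n * W.X j l - (-1 : ℂ) ^ W.B i j • (W.X j l * W.X i n))
        (T i * T j) := by
    intro i j n l
    have hs : (-1 : ℂ) ^ W.B i j * (-1) ^ W.B i j = 1 := by
      rw [← mul_zpow]; norm_num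
    have h1 : T j * T i = (-1 : ℂ) ^ W.B i j • (T i * T j) := by
      rw [hTT i j, smul_smul, hs, one_smul]
    rw [LieRing.of_associative_ring_bracket, ← TensorProduct.map_mul, ← TensorProduct.map_mul, h1,
      TensorProduct.map_smul_right, ← TensorProduct.map_smul_left, sub_eq_add_neg, sub_eq_add_neg,
      TensorProduct.map_add_left, ← neg_one_smul ℂ (TensorProduct.map _ _),
      ← TensorProduct.map_smul_left, neg_one_smul]
  have hsmul : ∀ (c : ℂ) (F G : Module.End ℂ (V ⊗[ℂ] L)), ⁅F, c • G⁆ = c • ⁅F, G⁆ := by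
    intro c F G
    rw [LieRing.of_associative_ring_bracket, LieRing.of_associative_ring_bracket, mul_smul_comm,
      smul_mul_assoc, smul_sub]
  obtain ⟨φ, hφ⟩ := Toroidal.exists_lieHom W.B f (by
    rintro x (g | ⟨i, n⟩ | ⟨i, j, m, m', hm, hm'⟩ | ⟨i, j, m, n, hm⟩ | ⟨i, n, n'⟩ |
      ⟨i, j, n, n', h⟩ | ⟨i, j, n, n', h⟩)
    · rw [LieHom.map_lie, hC, LieRing.of_associative_ring_bracket, one_mul, mul_one, sub_self]
    · rw [map_sub, map_smul, hX, hY, smul_smul, ← mul_zpow]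
      norm_num
    · rw [map_sub, LieHom.map_lie, map_smul, hH, hH, hC, LieRing.of_associative_ring_bracket,
        ← TensorProduct.map_mul, ← TensorProduct.map_mul, ← map_sub_left, W.az_az i j hm,
        TensorProduct.map_smul_left, mul_one, TensorProduct.map_one, sub_self]
    · rw [map_sub, LieHom.map_lie, map_smul, hH, hX, hX, LieRing.of_associative_ring_bracket,
        ← TensorProduct.map_mul, ← TensorProduct.map_mul, one_mul, mul_one,
        ← map_sub_left, W.az_X i j hm, TensorProduct.map_smul_left, sub_self]
    · rw [map_sub, LieHom.map_lie, map_smul, map_add, map_smul, hH, hX, hY, hC,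
        hsmul, hXX, hB, show (-1 : ℂ) ^ (2 : ℤ) = 1 by norm_num, one_smul, W.X_X_self (hB i),
        TensorProduct.map_smul_left, hT, TensorProduct.map_add_left, TensorProduct.map_smul_left,
        TensorProduct.map_one, smul_smul, ← mul_assoc, ← mul_zpow]
      norm_num
    · obtain ⟨a, ha⟩ := Int.eq_ofNat_of_zero_le h
      have h1 := W.sum_bracket_eq_zero i j n (n' - W.B i j) ((W.B i j).toNat + 1)
        (fun s => ((W.B i j).toNat.choose s : ℂ)) fun p => by
          rw [ha, Int.toNat_natCast]
          exact commCoeff_serre_nonneg a p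
      simp only [map_sum, map_smul, LieHom.map_lie, hX, hXX]
      rw [map_sum_smul_left, h1, TensorProduct.map_zero_left]
    · obtain ⟨a, ha⟩ : ∃ a : ℕ, W.B i j = -a := ⟨(-W.B i j).toNat, by omega⟩
      have h1 := W.sum_bracket_eq_zero i j n (n' - W.B i j) ((-W.B i j).toNat + 1)
        (fun s => (-1) ^ s * ((-W.B i j).toNat.choose s : ℂ)) fun p => by
          rw [ha, neg_neg, Int.toNat_natCast]
          exact commCoeff_serre_neg a p
      simp only [map_sum, map_smul, LieHom.map_lie, hX, hXX]
      rw [map_sum_smul_left, h1, TensorProduct.map_zero_left])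
  exact ⟨φ, fun i n => hφ _, fun i n => hφ _, fun i m hm => hφ _, hφ _⟩

end TwistedMcKay
end

theorem mainTheorem9 (Γ : Subgroup (Matrix.SpecialLinearGroup (Fin 2) ℂ)) [Finite Γ] [Nontrivial Γ]
    {E : Type*} [Group E] (S : GroupExtension ℤˣ E (Multiplicative (RF2 Γ)))
    (hS : IsSpinExtension (mcKay Γ) S)
    (e : S.Section) (he : e 1 = 1)
    (hsq : ∀ i : IrrChar Γ, e i.toRZ.bar * e i.toRZ.bar = 1)
    (ε : RZ Γ → RZ Γ → ℤˣ)
    (hε : ∀ α β, e α.bar * e β.bar = S.inl (ε α β) * e (α + β).bar)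
    (Φ : AddSubgroup (RZ Γ)) (hΦ : IsMaximalIsotropic (mcKay Γ) Φ)
    (ρ : Representation ℂ E (LatticeSpace Φ)) (hρ : ρ.IsIrreducible) (hneg : ρ (S.inl (-1)) = -1)
    (hmono : ∀ α β, ∃ c : ℂ, ρ (e α.bar) (latticeVec Φ β) = c • latticeVec Φ (α + β)) :
    (∀ i j : IrrChar Γ, (formMatrix (mcKay Γ) i j : ℂ) = weightedForm (mcKay Γ) i.1 j.1) ∧
    ∃ V : Toroidal (formMatrix (mcKay Γ)) →ₗ⁅ℂ⁆ Module.End ℂ (FockSpace Φ),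
      (∀ (i : IrrChar Γ) (n : ℤ), V (Toroidal.gen _ (.xPos i n)) = vertexOp (mcKay Γ) e ρ i.toRZ n) ∧
      (∀ (i : IrrChar Γ) (n : ℤ), V (Toroidal.gen _ (.xNeg i n)) =
        ((ε i.toRZ i.toRZ : ℤ) : ℂ) • vertexOp (mcKay Γ) e ρ (-i.toRZ) n) ∧
      (∀ (i : IrrChar Γ) (m : ℤ) (hm : Odd m), V (Toroidal.gen _ (.h i m hm)) = heisenbergOp (mcKay Γ) Φ i.toRZ m hm) ∧
      V (Toroidal.gen _ .C) = 1 := by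
  refine ⟨formMatrix_cast, ?_⟩
  obtain ⟨φ, hx, hy, hh, hC⟩ := (mcKaySystem Γ).exists_lieHom formMatrix_self
    (fun i => ρ (e i.toRZ.bar)) (fun i => by rw [← map_mul, hsq, map_one])
    (rep_section_comm e ρ hneg hS)
  refine ⟨φ, fun i n => ?_, fun i n => ?_, fun i m hm => ?_, hC⟩
  · rw [vertexOp, toClassFn_toRZ, vertexCoeff_eq_X]
    exact hx i n
  · rw [cocycle_self e he hsq hε, vertexOp, map_neg, toClassFn_toRZ, vertexCoeff_neg,
      vertexCoeff_eq_X, bar_neg, TensorProduct.map_smul_left, Units.val_one, Int.cast_one, one_smul]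
    exact hy i n
  · rw [heisenbergOp, toClassFn_toRZ, heisenberg_eq_az]
    exact hh i m hm
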